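/- Let $n\ge 2$. Let $A_0=A_0(n)$ be the crystallization of $C(SU_q(n+1))$, i.e. the universal unital $C^*$-algebra generated by $z_{i,j}$, $1\le i,j\le n+1$, subject to the relations $z_{i,j}z_{i,l}=0$ for $j<l$; $z_{i,j}z_{k,j}=0$ for $i<k$; and, for $i<k$ and $j<l$, $z_{i,l}z_{k,j}=z_{k,j}z_{i,l}$, with $z_{i,l}z_{k,j}=0$ if $\max\{i,j\}\ge\min\{k,l\}$, $z_{i,j}z_{k,l}-z_{k,l}z_{i,j}=z_{i,l}z_{k,j}$ if $\max\{i,j\}+1=\min\{k,l\}$, $z_{i,j}z_{k,l}=z_{k,l}z_{i,j}$ if $\max\{i,j\}+1<\min\{k,l\}$; together with $z_{1,1}z_{2,2}\cdots z_{n+1,n+1}=1$ and $z_{r,s}^*=\prod_{m=1}^{n} z_{i_m,j_m}$ (product in increasing order of $m$), where $i_1<\dots<i_n$ are the elements of $\{1,\dots,n+1\}\setminus\{r\}$ and $j_1<\dots<j_n$ those of $\{1,\dots,n+1\}\setminus\{s\}$. Let $S$ be the backward shift on $\ell^2(\mathbb N)$ ($Se_0=0$, $Se_{m+1}=e_m$),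 and $P_0=I-S^*S$. For the simple transposition $s_r=(r,r+1)$ put $\pi_{s_r}(z_{r,r})=S$, $\pi_{s_r}(z_{r+1,r+1})=S^*$, $\pi_{s_r}(z_{r,r+1})=\pi_{s_r}(z_{r+1,r})=P_0$, and $\pi_{s_r}(z_{i,j})=\delta_{i,j}I$ otherwise. For $t\in\mathbb T=T^n$ let $\chi_t(z_{i,j})=\delta_{i,j}\,\overline{t_{i-1}}\,t_i$, with $t_0=t_{n+1}=1$. The convolution of representations $\rho,\sigma$ is $(\rho*\sigma)(z_{i,j})=\sum_{k=\min\{i,j\}}^{\max\{i,j\}}\rho(z_{i,k})\otimes\sigma(z_{k,j})$. For a word $w=s_{r_1}\cdots s_{r_m}$ put $\pi^{(0)}_w=\pi_{s_{r_1}}*\cdots*\pi_{s_{r_m}}$ (the counit if $m=0$) and $\pi^{(0)}_{t,w}=\chi_t*\pi^{(0)}_w$, acting on $\ell^2(\mathbb N)^{\otimes m}$. Let $w_L=s_1(s_2s_1)(s_3s_2s_1)\cdots(s_ns_{n-1}\cdots s_1)$ be the longest word. Let $\hat A_0$ be the set of unitary equivalence classes of nonzero irreducible representations of $A_0$, with the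 topology pulled back from the Jacobson topology of $\mathrm{Prim}(A_0)$, and let $\hat A_{0,w_L}\subseteq\hat A_0$ be the set of the classes of $\pi^{(0)}_{t,w_L}$, $t\in\mathbb T$. Finally put $$a=(z_{n+1,1})(z_{n,1}z_{n+1,2})(z_{n-1,1}z_{n,2}z_{n+1,3})\cdots(z_{2,1}z_{3,2}\cdots z_{n+1,n})\in A_0 .$$ Then, for every $t\in\mathbb T$ and every word $w$, there is exactly one unital $*$-representation $\pi^{(0)}_{t,w}$ of $A_0$ with the above values on the generators, and: 1. $a\in\ker\pi^{(0)}_{t,w}$ for all $t\in\mathbb T$ and all reduced words $w$ whose permutation is not that of $w_L$. 2. $\pi^{(0)}_{w_L}(a)$ is nonzero and equals $P_0\otimes P_0\otimes\cdots\otimes P_0$ ($n(n+1)/2$ factors). Moreover $\hat A_{0,w_L}$ is open and dense in $\hat A_0$. 3. For each of the $n$ bracketed factors $b$ of $a$, the operator $\pi^{(0)}_{w_L}(b)$ is positive and is an elementary tensor each of whose factors is $P_0$ or $I$, both of which occur. -/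

import Mathlib

open scoped ENNReal

/-- The defining relations of the crystallized algebra `A₀(n)` for an `(n+1) × (n+1)` array `z`
(indices start at `0`).  They are the `q → 0⁺` limits of the relations of `C(SU_q(n+1))` for the
generators `(-q)^{min(i-j,0)} z_{i,j}(q)`.  In `star_eq` the product is the leading diagonal, in
increasing order of the rows, of the minor obtained by deleting row `r` and column `s`. -/
structure CrystalRelations {n : ℕ} {B : Type*} [Ring B] [StarRing B]
    (z : Fin (n + 1) → Fin (n + 1) → B) : Prop where
  row_zero : ∀ i j l, j < l → z i j * z i l = 0
  col_zero : ∀ i k j, i < k → z i j * z k j = 0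
  anti_comm : ∀ i k j l, i < k → j < l → z i l * z k j = z k j * z i l
  anti_zero : ∀ i k j l, i < k → j < l → min k l ≤ max i j → z i l * z k j = 0
  diag_cross : ∀ i k j l : Fin (n + 1), i < k → j < l → max (i : ℕ) j + 1 = min (k : ℕ) l →
    z i j * z k l - z k l * z i j = z i l * z k j
  diag_comm : ∀ i k j l : Fin (n + 1), i < k → j < l → max (i : ℕ) j + 1 < min (k : ℕ) l →
    z i j * z k l = z k l * z i j
  det_one : (List.ofFn fun i : Fin (n + 1) => z i i).prod = 1
  star_eq : ∀ r s, star (z r s) =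
    (List.ofFn fun i : Fin n => z (r.succAbove i) (s.succAbove i)).prod

/-- Every row satisfies `∑_{k ≤ r} z_{r,k} z_{r,k}^* = 1`. -/
theorem CrystalRelations.sum_row {n : ℕ} {B : Type*} [Ring B] [StarRing B]
    {z : Fin (n + 1) → Fin (n + 1) → B} (hz : CrystalRelations z) (r : Fin (n + 1)) :
    ∑ k ∈ Finset.Iic r, z r k * star (z r k) = 1 := by
  set y : ℕ → ℕ → B := fun i j => z (Fin.ofNat (n + 1) i) (Fin.ofNat (n + 1) j) with hy
  have hv : ∀ i : Fin (n + 1), Fin.ofNat (n + 1) (i : ℕ) = i := fun i => by simp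
  have hlt : ∀ i, i < n + 1 → ((Fin.ofNat (n + 1) i : Fin (n + 1)) : ℕ) = i := fun i hi => by
    simpa using Nat.mod_eq_of_lt hi
  obtain ⟨r, hr⟩ := r
  set g : ℕ → B := fun i => if i < r then y i (i + 1) else y (i + 1) (i + 1) with hg
  set D : ℕ → B := fun k => ((List.range k).map fun i => y i i).prod with hD
  set R : ℕ → B := fun k => ((List.range' k (n - k)).map g).prod with hR
  have hD1 : ∀ k, D (k + 1) = D k * y k k := fun k => by simp [hD, List.range_succ]
  have hR1 : ∀ k, k < n → R k = g k * R (k + 1) := fun k hk => by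
    have : n - k = (n - (k + 1)) + 1 := by omega
    simp only [hR]
    rw [this, List.range'_succ]
    simp
  have hminor : ∀ k, k ≤ r → star (y r k) = D k * R k := fun k hk => by
    have e : List.range n = List.range k ++ List.range' k (n - k) := by
      have := List.range'_append_1 (s := 0) (m := k) (n := n - k)
      simp only [Nat.zero_add, ← List.range_eq_range'] at this
      rw [this]; congr 1; omega
    rw [hy, hz.star_eq]
    simp only [hD, hR]
    rw [List.ofFn_eq_map, ← List.prod_append]
    have e2 : (List.finRange n).map (fun i : Fin n => z ((Fin.ofNat (n + 1) r).succAbove i)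
        ((Fin.ofNat (n + 1) k).succAbove i)) =
        (List.range n).map (fun i => if i < k then y i i else g i) := by
      rw [← List.map_coe_finRange_eq_range, List.map_map]
      apply List.map_congr_left
      intro i _
      have h1 := hlt r hr
      have h2 := hlt k (by omega)
      have hi := i.2
      simp only [Function.comp, hg, hy]
      split_ifs with h3 h4
      all_goals
        congr 1
        all_goals
          apply Fin.ext
          rw [hlt _ (by omega)]
          simp only [Fin.succAbove, Fin.lt_def, Fin.val_castSucc]
          split_ifs <;> simp <;> omega
    rw [e2, e, List.map_append]
    congr 2
    · apply List.map_congr_left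
      intro i hi
      simp at hi
      simp [hi]
    · apply List.map_congr_left
      intro i hi
      simp at hi
      simp [hi.1]
  have hcomm : ∀ k, k + 1 ≤ r → ∀ m, m ≤ k → y r (k + 1) * D m = D m * y r (k + 1) := by
    intro k hk m
    induction m with
    | zero => simp [hD]
    | succ m ih =>
      intro hm
      rw [hD1, ← mul_assoc, ih (by omega), mul_assoc, mul_assoc]
      congr 1
      refine (hz.diag_comm _ _ _ _ ?_ ?_ ?_).symm
      all_goals
        try simp only [Fin.lt_def]
        rw [hlt _ (by omega), hlt _ (by omega)]
      · omega
      · omega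
      · rw [hlt _ (by omega)]
        omega
  have key : ∀ k, k ≤ r → ∑ j ∈ Finset.range (k + 1), y r j * star (y r j) =
      D k * y r k * R k := by
    intro k
    induction k with
    | zero =>
      intro _
      simp [hminor 0 (by omega), hD]
    | succ k ih =>
      intro hk
      rw [Finset.sum_range_succ, ih (by omega), hminor _ hk, hD1, hR1 k (by omega)]
      have c1 : y k k * y r (k + 1) - y r (k + 1) * y k k = y k (k + 1) * y r k := by
        refine hz.diag_cross _ _ _ _ ?_ ?_ ?_
        all_goals
          try simp only [Fin.lt_def]
          rw [hlt _ (by omega), hlt _ (by omega)]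
        · omega
        · omega
        · rw [hlt _ (by omega)]
          omega
      have c2 : y k (k + 1) * y r k = y r k * y k (k + 1) := by
        refine hz.anti_comm _ _ _ _ ?_ ?_
        all_goals
          try simp only [Fin.lt_def]
          rw [hlt _ (by omega), hlt _ (by omega)]
          omega
      have c3 : g k = y k (k + 1) := by simp [hg]; omega
      have c4 : y r (k + 1) * (D k * y k k * R (k + 1)) =
          D k * (y k k * y r (k + 1) - y k (k + 1) * y r k) * R (k + 1) := by
        rw [← c1, sub_sub_cancel, ← mul_assoc, ← mul_assoc, hcomm k hk k le_rfl]
        simp only [mul_assoc]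
      rw [c4, c3, c2]
      noncomm_ring
  have fin : D r * y r r * R r = 1 := by
    rw [← hD1, ← hz.det_one, List.ofFn_eq_map]
    have e : List.range (n + 1) = List.range (r + 1) ++ List.range' (r + 1) (n - r) := by
      have := List.range'_append_1 (s := 0) (m := r + 1) (n := n - r)
      simp only [Nat.zero_add, ← List.range_eq_range'] at this
      rw [this]; congr 1; omega
    have e2 : (List.finRange (n + 1)).map (fun i => z i i) =
        (List.range (n + 1)).map (fun i => y i i) := by
      rw [← List.map_coe_finRange_eq_range, List.map_map]
      apply List.map_congr_left
      intro i _
      simp only [Function.comp, hy, hv]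
    rw [e2, e, List.map_append, List.prod_append]
    rw [List.range'_succ_left, List.map_map]
    congr 1
    simp only [hR]
    congr 1
    apply List.map_congr_left
    intro i hi
    simp at hi
    simp [hg, hi.1]
  rw [← fin, ← key r le_rfl]
  refine Finset.sum_bij (fun (k : Fin (n + 1)) _ => (k : ℕ)) ?_ ?_ ?_ ?_
  · intro a ha
    simp [Fin.le_def] at ha ⊢
    omega
  · intro a _ b _ h
    exact Fin.ext h
  · intro b hb
    simp at hb
    exact ⟨⟨b, by omega⟩, by simp [Fin.le_def]; omega, rfl⟩
  · intro a _
    have h1 : (Fin.ofNat (n + 1) r : Fin (n + 1)) = ⟨r, hr⟩ := Fin.ext (hlt r hr)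
    simp only [hy, hv, h1]

/-- In a C⋆-algebra the relations force `‖z_{i,j}‖ ≤ 1`; so the universal C⋆-algebra exists. -/
theorem CrystalRelations.norm_le_one {n : ℕ} {B : Type*} [CStarAlgebra B] [Nontrivial B]
    {z : Fin (n + 1) → Fin (n + 1) → B} (hz : CrystalRelations z) (i j : Fin (n + 1)) :
    ‖z i j‖ ≤ 1 := by
  have low : ∀ i j : Fin (n + 1), j ≤ i → ‖z i j‖ ≤ 1 := by
    intro i j hij
    let _ := CStarAlgebra.spectralOrder B
    let _ := CStarAlgebra.spectralOrderedRing B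
    have h1 : z i j * star (z i j) ≤ 1 := by
      rw [← hz.sum_row i]
      exact Finset.single_le_sum (f := fun k => z i k * star (z i k))
        (fun k _ => mul_star_self_nonneg _) (by simpa using hij)
    have h2 := CStarAlgebra.norm_le_norm_of_nonneg_of_le (mul_star_self_nonneg (z i j)) h1
    rw [CStarRing.norm_self_mul_star, CStarRing.norm_one] at h2
    nlinarith [norm_nonneg (z i j)]
  rcases le_total j i with h | h
  · exact low i j h
  · rw [← norm_star, hz.star_eq]
    have : ∀ l : List B, (∀ x ∈ l, ‖x‖ ≤ 1) → ‖l.prod‖ ≤ 1 := by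
      intro l
      induction l with
      | nil => simp
      | cons a l ih =>
        intro hl
        rw [List.prod_cons]
        exact (norm_mul_le _ _).trans (mul_le_one₀ (hl a (by simp)) (norm_nonneg _)
          (ih fun x hx => hl x (by simp [hx])))
    apply this
    intro x hx
    rw [List.mem_ofFn] at hx
    obtain ⟨k, rfl⟩ := hx
    apply low
    simp only [Fin.le_def, Fin.succAbove, Fin.lt_def, Fin.val_castSucc]
    have : (i : ℕ) ≤ j := h
    split_ifs <;> simp <;> omega

/-- `ℓ²(X)`.  The Hilbert space tensor power `ℓ²(ℕ)^{⊗N}` is realized as `ℓ²(ℕ^N)`, i.e. as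
`Ltwo (Fin N → ℕ)`, where `e_{m₁} ⊗ ⋯ ⊗ e_{m_N}` is the basis vector at `m = (m₁, …, m_N)`. -/
abbrev Ltwo (X : Type) : Type := lp (fun _ : X => ℂ) 2

theorem Ltwo.hasSum_sq {X : Type} (f : Ltwo X) : HasSum (fun x => ‖f x‖ ^ 2) (‖f‖ ^ 2) := by
  have := lp.hasSum_norm (p := 2) (by norm_num) f
  simpa using this

theorem Ltwo.memℓp_of_summable {X : Type} {f : X → ℂ} (hf : Summable fun x => ‖f x‖ ^ 2) :
    Memℓp f 2 := memℓp_gen (by simpa using hf)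

/-- Composition with an injective map. -/
noncomputable def Ltwo.pull {X Y : Type} (φ : X → Y) (hφ : Function.Injective φ) (f : Ltwo Y) :
    Ltwo X :=
  ⟨fun x => f (φ x), Ltwo.memℓp_of_summable ((Ltwo.hasSum_sq f).summable.comp_injective hφ)⟩

/-- The left (backward) shift `S` on `ℓ²(ℕ)`: `(S f)(m) = f(m+1)`, so `S e₀ = 0` and
`S e_{m+1} = e_m`. -/
noncomputable def shift : Ltwo ℕ →L[ℂ] Ltwo ℕ :=
  LinearMap.mkContinuous
    { toFun := fun f => Ltwo.pull Nat.succ Nat.succ_injective f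
      map_add' := fun _ _ => rfl
      map_smul' := fun _ _ => rfl } 1 (by
    intro f
    rw [one_mul]
    refine (sq_le_sq₀ (norm_nonneg _) (norm_nonneg _)).1 ?_
    rw [← (Ltwo.hasSum_sq _).tsum_eq, ← (Ltwo.hasSum_sq f).tsum_eq]
    exact (tsum_comp_le_tsum_of_inj (Ltwo.hasSum_sq f).summable (fun _ => by positivity)
      Nat.succ_injective))

/-- `P₀ = I - S^* S`, the orthogonal projection onto `ℂ e₀`. -/
noncomputable def vacuumProj : Ltwo ℕ →L[ℂ] Ltwo ℕ := 1 - ContinuousLinearMap.adjoint shift * shift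

/-- The vector `j ↦ f(m₁, …, m_{k-1}, j, m_{k+1}, …, m_N)` of `ℓ²(ℕ)`. -/
noncomputable def legSlice {N : ℕ} (k : Fin N) (f : Ltwo (Fin N → ℕ)) (m : Fin N → ℕ) : Ltwo ℕ :=
  Ltwo.pull (fun j => Function.update m k j) (Function.update_injective m k) f

theorem leg_aux {N : ℕ} (k : Fin N) (T : Ltwo ℕ →L[ℂ] Ltwo ℕ) (f : Ltwo (Fin N → ℕ)) :
    Summable (fun m : Fin N → ℕ => ‖T (legSlice k f m) (m k)‖ ^ 2) ∧
      ∑' m : Fin N → ℕ, ‖T (legSlice k f m) (m k)‖ ^ 2 ≤ (‖T‖ * ‖f‖) ^ 2 := by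
  let e : ({j // j ≠ k} → ℕ) × ℕ ≃ (Fin N → ℕ) :=
    (Equiv.prodComm _ _).trans (Equiv.funSplitAt k ℕ).symm
  let s : ({j // j ≠ k} → ℕ) → Ltwo ℕ := fun m' => legSlice k f (e (m', 0))
  have hek : ∀ m' j, e (m', j) k = j := fun m' j => by simp [e, Equiv.funSplitAt]
  have heu : ∀ m' i j, Function.update (e (m', i)) k j = e (m', j) := fun m' i j => by
    funext a
    by_cases h : a = k
    · subst h; simp [hek]
    · simp [e, Equiv.funSplitAt, h]
  have hs : ∀ m' j, legSlice k f (e (m', j)) = s m' := fun m' j => by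
    ext i
    simp only [s, legSlice, Ltwo.pull, heu]
  have hsf : ∀ m' j, s m' j = f (e (m', j)) := fun m' j => by
    simp only [s, legSlice, Ltwo.pull, heu]
  have hf : HasSum (fun x => ‖f (e x)‖ ^ 2) (‖f‖ ^ 2) := (e.hasSum_iff).2 (Ltwo.hasSum_sq f)
  have hf2 : HasSum (fun m' => ‖s m'‖ ^ 2) (‖f‖ ^ 2) := by
    refine hf.prod_fiberwise fun m' => ?_
    simpa only [hsf] using Ltwo.hasSum_sq (s m')
  have hle : ∀ m', ‖T (s m')‖ ^ 2 ≤ ‖T‖ ^ 2 * ‖s m'‖ ^ 2 := fun m' => by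
    rw [← mul_pow]
    gcongr
    exact T.le_opNorm _
  have hT : Summable fun m' => ‖T (s m')‖ ^ 2 :=
    Summable.of_nonneg_of_le (fun _ => by positivity) hle (hf2.summable.mul_left _)
  have hin : ∀ m', HasSum (fun j => ‖T (legSlice k f (e (m', j))) (e (m', j) k)‖ ^ 2)
      (‖T (s m')‖ ^ 2) := fun m' => by
    simpa only [hs, hek] using Ltwo.hasSum_sq (T (s m'))
  have hsum : Summable fun x => ‖T (legSlice k f (e x)) (e x k)‖ ^ 2 := by
    refine (summable_prod_of_nonneg fun _ => by positivity).2 ⟨fun m' => (hin m').summable, ?_⟩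
    simpa only [(hin _).tsum_eq] using hT
  refine ⟨(e.summable_iff).1 hsum, ?_⟩
  rw [← e.tsum_eq, hsum.tsum_prod]
  simp only [(hin _).tsum_eq]
  calc ∑' m', ‖T (s m')‖ ^ 2 ≤ ∑' m', ‖T‖ ^ 2 * ‖s m'‖ ^ 2 :=
        hT.tsum_le_tsum hle (hf2.summable.mul_left _)
    _ = (‖T‖ * ‖f‖) ^ 2 := by rw [tsum_mul_left, hf2.tsum_eq, mul_pow]

/-- `leg k T = I ⊗ ⋯ ⊗ T ⊗ ⋯ ⊗ I` on `ℓ²(ℕ)^{⊗N}`, with `T` acting on the `k`-th tensor factor. -/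
noncomputable def leg {N : ℕ} (k : Fin N) (T : Ltwo ℕ →L[ℂ] Ltwo ℕ) :
    Ltwo (Fin N → ℕ) →L[ℂ] Ltwo (Fin N → ℕ) :=
  LinearMap.mkContinuous
    { toFun := fun f => ⟨fun m => T (legSlice k f m) (m k),
        Ltwo.memℓp_of_summable (leg_aux k T f).1⟩
      map_add' := fun f g => by
        ext m
        have : legSlice k (f + g) m = legSlice k f m + legSlice k g m := rfl
        change T (legSlice k (f + g) m) (m k) = _
        rw [this, map_add]
        rfl
      map_smul' := fun c f => by
        ext m
        have : legSlice k (c • f) m = c • legSlice k f m := rfl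
        change T (legSlice k (c • f) m) (m k) = _
        rw [this, map_smul]
        rfl } ‖T‖ (fun f => by
    refine (sq_le_sq₀ (norm_nonneg _) (by positivity)).1 ?_
    rw [← (Ltwo.hasSum_sq _).tsum_eq]
    exact (leg_aux k T f).2)
theorem leg_apply {N : ℕ} (k : Fin N) (T : Ltwo ℕ →L[ℂ] Ltwo ℕ) (f : Ltwo (Fin N → ℕ))
    (m : Fin N → ℕ) : leg k T f m = T (legSlice k f m) (m k) := rfl

/-- The elementary tensor `T₁ ⊗ T₂ ⊗ ⋯ ⊗ T_N` on `ℓ²(ℕ)^{⊗N}`. -/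
noncomputable def tensorOp {N : ℕ} (T : Fin N → (Ltwo ℕ →L[ℂ] Ltwo ℕ)) :
    Ltwo (Fin N → ℕ) →L[ℂ] Ltwo (Fin N → ℕ) :=
  (List.ofFn fun k => leg k (T k)).prod

/-- A nonzero unital C⋆-algebra with an array of elements satisfying the crystal relations. -/
structure CrystalModel (n : ℕ) : Type 1 where
  carrier : Type
  [cstar : CStarAlgebra carrier]
  [nontriv : Nontrivial carrier]
  z : Fin (n + 1) → Fin (n + 1) → carrier
  rel : CrystalRelations z

attribute [instance] CrystalModel.cstar CrystalModel.nontriv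

/-- The `ℓ^∞`-product of all models; it is a C⋆-algebra. -/
abbrev CrystalProduct (n : ℕ) : Type 1 := lp (fun M : CrystalModel n => M.carrier) ∞

noncomputable instance instCStarAlgebraCrystalProduct (n : ℕ) :
    CStarAlgebra (CrystalProduct n) where

/-- The tautological array in the product of all models. -/
noncomputable def crystalTaut (n : ℕ) (i j : Fin (n + 1)) : CrystalProduct n :=
  ⟨fun M => M.z i j, memℓp_infty ⟨1, by
    rintro _ ⟨M, rfl⟩
    exact M.rel.norm_le_one i j⟩⟩

/-- The C⋆-subalgebra generated by the tautological array. -/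
noncomputable def crystalSubalgebra (n : ℕ) : StarSubalgebra ℂ (CrystalProduct n) :=
  (StarAlgebra.adjoin ℂ
    (Set.range fun p : Fin (n + 1) × Fin (n + 1) => crystalTaut n p.1 p.2)).topologicalClosure

instance instIsClosedCrystalSubalgebra (n : ℕ) :
    IsClosed (crystalSubalgebra n : Set (CrystalProduct n)) :=
  StarSubalgebra.isClosed_topologicalClosure _

/-- The crystallized algebra `A₀(n) = C(SU₀(n+1))`: the universal C⋆-algebra generated by
`z_{i,j}`, `0 ≤ i, j ≤ n`, subject to the crystal relations.  It is the C⋆-algebra generated by the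
tautological array in the product of all models.  (A C⋆-algebra generated by finitely many elements
has a copy in `Type`, so models with carrier in `Type` suffice.) -/
abbrev CrystalAlg (n : ℕ) : Type 1 := crystalSubalgebra n

/-- The generators `z_{i,j}` of `A₀(n)`. -/
noncomputable def crystalGen (n : ℕ) (i j : Fin (n + 1)) : CrystalAlg n :=
  ⟨crystalTaut n i j, StarSubalgebra.le_topologicalClosure _
    (StarAlgebra.subset_adjoin ℂ _ ⟨(i, j), rfl⟩)⟩

/-- Evaluation at a model. -/
noncomputable def CrystalModel.eval {n : ℕ} (M : CrystalModel n) : CrystalAlg n →⋆ₐ[ℂ] M.carrier where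
  toFun x := (x : CrystalProduct n) M
  map_one' := rfl
  map_mul' _ _ := rfl
  map_zero' := rfl
  map_add' _ _ := rfl
  commutes' _ := rfl
  map_star' _ := rfl

theorem CrystalModel.eval_gen {n : ℕ} (M : CrystalModel n) (i j : Fin (n + 1)) :
    M.eval (crystalGen n i j) = M.z i j := rfl

theorem crystalAlg_ext {n : ℕ} {x y : CrystalAlg n}
    (h : ∀ M : CrystalModel n, M.eval x = M.eval y) : x = y :=
  Subtype.ext (lp.ext (funext h))

/-- The generators of `A₀(n)` satisfy the crystal relations. -/
theorem crystalGen_relations (n : ℕ) : CrystalRelations (crystalGen n) where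
  row_zero i j l h := crystalAlg_ext fun M => by
    simpa [CrystalModel.eval_gen] using M.rel.row_zero i j l h
  col_zero i k j h := crystalAlg_ext fun M => by
    simpa [CrystalModel.eval_gen] using M.rel.col_zero i k j h
  anti_comm i k j l h h' := crystalAlg_ext fun M => by
    simpa [CrystalModel.eval_gen] using M.rel.anti_comm i k j l h h'
  anti_zero i k j l h h' h'' := crystalAlg_ext fun M => by
    simpa [CrystalModel.eval_gen] using M.rel.anti_zero i k j l h h' h''
  diag_cross i k j l h h' h'' := crystalAlg_ext fun M => by
    simpa [CrystalModel.eval_gen] using M.rel.diag_cross i k j l h h' h''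
  diag_comm i k j l h h' h'' := crystalAlg_ext fun M => by
    simpa [CrystalModel.eval_gen] using M.rel.diag_comm i k j l h h' h''
  det_one := crystalAlg_ext fun M => by
    rw [map_list_prod, List.map_ofFn, map_one]
    exact M.rel.det_one
  star_eq r s := crystalAlg_ext fun M => by
    rw [map_star, map_list_prod, List.map_ofFn]
    exact M.rel.star_eq r s

/-- The universal property of `A₀(n)`. -/
theorem crystalAlg_existsUnique_lift {n : ℕ} {B : Type} [CStarAlgebra B] [Nontrivial B]
    {T : Fin (n + 1) → Fin (n + 1) → B} (hT : CrystalRelations T) :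
    ∃! φ : CrystalAlg n →⋆ₐ[ℂ] B, ∀ i j, φ (crystalGen n i j) = T i j := by
  refine ⟨(CrystalModel.mk B T hT).eval, fun i j => rfl, fun φ hφ => ?_⟩
  have hc : ∀ ψ : CrystalAlg n →⋆ₐ[ℂ] B, Continuous ψ := fun ψ =>
    AddMonoidHomClass.continuous_of_bound ψ 1 fun a => by
      rw [one_mul]
      exact NonUnitalStarAlgHom.norm_apply_le ψ a
  refine StarAlgHom.ext_topologicalClosure (hc φ) (hc (CrystalModel.mk B T hT).eval) ?_
  refine StarAlgHom.ext_adjoin ?_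
  rintro ⟨_, hx⟩ ⟨p, rfl⟩
  exact hφ p.1 p.2

/-- The convolution of two arrays of operators, from the comultiplication
`Δ(z_{i,j}) = ∑_{k=min(i,j)}^{max(i,j)} z_{i,k} ⊗ z_{k,j}`. -/
def crystalConv {n : ℕ} {B : Type*} [Ring B] (X Y : Fin (n + 1) → Fin (n + 1) → B)
    (i j : Fin (n + 1)) : B :=
  ∑ k ∈ Finset.Icc (min i j) (max i j), X i k * Y k j

/-- The operators `π_{s_r}(z_{i,j})` on `ℓ²(ℕ)`.  Here `r : Fin n` stands for the simple
transposition exchanging `r` and `r + 1` in `{0, …, n}`. -/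
noncomputable def simpleOp {n : ℕ} (r : Fin n) (i j : Fin (n + 1)) : Ltwo ℕ →L[ℂ] Ltwo ℕ :=
  if i = r.castSucc ∧ j = r.castSucc then shift
  else if i = r.succ ∧ j = r.succ then ContinuousLinearMap.adjoint shift
  else if i = r.castSucc ∧ j = r.succ then vacuumProj
  else if i = r.succ ∧ j = r.castSucc then vacuumProj
  else if i = j then 1 else 0

/-- The value at `z_{i,i}` of the character `χ_t`, `t ∈ 𝕋 = T^n`: with indices from `1` to `n + 1`
it is `t₁`, `conj t_{i-1} t_i` and `conj t_n` for `i = 1`, `1 < i < n + 1` and `i = n + 1`. -/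
noncomputable def torusChar {n : ℕ} (t : Fin n → Circle) (i : Fin (n + 1)) : ℂ :=
  (if h : 0 < (i : ℕ) then star (t ⟨i - 1, by omega⟩ : ℂ) else 1) *
    (if h : (i : ℕ) < n then (t ⟨i, h⟩ : ℂ) else 1)

/-- The Hilbert space `ℓ²(ℕ)^{⊗ l(w)}` of a word `w`. -/
abbrev WordSpace {n : ℕ} (w : List (Fin n)) : Type := Ltwo (Fin w.length → ℕ)

/-- The operators `π_w(z_{i,j})`, `π_w = π_{s_{w₁}} * π_{s_{w₂}} * ⋯`; the `k`-th convolution factor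
acts on the `k`-th tensor leg.  The empty word gives the counit `δ_{i,j}` on `ℂ`. -/
noncomputable def wordOp {n : ℕ} (w : List (Fin n)) :
    Fin (n + 1) → Fin (n + 1) → (WordSpace w →L[ℂ] WordSpace w) :=
  (List.ofFn fun k : Fin w.length => fun i j => leg k (simpleOp (w.get k) i j)).foldr crystalConv
    (fun i j => if i = j then 1 else 0)

/-- The operators `π_{t,w}(z_{i,j})`, where `π_{t,w} = χ_t * π_w`. -/
noncomputable def torusWordOp {n : ℕ} (t : Fin n → Circle) (w : List (Fin n)) :
    Fin (n + 1) → Fin (n + 1) → (WordSpace w →L[ℂ] WordSpace w) :=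
  crystalConv (fun i j => if i = j then torusChar t i • 1 else 0) (wordOp w)

/-- `π` is the representation `π_{t,w}` of `A₀(n)`.  The representation `π_w` is `π_{1,w}`. -/
def IsCrystalRep {n : ℕ} (t : Fin n → Circle) (w : List (Fin n))
    (π : CrystalAlg n →⋆ₐ[ℂ] (WordSpace w →L[ℂ] WordSpace w)) : Prop :=
  ∀ i j, π (crystalGen n i j) = torusWordOp t w i j

/-- The permutation `s_{w₁} s_{w₂} ⋯` of `{0, …, n}` given by a word. -/
def wordPerm {n : ℕ} (w : List (Fin n)) : Equiv.Perm (Fin (n + 1)) :=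
  (w.map fun r => Equiv.swap r.castSucc r.succ).prod

/-- `w` is a reduced word: no shorter word gives the same permutation. -/
def IsReducedWord {n : ℕ} (w : List (Fin n)) : Prop :=
  ∀ w' : List (Fin n), wordPerm w' = wordPerm w → w.length ≤ w'.length

/-- The reduced word `w_L = s₁ (s₂ s₁) (s₃ s₂ s₁) ⋯ (s_n s_{n-1} ⋯ s₁)` of the longest element. -/
def longestWord (n : ℕ) : List (Fin n) :=
  (List.finRange n).flatMap fun k => ((List.finRange n).filter fun r => r ≤ k).reverse

/-- The bracket of `p + 1` factors along a lower subdiagonal; with indices from `1` to `n + 1` it is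
`z_{n+1-p,1} z_{n+2-p,2} ⋯ z_{n+1,p+1}`. -/
noncomputable def crystalBracket (n : ℕ) (p : Fin n) : CrystalAlg n :=
  (List.ofFn fun j : Fin (p + 1) =>
    crystalGen n ⟨(n - p) + j, by omega⟩ ⟨j, by omega⟩).prod

/-- The element `a = (z_{n+1,1}) (z_{n,1} z_{n+1,2}) ⋯ (z_{2,1} z_{3,2} ⋯ z_{n+1,n})`. -/
noncomputable def keyElement (n : ℕ) : CrystalAlg n :=
  (List.ofFn fun p : Fin n => crystalBracket n p).prod

/-- A nonzero irreducible representation of a separable unital C⋆-algebra.  Such a representation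
acts on a separable Hilbert space, so up to equivalence its space lies in `Type`. -/
structure IrrRep (A : Type*) [CStarAlgebra A] where
  space : Type
  [normed : NormedAddCommGroup space]
  [inner : InnerProductSpace ℂ space]
  [complete : CompleteSpace space]
  [nontriv : Nontrivial space]
  hom : A →⋆ₐ[ℂ] (space →L[ℂ] space)
  irreducible : ∀ K : Submodule ℂ space, IsClosed (K : Set space) →
    (∀ a, ∀ x ∈ K, hom a x ∈ K) → K = ⊥ ∨ K = ⊤

attribute [instance] IrrRep.normed IrrRep.inner IrrRep.complete IrrRep.nontriv

/-- Unitary equivalence of representations. -/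
def UnitaryEquiv {A H₁ H₂ : Type*} [CStarAlgebra A]
    [NormedAddCommGroup H₁] [InnerProductSpace ℂ H₁] [CompleteSpace H₁]
    [NormedAddCommGroup H₂] [InnerProductSpace ℂ H₂] [CompleteSpace H₂]
    (π₁ : A →⋆ₐ[ℂ] (H₁ →L[ℂ] H₁)) (π₂ : A →⋆ₐ[ℂ] (H₂ →L[ℂ] H₂)) : Prop :=
  ∃ U : H₁ ≃ₗᵢ[ℂ] H₂, ∀ a x, U (π₁ a x) = π₂ a (U x)

instance IrrRep.setoid (A : Type*) [CStarAlgebra A] : Setoid (IrrRep A) where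
  r ρ σ := UnitaryEquiv ρ.hom σ.hom
  iseqv :=
    { refl := fun ρ => ⟨LinearIsometryEquiv.refl ℂ _, fun _ _ => rfl⟩
      symm := fun ⟨U, hU⟩ => ⟨U.symm, fun a x => by
        apply U.injective
        rw [hU]
        simp⟩
      trans := fun ⟨U, hU⟩ ⟨V, hV⟩ => ⟨U.trans V, fun a x => by simp [hU, hV]⟩ }

/-- The set of primitive ideals: kernels of nonzero irreducible representations. -/
def PrimitiveIdeal (A : Type*) [CStarAlgebra A] : Type _ :=
  {J : Ideal A // ∃ ρ : IrrRep A, J = RingHom.ker ρ.hom}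

/-- The primitive ideals containing `M`. -/
def PrimitiveIdeal.hull {A : Type*} [CStarAlgebra A] (M : Set A) : Set (PrimitiveIdeal A) :=
  {J | M ⊆ (J.1 : Set A)}

/-- Primitive ideals are prime. -/
theorem PrimitiveIdeal.mem_or_mem {A : Type*} [CStarAlgebra A] (J : PrimitiveIdeal A) {x y : A}
    (h : ∀ a, x * a * y ∈ J.1) : x ∈ J.1 ∨ y ∈ J.1 := by
  obtain ⟨J, ρ, rfl⟩ := J
  simp only [RingHom.mem_ker] at h ⊢
  by_contra! hxy
  obtain ⟨hx, hy⟩ := hxy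
  obtain ⟨v, hv⟩ : ∃ v, ρ.hom y v ≠ 0 := by
    by_contra! h0
    exact hy (ContinuousLinearMap.ext h0)
  let L : A →ₗ[ℂ] ρ.space :=
    { toFun := fun a => ρ.hom a (ρ.hom y v)
      map_add' := fun a b => by simp
      map_smul' := fun c a => by simp }
  rcases ρ.irreducible (LinearMap.range L).topologicalClosure
      (Submodule.isClosed_topologicalClosure _) (by
    intro a u hu
    refine map_mem_closure (t := (LinearMap.range L : Set ρ.space)) (ρ.hom a).continuous hu ?_
    rintro _ ⟨b, rfl⟩
    exact ⟨a * b, by simp [L]⟩) with h0 | h0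
  · apply hv
    have : ρ.hom y v ∈ (LinearMap.range L).topologicalClosure :=
      Submodule.le_topologicalClosure _ ⟨1, by simp [L]⟩
    rwa [h0, Submodule.mem_bot] at this
  · apply hx
    ext u
    have hu : u ∈ (LinearMap.range L).topologicalClosure := by rw [h0]; trivial
    have hc : IsClosed {u | ρ.hom x u = 0} :=
      isClosed_eq (ρ.hom x).continuous continuous_const
    refine (closure_minimal ?_ hc) hu
    rintro _ ⟨b, rfl⟩
    have := congrArg (fun T => T v) (h b)
    simpa [L] using this

/-- The Jacobson topology: the closed sets are exactly the hulls. -/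
instance PrimitiveIdeal.topology (A : Type*) [CStarAlgebra A] :
    TopologicalSpace (PrimitiveIdeal A) :=
  TopologicalSpace.ofClosed {C | ∃ M : Set A, C = PrimitiveIdeal.hull M}
    ⟨Set.univ, by
      symm
      rw [Set.eq_empty_iff_forall_notMem]
      rintro ⟨J, ρ, rfl⟩ h
      have h1 : (1 : A) ∈ RingHom.ker ρ.hom := h (Set.mem_univ 1)
      rw [RingHom.mem_ker, map_one] at h1
      exact one_ne_zero h1⟩
    (by
      intro F hF
      refine ⟨⋃₀ {M | PrimitiveIdeal.hull M ∈ F}, ?_⟩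
      ext J
      simp only [Set.mem_sInter, PrimitiveIdeal.hull, Set.mem_ofPred_eq, Set.sUnion_subset_iff]
      constructor
      · intro h M hM
        exact h _ hM
      · intro h C hC
        obtain ⟨M, rfl⟩ := hF hC
        exact h M hC)
    (by
      rintro _ ⟨M₁, rfl⟩ _ ⟨M₂, rfl⟩
      refine ⟨{b | ∃ x ∈ M₁, ∃ a, ∃ y ∈ M₂, b = x * a * y}, ?_⟩
      ext J
      constructor
      · obtain ⟨J, ρ, rfl⟩ := J
        rintro (h | h) _ ⟨x, hx, a, y, hy, rfl⟩
        · have := (RingHom.mem_ker).1 (h hx)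
          exact (RingHom.mem_ker).2 (by simp [this])
        · have := (RingHom.mem_ker).1 (h hy)
          exact (RingHom.mem_ker).2 (by simp [this])
      · intro h
        by_contra hc
        simp only [PrimitiveIdeal.hull, Set.mem_union, Set.mem_ofPred_eq, not_or,
          Set.not_subset] at hc
        obtain ⟨⟨x, hx, hxJ⟩, y, hy, hyJ⟩ := hc
        rcases J.mem_or_mem (fun a => h ⟨x, hx, a, y, hy, rfl⟩) with h' | h'
        · exact hxJ h'
        · exact hyJ h')

/-- The spectrum `Â`: equivalence classes of nonzero irreducible representations. -/
def CStarSpectrum (A : Type*) [CStarAlgebra A] : Type _ := Quotient (IrrRep.setoid A)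

/-- The canonical map `Â → Prim(A)`. -/
noncomputable def CStarSpectrum.toPrim {A : Type*} [CStarAlgebra A] : CStarSpectrum A → PrimitiveIdeal A :=
  Quotient.lift (fun ρ => ⟨RingHom.ker ρ.hom, ρ, rfl⟩) (by
    rintro ρ σ ⟨U, hU⟩
    apply Subtype.ext
    ext a
    simp only [RingHom.mem_ker]
    constructor
    · intro h
      ext x
      have := hU a (U.symm x)
      simpa [h] using this.symm
    · intro h
      ext x
      apply U.injective
      rw [hU, h]
      simp)

/-- The topology of `Â` is pulled back from the Jacobson topology. -/
noncomputable instance CStarSpectrum.topology (A : Type*) [CStarAlgebra A] :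
    TopologicalSpace (CStarSpectrum A) :=
  TopologicalSpace.induced CStarSpectrum.toPrim inferInstance

/-- The subset `Â_{0,w} ⊆ Â₀` of the classes of the representations `π_{t,w}`, `t ∈ 𝕋`. -/
def spectrumStratum {n : ℕ} (w : List (Fin n)) : Set (CStarSpectrum (CrystalAlg n)) :=
  {x | ∃ (t : Fin n → Circle) (π : CrystalAlg n →⋆ₐ[ℂ] (WordSpace w →L[ℂ] WordSpace w))
    (ρ : IrrRep (CrystalAlg n)),
    IsCrystalRep t w π ∧ UnitaryEquiv ρ.hom π ∧ (Quotient.mk (IrrRep.setoid _) ρ) = x}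

namespace Crystal

/-! By the universal property, the existence of `π_{t,w}` amounts to the crystal relations for its
array of operators. The array is a convolution of simple reflections, one for each letter, each
given by a coisometry `s` on its own tensor leg. Convolution from the left mixes the rows `r` and `r
+ 1` with coefficients `s`, `star s` and `P = 1 - star s * s`, and the rules `s * star s = 1`, `s *
P = 0` reduce each new relation to the old ones (`CRel.conv_simple`). The torus multiplies the rows
by scalars with product `1`.

A bracket of `a` is a minor: a product of entries at `(f j, j)`, `j < q`, with `f` strictly
increasing. Such a minor obeys a short recursion when a letter is put in front of a reduced word. If
it is nonzero, its rows are dominated, in the sense of counting above every threshold, by the image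
of the first `q` points under the permutation (`cnt_le_of_minor_ne_zero`). For all brackets together
this forces the longest permutation. If the rows are exactly that image, a single branch of the
recursion survives, and the minor is an elementary tensor with `P₀` at the letters which move the
set and `I` elsewhere (`minor_eq_marks`). Every letter of `w_L` moves one of the sets, so `a` goes
to the vacuum projection, up to a scalar of modulus one.

The topological statements rest on the fact that the representations `π_t = π_{t,w_L}` separate the
points of the algebra (`rep_eq_zero`). Let `τ` be any representation and consider `π_{w_L} * τ`.
Normalized constants on large boxes are almost invariant under the shifts, so `π_{w_L}` looks like
the counit there and `τ` is recovered asymptotically (`Sym`). On the other hand `τ` is absorbed by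
the long word: the last row of the array consists of operators whose adjoints have powers tending
strongly to zero, a decomposition of Wold type (`Tower`) splits off a descending block of letters on
the right, and repetition turns `π_{w_L} * τ` into `D * π_{w_L}` with a diagonal array `D` of
commuting unitaries (`exists_absorption`). Gelfand theory for the entries of `D` bounds vacuum
expectations by those of the `π_t`, and the vacuum vectors generate the space (`exists_invariant`).
So an element killed by all `π_t` is killed by `τ`.

Density is then immediate. For openness, the stratum is shown to consist of the irreducible
representations which do not kill `a`. With `p = star a * a`, each `π_t` sends `p * x * p` to a
multiple of the vacuum projection; by separation the corner cut out by `p` is commutative in every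
representation, and in an irreducible one it consists of scalars (`corner_scalar`). The resulting
functional is found on monomials to be the vacuum state of some `π_t`, and uniqueness of the GNS
representation gives the unitary equivalence. -/

/-- The ordered product `f a * f (a + 1) * ⋯ * f (b - 1)`. -/
def oprod {B : Type*} [Monoid B] (f : ℕ → B) (a b : ℕ) : B := ((List.Ico a b).map f).prod

/-! ### Ordered products. -/

section oprod
variable {B : Type*} [Monoid B] {f g : ℕ → B} {a b c : ℕ}

theorem oprod_self (f : ℕ → B) (a : ℕ) : oprod f a a = 1 := by
  rw [oprod, List.Ico.self_empty]; rfl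

theorem oprod_succ (h : a ≤ b) : oprod f a (b + 1) = oprod f a b * f b := by
  simp [oprod, List.Ico.succ_top h]

theorem oprod_cons (h : a < b) : oprod f a b = f a * oprod f (a + 1) b := by
  simp [oprod, List.Ico.eq_cons h]

theorem oprod_mul (h : a ≤ b) (h' : b ≤ c) : oprod f a b * oprod f b c = oprod f a c := by
  rw [oprod, oprod, oprod, ← List.prod_append, ← List.map_append,
    List.Ico.append_consecutive h h']

theorem oprod_congr (h : ∀ i, a ≤ i → i < b → f i = g i) : oprod f a b = oprod g a b := by
  unfold oprod
  congr 1
  refine List.map_congr_left fun i hi => ?_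
  rw [List.Ico.mem] at hi
  exact h i hi.1 hi.2

theorem oprod_one (h : ∀ i, a ≤ i → i < b → f i = 1) : oprod f a b = 1 := by
  rw [oprod_congr h, oprod]
  simp

theorem commute_oprod {x : B} (h : ∀ i, a ≤ i → i < b → Commute x (f i)) :
    Commute x (oprod f a b) := by
  refine Commute.list_prod_right _ _ fun y hy => ?_
  simp only [List.mem_map, List.Ico.mem] at hy
  obtain ⟨i, hi, rfl⟩ := hy
  exact h i hi.1 hi.2

theorem oprod_split (h : a ≤ c) (h' : c < b) :
    oprod f a b = oprod f a c * f c * oprod f (c + 1) b := by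
  rw [← oprod_mul h h'.le, oprod_cons h', mul_assoc]

theorem oprod_shift (f : ℕ → B) (a b c : ℕ) :
    oprod (fun i => f (c + i)) a b = oprod f (a + c) (b + c) := by
  rw [oprod, oprod, ← List.Ico.map_add, List.map_map]
  rfl

theorem map_oprod {C F : Type*} [Monoid C] [FunLike F B C] [MonoidHomClass F B C] (φ : F) :
    φ (oprod f a b) = oprod (fun i => φ (f i)) a b := by
  rw [oprod, map_list_prod, List.map_map]
  rfl

theorem oprod_eq_zero {B : Type*} [MonoidWithZero B] {f : ℕ → B} (h : a ≤ c) (h' : c < b)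
    (h0 : f c = 0) : oprod f a b = 0 := by
  rw [oprod_split h h', h0, mul_zero, zero_mul]

theorem oprod_ofFn (n : ℕ) (f : ℕ → B) :
    (List.ofFn fun i : Fin n => f i).prod = oprod f 0 n := by
  rw [oprod, List.Ico.zero_bot, List.ofFn_eq_map, ← List.map_coe_finRange_eq_range, List.map_map]
  rfl

end oprod

/-! ### Crystal relations and convolution for arrays indexed by `ℕ`. -/

/-- The increasing enumeration of `ℕ \ {r}`. -/
def skip (r i : ℕ) : ℕ := if i < r then i else i + 1

/-- The crystal relations for the entries `y i j`, `i, j ≤ n`, of an array indexed by `ℕ`. -/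
structure CRel (n : ℕ) {B : Type*} [Ring B] [StarRing B] (y : ℕ → ℕ → B) : Prop where
  row_zero : ∀ i j l, i ≤ n → j < l → l ≤ n → y i j * y i l = 0
  col_zero : ∀ i k j, i < k → k ≤ n → j ≤ n → y i j * y k j = 0
  anti_comm : ∀ i k j l, i < k → k ≤ n → j < l → l ≤ n → y i l * y k j = y k j * y i l
  anti_zero : ∀ i k j l, i < k → k ≤ n → j < l → l ≤ n → min k l ≤ max i j →
    y i l * y k j = 0
  diag_cross : ∀ i k j l, i < k → k ≤ n → j < l → l ≤ n → max i j + 1 = min k l →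
    y i j * y k l - y k l * y i j = y i l * y k j
  diag_comm : ∀ i k j l, i < k → k ≤ n → j < l → l ≤ n → max i j + 1 < min k l →
    y i j * y k l = y k l * y i j
  det_one : oprod (fun i => y i i) 0 (n + 1) = 1
  star_eq : ∀ r s, r ≤ n → s ≤ n →
    star (y r s) = oprod (fun i => y (skip r i) (skip s i)) 0 n

/-- Convolution of arrays. -/
def conv {B : Type*} [Ring B] (X Y : ℕ → ℕ → B) (i j : ℕ) : B :=
  ∑ k ∈ Finset.uIcc i j, X i k * Y k j

/-- The identity array. -/
def idArr {B : Type*} [Ring B] (i j : ℕ) : B := if i = j then 1 else 0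

/-- The array of the simple reflection exchanging `r` and `r + 1`. -/
def simpleArr {B : Type*} [Ring B] [Star B] (r : ℕ) (s : B) (i j : ℕ) : B :=
  if i = r ∧ j = r then s
  else if i = r + 1 ∧ j = r + 1 then star s
  else if i = r ∧ j = r + 1 then 1 - star s * s
  else if i = r + 1 ∧ j = r then 1 - star s * s
  else if i = j then 1 else 0

section conv
variable {B : Type*} [Ring B]

theorem conv_assoc (X Y Z : ℕ → ℕ → B) : conv (conv X Y) Z = conv X (conv Y Z) := by
  funext i j
  simp only [conv, Finset.sum_mul, Finset.mul_sum]
  rw [Finset.sum_comm' (s' := fun y => Finset.uIcc y j) (t' := Finset.uIcc i j)]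
  · simp only [mul_assoc]
  · intro a b
    simp only [Finset.mem_uIcc]
    omega

theorem conv_id (X : ℕ → ℕ → B) : conv X idArr = X := by
  funext i j
  rw [conv, Finset.sum_eq_single j]
  · simp [idArr]
  · intro k _ hk
    simp [idArr, hk]
  · simp

theorem id_conv (X : ℕ → ℕ → B) : conv idArr X = X := by
  funext i j
  rw [conv, Finset.sum_eq_single i]
  · simp [idArr]
  · intro k _ hk
    simp [idArr, hk.symm]
  · simp

/-- Transposition reverses the order of convolution; this derives right convolution with a simple
reflection from left convolution. -/
theorem conv_swap {X Y : ℕ → ℕ → B} (h : ∀ i j k l, Commute (X i j) (Y k l)) :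
    (fun i j => conv X Y j i) = conv (fun i j => Y j i) (fun i j => X j i) := by
  funext i j
  rw [conv, conv, Finset.uIcc_comm]
  exact Finset.sum_congr rfl fun k _ => h _ _ _ _

/-- The summation range between `i` and `j` decides which terms occur: row `r` meets row `r + 1`
only in columns beyond `r`, and row `r + 1` meets row `r` only in columns up to `r`. -/
theorem conv_simple [StarRing B] (r : ℕ) (s : B) (Y : ℕ → ℕ → B) (i j : ℕ) :
    conv (simpleArr r s) Y i j =
      if i = r then s * Y r j + (if r < j then (1 - star s * s) * Y (r + 1) j else 0)
      else if i = r + 1 then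
        star s * Y (r + 1) j + (if j ≤ r then (1 - star s * s) * Y r j else 0)
      else Y i j := by
  split_ifs with h1 h2 h3 h4
  · subst h1
    rw [conv, ← Finset.sum_subset (s₁ := {i, i + 1})]
    · rw [Finset.sum_pair (by omega)]
      simp [simpleArr]
    · intro a; simp only [Finset.mem_insert, Finset.mem_singleton, Finset.mem_uIcc]; omega
    · intro a _ ha
      simp only [Finset.mem_insert, Finset.mem_singleton, not_or] at ha
      simp [simpleArr, ha.1, ha.2, Ne.symm ha.1]
  · subst h1
    rw [conv, Finset.sum_eq_single i]
    · simp [simpleArr]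
    · intro a ha hai
      rw [Finset.mem_uIcc] at ha
      have : a ≠ i + 1 := by omega
      simp [simpleArr, hai, Ne.symm hai, this]
    · simp
  · subst h3
    rw [conv, ← Finset.sum_subset (s₁ := {r + 1, r})]
    · rw [Finset.sum_pair (by omega)]
      simp [simpleArr]
    · intro a; simp only [Finset.mem_insert, Finset.mem_singleton, Finset.mem_uIcc]; omega
    · intro a _ ha
      simp only [Finset.mem_insert, Finset.mem_singleton, not_or] at ha
      simp [simpleArr, ha.1, ha.2, Ne.symm ha.1]
  · subst h3
    rw [conv, Finset.sum_eq_single (r + 1)]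
    · simp [simpleArr]
    · intro a ha hai
      rw [Finset.mem_uIcc] at ha
      have : a ≠ r := by omega
      simp [simpleArr, hai, Ne.symm hai, this]
    · simp
  · rw [conv, Finset.sum_eq_single i]
    · simp [simpleArr, h1, h3]
    · intro a _ ha
      simp [simpleArr, h1, h3, Ne.symm ha]
    · simp

end conv

/-! ### Convolution with a simple reflection preserves the crystal relations. -/

section simple
variable {B : Type*} [Ring B] [StarRing B]

/-- `s` commutes with all entries of `y` and with their adjoints. -/
def DComm (s : B) (y : ℕ → ℕ → B) : Prop := ∀ i j, Commute s (y i j) ∧ Commute (star s) (y i j)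

variable {n : ℕ} {y : ℕ → ℕ → B}

theorem CRel.transpose (hy : CRel n y) : CRel n fun i j => y j i where
  row_zero i j l hi hj hl := hy.col_zero _ _ _ hj hl hi
  col_zero i k j hi hk hj := hy.row_zero _ _ _ hj hi hk
  anti_comm i k j l h1 h2 h3 h4 := (hy.anti_comm _ _ _ _ h3 h4 h1 h2).symm
  anti_zero i k j l h1 h2 h3 h4 h5 := by
    rw [← hy.anti_comm _ _ _ _ h3 h4 h1 h2]
    exact hy.anti_zero _ _ _ _ h3 h4 h1 h2 (by omega)
  diag_cross i k j l h1 h2 h3 h4 h5 := by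
    rw [← hy.anti_comm _ _ _ _ h3 h4 h1 h2]
    exact hy.diag_cross _ _ _ _ h3 h4 h1 h2 (by omega)
  diag_comm i k j l h1 h2 h3 h4 h5 := hy.diag_comm _ _ _ _ h3 h4 h1 h2 (by omega)
  det_one := hy.det_one
  star_eq r s hr hs := hy.star_eq s r hs hr

theorem idArr_rel : CRel n (idArr : ℕ → ℕ → B) where
  row_zero i j l hi hj hl := by
    simp only [idArr]; split_ifs <;> first | omega | simp
  col_zero i k j hi hk hj := by
    simp only [idArr]; split_ifs <;> first | omega | simp
  anti_comm i k j l h1 h2 h3 h4 := by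
    simp only [idArr]; split_ifs <;> simp
  anti_zero i k j l h1 h2 h3 h4 h5 := by
    simp only [idArr]; split_ifs <;> first | omega | simp
  diag_cross i k j l h1 h2 h3 h4 h5 := by
    simp only [idArr]; split_ifs <;> first | omega | simp
  diag_comm i k j l h1 h2 h3 h4 h5 := by
    simp only [idArr]; split_ifs <;> simp
  det_one := oprod_one fun i _ _ => by simp [idArr]
  star_eq r s hr hs := by
    rcases lt_trichotomy r s with h | h | h
    -- For `r < s` the factor in position `r` of the minor is the off-diagonal entry at `(r + 1,
    -- r)`; for `s < r` the factor in position `s` is that at `(s, s + 1)`.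
    · rw [oprod_eq_zero (c := r) (by omega) (by omega)]
      · simp [idArr, h.ne]
      · simp [idArr, skip, h]
    · subst h
      rw [oprod_one]
      · simp [idArr]
      · intro i _ _; simp [idArr]
    · rw [oprod_eq_zero (c := s) (by omega) (by omega)]
      · simp [idArr, h.ne']
      · simp [idArr, skip, h]

variable {s : B} {r : ℕ}

/-- Rewriting rules for a coisometry `s` with adjoint `t` and `P = 1 - t * s`, commuting with `y`. -/
structure Toep (s t P : B) (y : ℕ → ℕ → B) : Prop where
  cs : ∀ i j x, y i j * (s * x) = s * (y i j * x)
  ct : ∀ i j x, y i j * (t * x) = t * (y i j * x)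
  cP : ∀ i j x, y i j * (P * x) = P * (y i j * x)
  st : ∀ x, s * (t * x) = x
  ts : ∀ x, t * (s * x) = x - P * x
  sP : ∀ x, s * (P * x) = 0
  Pt : ∀ x, P * (t * x) = 0
  PP : ∀ x, P * (P * x) = P * x

theorem DComm.toep (hs : s * star s = 1) (hc : DComm s y) : Toep s (star s) (1 - star s * s) y := by
  have hcs : ∀ i j x, y i j * (s * x) = s * (y i j * x) := fun i j x => by
    rw [← mul_assoc, ← (hc i j).1.eq, mul_assoc]
  have hct : ∀ i j x, y i j * (star s * x) = star s * (y i j * x) := fun i j x => by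
    rw [← mul_assoc, ← (hc i j).2.eq, mul_assoc]
  have hst : ∀ x, s * (star s * x) = x := fun x => by rw [← mul_assoc, hs, one_mul]
  have hsP : ∀ x, s * ((1 - star s * s) * x) = 0 := fun x => by
    rw [sub_mul, mul_sub, mul_assoc, hst]; simp
  refine ⟨hcs, hct, fun i j x => ?_, hst, fun x => ?_, hsP, fun x => ?_, fun x => ?_⟩
  · rw [sub_mul, mul_sub, mul_assoc, hct, hcs, sub_mul, mul_assoc]; simp
  · rw [sub_mul, mul_assoc]; simp
  · rw [sub_mul, mul_assoc, hst]; simp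
  · rw [sub_mul, mul_assoc, hsP]; simp

theorem CRel.anti_zero' (hy : CRel n y) (i k j l : ℕ) (h1 : i < k) (h2 : k ≤ n) (h3 : j < l)
    (h4 : l ≤ n) (h5 : min k l ≤ max i j) : y k j * y i l = 0 := by
  rw [← hy.anti_comm _ _ _ _ h1 h2 h3 h4, hy.anti_zero _ _ _ _ h1 h2 h3 h4 h5]

theorem CRel.diag_cross' (hy : CRel n y) (i k j l : ℕ) (h1 : i < k) (h2 : k ≤ n) (h3 : j < l)
    (h4 : l ≤ n) (h5 : max i j + 1 = min k l) :
    y k l * y i j = y i j * y k l - y i l * y k j := by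
  rw [← hy.diag_cross _ _ _ _ h1 h2 h3 h4 h5, sub_sub_cancel]

theorem CRel.anti_comm' (hy : CRel n y) (i k j l : ℕ) (h1 : i < k) (h2 : k ≤ n) (h3 : j < l)
    (h4 : l ≤ n) : y k j * y i l = y i l * y k j := (hy.anti_comm _ _ _ _ h1 h2 h3 h4).symm

theorem CRel.diag_comm' (hy : CRel n y) (i k j l : ℕ) (h1 : i < k) (h2 : k ≤ n) (h3 : j < l)
    (h4 : l ≤ n) (h5 : max i j + 1 < min k l) : y k l * y i j = y i j * y k l :=
  (hy.diag_comm _ _ _ _ h1 h2 h3 h4 h5).symm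

/-- The array `simpleArr r s * y`, with `t` and `P` in place of `star s` and `1 - star s * s`. -/
def lmul (r : ℕ) (s t P : B) (y : ℕ → ℕ → B) (i j : ℕ) : B :=
  if i = r then s * y r j + (if r < j then P * y (r + 1) j else 0)
  else if i = r + 1 then t * y (r + 1) j + (if j ≤ r then P * y r j else 0)
  else y i j

section lmul
variable {t P : B} (hy : CRel n y) (h : Toep s t P y) (hr : r < n)
include hy h hr

/-- A normal form computation, the same for all six quadratic relations: split according to the
position of the rows and columns relative to `r` and `r + 1`, move `s`, `t`, `P` to the left with
the rules of `Toep`, and reduce the remaining products of two entries of `y` by its own relations.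
-/
theorem lmul_row_zero (i j l : ℕ) (hi : i ≤ n) (hj : j < l) (hl : l ≤ n) :
    lmul r s t P y i j * lmul r s t P y i l = 0 := by
  unfold lmul
  split_ifs
  all_goals try (exfalso; omega)
  all_goals try subst_vars
  all_goals try
    simp only [mul_add, add_mul, mul_assoc, h.cs, h.ct, h.cP, h.st, h.ts, h.sP, h.Pt, h.PP,
      add_zero, zero_add, zero_mul, mul_zero]
  all_goals try
    simp (disch := omega) only [hy.row_zero, hy.col_zero, hy.anti_zero, hy.anti_zero',
      hy.anti_comm, hy.anti_comm', hy.diag_cross', hy.diag_comm, hy.diag_comm', mul_zero, add_zero, zero_add, sub_zero,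
      mul_sub, sub_self]
  all_goals try abel

theorem lmul_col_zero (i k j : ℕ) (hi : i < k) (hk : k ≤ n) (hj : j ≤ n) :
    lmul r s t P y i j * lmul r s t P y k j = 0 := by
  unfold lmul
  split_ifs
  all_goals try (exfalso; omega)
  all_goals try subst_vars
  all_goals try
    simp only [mul_add, add_mul, mul_assoc, h.cs, h.ct, h.cP, h.st, h.ts, h.sP, h.Pt, h.PP,
      add_zero, zero_add, zero_mul, mul_zero]
  all_goals try
    simp (disch := omega) only [hy.row_zero, hy.col_zero, hy.anti_zero, hy.anti_zero',
      hy.anti_comm, hy.anti_comm', hy.diag_cross', hy.diag_comm, hy.diag_comm', mul_zero, add_zero, zero_add, sub_zero,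
      mul_sub, sub_self]
  all_goals try abel

theorem lmul_anti_comm (i k j l : ℕ) (hi : i < k) (hk : k ≤ n) (hj : j < l) (hl : l ≤ n) :
    lmul r s t P y i l * lmul r s t P y k j = lmul r s t P y k j * lmul r s t P y i l := by
  unfold lmul
  split_ifs
  all_goals try (exfalso; omega)
  all_goals try subst_vars
  all_goals try
    simp only [mul_add, add_mul, mul_assoc, h.cs, h.ct, h.cP, h.st, h.ts, h.sP, h.Pt, h.PP,
      add_zero, zero_add, zero_mul, mul_zero]
  all_goals try
    simp (disch := omega) only [hy.row_zero, hy.col_zero, hy.anti_zero, hy.anti_zero',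
      hy.anti_comm, hy.anti_comm', hy.diag_cross', hy.diag_comm, hy.diag_comm', mul_zero, add_zero, zero_add, sub_zero,
      mul_sub, sub_self]
  all_goals try abel

theorem lmul_anti_zero (i k j l : ℕ) (hi : i < k) (hk : k ≤ n) (hj : j < l) (hl : l ≤ n)
    (hm : min k l ≤ max i j) :
    lmul r s t P y i l * lmul r s t P y k j = 0 := by
  unfold lmul
  split_ifs
  all_goals try (exfalso; omega)
  all_goals try subst_vars
  all_goals try
    simp only [mul_add, add_mul, mul_assoc, h.cs, h.ct, h.cP, h.st, h.ts, h.sP, h.Pt, h.PP,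
      add_zero, zero_add, zero_mul, mul_zero]
  all_goals try
    simp (disch := omega) only [hy.row_zero, hy.col_zero, hy.anti_zero, hy.anti_zero',
      hy.anti_comm, hy.anti_comm', hy.diag_cross', hy.diag_comm, hy.diag_comm', mul_zero, add_zero, zero_add, sub_zero,
      mul_sub, sub_self]
  all_goals try abel

theorem lmul_diag_cross (i k j l : ℕ) (hi : i < k) (hk : k ≤ n) (hj : j < l) (hl : l ≤ n)
    (hm : max i j + 1 = min k l) :
    lmul r s t P y i j * lmul r s t P y k l -
      lmul r s t P y k l * lmul r s t P y i j =
      lmul r s t P y i l * lmul r s t P y k j := by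
  unfold lmul
  split_ifs
  all_goals try (exfalso; omega)
  all_goals try subst_vars
  all_goals try
    simp only [mul_add, add_mul, mul_assoc, h.cs, h.ct, h.cP, h.st, h.ts, h.sP, h.Pt, h.PP,
      add_zero, zero_add, zero_mul, mul_zero]
  all_goals try
    simp (disch := omega) only [hy.row_zero, hy.col_zero, hy.anti_zero, hy.anti_zero',
      hy.anti_comm, hy.anti_comm', hy.diag_cross', hy.diag_comm, hy.diag_comm', mul_zero, add_zero, zero_add, sub_zero,
      mul_sub, sub_self]
  all_goals try abel

theorem lmul_diag_comm (i k j l : ℕ) (hi : i < k) (hk : k ≤ n) (hj : j < l) (hl : l ≤ n)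
    (hm : max i j + 1 < min k l) :
    lmul r s t P y i j * lmul r s t P y k l =
      lmul r s t P y k l * lmul r s t P y i j := by
  unfold lmul
  split_ifs
  all_goals try (exfalso; omega)
  all_goals try subst_vars
  all_goals try
    simp only [mul_add, add_mul, mul_assoc, h.cs, h.ct, h.cP, h.st, h.ts, h.sP, h.Pt, h.PP,
      add_zero, zero_add, zero_mul, mul_zero]
  all_goals try
    simp (disch := omega) only [hy.row_zero, hy.col_zero, hy.anti_zero, hy.anti_zero',
      hy.anti_comm, hy.anti_comm', hy.diag_cross', hy.diag_comm, hy.diag_comm', mul_zero, add_zero, zero_add, sub_zero,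
      mul_sub, sub_self]
  all_goals try abel

end lmul

theorem conv_simple_eq (r : ℕ) (s : B) (y : ℕ → ℕ → B) :
    conv (simpleArr r s) y = lmul r s (star s) (1 - star s * s) y := by
  funext i j
  rw [conv_simple]
  rfl

theorem DComm.proj (hc : DComm s y) (i j : ℕ) : Commute (1 - star s * s) (y i j) :=
  (Commute.one_left _).sub_left ((hc i j).2.mul_left (hc i j).1)

theorem star_proj (s : B) : star (1 - star s * s) = 1 - star s * s := by simp

theorem lmul_of_ne {t P : B} {i : ℕ} (h1 : i ≠ r) (h2 : i ≠ r + 1) (j : ℕ) :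
    lmul r s t P y i j = y i j := by simp [lmul, h1, h2]

/-- Only the leading term survives, because `s * t = 1` and `s * P = P * t = 0`; the term with `P *
P` would need `r < j < l ≤ r`. -/
theorem lmul_pair {t P : B} (h : Toep s t P y) {j l : ℕ} (hj : j < l) :
    lmul r s t P y r j * lmul r s t P y (r + 1) l = y r j * y (r + 1) l := by
  simp only [lmul, if_true, Nat.succ_ne_self, if_false]
  split_ifs
  all_goals first
    | omega
    | simp only [mul_add, add_mul, mul_assoc, h.cs, h.ct, h.cP, h.st, h.ts, h.sP, h.Pt, h.PP,
      add_zero, zero_add, mul_zero, zero_mul]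

/-- An ordered product over rows containing both or neither of `r`, `r + 1` is not changed. -/
theorem oprod_lmul {t P : B} (h : Toep s t P y) {a b : ℕ} {f g : ℕ → ℕ}
    (hg : ∀ i, a ≤ i → i + 1 < b → g i < g (i + 1))
    (hf : (∀ i, a ≤ i → i < b → f i ≠ r ∧ f i ≠ r + 1) ∨
      ∃ c, a ≤ c ∧ c + 1 < b ∧ f c = r ∧ f (c + 1) = r + 1 ∧
        ∀ i, a ≤ i → i < b → i ≠ c → i ≠ c + 1 → f i ≠ r ∧ f i ≠ r + 1) :
    oprod (fun i => lmul r s t P y (f i) (g i)) a b = oprod (fun i => y (f i) (g i)) a b := by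
  rcases hf with hf | ⟨c, h1, h2, h3, h4, hf⟩
  · exact oprod_congr fun i hi hi' => lmul_of_ne (hf i hi hi').1 (hf i hi hi').2 _
  · have e : ∀ i, a ≤ i → i < b → i ≠ c → i ≠ c + 1 →
        lmul r s t P y (f i) (g i) = y (f i) (g i) := fun i h1 h2 h3 h4 =>
      lmul_of_ne (hf i h1 h2 h3 h4).1 (hf i h1 h2 h3 h4).2 _
    have sp : ∀ F : ℕ → B, oprod F a b = oprod F a c * (F c * F (c + 1)) * oprod F (c + 2) b :=
      fun F => by
        rw [oprod_split h1 (Nat.lt_of_succ_lt h2), oprod_cons h2]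
        simp only [mul_assoc]
    rw [sp, sp fun i => y (f i) (g i)]
    rw [oprod_congr (a := a) (b := c) fun i h1 h2 => e i (by omega) (by omega) (by omega) (by omega),
      oprod_congr (b := b) fun i h1 h2 => e i (by omega) (by omega) (by omega) (by omega)]
    have := lmul_pair (r := r) h (hg c h1 h2)
    simp only [h3, h4]
    rw [this]

theorem lmul_det_one {t P : B} (hy : CRel n y) (h : Toep s t P y) (hr : r < n) :
    oprod (fun i => lmul r s t P y i i) 0 (n + 1) = 1 := by
  rw [← hy.det_one]
  refine oprod_lmul (f := id) (g := id) h (fun i _ _ => Nat.lt_succ_self i)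
    (Or.inr ⟨r, by omega, by omega, rfl, rfl, fun i _ _ h1 h2 => ⟨h1, h2⟩⟩)

/-- If `p` is `r` or `r + 1`, the minor contains just the other of these two rows, in position `r`,
and this one factor carries the whole change. For all other `p` the minor contains both rows in
neighbouring positions and does not change. -/
theorem lmul_star_eq (hy : CRel n y) (hs : s * star s = 1) (hc : DComm s y) (hr : r < n)
    (p q : ℕ) (hp : p ≤ n) (hq : q ≤ n) :
    star (lmul r s (star s) (1 - star s * s) y p q) =
      oprod (fun i => lmul r s (star s) (1 - star s * s) y (skip p i) (skip q i)) 0 n := by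
  have h := hc.toep hs
  have hcs : ∀ i j, star (y i j) * star s = star s * star (y i j) := fun i j =>
    (hc i j).1.star_star.eq.symm
  have hcs' : ∀ i j, star (y i j) * s = s * star (y i j) := fun i j => by
    simpa using (hc i j).2.star_star.eq.symm
  have hcP : ∀ i j, star (y i j) * (1 - star s * s) = (1 - star s * s) * star (y i j) :=
    fun i j => by simpa [star_proj] using (hc.proj i j).star_star.eq.symm
  by_cases h1 : p = r
  · subst h1
    have e : ∀ i, i ≠ p → ∀ j, lmul p s (star s) (1 - star s * s) y (skip p i) j =
        y (skip p i) j := fun i hi j => by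
      apply lmul_of_ne <;> simp only [skip] <;> split_ifs <;> omega
    rw [oprod_split (c := p) (by omega) hr,
      oprod_congr (a := 0) (b := p) fun i h1 h2 => e i (by omega) _,
      oprod_congr (b := n) fun i h1 h2 => e i (by omega) _]
    have h2 : skip p p = p + 1 := by simp [skip]
    -- The minors which compute the adjoints of the rows `p` and `p + 1` share all factors except
    -- the one in position `p`.
    have h3 : ∀ q', (q' = p ∨ q' = p + 1) → star (y q' q) =
        oprod (fun i => y (skip p i) (skip q i)) 0 p * y (p + 1 - (q' - p)) (skip q p) *
        oprod (fun i => y (skip p i) (skip q i)) (p + 1) n := fun q' hq' => by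
      rw [hy.star_eq _ _ (by omega) hq, oprod_split (c := p) (by omega) hr]
      refine congr_arg₂ _ (congr_arg₂ _ ?_ ?_) ?_
      · refine oprod_congr fun i h1 h2 => ?_
        congr 1; simp only [skip]; split_ifs <;> omega
      · congr 1; simp only [skip]; split_ifs <;> omega
      · refine oprod_congr fun i h1 h2 => ?_
        congr 1; simp only [skip]; split_ifs <;> omega
    have c1 : Commute (oprod (fun i => y (skip p i) (skip q i)) 0 p) (star s) :=
      (commute_oprod fun i _ _ => (hc _ _).2).symm
    have c2 : Commute (oprod (fun i => y (skip p i) (skip q i)) 0 p) (1 - star s * s) :=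
      (commute_oprod fun i _ _ => hc.proj _ _).symm
    have h4 := h3 p (Or.inl rfl)
    have h5 := h3 (p + 1) (Or.inr rfl)
    simp only [Nat.sub_self, Nat.sub_zero, Nat.add_sub_cancel_left, Nat.add_sub_cancel] at h4 h5
    simp only [h2]
    simp only [lmul, if_true, Nat.succ_ne_self, if_false]
    by_cases h6 : p < q
    · have : skip q p ≤ p := by simp [skip, h6]
      rw [if_pos h6, if_pos this, star_add, star_mul, star_mul, hcs, star_proj, hcP, h4, h5,
        mul_add, add_mul]
      simp only [← mul_assoc, c1.eq, c2.eq]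
    · have : ¬ skip q p ≤ p := by simp [skip, h6]
      rw [if_neg h6, if_neg this, add_zero, add_zero, star_mul, hcs, h4]
      simp only [← mul_assoc, c1.eq]
  by_cases h2 : p = r + 1
  · subst h2
    have e : ∀ i, i ≠ r → ∀ j, lmul r s (star s) (1 - star s * s) y (skip (r + 1) i) j =
        y (skip (r + 1) i) j := fun i hi j => by
      apply lmul_of_ne <;> simp only [skip] <;> split_ifs <;> omega
    rw [oprod_split (c := r) (by omega) hr,
      oprod_congr (a := 0) (b := r) fun i h1 h2 => e i (by omega) _,
      oprod_congr (b := n) fun i h1 h2 => e i (by omega) _]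
    have h2 : skip (r + 1) r = r := by simp [skip]
    have h3 : ∀ q', (q' = r ∨ q' = r + 1) → star (y q' q) =
        oprod (fun i => y (skip (r + 1) i) (skip q i)) 0 r * y (r + 1 - (q' - r)) (skip q r) *
        oprod (fun i => y (skip (r + 1) i) (skip q i)) (r + 1) n := fun q' hq' => by
      rw [hy.star_eq _ _ (by omega) hq, oprod_split (c := r) (by omega) hr]
      refine congr_arg₂ _ (congr_arg₂ _ ?_ ?_) ?_
      · refine oprod_congr fun i h1 h2 => ?_
        congr 1; simp only [skip]; split_ifs <;> omega
      · congr 1; simp only [skip]; split_ifs <;> omega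
      · refine oprod_congr fun i h1 h2 => ?_
        congr 1; simp only [skip]; split_ifs <;> omega
    have c1 : Commute (oprod (fun i => y (skip (r + 1) i) (skip q i)) 0 r) s :=
      (commute_oprod fun i _ _ => (hc _ _).1).symm
    have c2 : Commute (oprod (fun i => y (skip (r + 1) i) (skip q i)) 0 r) (1 - star s * s) :=
      (commute_oprod fun i _ _ => hc.proj _ _).symm
    have h4 := h3 r (Or.inl rfl)
    have h5 := h3 (r + 1) (Or.inr rfl)
    simp only [Nat.sub_self, Nat.sub_zero, Nat.add_sub_cancel_left, Nat.add_sub_cancel] at h4 h5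
    simp only [h2]
    simp only [lmul, if_true, Nat.succ_ne_self, if_false]
    by_cases h6 : q ≤ r
    · have : r < skip q r := by simp only [skip]; split_ifs <;> omega
      rw [if_pos h6, if_pos this, star_add, star_mul, star_mul, star_star, hcs', star_proj, hcP,
        h4, h5, mul_add, add_mul]
      simp only [← mul_assoc, c1.eq, c2.eq]
    · have : ¬ r < skip q r := by simp only [skip]; split_ifs <;> omega
      rw [if_neg h6, if_neg this, add_zero, add_zero, star_mul, star_star, hcs', h5]
      simp only [← mul_assoc, c1.eq]
  · rw [lmul_of_ne h1 h2, hy.star_eq _ _ hp hq, oprod_lmul h]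
    · intro i _ _
      simp only [skip]; split_ifs <;> omega
    · right
      -- The position of row `r` once row `p` has been removed.
      refine ⟨if r < p then r else r - 1, by omega, ?_, ?_, ?_, fun i _ _ h4 h5 => ?_⟩
      · split_ifs <;> omega
      all_goals simp only [skip]; split_ifs at * <;> omega

/-- Convolution from the left with a simple reflection preserves the crystal relations. -/
theorem CRel.conv_simple (hy : CRel n y) (hs : s * star s = 1) (hc : DComm s y) (hr : r < n) :
    CRel n (conv (simpleArr r s) y) := by
  have h := hc.toep hs
  rw [conv_simple_eq]
  exact
    { row_zero := lmul_row_zero hy h hr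
      col_zero := lmul_col_zero hy h hr
      anti_comm := lmul_anti_comm hy h hr
      anti_zero := lmul_anti_zero hy h hr
      diag_cross := lmul_diag_cross hy h hr
      diag_comm := lmul_diag_comm hy h hr
      det_one := lmul_det_one hy h hr
      star_eq := lmul_star_eq hy hs hc hr }

theorem simpleArr_comm (r : ℕ) (s : B) (i j : ℕ) : simpleArr r s i j = simpleArr r s j i := by
  simp only [simpleArr]
  split_ifs <;> first | rfl | omega

theorem DComm.simple (hc : DComm s y) (i j k l : ℕ) :
    Commute (simpleArr r s i j) (y k l) ∧ Commute (star (simpleArr r s i j)) (y k l) := by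
  have h1 := hc k l
  have h2 := hc.proj k l
  simp only [simpleArr]
  split_ifs <;> simp_all [star_proj]

theorem conv_simple_right (hc : DComm s y) :
    conv y (simpleArr r s) = fun i j => conv (simpleArr r s) (fun i j => y j i) j i := by
  have := conv_swap (X := y) (Y := simpleArr r s) fun i j k l => (hc.simple k l i j).1.symm
  funext i j
  have h2 := congrFun (congrFun this j) i
  rw [h2]
  congr 1
  funext a b
  exact simpleArr_comm _ _ _ _

theorem CRel.conv_simple_right (hy : CRel n y) (hs : s * star s = 1) (hc : DComm s y)
    (hr : r < n) : CRel n (conv y (simpleArr r s)) := by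
  rw [Crystal.conv_simple_right hc]
  exact (hy.transpose.conv_simple hs (fun i j => hc j i) hr).transpose

/-- The entries on and above the diagonal determine a crystal array. -/
theorem CRel.ext_upper {y' : ℕ → ℕ → B} (hy : CRel n y) (hy' : CRel n y')
    (h : ∀ i j, i ≤ j → j ≤ n → y i j = y' i j) (i j : ℕ) (hi : i ≤ n) (hj : j ≤ n) :
    y i j = y' i j := by
  rcases le_or_gt i j with hij | hij
  · exact h i j hij hj
  -- The adjoint of an entry below the diagonal is a product of entries on or above it.
  · apply star_injective
    rw [hy.star_eq _ _ hi hj, hy'.star_eq _ _ hi hj]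
    refine oprod_congr fun a _ ha => h _ _ ?_ ?_
    all_goals simp only [skip]; split_ifs <;> omega

/-- Multiplication of the rows by commuting unitaries with product `1`. -/
theorem CRel.twist (hy : CRel n y) {d : ℕ → B} (hd : ∀ i, d i * star (d i) = 1)
    (hd' : ∀ i, star (d i) * d i = 1) (hdd : ∀ i j, Commute (d i) (d j))
    (hdy : ∀ i, DComm (d i) y) (hprod : oprod d 0 (n + 1) = 1) :
    CRel n fun i j => d i * y i j := by
  have key : ∀ i k j l, d i * y i j * (d k * y k l) = d i * d k * (y i j * y k l) :=
    fun i k j l => by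
      rw [mul_assoc, ← mul_assoc (y i j), ← (hdy k i j).1.eq]
      simp only [mul_assoc]
  have hprods : ∀ (f : ℕ → ℕ) (g : ℕ → ℕ) m, oprod (fun i => d (f i) * y (f i) (g i)) 0 m =
      oprod (fun i => d (f i)) 0 m * oprod (fun i => y (f i) (g i)) 0 m := by
    intro f g m
    induction m with
    | zero => simp [oprod_self]
    | succ m ih =>
      rw [oprod_succ (Nat.zero_le _), oprod_succ (Nat.zero_le _), oprod_succ (Nat.zero_le _), ih]
      have : Commute (d (f m)) (oprod (fun i => y (f i) (g i)) 0 m) :=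
        commute_oprod fun i _ _ => (hdy _ _ _).1
      rw [mul_assoc, ← mul_assoc (oprod (fun i => y (f i) (g i)) 0 m), ← this.eq]
      simp only [mul_assoc]
  refine ⟨?_, ?_, ?_, ?_, ?_, ?_, ?_, ?_⟩
  · intro i j l h1 h2 h3; rw [key, hy.row_zero _ _ _ h1 h2 h3, mul_zero]
  · intro i k j h1 h2 h3; rw [key, hy.col_zero _ _ _ h1 h2 h3, mul_zero]
  · intro i k j l h1 h2 h3 h4
    rw [key, key, hy.anti_comm _ _ _ _ h1 h2 h3 h4, (hdd i k).eq]
  · intro i k j l h1 h2 h3 h4 h5; rw [key, hy.anti_zero _ _ _ _ h1 h2 h3 h4 h5, mul_zero]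
  · intro i k j l h1 h2 h3 h4 h5
    rw [key, key, key, (hdd k i).eq, ← mul_sub, hy.diag_cross _ _ _ _ h1 h2 h3 h4 h5]
  · intro i k j l h1 h2 h3 h4 h5
    rw [key, key, (hdd k i).eq, hy.diag_comm _ _ _ _ h1 h2 h3 h4 h5]
  · have := hprods id id (n + 1)
    simp only [id] at this
    rw [this, hy.det_one, hprod, mul_one]
  · intro r s hr hs
    rw [hprods, ← hy.star_eq _ _ hr hs, star_mul]
    -- The factors commute, so `d r` can be taken out of the full product, which is `1`.
    have h1 : d r * oprod (fun i => d (skip r i)) 0 n = 1 := by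
      rw [← hprod, oprod_split (f := d) (c := r) (b := n + 1) (by omega) (by omega),
        ← oprod_mul (f := fun i => d (skip r i)) (b := r) (by omega) hr]
      have c : Commute (d r) (oprod d 0 r) := commute_oprod fun i _ _ => hdd _ _
      rw [oprod_congr (g := d) (fun i _ hi => by simp [skip, hi]),
        oprod_congr (f := fun i => d (skip r i)) (g := fun i => d (1 + i)) (fun i hi _ => by
          simp [skip, Nat.add_comm, Nat.not_lt.2 hi]), oprod_shift, ← mul_assoc, c.eq]
    have h2 : oprod (fun i => d (skip r i)) 0 n = star (d r) := by
      rw [← one_mul (oprod _ _ _), ← hd' r, mul_assoc, h1, mul_one]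
    rw [h2]
    exact ((hdy r r s).1.star_star).eq.symm

end simple

/-! ### Operators on `ℓ²(I; E)`: pull-backs along injections and amplifications. -/

/-- The Hilbert space `ℓ²(I; E)`. -/
abbrev L2 (I E : Type) [NormedAddCommGroup E] : Type := lp (fun _ : I => E) 2

section L2
variable {I E V : Type} [NormedAddCommGroup E] [InnerProductSpace ℂ E]
  [NormedAddCommGroup V] [InnerProductSpace ℂ V]

theorem L2.hasSum_sq (f : L2 I E) : HasSum (fun x => ‖f x‖ ^ 2) (‖f‖ ^ 2) := by
  have := lp.hasSum_norm (p := 2) (by norm_num) f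
  simpa using this

theorem L2.memℓp {f : I → E} (hf : Summable fun x => ‖f x‖ ^ 2) : Memℓp f 2 :=
  memℓp_gen (by simpa using hf)

/-- A bounded operator into `ℓ²(I; E)` from its coordinates. -/
noncomputable def L2.op (F : V →ₗ[ℂ] (I → E)) (C : ℝ) (hC : 0 ≤ C)
    (h : ∀ v, Summable (fun i => ‖F v i‖ ^ 2) ∧ ∑' i, ‖F v i‖ ^ 2 ≤ (C * ‖v‖) ^ 2) :
    V →L[ℂ] L2 I E :=
  LinearMap.mkContinuous
    { toFun := fun v => ⟨F v, L2.memℓp (h v).1⟩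
      map_add' := fun v w => by ext i; exact congrFun (map_add F v w) i
      map_smul' := fun c v => by ext i; exact congrFun (map_smul F c v) i } C (fun v => by
    refine (sq_le_sq₀ (norm_nonneg _) (by positivity)).1 ?_
    rw [← (L2.hasSum_sq _).tsum_eq]
    exact (h v).2)

/-- The vector `e_i ⊗ a`. -/
noncomputable def L2.single [DecidableEq I] (i : I) (a : E) : L2 I E := lp.single 2 i a

theorem L2.single_apply [DecidableEq I] (i : I) (a : E) (j : I) :
    (L2.single i a : L2 I E) j = if j = i then a else 0 := by
  rw [L2.single, lp.single_apply, Pi.single_apply]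

theorem L2.inner_single [DecidableEq I] (i : I) (a : E) (f : L2 I E) :
    inner ℂ (L2.single i a) f = inner ℂ a (f i) := lp.inner_single_left _ _ _

theorem L2.norm_single [DecidableEq I] (i : I) (a : E) : ‖(L2.single i a : L2 I E)‖ = ‖a‖ :=
  lp.norm_single (by norm_num) _ _

/-- Composition with an injective map of the index set. -/
noncomputable def pullL (E : Type) [NormedAddCommGroup E] [InnerProductSpace ℂ E] (φ : I → I) (hφ : Function.Injective φ) : L2 I E →L[ℂ] L2 I E :=
  L2.op { toFun := fun f i => f (φ i), map_add' := fun _ _ => rfl, map_smul' := fun _ _ => rfl } 1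
    zero_le_one fun f => by
      rw [one_mul, ← (L2.hasSum_sq f).tsum_eq]
      exact ⟨(L2.hasSum_sq f).summable.comp_injective hφ,
        tsum_comp_le_tsum_of_inj (L2.hasSum_sq f).summable (fun _ => by positivity) hφ⟩

theorem pullL_apply (φ : I → I) (hφ : Function.Injective φ) (f : L2 I E) (i : I) :
    pullL E φ hφ f i = f (φ i) := rfl

theorem ampAux (Y : E →L[ℂ] E) (f : L2 I E) : Summable (fun i => ‖Y (f i)‖ ^ 2) ∧
    ∑' i, ‖Y (f i)‖ ^ 2 ≤ (‖Y‖ * ‖f‖) ^ 2 := by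
  have hle : ∀ i, ‖Y (f i)‖ ^ 2 ≤ ‖Y‖ ^ 2 * ‖f i‖ ^ 2 := fun i => by
    rw [← mul_pow]
    gcongr
    exact Y.le_opNorm _
  have hs := (L2.hasSum_sq f).mul_left (‖Y‖ ^ 2)
  have h1 : Summable fun i => ‖Y (f i)‖ ^ 2 :=
    Summable.of_nonneg_of_le (fun _ => by positivity) hle hs.summable
  refine ⟨h1, (h1.tsum_le_tsum hle hs.summable).trans ?_⟩
  rw [hs.tsum_eq, mul_pow]

/-- The amplification `Y ↦ 1 ⊗ Y`. -/
noncomputable def ampFun (I : Type) (Y : E →L[ℂ] E) : L2 I E →L[ℂ] L2 I E :=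
  L2.op { toFun := fun f i => Y (f i)
          map_add' := fun f g => by ext i; simp
          map_smul' := fun c f => by ext i; simp } ‖Y‖ (norm_nonneg _) (ampAux Y)

theorem ampFun_apply (Y : E →L[ℂ] E) (f : L2 I E) (i : I) : ampFun I Y f i = Y (f i) := rfl

variable [CompleteSpace E]

/-- Pairing with `e_i ⊗ a` reads off the coordinate `i`, and the pull-back takes `e_{φ i} ⊗ a` to
`e_i ⊗ a`. -/
theorem pullL_star (φ : I → I) (hφ : Function.Injective φ) (f : L2 I E) (i : I) :
    star (pullL E φ hφ : L2 I E →L[ℂ] L2 I E) f (φ i) = f i := by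
  classical
  refine ext_inner_left ℂ fun a => ?_
  rw [← L2.inner_single, ContinuousLinearMap.star_eq_adjoint,
    ContinuousLinearMap.adjoint_inner_right, ← L2.inner_single]
  congr 1
  ext j
  rw [pullL_apply, L2.single_apply, L2.single_apply]
  simp only [hφ.eq_iff]

theorem pullL_star_of_notMem (φ : I → I) (hφ : Function.Injective φ) (f : L2 I E) (i : I)
    (hi : ∀ j, φ j ≠ i) : star (pullL E φ hφ : L2 I E →L[ℂ] L2 I E) f i = 0 := by
  classical
  refine ext_inner_left ℂ fun a => ?_
  rw [← L2.inner_single, ContinuousLinearMap.star_eq_adjoint,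
    ContinuousLinearMap.adjoint_inner_right]
  have : pullL E φ hφ (L2.single i a) = (0 : L2 I E) := by
    ext j
    rw [pullL_apply, L2.single_apply, if_neg (hi j)]
    rfl
  rw [this]; simp

theorem pullL_mul_star (φ : I → I) (hφ : Function.Injective φ) :
    (pullL E φ hφ : L2 I E →L[ℂ] L2 I E) * star (pullL E φ hφ) = 1 := by
  ext f i
  exact pullL_star φ hφ f i

/-- The amplification `Y ↦ 1 ⊗ Y` as a homomorphism. -/
noncomputable def amp (I E : Type) [NormedAddCommGroup E] [InnerProductSpace ℂ E]
    [CompleteSpace E] : (E →L[ℂ] E) →⋆ₐ[ℂ] (L2 I E →L[ℂ] L2 I E) where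
  toFun := ampFun I
  map_one' := by ext f i; rfl
  map_mul' _ _ := by ext f i; rfl
  map_zero' := by ext f i; rfl
  map_add' _ _ := by ext f i; rfl
  commutes' _ := by ext f i; rfl
  map_star' Y := by
    rw [ContinuousLinearMap.star_eq_adjoint, ContinuousLinearMap.star_eq_adjoint,
      ContinuousLinearMap.eq_adjoint_iff]
    intro f g
    rw [lp.inner_eq_tsum, lp.inner_eq_tsum]
    congr 1
    funext i
    rw [ampFun_apply, ampFun_apply, ContinuousLinearMap.adjoint_inner_left]

theorem amp_apply (Y : E →L[ℂ] E) (f : L2 I E) (i : I) : amp I E Y f i = Y (f i) := rfl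

theorem commute_pullL_amp (φ : I → I) (hφ : Function.Injective φ) (Y : E →L[ℂ] E) :
    Commute (pullL E φ hφ) (amp I E Y) := by
  change pullL E φ hφ * amp I E Y = amp I E Y * pullL E φ hφ
  ext f i
  rfl

theorem commute_star_pullL_amp (φ : I → I) (hφ : Function.Injective φ) (Y : E →L[ℂ] E) :
    Commute (star (pullL E φ hφ)) (amp I E Y) := by
  have := (commute_pullL_amp φ hφ (star Y)).star_star
  rwa [← map_star, star_star] at this

/-- Operators which agree on the vectors `e_i ⊗ h` are equal. -/
theorem L2.ext_single [DecidableEq I] {F : Type} [NormedAddCommGroup F] [InnerProductSpace ℂ F]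
    {X Y : L2 I E →L[ℂ] F}
    (h : ∀ i a, X (L2.single i a) = Y (L2.single i a)) : X = Y := by
  ext f
  have h1 := (lp.hasSum_single (p := 2) (by norm_num) f)
  have h2 := h1.mapL X
  have h3 : HasSum (fun i => X (lp.single 2 i (f i))) (Y f) := by
    have e : ∀ i, X (lp.single 2 i (f i)) = Y (lp.single 2 i (f i)) := fun i => h i (f i)
    simpa only [e] using h1.mapL Y
  exact h2.unique h3

theorem amp_single [DecidableEq I] (Y : E →L[ℂ] E) (i : I) (a : E) :
    amp I E Y (L2.single i a) = L2.single i (Y a) := by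
  ext j
  rw [amp_apply, L2.single_apply, L2.single_apply]
  by_cases h : j = i
  · subst h; simp
  · simp [h]

theorem pullL_single [DecidableEq I] (φ : I → I) (hφ : Function.Injective φ) (i : I) (a : E) :
    pullL E φ hφ (L2.single (φ i) a : L2 I E) = L2.single i a := by
  ext j
  rw [pullL_apply, L2.single_apply, L2.single_apply]
  simp only [hφ.eq_iff]

theorem pullL_single_of_notMem [DecidableEq I] (φ : I → I) (hφ : Function.Injective φ) (i : I)
    (a : E) (hi : ∀ j, φ j ≠ i) : pullL E φ hφ (L2.single i a : L2 I E) = 0 := by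
  ext j
  rw [pullL_apply, L2.single_apply, if_neg (hi j)]
  rfl

theorem star_pullL_single [DecidableEq I] (φ : I → I) (hφ : Function.Injective φ) (i : I) (a : E) :
    star (pullL E φ hφ) (L2.single i a : L2 I E) = L2.single (φ i) a := by
  ext j
  by_cases h : ∃ k, φ k = j
  · obtain ⟨k, rfl⟩ := h
    rw [pullL_star, L2.single_apply, L2.single_apply]
    simp only [hφ.eq_iff]
  · push Not at h
    rw [pullL_star_of_notMem _ _ _ _ h, L2.single_apply, if_neg (h i).symm]

end L2

/-! ### Shifts on the tensor legs and their relation to `leg`. -/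

section legs
variable {N : ℕ} {E : Type} [NormedAddCommGroup E] [InnerProductSpace ℂ E]

/-- Raise the index `k` by one. -/
def up (k : Fin N) (m : Fin N → ℕ) : Fin N → ℕ := Function.update m k (m k + 1)

theorem up_injective (k : Fin N) : Function.Injective (up k) := by
  intro a b h
  funext i
  have := congrFun h i
  by_cases hi : i = k
  · subst hi; simpa [up] using this
  · simpa [up, hi] using this

theorem up_comm (k l : Fin N) (m : Fin N → ℕ) : up k (up l m) = up l (up k m) := by
  by_cases h : k = l
  · rw [h]
  · simp only [up, Function.update_of_ne h, Function.update_of_ne (Ne.symm h)]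
    exact Function.update_comm (Ne.symm h) _ _ _

theorem exists_up (k : Fin N) (m : Fin N → ℕ) : (∃ m', up k m' = m) ↔ m k ≠ 0 := by
  constructor
  · rintro ⟨m', rfl⟩; simp [up]
  · intro h
    refine ⟨Function.update m k (m k - 1), ?_⟩
    simp [up, Nat.sub_add_cancel (Nat.pos_of_ne_zero h)]

/-- The backward shift of the index `k`. -/
noncomputable def legS (E : Type) [NormedAddCommGroup E] [InnerProductSpace ℂ E] (k : Fin N) :
    L2 (Fin N → ℕ) E →L[ℂ] L2 (Fin N → ℕ) E := pullL E (up k) (up_injective k)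

theorem commute_legS (k l : Fin N) : Commute (legS E k) (legS E l) := by
  change legS E k * legS E l = legS E l * legS E k
  ext f m
  change f (up l (up k m)) = f (up k (up l m))
  rw [up_comm]

variable [CompleteSpace E]

/-- The two operators concern different coordinates. Whether the adjoint of the shift `k` returns
zero depends only on `m k`, which is unaffected by raising the index `l`. -/
theorem commute_star_legS {k l : Fin N} (h : k ≠ l) :
    Commute (star (legS E k)) (legS E l) := by
  change star (legS E k) * legS E l = legS E l * star (legS E k)
  ext f m
  change star (legS E k) (legS E l f) m = star (legS E k) f (up l m)
  have h2 : up l m k = m k := by simp [up, h]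
  by_cases hm : m k = 0
  · have h1 : ∀ j, up k j ≠ m := fun j hj => (exists_up k m).1 ⟨j, hj⟩ hm
    have h3 : ∀ j, up k j ≠ up l m := fun j hj => (exists_up k _).1 ⟨j, hj⟩ (by rw [h2, hm])
    rw [legS, pullL_star_of_notMem _ _ _ _ h1, pullL_star_of_notMem _ _ _ _ h3]
  · obtain ⟨m', rfl⟩ := (exists_up k m).2 hm
    rw [up_comm l k, legS, pullL_star, pullL_star]
    rfl

theorem legS_mul_star (k : Fin N) : legS E k * star (legS E k) = 1 := pullL_mul_star _ _

end legs

section frozen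

theorem shift_eq : shift = pullL ℂ Nat.succ Nat.succ_injective := by
  ext f m
  rfl

variable {N : ℕ} (k : Fin N)

theorem leg_shift : leg k shift = legS ℂ k := by
  ext f m
  rfl

theorem leg_one : leg k 1 = 1 := by
  ext f m
  rw [leg_apply]
  change f (Function.update m k (m k)) = f m
  rw [Function.update_eq_self]

theorem leg_zero : leg k 0 = 0 := by
  ext f m
  rfl

theorem leg_sub (S T : Ltwo ℕ →L[ℂ] Ltwo ℕ) : leg k (S - T) = leg k S - leg k T := by
  ext f m
  rfl

theorem leg_mul (S T : Ltwo ℕ →L[ℂ] Ltwo ℕ) : leg k (S * T) = leg k S * leg k T := by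
  ext f m
  change S (T (legSlice k f m)) (m k) = S (legSlice k (leg k T f) m) (m k)
  have : T (legSlice k f m) = legSlice k (leg k T f) m := by
   apply lp.ext
   funext j
   change T (legSlice k f m) j = T (legSlice k f (Function.update m k j)) (Function.update m k j k)
   have h : legSlice k f (Function.update m k j) = legSlice k f m := by
     apply lp.ext
     funext i
     exact congrArg (fun m' => f m') (Function.update_idem j i m)
   rw [Function.update_self, h]
  rw [this]

theorem leg_star_shift : leg k (star shift) = star (leg k shift) := by
  ext f m
  rw [leg_apply, leg_shift, shift_eq]
  by_cases hm : m k = 0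
  · rw [hm, pullL_star_of_notMem _ _ _ _ fun j => Nat.succ_ne_zero j, legS,
      pullL_star_of_notMem _ _ _ _ fun j hj => (exists_up k m).1 ⟨j, hj⟩ hm]
  · obtain ⟨m', rfl⟩ := (exists_up k m).2 hm
    have : up k m' k = Nat.succ (m' k) := by simp [up]
    rw [this, pullL_star, legS, pullL_star]
    change f (Function.update (up k m') k (m' k)) = f m'
    simp [up]

theorem leg_vacuumProj : leg k vacuumProj = 1 - star (leg k shift) * leg k shift := by
  rw [vacuumProj, leg_sub, leg_one, leg_mul, ← leg_star_shift,
    ContinuousLinearMap.star_eq_adjoint]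

end frozen

/-! ### Passage from indices in `Fin (n + 1)` to indices in `ℕ`. -/

section translate
variable {n : ℕ} {B : Type*} [Ring B]

theorem val_succAbove (r : Fin (n + 1)) (i : Fin n) : (r.succAbove i : ℕ) = skip r i := by
  simp only [Fin.succAbove, skip, Fin.lt_def, Fin.val_castSucc]
  split_ifs <;> simp

theorem crystalConv_eq {X Y : Fin (n + 1) → Fin (n + 1) → B} {x y : ℕ → ℕ → B}
    (hX : ∀ i j, X i j = x i j) (hY : ∀ i j, Y i j = y i j) (i j : Fin (n + 1)) :
    crystalConv X Y i j = conv x y i j := by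
  have : Finset.uIcc (i : ℕ) j = (Finset.Icc (min i j) (max i j)).map Fin.valEmbedding := by
    rw [Fin.map_valEmbedding_Icc]
    rfl
  rw [crystalConv, conv, this, Finset.sum_map]
  exact Finset.sum_congr rfl fun k _ => by rw [hX, hY]; rfl

variable [StarRing B]

theorem crystalRelations_iff {z : Fin (n + 1) → Fin (n + 1) → B} {y : ℕ → ℕ → B}
    (h : ∀ i j, z i j = y i j) : CrystalRelations z ↔ CRel n y := by
  have hF : ∀ i (hi : i ≤ n), ∃ a : Fin (n + 1), (a : ℕ) = i := fun i hi =>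
    ⟨⟨i, by omega⟩, rfl⟩
  have hdet : (List.ofFn fun i : Fin (n + 1) => z i i).prod = oprod (fun i => y i i) 0 (n + 1) := by
    rw [← oprod_ofFn]
    simp only [h]
  have hstar : ∀ r s : Fin (n + 1), (List.ofFn fun i : Fin n => z (r.succAbove i)
      (s.succAbove i)).prod = oprod (fun i => y (skip r i) (skip s i)) 0 n := fun r s => by
    rw [← oprod_ofFn]
    simp only [h, val_succAbove]
  constructor
  · intro hz
    refine ⟨?_, ?_, ?_, ?_, ?_, ?_, ?_, ?_⟩
    · intro i j l h1 h2 h3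
      obtain ⟨i, rfl⟩ := hF i (by omega); obtain ⟨j, rfl⟩ := hF j (by omega)
      obtain ⟨l, rfl⟩ := hF l (by omega)
      simpa only [h] using hz.row_zero i j l h2
    · intro i k j h1 h2 h3
      obtain ⟨i, rfl⟩ := hF i (by omega); obtain ⟨j, rfl⟩ := hF j (by omega)
      obtain ⟨k, rfl⟩ := hF k (by omega)
      simpa only [h] using hz.col_zero i k j h1
    · intro i k j l h1 h2 h3 h4
      obtain ⟨i, rfl⟩ := hF i (by omega); obtain ⟨j, rfl⟩ := hF j (by omega)
      obtain ⟨k, rfl⟩ := hF k (by omega); obtain ⟨l, rfl⟩ := hF l (by omega)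
      simpa only [h] using hz.anti_comm i k j l h1 h3
    · intro i k j l h1 h2 h3 h4 h5
      obtain ⟨i, rfl⟩ := hF i (by omega); obtain ⟨j, rfl⟩ := hF j (by omega)
      obtain ⟨k, rfl⟩ := hF k (by omega); obtain ⟨l, rfl⟩ := hF l (by omega)
      have := hz.anti_zero i k j l h1 h3 (by
        simp only [Fin.le_def, Fin.coe_max, Fin.coe_min]; exact h5)
      simpa only [h] using this
    · intro i k j l h1 h2 h3 h4 h5
      obtain ⟨i, rfl⟩ := hF i (by omega); obtain ⟨j, rfl⟩ := hF j (by omega)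
      obtain ⟨k, rfl⟩ := hF k (by omega); obtain ⟨l, rfl⟩ := hF l (by omega)
      simpa only [h] using hz.diag_cross i k j l h1 h3 h5
    · intro i k j l h1 h2 h3 h4 h5
      obtain ⟨i, rfl⟩ := hF i (by omega); obtain ⟨j, rfl⟩ := hF j (by omega)
      obtain ⟨k, rfl⟩ := hF k (by omega); obtain ⟨l, rfl⟩ := hF l (by omega)
      simpa only [h] using hz.diag_comm i k j l h1 h3 h5
    · rw [← hdet, hz.det_one]
    · intro r s hr hs
      obtain ⟨r, rfl⟩ := hF r hr; obtain ⟨s, rfl⟩ := hF s hs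
      rw [← h, hz.star_eq, hstar]
  · intro hy
    refine ⟨?_, ?_, ?_, ?_, ?_, ?_, ?_, ?_⟩
    · intro i j l h1
      simpa only [h] using hy.row_zero i j l (by omega) h1 (by omega)
    · intro i k j h1
      simpa only [h] using hy.col_zero i k j h1 (by omega) (by omega)
    · intro i k j l h1 h2
      simpa only [h] using hy.anti_comm i k j l h1 (by omega) h2 (by omega)
    · intro i k j l h1 h2 h3
      simp only [Fin.le_def, Fin.coe_max, Fin.coe_min] at h3
      simpa only [h] using hy.anti_zero i k j l h1 (by omega) h2 (by omega) h3
    · intro i k j l h1 h2 h3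
      simpa only [h] using hy.diag_cross i k j l h1 (by omega) h2 (by omega) h3
    · intro i k j l h1 h2 h3
      simpa only [h] using hy.diag_comm i k j l h1 (by omega) h2 (by omega) h3
    · rw [hdet, hy.det_one]
    · intro r s
      rw [h, hy.star_eq _ _ (by omega) (by omega), hstar]

/-- Extend an array indexed by `Fin (n + 1)` to `ℕ`. -/
def toNat (z : Fin (n + 1) → Fin (n + 1) → B) (i j : ℕ) : B :=
  z (Fin.ofNat (n + 1) i) (Fin.ofNat (n + 1) j)

theorem toNat_val (z : Fin (n + 1) → Fin (n + 1) → B) (i j : Fin (n + 1)) :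
    z i j = toNat z i j := by simp [toNat]

end translate

/-! ### Double commutation and iterated convolution along a word. -/

section act
variable {B : Type*} [Ring B] [StarRing B] {n : ℕ}

/-- `a` commutes with `b` and `star b`. -/
def DC (a b : B) : Prop := Commute a b ∧ Commute (star a) b

theorem DC.symm {a b : B} (h : DC a b) : DC b a :=
  ⟨h.1.symm, by simpa using h.2.symm.star_star⟩

theorem DC.star_left {a b : B} (h : DC a b) : DC (star a) b := ⟨h.2, by simpa using h.1⟩

theorem DC.star_right {a b : B} (h : DC a b) : DC a (star b) := h.symm.star_left.symm

theorem DC.one (a : B) : DC a 1 := ⟨Commute.one_right _, Commute.one_right _⟩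

theorem DC.zero (a : B) : DC a 0 := ⟨Commute.zero_right _, Commute.zero_right _⟩

theorem DC.mul {a b c : B} (h : DC a b) (h' : DC a c) : DC a (b * c) :=
  ⟨h.1.mul_right h'.1, h.2.mul_right h'.2⟩

theorem DC.sub {a b c : B} (h : DC a b) (h' : DC a c) : DC a (b - c) :=
  ⟨h.1.sub_right h'.1, h.2.sub_right h'.2⟩

theorem DC.sum {ι : Type*} {a : B} {s : Finset ι} {f : ι → B} (h : ∀ i ∈ s, DC a (f i)) :
    DC a (∑ i ∈ s, f i) :=
  ⟨Commute.sum_right _ _ _ fun i hi => (h i hi).1, Commute.sum_right _ _ _ fun i hi => (h i hi).2⟩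

theorem DC.oprod {a : B} {f : ℕ → B} {p q : ℕ} (h : ∀ i, p ≤ i → i < q → DC a (f i)) :
    DC a (oprod f p q) :=
  ⟨commute_oprod fun i h1 h2 => (h i h1 h2).1, commute_oprod fun i h1 h2 => (h i h1 h2).2⟩

theorem DC.proj {a b : B} (h : DC a b) : DC a (1 - star b * b) :=
  (DC.one a).sub (h.star_right.mul h)

theorem DC.simple {a b : B} (h : DC a b) (r i j : ℕ) : DC a (simpleArr r b i j) := by
  simp only [simpleArr]
  split_ifs
  exacts [h, h.star_right, h.proj, h.proj, DC.one a, DC.zero a]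

theorem DComm.conv {a : B} {x y : ℕ → ℕ → B} (hx : DComm a x) (hy : DComm a y) :
    DComm a (conv x y) := fun _ _ => DC.sum fun _ _ => DC.mul (hx _ _) (hy _ _)

theorem DComm.idArr (a : B) : DComm a idArr := fun i j => by
  simp only [Crystal.idArr]
  split_ifs
  exacts [DC.one a, DC.zero a]

/-- Left convolution with the simple reflections of a list of letters and coisometries. -/
def act (L : List (ℕ × B)) (y : ℕ → ℕ → B) : ℕ → ℕ → B :=
  L.foldr (fun p y => conv (simpleArr p.1 p.2) y) y

theorem act_nil (y : ℕ → ℕ → B) : act [] y = y := rfl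

theorem act_cons (p : ℕ × B) (L : List (ℕ × B)) (y : ℕ → ℕ → B) :
    act (p :: L) y = conv (simpleArr p.1 p.2) (act L y) := rfl

theorem act_append (L L' : List (ℕ × B)) (y : ℕ → ℕ → B) :
    act (L ++ L') y = act L (act L' y) := List.foldr_append

theorem conv_act (L : List (ℕ × B)) (x y : ℕ → ℕ → B) :
    conv (act L x) y = act L (conv x y) := by
  induction L with
  | nil => rfl
  | cons p L ih => rw [act_cons, act_cons, conv_assoc, ih]

theorem act_eq (L : List (ℕ × B)) (y : ℕ → ℕ → B) : act L y = conv (act L idArr) y := by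
  rw [conv_act, id_conv]

theorem DComm.act {a : B} {L : List (ℕ × B)} {y : ℕ → ℕ → B} (hL : ∀ p ∈ L, DC a p.2)
    (hy : DComm a y) : DComm a (act L y) := by
  induction L with
  | nil => exact hy
  | cons p L ih =>
    refine DComm.conv (fun i j => (hL p (by simp)).simple _ _ _)
      (ih fun q hq => hL q (by simp [hq]))

/-- A list of letters `< n` and doubly commuting coisometries. -/
structure LegList (n : ℕ) (L : List (ℕ × B)) : Prop where
  lt : ∀ p ∈ L, p.1 < n
  coisom : ∀ p ∈ L, p.2 * star p.2 = 1
  pairwise : L.Pairwise fun p q => DC p.2 q.2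

theorem LegList.tail {p : ℕ × B} {L : List (ℕ × B)} (h : LegList n (p :: L)) : LegList n L :=
  ⟨fun q hq => h.lt q (by simp [hq]), fun q hq => h.coisom q (by simp [hq]),
    (List.pairwise_cons.1 h.pairwise).2⟩

theorem CRel.act {L : List (ℕ × B)} {y : ℕ → ℕ → B} (hL : LegList n L) (hy : CRel n y)
    (hLy : ∀ p ∈ L, DComm p.2 y) : CRel n (act L y) := by
  induction L with
  | nil => exact hy
  | cons p L ih =>
    refine (ih hL.tail fun q hq => hLy q (by simp [hq])).conv_simple (hL.coisom p (by simp)) ?_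
      (hL.lt p (by simp))
    exact DComm.act (List.pairwise_cons.1 hL.pairwise).1 (hLy p (by simp))

/-- The array of a list of letters and coisometries. -/
def wordArr (L : List (ℕ × B)) : ℕ → ℕ → B := act L idArr

theorem wordArr_rel {L : List (ℕ × B)} (hL : LegList n L) : CRel n (wordArr L) :=
  idArr_rel.act hL fun _ _ => DComm.idArr _

end act

/-! ### Existence and uniqueness of `π_{t,w}`. -/

section words
variable {n : ℕ}

theorem DC_legS {N : ℕ} {E : Type} [NormedAddCommGroup E] [InnerProductSpace ℂ E]
    [CompleteSpace E] {k l : Fin N} (h : k ≠ l) : DC (legS E k) (legS E l) :=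
  ⟨commute_legS k l, commute_star_legS h⟩

/-- The letters of `w` with the coisometries acting on the legs of `ℓ²(ℕ^N; E)`. -/
noncomputable def wordLegs (E : Type) [NormedAddCommGroup E] [InnerProductSpace ℂ E]
    (w : List (Fin n)) :
    List (ℕ × (L2 (Fin w.length → ℕ) E →L[ℂ] L2 (Fin w.length → ℕ) E)) :=
  List.ofFn fun k : Fin w.length => ((w.get k : ℕ), legS E k)

theorem wordLegs_legList (E : Type) [NormedAddCommGroup E] [InnerProductSpace ℂ E]
    [CompleteSpace E] (w : List (Fin n)) : LegList n (wordLegs E w) where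
  lt p hp := by
    obtain ⟨k, rfl⟩ := List.mem_ofFn.1 hp
    exact (w.get k).2
  coisom p hp := by
    obtain ⟨k, rfl⟩ := List.mem_ofFn.1 hp
    exact legS_mul_star k
  pairwise := by
    rw [wordLegs, List.pairwise_ofFn]
    intro i j hij
    exact DC_legS hij.ne

theorem wordLegs_map (E : Type) [NormedAddCommGroup E] [InnerProductSpace ℂ E]
    (w : List (Fin n)) : (wordLegs E w).map Prod.fst = w.map Fin.val := by
  rw [wordLegs, List.map_ofFn]
  conv_rhs => rw [← List.ofFn_get w, List.map_ofFn]
  rfl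

theorem leg_simpleOp {N : ℕ} (k : Fin N) (r : Fin n) (i j : Fin (n + 1)) :
    leg k (simpleOp r i j) = simpleArr (r : ℕ) (legS ℂ k) i j := by
  rw [← leg_shift]
  simp only [simpleOp, simpleArr, Fin.ext_iff, Fin.val_castSucc, Fin.val_succ]
  split_ifs
  · rfl
  · rw [← ContinuousLinearMap.star_eq_adjoint, leg_star_shift]
  · exact leg_vacuumProj k
  · exact leg_vacuumProj k
  · exact leg_one k
  · exact leg_zero k

theorem wordOp_eq (w : List (Fin n)) (i j : Fin (n + 1)) :
    wordOp w i j = wordArr (wordLegs ℂ w) i j := by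
  have key : ∀ (l : List (Fin w.length)) (i j : Fin (n + 1)),
      (l.map fun k => fun i j => leg k (simpleOp (w.get k) i j)).foldr crystalConv
        (fun i j => if i = j then 1 else 0) i j =
      act (l.map fun k => ((w.get k : ℕ), legS ℂ k)) idArr i j := by
    intro l
    induction l with
    | nil => intro i j; simp [act_nil, idArr, Fin.ext_iff]
    | cons k l ih =>
      intro i j
      rw [List.map_cons, List.map_cons, List.foldr_cons, act_cons]
      exact crystalConv_eq (leg_simpleOp k _) ih i j
  rw [wordOp, wordArr, wordLegs, List.ofFn_eq_map, List.ofFn_eq_map]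
  exact key _ i j

/-- The values of the character `χ_t`, indexed by `ℕ`. -/
noncomputable def torusNat (t : Fin n → Circle) (i : ℕ) : ℂ :=
  if h : i ≤ n then torusChar t ⟨i, by omega⟩ else 1

theorem torusNat_val (t : Fin n → Circle) (i : Fin (n + 1)) : torusNat t i = torusChar t i := by
  have : (i : ℕ) ≤ n := by omega
  simp [torusNat, this]

theorem torusChar_mul_star (t : Fin n → Circle) (i : Fin (n + 1)) :
    torusChar t i * star (torusChar t i) = 1 := by
  have h : ∀ z : Circle, (z : ℂ) * star (z : ℂ) = 1 := fun z => by
    rw [Complex.star_def, Complex.mul_conj, Circle.normSq_coe]; simp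
  have h' : ∀ z : Circle, star (z : ℂ) * (z : ℂ) = 1 := fun z => by rw [mul_comm, h]
  rw [torusChar, star_mul]
  split_ifs
  all_goals simp only [star_star, star_one, mul_one, one_mul, h, h']
  rw [mul_assoc, ← mul_assoc _ (star _) _, h]
  simp only [one_mul, h']

theorem torusNat_mul_star (t : Fin n → Circle) (i : ℕ) :
    torusNat t i * star (torusNat t i) = 1 := by
  rw [torusNat]
  split_ifs
  · exact torusChar_mul_star t _
  · simp

theorem torusNat_prod (t : Fin n → Circle) : oprod (torusNat t) 0 (n + 1) = 1 := by
  have h' : ∀ z : Circle, (z : ℂ) * star (z : ℂ) = 1 := fun z => by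
    rw [Complex.star_def, Complex.mul_conj, Circle.normSq_coe]; simp
  have key : ∀ m, m ≤ n → oprod (torusNat t) 0 (m + 1) =
      if h : m < n then (t ⟨m, h⟩ : ℂ) else 1 := by
    intro m
    induction m with
    | zero =>
      intro _
      rw [oprod_succ le_rfl, oprod_self, one_mul, torusNat, dif_pos (Nat.zero_le n), torusChar]
      simp
    | succ m ih =>
      intro hm
      rw [oprod_succ (Nat.zero_le _), ih (by omega), dif_pos (by omega), torusNat, dif_pos hm,
        torusChar, dif_pos (by simp), ← mul_assoc]
      simp only [Nat.add_sub_cancel, h', one_mul]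
  rw [key n le_rfl, dif_neg (lt_irrefl n)]

theorem torusWordOp_eq (t : Fin n → Circle) (w : List (Fin n)) (i j : Fin (n + 1)) :
    torusWordOp t w i j = algebraMap ℂ (WordSpace w →L[ℂ] WordSpace w) (torusNat t i) *
      wordArr (wordLegs ℂ w) i j := by
  rw [torusWordOp, crystalConv, Finset.sum_eq_single i]
  · rw [if_pos rfl, wordOp_eq, torusNat_val, Algebra.algebraMap_eq_smul_one]
  · intro k _ hk
    rw [if_neg hk.symm, zero_mul]
  · simp

theorem DC_algebraMap {B : Type*} [Ring B] [StarRing B] [Algebra ℂ B] [StarModule ℂ B] (c : ℂ)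
    (b : B) : DC (algebraMap ℂ B c) b :=
  ⟨Algebra.commutes c b, by rw [← algebraMap_star_comm]; exact Algebra.commutes _ b⟩

theorem twist_scalar {B : Type*} [Ring B] [StarRing B] [Algebra ℂ B] [StarModule ℂ B]
    {y : ℕ → ℕ → B} (hy : CRel n y) (t : Fin n → Circle) :
    CRel n fun i j => algebraMap ℂ B (torusNat t i) * y i j := by
  refine hy.twist (fun i => ?_) (fun i => ?_) (fun i j => (DC_algebraMap _ _).1)
    (fun i k l => DC_algebraMap _ _) ?_
  · rw [← algebraMap_star_comm, ← map_mul, torusNat_mul_star, map_one]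
  · rw [← algebraMap_star_comm, ← map_mul, mul_comm, torusNat_mul_star, map_one]
  · rw [← map_oprod (algebraMap ℂ B), torusNat_prod, map_one]

theorem torusWordOp_rel (t : Fin n → Circle) (w : List (Fin n)) :
    CrystalRelations (torusWordOp t w) :=
  (crystalRelations_iff (torusWordOp_eq t w)).2
    (twist_scalar (wordArr_rel (wordLegs_legList ℂ w)) t)

instance nontrivial_L2 {I E : Type} [Nonempty I] [NormedAddCommGroup E] [InnerProductSpace ℂ E]
    [Nontrivial E] : Nontrivial (L2 I E) := by
  classical
  obtain ⟨a, ha⟩ := exists_ne (0 : E)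
  obtain ⟨i⟩ := ‹Nonempty I›
  refine ⟨L2.single i a, 0, fun h => ha ?_⟩
  rw [← norm_eq_zero, ← L2.norm_single i a, h, norm_zero]

/-- Every `π_{t,w}` exists and is unique. -/
theorem existsUnique_crystalRep (t : Fin n → Circle) (w : List (Fin n)) :
    ∃! π : CrystalAlg n →⋆ₐ[ℂ] (WordSpace w →L[ℂ] WordSpace w), IsCrystalRep t w π :=
  crystalAlg_existsUnique_lift (torusWordOp_rel t w)

end words

/-! ### Reduced words and the longest permutation. -/

section perms

/-- The permutation of `ℕ` given by a word in the simple transpositions. -/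
def wp (w : List ℕ) : Equiv.Perm ℕ := (w.map fun r => Equiv.swap r (r + 1)).prod

theorem wp_nil : wp [] = 1 := rfl

theorem wp_cons (r : ℕ) (w : List ℕ) : wp (r :: w) = Equiv.swap r (r + 1) * wp w := by
  simp [wp]

theorem wp_append (u v : List ℕ) : wp (u ++ v) = wp u * wp v := by simp [wp]

theorem swap_succ (r x : ℕ) : Equiv.swap r (r + 1) x =
    if x = r then r + 1 else if x = r + 1 then r else x := Equiv.swap_apply_def _ _ _

/-- Every suffix `r :: v` of the word `w` increases the length of the permutation. -/
def Red (w : List ℕ) : Prop :=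
  ∀ u r v, w = u ++ r :: v → (wp v).symm r < (wp v).symm (r + 1)

theorem Red.tail {r : ℕ} {w : List ℕ} (h : Red (r :: w)) : Red w :=
  fun u r' v e => h (r :: u) r' v (by rw [e]; rfl)

theorem Red.head {r : ℕ} {w : List ℕ} (h : Red (r :: w)) :
    (wp w).symm r < (wp w).symm (r + 1) := h [] r w rfl

/-- The exchange condition. If `x, y` are `a, a + 1` for the first letter `a`, that letter is
deleted. Otherwise the letter preserves the order of the pair and conjugates one transposition into
the other, so the tail of the word can be treated instead. -/
theorem wp_exchange {n : ℕ} (w : List (Fin n)) (x y : ℕ) (hxy : x < y)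
    (h : (wp (w.map Fin.val)).symm y < (wp (w.map Fin.val)).symm x) :
    ∃ v : List (Fin n), v.length + 1 = w.length ∧
      wp (v.map Fin.val) = Equiv.swap x y * wp (w.map Fin.val) := by
  induction w generalizing x y with
  | nil =>
    simp only [List.map_nil, wp_nil] at h
    change y < x at h
    omega
  | cons a w ih =>
    rw [List.map_cons, wp_cons] at h
    obtain ⟨a, ha⟩ := a
    by_cases hxa : x = a ∧ y = a + 1
    · obtain ⟨rfl, rfl⟩ := hxa
      refine ⟨w, rfl, ?_⟩
      rw [List.map_cons, wp_cons, ← mul_assoc, Equiv.swap_mul_self, one_mul]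
    · have hlt : Equiv.swap a (a + 1) x < Equiv.swap a (a + 1) y := by
        rw [swap_succ, swap_succ]
        split_ifs <;> omega
      have e : ∀ z, (Equiv.swap a (a + 1) * wp (w.map Fin.val)).symm z =
          (wp (w.map Fin.val)).symm (Equiv.swap a (a + 1) z) := fun z => by
        rw [← Equiv.Perm.inv_def, mul_inv_rev, Equiv.swap_inv]
        rfl
      rw [e, e] at h
      obtain ⟨v, hv, hv'⟩ := ih _ _ hlt h
      refine ⟨⟨a, ha⟩ :: v, by simp [hv], ?_⟩
      rw [List.map_cons, wp_cons, List.map_cons, wp_cons, hv', ← mul_assoc,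
        Equiv.mul_swap_eq_swap_mul, Equiv.swap_apply_self, Equiv.swap_apply_self, mul_assoc]

theorem wordPerm_val {n : ℕ} (w : List (Fin n)) (i : Fin (n + 1)) :
    (wordPerm w i : ℕ) = wp (w.map Fin.val) i := by
  induction w with
  | nil => rfl
  | cons a w ih =>
    have : wordPerm (a :: w) = Equiv.swap a.castSucc a.succ * wordPerm w := by simp [wordPerm]
    rw [this, List.map_cons, wp_cons, Equiv.Perm.mul_apply, Equiv.Perm.mul_apply, ← ih, swap_succ,
      Equiv.swap_apply_def]
    simp only [Fin.ext_iff, Fin.val_castSucc, Fin.val_succ]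
    split_ifs <;> simp

theorem wordPerm_eq_of_wp {n : ℕ} {w w' : List (Fin n)}
    (h : ∀ i ≤ n, wp (w.map Fin.val) i = wp (w'.map Fin.val) i) : wordPerm w = wordPerm w' := by
  ext i
  rw [wordPerm_val, wordPerm_val, h i (by omega)]

theorem wp_le {n : ℕ} (w : List ℕ) (hw : ∀ r ∈ w, r < n) (i : ℕ) (hi : i ≤ n) : wp w i ≤ n := by
  induction w with
  | nil => exact hi
  | cons a w ih =>
    have h1 := ih fun r hr => hw r (by simp [hr])
    have h2 := hw a (by simp)
    rw [wp_cons, Equiv.Perm.mul_apply, swap_succ]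
    split_ifs <;> omega

theorem wp_symm_le {n : ℕ} (w : List ℕ) (hw : ∀ r ∈ w, r < n) (i : ℕ) (hi : i ≤ n) :
    (wp w).symm i ≤ n := by
  induction w generalizing i with
  | nil => exact hi
  | cons a w ih =>
    have h2 := hw a (by simp)
    rw [wp_cons, ← Equiv.Perm.inv_def, mul_inv_rev, Equiv.swap_inv, Equiv.Perm.mul_apply]
    refine ih (fun r hr => hw r (by simp [hr])) _ ?_
    rw [swap_succ]
    split_ifs <;> omega

/-- If a letter `r` did not increase the length of the suffix `v` behind it, the exchange condition
would delete a letter of `v` together with `r` and yield a word shorter by two. -/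
theorem red_of_isReducedWord {n : ℕ} {w : List (Fin n)} (hw : IsReducedWord w) :
    Red (w.map Fin.val) := by
  intro u r v h
  obtain ⟨u, w', rfl, rfl, h1⟩ := List.map_eq_append_iff.1 h
  obtain ⟨r, v, rfl, rfl, rfl⟩ := List.map_eq_cons_iff.1 h1
  by_contra hlt
  have hne : (wp (v.map Fin.val)).symm r ≠ (wp (v.map Fin.val)).symm (r + 1) := fun e => by
    have := (wp (v.map Fin.val)).symm.injective e
    omega
  obtain ⟨v', hv', hv''⟩ := wp_exchange v r (r + 1) (by omega) (by omega)
  have := hw (u ++ v') (wordPerm_eq_of_wp fun i _ => by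
    rw [List.map_append, wp_append, h, wp_append, wp_cons, hv''])
  simp only [List.length_append, List.length_cons] at this
  omega

/-- The word of the longest element, as a word in `ℕ`. -/
def lw (n : ℕ) : List ℕ := (List.range n).flatMap fun k => (List.range (k + 1)).reverse

theorem lw_succ (n : ℕ) : lw (n + 1) = lw n ++ (List.range (n + 1)).reverse := by
  simp [lw, List.range_succ]

theorem filter_le_map {n : ℕ} (k : Fin n) :
    ((List.finRange n).filter fun r : Fin n => r ≤ k).map Fin.val = List.range (k + 1) := by
  have h1 : ∀ l : List (Fin n), (l.filter fun r : Fin n => r ≤ k).map Fin.val =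
      (l.map Fin.val).filter fun x : ℕ => x < (k : ℕ) + 1 := by
    intro l
    induction l with
    | nil => rfl
    | cons a l ih =>
      by_cases h : a ≤ k
      · have h' : (a : ℕ) < k + 1 := Nat.lt_succ_of_le h
        simp [List.filter_cons, h, h', ih]
      · have h' : ¬ (a : ℕ) < k + 1 := fun hh => h (Nat.le_of_lt_succ hh)
        simp [List.filter_cons, h, h', ih]
  rw [h1, List.map_coe_finRange_eq_range, ← List.Ico.zero_bot, ← List.Ico.zero_bot,
    List.Ico.filter_lt_of_ge (by omega)]

theorem longestWord_map (n : ℕ) : (longestWord n).map Fin.val = lw n := by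
  rw [longestWord, lw, List.map_flatMap, ← List.map_coe_finRange_eq_range, List.flatMap_map]
  refine congrArg (fun g : Fin n → List ℕ => (List.finRange n).flatMap g) (funext fun k => ?_)
  rw [List.map_reverse]
  exact congrArg _ (filter_le_map k)

theorem lw_lt {n : ℕ} : ∀ r ∈ lw n, r < n := by
  intro r hr
  simp only [lw, List.mem_flatMap, List.mem_range, List.mem_reverse] at hr
  omega

theorem wp_block (m j : ℕ) : wp (List.range m).reverse j =
    if j = 0 then m else if j ≤ m then j - 1 else j := by
  induction m with
  | zero =>
    change j = _
    split_ifs <;> omega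
  | succ m ih =>
    rw [List.range_succ, List.reverse_append, List.reverse_singleton, List.singleton_append,
      wp_cons, Equiv.Perm.mul_apply, ih, swap_succ]
    split_ifs <;> omega

theorem wp_lw (n j : ℕ) : wp (lw n) j = if j ≤ n then n - j else j := by
  induction n generalizing j with
  | zero =>
    change j = _
    split_ifs <;> omega
  | succ n ih =>
    rw [lw_succ, wp_append, Equiv.Perm.mul_apply, wp_block, ih]
    split_ifs <;> omega

/-- The letters `m - 1, …, 0` carry the largest value of `ρ` on `[0, m]` down from position `m`, and
each of them passes it by a smaller value. -/
theorem block_split (m : ℕ) (ρ : Equiv.Perm ℕ) (hρ : ∀ j < m, ρ j < ρ m) (u : List ℕ) (r : ℕ)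
    (v : List ℕ) (h : (List.range m).reverse = u ++ r :: v) :
    ρ (wp u r) < ρ (wp u (r + 1)) := by
  induction m generalizing ρ u with
  | zero => simp at h
  | succ m ih =>
    rw [List.range_succ, List.reverse_append, List.reverse_singleton, List.singleton_append] at h
    rcases List.cons_eq_append_iff.1 h with ⟨rfl, h1⟩ | ⟨u, rfl, h1⟩
    · rw [List.cons.injEq] at h1
      obtain ⟨rfl, -⟩ := h1
      exact hρ r (by omega)
    · rw [wp_cons]
      refine ih (ρ * Equiv.swap m (m + 1)) (fun j hj => ?_) u h1
      rw [Equiv.Perm.mul_apply, Equiv.Perm.mul_apply, swap_succ, swap_succ, if_pos rfl,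
        if_neg (by omega), if_neg (by omega)]
      exact hρ j (by omega)

/-- Before the last block acts, the word is the reversal of `[0, n]` and fixes `n + 1`, so the
largest value stands in the last position as `block_split` requires. -/
theorem lw_split (n : ℕ) (u : List ℕ) (r : ℕ) (v : List ℕ) (h : lw n = u ++ r :: v) :
    wp u r < wp u (r + 1) := by
  induction n generalizing v with
  | zero => simp [lw] at h
  | succ n ih =>
    rw [lw_succ, List.append_eq_append_iff] at h
    rcases h with ⟨u', rfl, h⟩ | ⟨v', h, h'⟩
    · rw [wp_append]
      refine block_split (n + 1) (wp (lw n)) (fun j hj => ?_) u' r v h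
      rw [wp_lw, wp_lw, if_pos (by omega), if_neg (by omega)]
      omega
    · rcases v' with _ | ⟨a, v'⟩
      · simp only [List.nil_append] at h'
        simp only [List.append_nil] at h
        rw [← h]
        refine block_split (n + 1) (wp (lw n)) (fun j hj => ?_) [] r v h'.symm
        rw [wp_lw, wp_lw, if_pos (by omega), if_neg (by omega)]
        omega
      · rw [List.cons_append, List.cons.injEq] at h'
        obtain ⟨rfl, -⟩ := h'
        exact ih v' h

/-- `lw_split` speaks of prefixes. The inverse of a suffix is the inverse of the longest permutation
times a prefix and the letter, and the longest permutation reverses the order. -/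
theorem red_lw (n : ℕ) : Red (lw n) := by
  intro u r v h
  have h1 := lw_split n u r v h
  have hr : r < n := lw_lt r (by rw [h]; simp)
  have hu : ∀ x ∈ u, x < n := fun x hx => lw_lt x (by rw [h]; simp [hx])
  have h2 : ∀ x ≤ n, (wp (lw n)).symm x = n - x := fun x hx => by
    rw [Equiv.symm_apply_eq, wp_lw, if_pos (by omega)]
    omega
  have h3 : ∀ x, (wp v).symm x = (wp (lw n)).symm (wp u (Equiv.swap r (r + 1) x)) := fun x => by
    rw [Equiv.eq_symm_apply, h, wp_append, wp_cons]
    simp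
  have h4 := wp_le u hu r hr.le
  have h5 := wp_le u hu (r + 1) hr
  rw [h3, h3, swap_succ, swap_succ, if_pos rfl, if_neg (by omega), if_pos rfl, h2 _ h5, h2 _ h4]
  omega

end perms

/-! ### Counting values above a threshold. -/

section count

/-- The number of `j < q` with `m ≤ g j`. -/
def cnt (g : ℕ → ℕ) (q m : ℕ) : ℕ := ((Finset.range q).filter fun j => m ≤ g j).card

/-- The number of `j < q` with `g j = m`. -/
def cntEq (g : ℕ → ℕ) (q m : ℕ) : ℕ := ((Finset.range q).filter fun j => g j = m).card

theorem cnt_succ (g : ℕ → ℕ) (q m : ℕ) : cnt g q m = cnt g q (m + 1) + cntEq g q m := by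
  rw [cnt, cnt, cntEq, ← Finset.card_union_of_disjoint]
  · congr 1
    ext j
    simp only [Finset.mem_filter, Finset.mem_union, Finset.mem_range]
    omega
  · rw [Finset.disjoint_filter]
    intro j _ h
    omega

theorem cntEq_le_one {g : ℕ → ℕ} {q : ℕ} (hg : ∀ i < q, ∀ j < q, g i = g j → i = j) (m : ℕ) :
    cntEq g q m ≤ 1 := by
  rw [cntEq, Finset.card_le_one]
  intro a ha b hb
  simp only [Finset.mem_filter, Finset.mem_range] at ha hb
  exact hg a ha.1 b hb.1 (ha.2.trans hb.2.symm)

theorem cntEq_eq_zero {g : ℕ → ℕ} {q m : ℕ} (h : ∀ j < q, g j ≠ m) : cntEq g q m = 0 := by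
  rw [cntEq, Finset.card_eq_zero, Finset.filter_eq_empty_iff]
  intro j hj
  exact h j (Finset.mem_range.1 hj)

theorem cntEq_pos {g : ℕ → ℕ} {q m : ℕ} : 0 < cntEq g q m ↔ ∃ j < q, g j = m := by
  rw [cntEq, Finset.card_pos]
  constructor
  · rintro ⟨j, hj⟩
    simp only [Finset.mem_filter, Finset.mem_range] at hj
    exact ⟨j, hj⟩
  · rintro ⟨j, hj⟩
    exact ⟨j, by simpa using hj⟩

theorem cnt_congr {g g' : ℕ → ℕ} {q m : ℕ} (h : ∀ j < q, m ≤ g j ↔ m ≤ g' j) :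
    cnt g q m = cnt g' q m := by
  rw [cnt, cnt]
  congr 1
  ext j
  simp only [Finset.mem_filter, Finset.mem_range]
  exact and_congr_right fun hj => h j hj

theorem cntEq_congr {g g' : ℕ → ℕ} {q m m' : ℕ} (h : ∀ j < q, g j = m ↔ g' j = m') :
    cntEq g q m = cntEq g' q m' := by
  rw [cntEq, cntEq]
  congr 1
  ext j
  simp only [Finset.mem_filter, Finset.mem_range]
  exact and_congr_right fun hj => h j hj

theorem cnt_swap_of_ne (r m q : ℕ) (hm : m ≠ r + 1) (g : ℕ → ℕ) :
    cnt (fun j => Equiv.swap r (r + 1) (g j)) q m = cnt g q m :=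
  cnt_congr fun j _ => by
    rw [swap_succ]
    split_ifs <;> omega

theorem cnt_swap (r q : ℕ) (g : ℕ → ℕ) :
    cnt (fun j => Equiv.swap r (r + 1) (g j)) q (r + 1) = cnt g q (r + 2) + cntEq g q r := by
  rw [cnt_succ, cnt_swap_of_ne _ _ _ (by omega)]
  congr 1
  refine cntEq_congr fun j _ => ?_
  rw [swap_succ]
  split_ifs <;> omega

/-- The value `r` is taken earlier than `r + 1`, so it is among the first `q` values whenever `r +
1` is. -/
theorem cntEq_swap_symm (r q : ℕ) {w : List ℕ} (h : (wp w).symm r < (wp w).symm (r + 1)) :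
    cntEq (wp w) q (r + 1) ≤ cntEq (wp w) q r := by
  rcases Nat.eq_zero_or_pos (cntEq (wp w) q (r + 1)) with h0 | h0
  · omega
  · have h1 := cntEq_le_one (g := wp w) (q := q) (fun i _ j _ e => (wp w).injective e) (r + 1)
    obtain ⟨j, hj, e⟩ := cntEq_pos.1 h0
    rw [← e, Equiv.symm_apply_apply] at h
    have : 0 < cntEq (wp w) q r := cntEq_pos.2 ⟨(wp w).symm r, by omega, by simp⟩
    omega

end count

/-! ### Recursion and vanishing of minors. -/

section minors
variable {B : Type*} [Ring B] [StarRing B] {n : ℕ}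

/-- The product of the entries at `(f j, j)`, `j < q`. -/
def minor (f : ℕ → ℕ) (q : ℕ) (y : ℕ → ℕ → B) : B := oprod (fun j => y (f j) j) 0 q

variable {s : B} {r : ℕ} {y : ℕ → ℕ → B} {f : ℕ → ℕ} {q : ℕ}

theorem le_of_strictMono (hf : ∀ i j, i < j → j < q → f i < f j) (j : ℕ) (hj : j < q) :
    j ≤ f j := by
  induction j with
  | zero => exact Nat.zero_le _
  | succ j ih =>
    have := ih (by omega)
    have := hf j (j + 1) (by omega) hj
    omega

/-- Rows `r` and `r + 1`, when present, stand in neighbouring columns by monotonicity, and the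
product of these two factors does not change by `lmul_pair`. -/
theorem minor_conv_same (hs : s * star s = 1) (hc : DComm s y)
    (hf : ∀ i j, i < j → j < q → f i < f j)
    (h : (∃ j < q, f j = r) ↔ ∃ j < q, f j = r + 1) :
    minor f q (conv (simpleArr r s) y) = minor f q y := by
  rw [conv_simple_eq]
  refine oprod_lmul (g := id) (hc.toep hs) (fun i _ _ => Nat.lt_succ_self i) ?_
  have inj : ∀ i j, i < q → j < q → f i = f j → i = j := fun i j hi hj e => by
    rcases lt_trichotomy i j with h | h | h
    · have := hf i j h hj; omega
    · exact h
    · have := hf j i h hi; omega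
  by_cases h1 : ∃ j < q, f j = r
  · right
    obtain ⟨c, hc, hc'⟩ := h1
    obtain ⟨d, hd, hd'⟩ := h.1 ⟨c, hc, hc'⟩
    have hcd : c < d := by
      by_contra hh
      rcases Nat.lt_or_ge d c with h3 | h3
      · have := hf d c h3 hc; omega
      · have : c = d := by omega
        subst this; omega
    have hcd' : d = c + 1 := by
      by_contra hne
      have h1 := hf c (c + 1) (by omega) (by omega)
      have h2 := hf (c + 1) d (by omega) hd
      omega
    subst hcd'
    refine ⟨c, Nat.zero_le _, hd, hc', hd', fun i _ hi h3 h4 => ⟨fun e => h3 ?_, fun e => h4 ?_⟩⟩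
    · exact inj _ _ hi hc (e.trans hc'.symm)
    · exact inj _ _ hi hd (e.trans hd'.symm)
  · left
    intro i _ hi
    exact ⟨fun e => h1 ⟨i, hi, e⟩, fun e => h1 (h.2 ⟨i, hi, e⟩)⟩

/-- Row `r` stands in a column not beyond `r`, so its entry has no term with the projection `1 -
star s * s`. -/
theorem minor_conv_lower (hc : DComm s y)
    (hf : ∀ i j, i < j → j < q → f i < f j) {c : ℕ} (hcq : c < q) (hfc : f c = r)
    (h : ∀ j < q, f j ≠ r + 1) :
    minor f q (conv (simpleArr r s) y) = s * minor f q y := by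
  rw [conv_simple_eq, minor, minor, oprod_split (Nat.zero_le c) hcq,
    oprod_split (f := fun j => y (f j) j) (Nat.zero_le c) hcq]
  have e : ∀ i, i < q → i ≠ c → lmul r s (star s) (1 - star s * s) y (f i) i = y (f i) i :=
    fun i hi hic => lmul_of_ne (fun e => hic (by
      rcases lt_trichotomy i c with h | h | h
      · have := hf i c h hcq; omega
      · exact h
      · have := hf c i h hi; omega)) (h i hi) _
  rw [oprod_congr (a := 0) (b := c) fun i h1 h2 => e i (by omega) (by omega),
    oprod_congr (b := q) fun i h1 h2 => e i (by omega) (by omega)]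
  have h1 : ¬ r < c := by have := le_of_strictMono hf c hcq; omega
  have h2 : Commute (oprod (fun j => y (f j) j) 0 c) s :=
    (commute_oprod fun i _ _ => (hc _ _).1).symm
  simp only [lmul, hfc, if_true, h1, if_false, add_zero]
  simp only [← mul_assoc, h2.eq]

/-- Since row `r` is absent, row `r + 1` stands in a column `c ≤ r`, and both terms of its entry
occur; the second one has row `r` in place of row `r + 1`. -/
theorem minor_conv_upper (hc : DComm s y)
    (hf : ∀ i j, i < j → j < q → f i < f j) {c : ℕ} (hcq : c < q) (hfc : f c = r + 1)
    (h : ∀ j < q, f j ≠ r) :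
    minor f q (conv (simpleArr r s) y) = star s * minor f q y +
      (1 - star s * s) * minor (fun j => Equiv.swap r (r + 1) (f j)) q y := by
  have e0 : ∀ i, i < q → i ≠ c → f i ≠ r + 1 := fun i hi hic e => hic (by
      rcases lt_trichotomy i c with h | h | h
      · have := hf i c h hcq; omega
      · exact h
      · have := hf c i h hi; omega)
  have e : ∀ i, i < q → i ≠ c → lmul r s (star s) (1 - star s * s) y (f i) i = y (f i) i :=
    fun i hi hic => lmul_of_ne (h i hi) (e0 i hi hic) _
  have e2 : ∀ i, i < q → i ≠ c → y (Equiv.swap r (r + 1) (f i)) i = y (f i) i :=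
    fun i hi hic => by
      rw [swap_succ, if_neg (h i hi), if_neg (e0 i hi hic)]
  rw [conv_simple_eq, minor, minor, minor, oprod_split (Nat.zero_le c) hcq,
    oprod_split (f := fun j => y (f j) j) (Nat.zero_le c) hcq,
    oprod_split (f := fun j => y (Equiv.swap r (r + 1) (f j)) j) (Nat.zero_le c) hcq]
  rw [oprod_congr (a := 0) (b := c) fun i h1 h2 => e i (by omega) (by omega),
    oprod_congr (f := fun j => lmul r s (star s) (1 - star s * s) y (f j) j) (b := q)
      fun i h1 h2 => e i (by omega) (by omega),
    oprod_congr (f := fun j => y (Equiv.swap r (r + 1) (f j)) j) (a := 0) (b := c)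
      fun i h1 h2 => e2 i (by omega) (by omega),
    oprod_congr (f := fun j => y (Equiv.swap r (r + 1) (f j)) j) (b := q)
      fun i h1 h2 => e2 i (by omega) (by omega)]
  have h1 : c ≤ r := by
    rcases c with _ | c
    · exact Nat.zero_le r
    · have h1 := le_of_strictMono hf c (by omega)
      have h2 := hf c (c + 1) (by omega) hcq
      have h3 := h c (by omega)
      omega
  have h2 : Commute (oprod (fun j => y (f j) j) 0 c) (star s) :=
    (commute_oprod fun i _ _ => (hc _ _).2).symm
  have h3 : Commute (oprod (fun j => y (f j) j) 0 c) (1 - star s * s) :=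
    (commute_oprod fun i _ _ => hc.proj _ _).symm
  simp only [lmul, hfc, if_true, Nat.succ_ne_self, if_false, h1, Equiv.swap_apply_right]
  rw [mul_add, add_mul]
  simp only [← mul_assoc, h2.eq, h3.eq]

theorem strictMono_swap (hf : ∀ i j, i < j → j < q → f i < f j) (h : ∀ j < q, f j ≠ r) :
    ∀ i j, i < j → j < q → Equiv.swap r (r + 1) (f i) < Equiv.swap r (r + 1) (f j) := by
  intro i j hij hj
  have h1 := hf i j hij hj
  have h2 := h i (by omega)
  have h3 := h j hj
  rw [swap_succ, swap_succ]
  split_ifs <;> omega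

/-- A condition in the style of the Bruhat order. By the recursion a nonzero minor of the longer
word comes from a nonzero minor of the tail with the same rows, or with `r + 1` replaced by `r`. The
letter in front changes only the count at the threshold `r + 1`, and reducedness ensures that this
count does not decrease for the permutation. -/
theorem cnt_le_of_minor_ne_zero (L : List (ℕ × B)) (hL : LegList n L)
    (hred : Red (L.map Prod.fst)) (hf : ∀ i j, i < j → j < q → f i < f j)
    (h : minor f q (wordArr L) ≠ 0) (m : ℕ) : cnt f q m ≤ cnt (wp (L.map Prod.fst)) q m := by
  induction L generalizing f m with
  | nil =>
    refine le_of_eq (cnt_congr fun j hj => ?_)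
    have : f j = j := by
      by_contra hne
      refine h (oprod_eq_zero (Nat.zero_le j) hj ?_)
      simp [wordArr, act_nil, idArr, hne]
    rw [this]
    rfl
  | cons p L ih =>
    obtain ⟨r, s⟩ := p
    have hdc : DComm s (wordArr L) :=
      DComm.act (List.pairwise_cons.1 hL.pairwise).1 (DComm.idArr s)
    have hs : s * star s = 1 := hL.coisom (r, s) (by simp)
    rw [List.map_cons] at hred ⊢
    have ih' := fun {f} (hf : ∀ i j, i < j → j < q → f i < f j) =>
      ih hL.tail hred.tail (f := f) hf
    have hw : wordArr ((r, s) :: L) = conv (simpleArr r s) (wordArr L) := rfl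
    rw [hw] at h
    set σ := wp (L.map Prod.fst) with hσ
    have e1 : ∀ m, cnt (wp (r :: L.map Prod.fst)) q m =
        cnt (fun j => Equiv.swap r (r + 1) (σ j)) q m := fun m => by
      rw [wp_cons]; rfl
    have hsw := cntEq_swap_symm r q hred.head
    rw [← hσ] at hsw
    have c1 := cnt_succ σ q r
    have c2 := cnt_succ σ q (r + 1)
    have c3 := cntEq_le_one (g := σ) (q := q) (fun i _ j _ e => σ.injective e) r
    rw [e1]
    by_cases h1 : minor f q (wordArr L) = 0
    · by_cases h2 : (∃ j < q, f j = r) ↔ ∃ j < q, f j = r + 1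
      · rw [minor_conv_same hs hdc hf h2] at h
        exact absurd h1 h
      · by_cases h3 : ∃ c < q, f c = r
        · obtain ⟨c, hc, hc'⟩ := h3
          rw [minor_conv_lower hdc hf hc hc', h1, mul_zero] at h
          · exact absurd rfl h
          · intro j hj e
            exact h2 ⟨fun _ => ⟨j, hj, e⟩, fun _ => ⟨c, hc, hc'⟩⟩
        · have h4 : ∃ c < q, f c = r + 1 := by
            by_contra h4
            exact h2 ⟨fun h => absurd h h3, fun h => absurd h h4⟩
          obtain ⟨c, hc, hc'⟩ := h4
          have h5 : ∀ j < q, f j ≠ r := fun j hj e => h3 ⟨j, hj, e⟩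
          rw [minor_conv_upper hdc hf hc hc' h5, h1, mul_zero, zero_add] at h
          have h6 : minor (fun j => Equiv.swap r (r + 1) (f j)) q (wordArr L) ≠ 0 :=
            fun e => h (by rw [e, mul_zero])
          have ihf := ih' (strictMono_swap hf h5) h6
          -- Only the threshold `r + 1` matters. If `r` is among the first `q` values of `σ`,
          -- compare at `r + 2`; if it is not, neither is `r + 1`, and the comparison at `r`
          -- suffices.
          by_cases hm : m = r + 1
          · subst hm
            rw [cnt_swap]
            have i1 := ihf r
            have i2 := ihf (r + 2)
            rw [cnt_swap_of_ne _ _ _ (by omega)] at i1 i2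
            have d1 := cnt_succ f q r
            have d2 := cnt_succ f q (r + 1)
            rw [cntEq_eq_zero h5] at d1
            have d3 := cntEq_le_one (g := f) (q := q) (fun i hi j hj e => by
              rcases lt_trichotomy i j with h | h | h
              · have := hf i j h hj; omega
              · exact h
              · have := hf j i h hi; omega) (r + 1)
            simp only [Nat.add_assoc, Nat.reduceAdd] at *
            omega
          · have := ihf m
            rw [cnt_swap_of_ne _ _ _ hm] at this ⊢
            exact this
    · have := ih' hf h1 m
      by_cases hm : m = r + 1
      · subst hm
        rw [cnt_swap]
        simp only [Nat.add_assoc, Nat.reduceAdd] at *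
        omega
      · rwa [cnt_swap_of_ne _ _ _ hm]

end minors

/-! ### Extreme minors as products of projections. -/

section moving
variable {B : Type*} [Ring B] [StarRing B] {n q : ℕ}

/-- The letter `r` in front of the word `v` moves the set `wp v '' [0, q)`. -/
def Moves (q r : ℕ) (v : List ℕ) : Prop := (wp v).symm r < q ∧ ¬ (wp v).symm (r + 1) < q

instance (q r : ℕ) (v : List ℕ) : Decidable (Moves q r v) :=
  inferInstanceAs (Decidable (_ ∧ _))

/-- The projections at the positions of the letters which move the set of the first `q` points. -/
def marks (q : ℕ) : List (ℕ × B) → List B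
  | [] => []
  | p :: L => (if Moves q p.1 (L.map Prod.fst) then 1 - star p.2 * p.2 else 1) :: marks q L

theorem length_marks (L : List (ℕ × B)) : (marks q L).length = L.length := by
  induction L with
  | nil => rfl
  | cons p L ih => simp [marks, ih]

theorem getElem_marks (L : List (ℕ × B)) (k : ℕ) (h : k < (marks q L).length)
    (h' : k < L.length) : (marks q L)[k] =
      if Moves q L[k].1 ((L.drop (k + 1)).map Prod.fst) then 1 - star L[k].2 * L[k].2 else 1 := by
  induction L generalizing k with
  | nil => simp at h'
  | cons p L ih =>
    rcases k with _ | k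
    · rfl
    · exact ih k _ (by simpa using h')

theorem symm_cons (r m : ℕ) (v : List ℕ) :
    (wp (r :: v)).symm m = (wp v).symm (Equiv.swap r (r + 1) m) := by
  rw [wp_cons, ← Equiv.Perm.inv_def, mul_inv_rev, Equiv.swap_inv]
  rfl

theorem strictMono_le {f : ℕ → ℕ} (hf : ∀ i j, i < j → j < q → f i < f j) (i d : ℕ)
    (h : i + d < q) : f i + d ≤ f (i + d) := by
  induction d with
  | zero => exact le_rfl
  | succ d ih =>
    have h1 := ih (by omega)
    have h2 := hf (i + d) (i + (d + 1)) (by omega) h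
    omega

theorem cnt_eq_of_image {f g : ℕ → ℕ} {m : ℕ} (hf : ∀ i < q, ∀ j < q, f i = f j → i = j)
    (hg : ∀ i < q, ∀ j < q, g i = g j → i = j)
    (h : ∀ x, m ≤ x → ((∃ j < q, f j = x) ↔ ∃ j < q, g j = x)) : cnt f q m = cnt g q m := by
  have e : ∀ f : ℕ → ℕ, (∀ i < q, ∀ j < q, f i = f j → i = j) →
      cnt f q m = (((Finset.range q).filter fun j => m ≤ f j).image f).card := fun f hf => by
    rw [cnt, Finset.card_image_of_injOn]
    intro i hi j hj hij
    simp only [Finset.coe_filter, Finset.mem_range, Set.mem_ofPred_eq] at hi hj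
    exact hf i hi.1 j hj.1 hij
  rw [e f hf, e g hg]
  congr 1
  ext x
  simp only [Finset.mem_image, Finset.mem_filter, Finset.mem_range]
  constructor
  · rintro ⟨j, ⟨h1, h2⟩, rfl⟩
    obtain ⟨i, hi, e⟩ := (h _ h2).1 ⟨j, h1, rfl⟩
    exact ⟨i, ⟨hi, e ▸ h2⟩, e⟩
  · rintro ⟨j, ⟨h1, h2⟩, rfl⟩
    obtain ⟨i, hi, e⟩ := (h _ h2).2 ⟨j, h1, rfl⟩
    exact ⟨i, ⟨hi, e ▸ h2⟩, e⟩

theorem exists_wp_iff (w : List ℕ) (m : ℕ) : (∃ j < q, wp w j = m) ↔ (wp w).symm m < q := by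
  constructor
  · rintro ⟨j, hj, rfl⟩
    simpa using hj
  · intro h
    exact ⟨_, h, by simp⟩

/-- If the first letter `r` moves the set, then `r + 1` is a row and `r` is not. In
`minor_conv_upper` the minor with unchanged rows vanishes, because it has one row too many at the
threshold `r + 1` for the tail; what remains is the projection times the extreme minor of the tail.
If the letter does not move the set, the minor is unchanged. -/
theorem minor_eq_marks (L : List (ℕ × B)) (hL : LegList n L) (hred : Red (L.map Prod.fst))
    {f : ℕ → ℕ} (hf : ∀ i j, i < j → j < q → f i < f j)
    (him : ∀ m, (∃ j < q, f j = m) ↔ (wp (L.map Prod.fst)).symm m < q) :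
    minor f q (wordArr L) = (marks q L).prod := by
  induction L generalizing f with
  | nil =>
    refine oprod_one fun i _ hi => ?_
    -- A strictly increasing map of `[0, q)` to itself is the identity.
    have h1 := strictMono_le hf i (q - 1 - i) (by omega)
    have h2 := le_of_strictMono hf i hi
    have h3 : f (i + (q - 1 - i)) < q := (him _).1 ⟨_, by omega, rfl⟩
    have : f i = i := by omega
    simp [wordArr, act_nil, idArr, this]
  | cons p L ih =>
    obtain ⟨r, s⟩ := p
    have hdc : DComm s (wordArr L) :=
      DComm.act (List.pairwise_cons.1 hL.pairwise).1 (DComm.idArr s)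
    have hs : s * star s = 1 := hL.coisom (r, s) (by simp)
    rw [List.map_cons] at hred him
    have hlt := hred.head
    have inj : ∀ i < q, ∀ j < q, f i = f j → i = j := fun i hi j hj e => by
      rcases lt_trichotomy i j with h | h | h
      · have := hf i j h hj; omega
      · exact h
      · have := hf j i h hi; omega
    change minor f q (conv (simpleArr r s) (wordArr L)) = _
    rw [marks, List.prod_cons]
    simp only [symm_cons] at him
    by_cases hm : Moves q r (L.map Prod.fst)
    · rw [if_pos hm]
      have hr : ∀ j < q, f j ≠ r := fun j hj e => hm.2 (by
        have := (him r).1 ⟨j, hj, e⟩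
        rwa [swap_succ, if_pos rfl] at this)
      obtain ⟨c, hc, hc'⟩ := (him (r + 1)).2 (by
        rw [swap_succ, if_neg (by omega), if_pos rfl]; exact hm.1)
      rw [minor_conv_upper hdc hf hc hc' hr]
      have h0 : minor f q (wordArr L) = 0 := by
        by_contra hne
        have h1 := cnt_le_of_minor_ne_zero L hL.tail hred.tail hf hne (r + 1)
        have h2 : cnt f q (r + 2) = cnt (wp (L.map Prod.fst)) q (r + 2) :=
          cnt_eq_of_image inj (fun i _ j _ e => (wp _).injective e) fun x hx => by
            rw [him, exists_wp_iff, swap_succ, if_neg (by omega), if_neg (by omega)]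
        have h3 : cntEq (wp (L.map Prod.fst)) q (r + 1) = 0 := cntEq_eq_zero fun j hj e =>
          hm.2 ((exists_wp_iff _ _).1 ⟨j, hj, e⟩)
        have h4 : 0 < cntEq f q (r + 1) := cntEq_pos.2 ⟨c, hc, hc'⟩
        have h5 := cnt_succ f q (r + 1)
        have h6 := cnt_succ (wp (L.map Prod.fst)) q (r + 1)
        simp only [Nat.add_assoc, Nat.reduceAdd] at *
        omega
      rw [h0, mul_zero, zero_add, ih hL.tail hred.tail (strictMono_swap hf hr)]
      intro m
      have := him (Equiv.swap r (r + 1) m)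
      rw [Equiv.swap_apply_self] at this
      rw [← this]
      refine exists_congr fun j => and_congr_right fun _ => ?_
      rw [← (Equiv.swap r (r + 1)).injective.eq_iff, Equiv.swap_apply_self]
    · rw [if_neg hm, one_mul]
      have hiff : (wp (L.map Prod.fst)).symm r < q ↔ (wp (L.map Prod.fst)).symm (r + 1) < q := by
        have hm' : ¬ ((wp (L.map Prod.fst)).symm r < q ∧
          ¬ (wp (L.map Prod.fst)).symm (r + 1) < q) := hm
        have hlt' : (wp (L.map Prod.fst)).symm r < (wp (L.map Prod.fst)).symm (r + 1) := hlt
        omega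
      have him' : ∀ m, (∃ j < q, f j = m) ↔ (wp (L.map Prod.fst)).symm m < q := fun m => by
        rw [him, swap_succ]
        split_ifs with h1 h2
        · rw [h1, hiff]
        · rw [h2, hiff]
        · rfl
      rw [minor_conv_same hs hdc hf (by rw [him', him', hiff]), ih hL.tail hred.tail hf him']

/-- Each letter has `r` and `r + 1` both inside or both outside of `[0, q)`; reducedness excludes
the case that only `r + 1` is inside. This yields a projection in every bracket, since `w_L` does
not preserve `[0, q)` for `1 ≤ q ≤ n`. -/
theorem not_moves_symm {w : List ℕ} (hw : Red w)
    (h : ∀ u r v, w = u ++ r :: v → ¬ Moves q r v) (m : ℕ) : (wp w).symm m < q ↔ m < q := by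
  induction w generalizing m with
  | nil => rfl
  | cons r w ih =>
    have ih' := ih hw.tail fun u r' v e => h (r :: u) r' v (by rw [e]; rfl)
    have h1 := h [] r w rfl
    simp only [Moves, ih'] at h1
    rw [symm_cons, ih', swap_succ]
    have h2 := ih' r
    have h3 := ih' (r + 1)
    have h4 := hw.head
    split_ifs <;> omega

end moving

/-! ### The brackets and the element `a` under `π_{t,w}`. -/

section tensor
variable {n : ℕ}

/-- The positions of the letters of `w` which move the set of the first `q` points. -/
def movers (q : ℕ) (w : List (Fin n)) : Finset (Fin w.length) :=
  Finset.univ.filter fun k => Moves q (w.get k) ((w.drop (k + 1)).map Fin.val)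

/-- The tensor product of the vacuum projection over `E` with the identity. -/
noncomputable def vacTensor {N : ℕ} (E : Finset (Fin N)) :
    Ltwo (Fin N → ℕ) →L[ℂ] Ltwo (Fin N → ℕ) :=
  tensorOp fun k => if k ∈ E then vacuumProj else 1

theorem vacTensor_eq {N : ℕ} (E : Finset (Fin N)) : vacTensor E =
    (List.ofFn fun k => if k ∈ E then 1 - star (legS ℂ k) * legS ℂ k else 1).prod := by
  rw [vacTensor, tensorOp]
  congr 2
  funext k
  split_ifs
  · rw [leg_vacuumProj, leg_shift]
  · exact leg_one k

theorem marks_wordLegs (q : ℕ) (w : List (Fin n)) :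
    (marks q (wordLegs ℂ w)).prod = vacTensor (movers q w) := by
  rw [vacTensor_eq]
  congr 1
  refine List.ext_getElem (by simp [length_marks, wordLegs]) fun k h1 h2 => ?_
  have hk : k < (wordLegs ℂ w).length := by rwa [length_marks] at h1
  have hk' : k < w.length := by simpa [wordLegs] using hk
  rw [getElem_marks _ _ _ hk, List.getElem_ofFn, List.map_drop, wordLegs_map]
  simp only [wordLegs, List.getElem_ofFn, movers, Finset.mem_filter, Finset.mem_univ, true_and,
    List.map_drop]

theorem minor_wordLegs {q : ℕ} {w : List (Fin n)} (hred : Red (w.map Fin.val))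
    {f : ℕ → ℕ} (hf : ∀ i j, i < j → j < q → f i < f j)
    (him : ∀ m, (∃ j < q, f j = m) ↔ (wp (w.map Fin.val)).symm m < q) :
    minor f q (wordArr (wordLegs ℂ w)) = vacTensor (movers q w) := by
  rw [← marks_wordLegs, ← wordLegs_map ℂ] at *
  exact minor_eq_marks _ (wordLegs_legList ℂ w) hred hf him

theorem oprod_algebraMap_mul {B : Type*} [Ring B] [Algebra ℂ B] (c : ℕ → ℂ) (y : ℕ → B) (b : ℕ) :
    oprod (fun j => algebraMap ℂ B (c j) * y j) 0 b =
      algebraMap ℂ B (oprod c 0 b) * oprod y 0 b := by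
  induction b with
  | zero => simp [oprod_self]
  | succ b ih =>
    rw [oprod_succ (Nat.zero_le _), oprod_succ (Nat.zero_le _), oprod_succ (Nat.zero_le _), ih,
      map_mul, mul_assoc, ← mul_assoc (oprod y 0 b), ← Algebra.commutes]
    simp only [mul_assoc]

variable {t : Fin n → Circle} {w : List (Fin n)}
  {π : CrystalAlg n →⋆ₐ[ℂ] (WordSpace w →L[ℂ] WordSpace w)}

/-- The scalar by which the bracket is twisted in `π_{t,w}`. -/
noncomputable def bracketScalar (t : Fin n → Circle) (p : Fin n) : ℂ :=
  oprod (fun j => torusNat t (n - p + j)) 0 (p + 1)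

theorem rep_bracket (hπ : IsCrystalRep t w π) (p : Fin n) :
    π (crystalBracket n p) = algebraMap ℂ _ (bracketScalar t p) *
      minor (fun j => n - p + j) (p + 1) (wordArr (wordLegs ℂ w)) := by
  rw [crystalBracket, map_list_prod, List.map_ofFn, minor, bracketScalar, ← oprod_algebraMap_mul,
    ← oprod_ofFn]
  congr 2
  funext j
  exact (hπ _ _).trans (torusWordOp_eq t w _ _)

theorem norm_torusNat (t : Fin n → Circle) (i : ℕ) : ‖torusNat t i‖ = 1 := by
  have := congrArg norm (torusNat_mul_star t i)
  rw [norm_mul, norm_star, norm_one] at this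
  nlinarith [norm_nonneg (torusNat t i)]

theorem norm_bracketScalar (t : Fin n → Circle) (p : Fin n) : ‖bracketScalar t p‖ = 1 := by
  have : ∀ b, ‖oprod (fun j => torusNat t (n - p + j)) 0 b‖ = 1 := by
    intro b
    induction b with
    | zero => simp [oprod_self]
    | succ b ih => rw [oprod_succ (Nat.zero_le _), norm_mul, ih, norm_torusNat, one_mul]
  exact this _

theorem bracketScalar_one (p : Fin n) : bracketScalar 1 p = 1 := by
  refine oprod_one fun j _ _ => ?_
  rw [torusNat]
  split_ifs
  · simp [torusChar]
  · rfl

/-- Otherwise no bracket vanishes. The bracket with `p + 1` factors has all of its rows at or above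
`n - p`, so counting gives `w j ≥ n - p` for all `j ≤ p`. Inductively `w j = n - j`, because the
larger values are already taken, and `w` is the longest permutation. -/
theorem keyElement_mem_ker (hπ : IsCrystalRep t w π) (hw : IsReducedWord w)
    (hne : wordPerm w ≠ wordPerm (longestWord n)) : keyElement n ∈ RingHom.ker π := by
  rw [RingHom.mem_ker, keyElement, map_list_prod, List.map_ofFn]
  by_contra h0
  have hL := wordLegs_legList ℂ w
  have hred : Red ((wordLegs ℂ w).map Prod.fst) := by
    rw [wordLegs_map]
    exact red_of_isReducedWord hw
  have hmin : ∀ p < n, minor (fun j => n - p + j) (p + 1) (wordArr (wordLegs ℂ w)) ≠ 0 := by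
    intro p hp h
    refine h0 (List.prod_eq_zero ?_)
    rw [List.mem_ofFn]
    refine ⟨⟨p, hp⟩, ?_⟩
    change π (crystalBracket n ⟨p, hp⟩) = 0
    rw [rep_bracket hπ, h, mul_zero]
  have hcnt : ∀ p < n, ∀ j ≤ p, n - p ≤ wp (w.map Fin.val) j := by
    intro p hp
    have h1 := cnt_le_of_minor_ne_zero _ hL hred (fun i j hij _ => by omega) (hmin p hp) (n - p)
    rw [wordLegs_map] at h1
    have h2 : cnt (fun j => n - p + j) (p + 1) (n - p) = p + 1 := by
      rw [cnt, Finset.filter_true_of_mem fun j _ => by omega, Finset.card_range]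
    rw [h2, cnt] at h1
    have h3 := Finset.eq_of_subset_of_card_le
      (Finset.filter_subset (fun j => n - p ≤ wp (w.map Fin.val) j) (Finset.range (p + 1)))
      (by rw [Finset.card_range]; exact h1)
    intro j hj
    have : j ∈ Finset.range (p + 1) := Finset.mem_range.2 (by omega)
    rw [← h3] at this
    exact (Finset.mem_filter.1 this).2
  have hwlt : ∀ r ∈ w.map Fin.val, r < n := by
    intro r hr
    obtain ⟨a, -, rfl⟩ := List.mem_map.1 hr
    exact a.2
  have hval : ∀ j < n, wp (w.map Fin.val) j = n - j := by
    intro j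
    induction j using Nat.strong_induction_on with
    | _ j ih =>
      intro hj
      have h1 := hcnt j hj j le_rfl
      have h2 := wp_le _ hwlt j hj.le
      by_contra hne
      have h3 : n - wp (w.map Fin.val) j < j := by omega
      have h4 := ih _ h3 (by omega)
      have h5 : n - wp (w.map Fin.val) j = j :=
        (wp (w.map Fin.val)).injective (by rw [h4]; omega)
      omega
  refine hne (wordPerm_eq_of_wp fun i hi => ?_)
  rw [longestWord_map, wp_lw, if_pos hi]
  rcases Nat.lt_or_ge i n with h | h
  · exact hval i h
  · have h1 := wp_symm_le _ hwlt 0 (Nat.zero_le _)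
    have h2 : (wp (w.map Fin.val)).symm 0 = i := by
      by_contra hne
      have h3 := hval ((wp (w.map Fin.val)).symm 0) (by omega)
      rw [Equiv.apply_symm_apply] at h3
      omega
    have h3 : wp (w.map Fin.val) i = 0 := by rw [← h2, Equiv.apply_symm_apply]
    omega

theorem red_longestWord (n : ℕ) : Red ((longestWord n).map Fin.val) := by
  rw [longestWord_map]
  exact red_lw n

theorem lw_symm {x : ℕ} (n : ℕ) (hx : x ≤ n) : (wp (lw n)).symm x = n - x := by
  rw [Equiv.symm_apply_eq, wp_lw, if_pos (by omega)]
  omega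

/-- The longest permutation maps `[0, p]` onto `[n - p, n]`, which are the rows of the bracket; so
the minor is extreme. -/
theorem minor_longestWord (p : Fin n) :
    minor (fun j => n - p + j) (p + 1) (wordArr (wordLegs ℂ (longestWord n))) =
      vacTensor (movers (p + 1) (longestWord n)) := by
  refine minor_wordLegs (red_longestWord n) (fun i j hij _ => by omega) fun m => ?_
  rw [longestWord_map]
  constructor
  · rintro ⟨j, hj, rfl⟩
    rw [lw_symm n (by omega)]
    omega
  · intro h
    by_cases hm : m ≤ n
    · rw [lw_symm n hm] at h
      exact ⟨m - (n - p), by omega, by omega⟩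
    · have : (wp (lw n)).symm m = m := by
        rw [Equiv.symm_apply_eq, wp_lw, if_neg hm]
      omega

theorem get_of_split {w : List (Fin n)} {u : List ℕ} {r : ℕ} {v : List ℕ}
    (h : w.map Fin.val = u ++ r :: v) : ∃ k : Fin w.length, (k : ℕ) = u.length ∧
      (w.get k : ℕ) = r ∧ (w.drop (k + 1)).map Fin.val = v := by
  obtain ⟨u, w', rfl, rfl, h1⟩ := List.map_eq_append_iff.1 h
  obtain ⟨r, v, rfl, rfl, rfl⟩ := List.map_eq_cons_iff.1 h1
  refine ⟨⟨u.length, by simp⟩, by simp, by simp, ?_⟩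
  simp

theorem split_get (w : List (Fin n)) (k : Fin w.length) : w.map Fin.val =
    (w.take k).map Fin.val ++ (w.get k : ℕ) :: (w.drop (k + 1)).map Fin.val := by
  have h : w = w.take k ++ w.get k :: w.drop (k + 1) := by
    conv_lhs => rw [← List.take_append_drop k w, List.drop_eq_getElem_cons k.2]
    rfl
  conv_lhs => rw [h, List.map_append, List.map_cons]

theorem movers_nonempty (p : Fin n) : (movers (p + 1) (longestWord n)).Nonempty := by
  by_contra hne
  rw [Finset.not_nonempty_iff_eq_empty] at hne
  have h := not_moves_symm (q := p + 1) (red_longestWord n) (fun u r v e hm => by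
    obtain ⟨k, -, h1, h2⟩ := get_of_split e
    have : k ∈ movers (p + 1) (longestWord n) := by
      simp only [movers, Finset.mem_filter, Finset.mem_univ, true_and]
      rw [h1, h2]
      exact hm
    rw [hne] at this
    simp at this) n
  rw [longestWord_map, lw_symm n le_rfl] at h
  omega

/-- For `p = 0` the first letter of the word does not move the set, as `n ≥ 2`. For `p > 0` the last
letter exchanges the points `0` and `1`, which both belong to the set. -/
theorem movers_ne_univ (hn : 2 ≤ n) (p : Fin n) :
    movers (p + 1) (longestWord n) ≠ Finset.univ := by
  intro h
  have key : ∀ u r v, lw n = u ++ r :: v → Moves (p + 1) r v := by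
    intro u r v e
    obtain ⟨k, -, h1, h2⟩ := get_of_split ((longestWord_map n).trans e)
    have : k ∈ movers (p + 1) (longestWord n) := by rw [h]; exact Finset.mem_univ k
    simp only [movers, Finset.mem_filter, Finset.mem_univ, true_and] at this
    rwa [h1, h2] at this
  obtain ⟨m, rfl⟩ : ∃ m, n = m + 1 := ⟨n - 1, by omega⟩
  rcases Nat.eq_zero_or_pos (p : ℕ) with hp | hp
  · have e : ∀ m, ∃ v, lw (m + 1) = 0 :: v := by
      intro m
      induction m with
      | zero => exact ⟨[], rfl⟩
      | succ m ih =>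
        obtain ⟨v, hv⟩ := ih
        rw [lw_succ, hv]
        exact ⟨_, rfl⟩
    obtain ⟨v, hv⟩ := e m
    have h1 := (key [] 0 v hv).1
    have h2 := symm_cons 0 (Equiv.swap 0 (0 + 1) 0) v
    rw [Equiv.swap_apply_self, ← hv, Equiv.swap_apply_left, lw_symm _ (by omega)] at h2
    omega
  · have e : lw (m + 1) = (lw m ++ ((List.range m).map Nat.succ).reverse) ++ 0 :: [] := by
      rw [lw_succ, List.range_succ_eq_map, List.reverse_cons, List.append_assoc]
    have h1 := (key _ _ _ e).2
    change ¬ 0 + 1 < (p : ℕ) + 1 at h1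
    omega

/-- The word is reduced, so the letter `r` in front of the suffix `v` satisfies `v⁻¹ r < v⁻¹ (r +
1)`; the choice `p = v⁻¹ r` separates the two points. -/
theorem exists_mem_movers (k : Fin (longestWord n).length) :
    ∃ p : Fin n, k ∈ movers (p + 1) (longestWord n) := by
  have h := red_longestWord n _ _ _ (split_get _ k)
  have h1 : (wp (((longestWord n).drop (k + 1)).map Fin.val)).symm
      (((longestWord n).get k : ℕ) + 1) ≤ n := by
    refine wp_symm_le _ (fun r hr => ?_) _ (by omega)
    obtain ⟨a, -, rfl⟩ := List.mem_map.1 hr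
    exact a.2
  refine ⟨⟨_, lt_of_lt_of_le h h1⟩, ?_⟩
  simp only [movers, Finset.mem_filter, Finset.mem_univ, true_and]
  exact ⟨Nat.lt_succ_self _, by omega⟩

theorem ofFn_prod_mul {B : Type*} [Monoid B] {N : ℕ} {a b : Fin N → B}
    (h : ∀ i j, Commute (a i) (b j)) :
    (List.ofFn a).prod * (List.ofFn b).prod = (List.ofFn fun k => a k * b k).prod := by
  induction N with
  | zero => simp
  | succ N ih =>
    rw [List.ofFn_succ, List.ofFn_succ, List.ofFn_succ, List.prod_cons, List.prod_cons,
      List.prod_cons, ← ih fun i j => h _ _]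
    have : Commute (List.ofFn fun i : Fin N => a i.succ).prod (b 0) :=
      Commute.list_prod_left _ _ fun x hx => by
        obtain ⟨i, rfl⟩ := List.mem_ofFn.1 hx
        exact h _ _
    rw [mul_assoc, ← mul_assoc _ (b 0), this.eq]
    simp only [mul_assoc]

theorem isIdempotent_proj {B : Type*} [Ring B] [StarRing B] {s : B} (hs : s * star s = 1) :
    (1 - star s * s) * (1 - star s * s) = 1 - star s * s := by
  have : star s * s * (star s * s) = star s * s := by
    rw [mul_assoc, ← mul_assoc s, hs, one_mul]
  simp only [mul_sub, sub_mul, mul_one, one_mul, this, sub_self, sub_zero]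

theorem commute_legP {N : ℕ} (i j : Fin N) :
    Commute (1 - star (legS ℂ i) * legS ℂ i) (1 - star (legS ℂ j) * legS ℂ j) := by
  by_cases h : i = j
  · rw [h]
  · exact ((DC_legS (E := ℂ) h).proj.symm.proj).1.symm

theorem vacTensor_mul {N : ℕ} (E F : Finset (Fin N)) :
    vacTensor E * vacTensor F = vacTensor (E ∪ F) := by
  rw [vacTensor_eq, vacTensor_eq, vacTensor_eq, ofFn_prod_mul]
  · congr 2
    funext k
    by_cases h1 : k ∈ E <;> by_cases h2 : k ∈ F <;>
      simp [h1, h2, isIdempotent_proj (legS_mul_star (E := ℂ) k)]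
  · intro i j
    split_ifs
    exacts [commute_legP i j, Commute.one_right _, Commute.one_left _, Commute.one_left _]

theorem vacTensor_star {N : ℕ} (E : Finset (Fin N)) : star (vacTensor E) = vacTensor E := by
  have key : ∀ l : List (Ltwo (Fin N → ℕ) →L[ℂ] Ltwo (Fin N → ℕ)), (∀ x ∈ l, star x = x) →
      (∀ x ∈ l, ∀ y ∈ l, Commute x y) → star l.prod = l.prod := by
    intro l
    induction l with
    | nil => simp
    | cons a l ih =>
      intro h1 h2
      rw [List.prod_cons, star_mul, h1 a (by simp), ih (fun x hx => h1 x (by simp [hx]))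
        fun x hx y hy => h2 x (by simp [hx]) y (by simp [hy])]
      exact (Commute.list_prod_right _ _ fun y hy => h2 a (by simp) y (by simp [hy])).symm.eq
  rw [vacTensor_eq]
  refine key _ (fun x hx => ?_) fun x hx y hy => ?_
  · obtain ⟨k, rfl⟩ := List.mem_ofFn.1 hx
    split_ifs
    exacts [star_proj _, star_one _]
  · obtain ⟨i, rfl⟩ := List.mem_ofFn.1 hx
    obtain ⟨j, rfl⟩ := List.mem_ofFn.1 hy
    split_ifs
    exacts [commute_legP i j, Commute.one_right _, Commute.one_left _, Commute.one_left _]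

theorem vacTensor_isPositive {N : ℕ} (E : Finset (Fin N)) : (vacTensor E).IsPositive := by
  have : IsStarProjection (vacTensor E) :=
    ⟨by rw [IsIdempotentElem, vacTensor_mul, Finset.union_self], vacTensor_star E⟩
  exact ContinuousLinearMap.IsPositive.of_isStarProjection this

theorem vacTensor_univ_single {N : ℕ} (c : ℂ) :
    vacTensor (Finset.univ : Finset (Fin N)) (L2.single 0 c) = L2.single 0 c := by
  have key : ∀ l : List (Fin N), (l.map fun k => 1 - star (legS ℂ k) * legS ℂ k).prod
      (L2.single 0 c : L2 (Fin N → ℕ) ℂ) = L2.single 0 c := by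
    intro l
    induction l with
    | nil => rfl
    | cons a l ih =>
      rw [List.map_cons, List.prod_cons, ContinuousLinearMap.mul_apply, ih,
        ContinuousLinearMap.sub_apply, ContinuousLinearMap.mul_apply, legS,
        pullL_single_of_notMem _ _ _ _ fun j hj => (exists_up a 0).1 ⟨j, hj⟩ rfl]
      simp
  rw [vacTensor_eq]
  simp only [Finset.mem_univ, if_true]
  rw [List.ofFn_eq_map]
  exact key _

theorem rep_bracket_longestWord
    {π : CrystalAlg n →⋆ₐ[ℂ] (WordSpace (longestWord n) →L[ℂ] WordSpace (longestWord n))}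
    (hπ : IsCrystalRep t (longestWord n) π) (p : Fin n) :
    π (crystalBracket n p) = bracketScalar t p • vacTensor (movers (p + 1) (longestWord n)) := by
  rw [rep_bracket hπ, minor_longestWord, Algebra.algebraMap_eq_smul_one, smul_mul_assoc, one_mul]

/-- Products of the projections `vacTensor` correspond to unions of positions, and the positions of
all brackets together exhaust the word. -/
theorem exists_rep_keyElement
    {π : CrystalAlg n →⋆ₐ[ℂ] (WordSpace (longestWord n) →L[ℂ] WordSpace (longestWord n))}
    (hπ : IsCrystalRep t (longestWord n) π) :
    π (keyElement n) = (List.ofFn (bracketScalar t)).prod • vacTensor Finset.univ := by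
  have key : ∀ l : List (Fin n), (l.map fun p => π (crystalBracket n p)).prod =
      (l.map (bracketScalar t)).prod •
        vacTensor (l.toFinset.biUnion fun p => movers (p + 1) (longestWord n)) := by
    intro l
    induction l with
    | nil =>
      have : vacTensor (∅ : Finset (Fin (longestWord n).length)) = 1 := by
        rw [vacTensor_eq, List.prod_eq_one]
        intro x hx
        obtain ⟨k, rfl⟩ := List.mem_ofFn.1 hx
        simp
      simp [this]
    | cons p l ih =>
      rw [List.map_cons, List.prod_cons, ih, rep_bracket_longestWord hπ, smul_mul_smul_comm,
        vacTensor_mul, List.map_cons, List.prod_cons, List.toFinset_cons, Finset.biUnion_insert]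
  rw [keyElement, map_list_prod, List.map_ofFn, List.ofFn_eq_map, List.ofFn_eq_map]
  refine (key _).trans ?_
  congr 2
  ext k
  obtain ⟨p, hp⟩ := exists_mem_movers k
  simp only [Finset.mem_biUnion, List.mem_toFinset, List.mem_finRange, true_and, Finset.mem_univ,
    iff_true]
  exact ⟨p, hp⟩

theorem rep_keyElement
    {π : CrystalAlg n →⋆ₐ[ℂ] (WordSpace (longestWord n) →L[ℂ] WordSpace (longestWord n))}
    (hπ : IsCrystalRep 1 (longestWord n) π) :
    π (keyElement n) ≠ 0 ∧ π (keyElement n) = tensorOp fun _ => vacuumProj := by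
  have h : π (keyElement n) = vacTensor Finset.univ := by
    rw [exists_rep_keyElement hπ, List.prod_eq_one, one_smul]
    intro x hx
    obtain ⟨p, rfl⟩ := List.mem_ofFn.1 hx
    exact bracketScalar_one p
  constructor
  · rw [h]
    intro h0
    have h1 := vacTensor_univ_single (N := (longestWord n).length) 1
    rw [h0, ContinuousLinearMap.zero_apply] at h1
    have h2 := L2.norm_single (I := Fin (longestWord n).length → ℕ) 0 (1 : ℂ)
    rw [← h1, norm_zero, norm_one] at h2
    exact zero_ne_one h2
  · rw [h, vacTensor]
    simp

theorem rep_bracket_positive (hn : 2 ≤ n)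
    {π : CrystalAlg n →⋆ₐ[ℂ] (WordSpace (longestWord n) →L[ℂ] WordSpace (longestWord n))}
    (hπ : IsCrystalRep 1 (longestWord n) π) (p : Fin n) :
    (π (crystalBracket n p)).IsPositive ∧
      ∃ E : Finset (Fin (longestWord n).length), E.Nonempty ∧ E ≠ Finset.univ ∧
        π (crystalBracket n p) = tensorOp fun k => if k ∈ E then vacuumProj else 1 := by
  have h : π (crystalBracket n p) = vacTensor (movers (p + 1) (longestWord n)) := by
    rw [rep_bracket_longestWord hπ, bracketScalar_one, one_smul]
  exact ⟨h ▸ vacTensor_isPositive _, _, movers_nonempty p, movers_ne_univ hn p, h⟩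

end tensor

open Filter Topology

/-! ### Symbols with respect to asymptotically intertwining isometries. -/

section symbol
variable {H K : Type} [NormedAddCommGroup H] [InnerProductSpace ℂ H] [CompleteSpace H]
  [NormedAddCommGroup K] [InnerProductSpace ℂ K] [CompleteSpace K]

/-- `Y` is the symbol of `X` with respect to a sequence of isometries: the isometries
asymptotically intertwine `X` with `Y` and `star X` with `star Y`. -/
def Sym (ι : ℕ → K →ₗᵢ[ℂ] H) (X : H →L[ℂ] H) (Y : K →L[ℂ] K) : Prop :=
  (∀ h, Tendsto (fun N => X (ι N h) - ι N (Y h)) atTop (𝓝 0)) ∧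
    ∀ h, Tendsto (fun N => star X (ι N h) - ι N (star Y h)) atTop (𝓝 0)

variable {ι : ℕ → K →ₗᵢ[ℂ] H} {X X' : H →L[ℂ] H} {Y Y' : K →L[ℂ] K}

theorem Sym.star (h : Sym ι X Y) : Sym ι (star X) (star Y) := ⟨h.2, by simpa using h.1⟩

theorem Sym.add (h : Sym ι X Y) (h' : Sym ι X' Y') : Sym ι (X + X') (Y + Y') := by
  constructor
  · intro a
    have := (h.1 a).add (h'.1 a)
    rw [add_zero] at this
    refine this.congr fun N => ?_
    simp only [ContinuousLinearMap.add_apply, map_add]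
    abel
  · intro a
    have := (h.2 a).add (h'.2 a)
    rw [add_zero] at this
    refine this.congr fun N => ?_
    simp only [star_add, ContinuousLinearMap.add_apply, map_add]
    abel

theorem Sym.smul (h : Sym ι X Y) (c : ℂ) : Sym ι (c • X) (c • Y) := by
  constructor
  · intro a
    have := (h.1 a).const_smul c
    rw [smul_zero] at this
    refine this.congr fun N => ?_
    simp only [ContinuousLinearMap.smul_apply, map_smul, smul_sub]
  · intro a
    have := (h.2 a).const_smul (Star.star c)
    rw [smul_zero] at this
    refine this.congr fun N => ?_
    simp only [star_smul, ContinuousLinearMap.smul_apply, map_smul, smul_sub]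

theorem Sym.sub (h : Sym ι X Y) (h' : Sym ι X' Y') : Sym ι (X - X') (Y - Y') := by
  have := h.add (h'.smul (-1))
  simpa [sub_eq_add_neg] using this

theorem Sym.mul (h : Sym ι X Y) (h' : Sym ι X' Y') : Sym ι (X * X') (Y * Y') := by
  have key : ∀ {X X' : H →L[ℂ] H} {Y Y' : K →L[ℂ] K},
      (∀ h, Tendsto (fun N => X (ι N h) - ι N (Y h)) atTop (𝓝 0)) →
      (∀ h, Tendsto (fun N => X' (ι N h) - ι N (Y' h)) atTop (𝓝 0)) →
      ∀ h, Tendsto (fun N => (X * X') (ι N h) - ι N ((Y * Y') h)) atTop (𝓝 0) := by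
    intro X X' Y Y' h h' a
    have h1 := (X.continuous.tendsto 0).comp (h' a)
    rw [map_zero] at h1
    have := h1.add (h (Y' a))
    rw [add_zero] at this
    refine this.congr fun N => ?_
    simp only [Function.comp, map_sub, ContinuousLinearMap.mul_apply]
    abel
  refine ⟨key h.1 h'.1, ?_⟩
  rw [star_mul, star_mul]
  exact key h'.2 h.2

theorem Sym.one : Sym ι 1 1 := by
  constructor <;> intro a <;> simp

theorem Sym.zero : Sym ι 0 0 := by
  constructor <;> intro a <;> simp

theorem Sym.sum {I : Type*} {s : Finset I} {f : I → H →L[ℂ] H} {g : I → K →L[ℂ] K}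
    (h : ∀ i ∈ s, Sym ι (f i) (g i)) : Sym ι (∑ i ∈ s, f i) (∑ i ∈ s, g i) := by
  classical
  induction s using Finset.induction_on with
  | empty => simpa using Sym.zero
  | insert i s hi ih =>
    rw [Finset.sum_insert hi, Finset.sum_insert hi]
    exact (h i (by simp)).add (ih fun j hj => h j (by simp [hj]))

theorem Sym.oprod {f : ℕ → H →L[ℂ] H} {g : ℕ → K →L[ℂ] K} {a b : ℕ}
    (h : ∀ i, a ≤ i → i < b → Sym ι (f i) (g i)) : Sym ι (oprod f a b) (oprod g a b) := by
  rcases Nat.lt_or_ge b a with hab | hab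
  · rw [Crystal.oprod, Crystal.oprod, List.Ico.eq_nil_of_le hab.le]
    exact Sym.one
  · induction b, hab using Nat.le_induction with
    | base => rw [oprod_self, oprod_self]; exact Sym.one
    | succ b hb ih =>
      rw [oprod_succ hb, oprod_succ hb]
      exact (ih fun i h1 h2 => h i h1 (by omega)).mul (h b hb (by omega))

theorem Sym.norm_le (h : Sym ι X Y) (a : K) : ‖Y a‖ ≤ ‖X‖ * ‖a‖ := by
  have h1 := (h.1 a).norm
  rw [norm_zero] at h1
  have h2 : ∀ N, ‖Y a‖ - ‖X‖ * ‖a‖ ≤ ‖X (ι N a) - ι N (Y a)‖ := fun N => by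
    have e1 := norm_sub_norm_le (ι N (Y a)) (X (ι N a))
    have e2 := X.le_opNorm (ι N a)
    rw [(ι N).norm_map] at e1 e2
    rw [norm_sub_rev]
    linarith
  have := ge_of_tendsto' h1 h2
  linarith

/-- Isometries preserve norms, so the symbol of the zero operator is zero. Uniqueness allows every
algebraic identity among operators to be transferred to their symbols. -/
theorem Sym.unique (h : Sym ι X Y) (h' : Sym ι X Y') : Y = Y' := by
  have h1 := h.sub h'
  rw [sub_self] at h1
  ext a
  have := h1.norm_le a
  rw [norm_zero, zero_mul] at this
  exact sub_eq_zero.1 (norm_le_zero_iff.1 this)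

theorem Sym.conv {x : ℕ → ℕ → H →L[ℂ] H} {u : ℕ → ℕ → K →L[ℂ] K} {y : ℕ → ℕ → H →L[ℂ] H}
    {v : ℕ → ℕ → K →L[ℂ] K} {i j : ℕ} (h : ∀ k ∈ Finset.uIcc i j, Sym ι (x i k) (u i k))
    (h' : ∀ k ∈ Finset.uIcc i j, Sym ι (y k j) (v k j)) :
    Sym ι (conv x y i j) (conv u v i j) := Sym.sum fun k hk => (h k hk).mul (h' k hk)

/-- A coisometry with symbol `1` has a defect projection with symbol `0`; asymptotically the simple
reflection becomes the counit. -/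
theorem Sym.simple {s : H →L[ℂ] H} (h : Sym ι s 1) (r i j : ℕ) :
    Sym ι (simpleArr r s i j) (idArr i j) := by
  have h1 : Sym ι (1 - Star.star s * s) 0 := by
    simpa using Sym.one.sub (h.star.mul h)
  have h2 : Sym ι (Star.star s) 1 := by simpa using h.star
  have e1 : i = j → (Crystal.idArr i j : K →L[ℂ] K) = 1 := fun e => if_pos e
  have e0 : i ≠ j → (Crystal.idArr i j : K →L[ℂ] K) = 0 := fun e => if_neg e
  simp only [simpleArr]
  split_ifs with c1 c2 c3 c4 c5
  · rw [e1 (by omega)]; exact h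
  · rw [e1 (by omega)]; exact h2
  · rw [e0 (by omega)]; exact h1
  · rw [e0 (by omega)]; exact h1
  · rw [e1 c5]; exact Sym.one
  · rw [e0 c5]; exact Sym.zero

theorem Sym.act {L : List (ℕ × (H →L[ℂ] H))} (hL : ∀ p ∈ L, Sym ι p.2 1)
    {x : ℕ → ℕ → H →L[ℂ] H} {u : ℕ → ℕ → K →L[ℂ] K} (h : ∀ i j, Sym ι (x i j) (u i j)) (i j : ℕ) :
    Sym ι (act L x i j) (u i j) := by
  induction L generalizing i j with
  | nil => exact h i j
  | cons p L ih =>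
    have := Sym.conv (i := i) (j := j) (fun k _ => (hL p (by simp)).simple p.1 i k)
      fun k _ => ih (fun q hq => hL q (by simp [hq])) k j
    rwa [id_conv] at this

theorem Sym.idArr (i j : ℕ) : Sym ι (idArr i j) (idArr i j) := by
  simp only [Crystal.idArr]
  split_ifs
  exacts [Sym.one, Sym.zero]

/-- Every crystal relation equates polynomials in the entries and their adjoints. Symbols respect
sums, products and adjoints, so uniqueness transfers the relations. -/
theorem CRel.symbol {n : ℕ} {z : ℕ → ℕ → H →L[ℂ] H} {u : ℕ → ℕ → K →L[ℂ] K} (hz : CRel n z)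
    (h : ∀ i j, i ≤ n → j ≤ n → Sym ι (z i j) (u i j)) : CRel n u where
  row_zero i j l h1 h2 h3 := ((h i j h1 (by omega)).mul (h i l h1 h3)).unique
    (hz.row_zero i j l h1 h2 h3 ▸ Sym.zero)
  col_zero i k j h1 h2 h3 := ((h i j (by omega) h3).mul (h k j h2 h3)).unique
    (hz.col_zero i k j h1 h2 h3 ▸ Sym.zero)
  anti_comm i k j l h1 h2 h3 h4 := ((h i l (by omega) h4).mul (h k j h2 (by omega))).unique
    (hz.anti_comm i k j l h1 h2 h3 h4 ▸ (h k j h2 (by omega)).mul (h i l (by omega) h4))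
  anti_zero i k j l h1 h2 h3 h4 h5 := ((h i l (by omega) h4).mul (h k j h2 (by omega))).unique
    (hz.anti_zero i k j l h1 h2 h3 h4 h5 ▸ Sym.zero)
  diag_cross i k j l h1 h2 h3 h4 h5 :=
    (((h i j (by omega) (by omega)).mul (h k l h2 h4)).sub
      ((h k l h2 h4).mul (h i j (by omega) (by omega)))).unique
    (hz.diag_cross i k j l h1 h2 h3 h4 h5 ▸ (h i l (by omega) h4).mul (h k j h2 (by omega)))
  diag_comm i k j l h1 h2 h3 h4 h5 := ((h i j (by omega) (by omega)).mul (h k l h2 h4)).unique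
    (hz.diag_comm i k j l h1 h2 h3 h4 h5 ▸ (h k l h2 h4).mul (h i j (by omega) (by omega)))
  det_one := (Sym.oprod (ι := ι) fun i _ h2 => h i i (by omega) (by omega)).unique
    (hz.det_one ▸ Sym.one)
  star_eq r s hr hs := (h r s hr hs).star.unique (by
    rw [hz.star_eq r s hr hs]
    refine Sym.oprod fun i _ h2 => h _ _ ?_ ?_ <;> simp only [skip] <;> split_ifs <;> omega)

/-- The symbol of a coisometry is determined by one of the two conditions. -/
theorem Sym.of_coisometry {s : H →L[ℂ] H} (hs : s * Star.star s = 1)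
    (h : ∀ a, Tendsto (fun N => s (ι N a) - ι N a) atTop (𝓝 0)) : Sym ι s 1 := by
  refine ⟨h, fun a => ?_⟩
  have hst : ∀ g, s (Star.star s g) = g := fun g => congrArg (fun T => T g) hs
  -- `star s * s` is a projection, so this is the theorem of Pythagoras; the defect of `ι N a` tends
  -- to zero since its norm and the norm of its image under `s` have the same limit.
  have hP : ∀ g, ‖g - Star.star s (s g)‖ ^ 2 = ‖g‖ ^ 2 - ‖s g‖ ^ 2 := fun g => by
    have e1 : inner ℂ g (Star.star s (s g)) = ((‖s g‖ ^ 2 : ℝ) : ℂ) := by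
      rw [ContinuousLinearMap.star_eq_adjoint, ContinuousLinearMap.adjoint_inner_right,
        inner_self_eq_norm_sq_to_K]
      simp
    have e2 : ‖Star.star s (s g)‖ ^ 2 = ‖s g‖ ^ 2 := by
      have : inner ℂ (Star.star s (s g)) (Star.star s (s g)) = ((‖s g‖ ^ 2 : ℝ) : ℂ) := by
        nth_rewrite 2 [ContinuousLinearMap.star_eq_adjoint]
        rw [ContinuousLinearMap.adjoint_inner_right, hst, inner_self_eq_norm_sq_to_K]
        simp
      have h2 := congrArg RCLike.re this
      rw [inner_self_eq_norm_sq] at h2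
      exact h2.trans (Complex.ofReal_re _)
    rw [@norm_sub_sq ℂ, e1, e2, RCLike.re_to_complex, Complex.ofReal_re]
    ring
  have h1 : Tendsto (fun N => ‖s (ι N a)‖) atTop (𝓝 ‖a‖) := by
    rw [tendsto_iff_dist_tendsto_zero]
    refine squeeze_zero (fun _ => dist_nonneg) (fun N => ?_) (by simpa using (h a).norm)
    rw [Real.dist_eq, ← (ι N).norm_map a]
    exact abs_norm_sub_norm_le _ _
  have h2 : Tendsto (fun N => ι N a - Star.star s (s (ι N a))) atTop (𝓝 0) := by
    rw [tendsto_zero_iff_norm_tendsto_zero]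
    have h3 : Tendsto (fun N => ‖ι N a - Star.star s (s (ι N a))‖ ^ 2) atTop (𝓝 0) := by
      have := (h1.pow 2).const_sub (‖a‖ ^ 2)
      rw [sub_self] at this
      refine this.congr fun N => ?_
      rw [hP, (ι N).norm_map]
    have := h3.sqrt
    simpa using this
  have h3 := ((Star.star s).continuous.tendsto 0).comp (h a)
  rw [map_zero] at h3
  have := (h3.add h2).neg
  rw [add_zero, neg_zero] at this
  refine this.congr fun N => ?_
  simp only [Function.comp, map_sub, star_one, ContinuousLinearMap.one_apply]
  abel

end symbol

/-! ### Almost invariant vectors on large boxes. -/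

section boxes
variable {k : ℕ} {E : Type} [NormedAddCommGroup E] [InnerProductSpace ℂ E]

/-- The multi-indices with entries at most `N`. -/
def box (k N : ℕ) : Finset (Fin k → ℕ) := Fintype.piFinset fun _ => Finset.range (N + 1)

theorem card_box (k N : ℕ) : (box k N).card = (N + 1) ^ k := by
  simp [box, Fintype.card_piFinset]

theorem hasSum_box (s : Finset (Fin k → ℕ)) (N : ℕ) (h : E) :
    HasSum (fun α => ‖if α ∈ s then (((√((N + 1) ^ k))⁻¹ : ℝ) : ℂ) • h else 0‖ ^ 2)
      (s.card * (((N : ℝ) + 1) ^ k)⁻¹ * ‖h‖ ^ 2) := by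
  have h1 : ((√((N + 1) ^ k))⁻¹ : ℝ) ^ 2 = (((N : ℝ) + 1) ^ k)⁻¹ := by
    rw [inv_pow, Real.sq_sqrt (by positivity)]
  have h2 : ∑ α ∈ s, ‖if α ∈ s then (((√((N + 1) ^ k))⁻¹ : ℝ) : ℂ) • h else 0‖ ^ 2 =
      s.card * (((N : ℝ) + 1) ^ k)⁻¹ * ‖h‖ ^ 2 := by
    rw [Finset.sum_congr rfl fun α hα => by rw [if_pos hα], Finset.sum_const, norm_smul, mul_pow,
      Complex.norm_real, Real.norm_eq_abs, sq_abs, h1, nsmul_eq_mul, mul_assoc]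
  rw [← h2]
  refine hasSum_sum_of_ne_finset_zero fun α hα => ?_
  rw [if_neg hα, norm_zero]
  norm_num

theorem hasSum_box' (N : ℕ) (h : E) :
    HasSum (fun α => ‖if α ∈ box k N then (((√((N + 1) ^ k))⁻¹ : ℝ) : ℂ) • h else 0‖ ^ 2)
      (‖h‖ ^ 2) := by
  have := hasSum_box (box k N) N h
  rw [card_box] at this
  rwa [Nat.cast_pow, Nat.cast_succ, mul_inv_cancel₀ (by positivity), one_mul] at this

/-- The normalized constant functions on the boxes. -/
noncomputable def boxIso (k : ℕ) (E : Type) [NormedAddCommGroup E] [InnerProductSpace ℂ E]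
    (N : ℕ) : E →ₗᵢ[ℂ] L2 (Fin k → ℕ) E where
  toLinearMap := (L2.op (I := Fin k → ℕ) (E := E) (V := E)
    { toFun := fun h α => if α ∈ box k N then (((√((N + 1) ^ k))⁻¹ : ℝ) : ℂ) • h else 0
      map_add' := fun a b => by
        funext α
        simp only [Pi.add_apply]
        split_ifs <;> simp
      map_smul' := fun c a => by
        funext α
        simp only [Pi.smul_apply, RingHom.id_apply]
        split_ifs
        · rw [smul_comm]
        · simp } 1 zero_le_one fun v => by
      have := hasSum_box' (k := k) N v
      exact ⟨this.summable, by rw [one_mul]; exact this.tsum_eq.le⟩).toLinearMap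
  norm_map' h := by
    refine (sq_eq_sq₀ (norm_nonneg _) (norm_nonneg _)).1 ?_
    rw [← (L2.hasSum_sq _).tsum_eq]
    exact (hasSum_box' (k := k) N h).tsum_eq

theorem boxIso_apply (N : ℕ) (h : E) (α : Fin k → ℕ) : boxIso k E N h α =
    if α ∈ box k N then (((√((N + 1) ^ k))⁻¹ : ℝ) : ℂ) • h else 0 := rfl

variable [CompleteSpace E]

theorem sym_amp (Y : E →L[ℂ] E) : Sym (boxIso k E) (amp (Fin k → ℕ) E Y) Y := by
  have key : ∀ (Y : E →L[ℂ] E) (N : ℕ) (h : E),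
      amp (Fin k → ℕ) E Y (boxIso k E N h) = boxIso k E N (Y h) := fun Y N h => by
    ext α
    rw [amp_apply, boxIso_apply, boxIso_apply]
    split_ifs <;> simp
  constructor
  · intro h
    simp [key]
  · intro h
    rw [← map_star]
    simp [key]

/-- The boxes form a Følner sequence: a shift in the direction `r` alters the normalized constant
only on one face, which is the fraction `1 / (N + 1)` of the box. -/
theorem sym_legS (r : Fin k) : Sym (boxIso k E) (legS E r) 1 := by
  refine Sym.of_coisometry (legS_mul_star r) fun h => ?_
  rw [tendsto_zero_iff_norm_tendsto_zero]
  set face : ℕ → Finset (Fin k → ℕ) := fun N =>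
    Fintype.piFinset fun i => if i = r then {N} else Finset.range (N + 1) with hface
  have hcard : ∀ N, ((face N).card : ℝ) * (((N : ℝ) + 1) ^ k)⁻¹ = ((N : ℝ) + 1)⁻¹ := fun N => by
    have h1 : (face N).card * (N + 1) = (N + 1) ^ k := by
      rw [hface, Fintype.card_piFinset]
      have e1 : ∀ i : Fin k, (if i = r then ({N} : Finset ℕ) else Finset.range (N + 1)).card =
          if i = r then 1 else N + 1 := fun i => by split_ifs <;> simp
      have e2 : ∏ i : Fin k, (if i = r then N + 1 else 1) = N + 1 := by simp
      have e3 : ∏ i : Fin k, (N + 1) = (N + 1) ^ k := by simp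
      simp only [e1]
      conv_lhs => rw [← e2]
      rw [← Finset.prod_mul_distrib, ← e3]
      refine Finset.prod_congr rfl fun i _ => ?_
      split_ifs <;> simp
    have h2 : ((face N).card : ℝ) * ((N : ℝ) + 1) = ((N : ℝ) + 1) ^ k := by exact_mod_cast h1
    have h3 : ((N : ℝ) + 1) ≠ 0 := by positivity
    have h4 : ((N : ℝ) + 1) ^ k ≠ 0 := by positivity
    rw [← div_eq_mul_inv, div_eq_iff h4, ← h2]
    field_simp
  have hsq : ∀ N, ‖legS E r (boxIso k E N h) - boxIso k E N h‖ ^ 2 = ((N : ℝ) + 1)⁻¹ * ‖h‖ ^ 2 :=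
    fun N => by
      rw [← (L2.hasSum_sq _).tsum_eq, ← hcard N, ← (hasSum_box (face N) N h).tsum_eq]
      congr 1
      funext α
      have e : (legS E r (boxIso k E N h) - boxIso k E N h) α =
          boxIso k E N h (up r α) - boxIso k E N h α := rfl
      rw [e, boxIso_apply, boxIso_apply]
      by_cases hα : α ∈ box k N
      · by_cases hr : α r = N
        · have h1 : up r α ∉ box k N := fun hh => by
            have := Fintype.mem_piFinset.1 hh r
            simp [up, hr] at this
          have h2 : α ∈ face N := Fintype.mem_piFinset.2 fun i => by
            split_ifs with hi
            · subst hi; simp [hr]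
            · exact Fintype.mem_piFinset.1 hα i
          rw [if_neg h1, if_pos hα, if_pos h2, zero_sub, norm_neg]
        · have h1 : up r α ∈ box k N := Fintype.mem_piFinset.2 fun i => by
            have := Fintype.mem_piFinset.1 hα i
            rw [Finset.mem_range] at this ⊢
            by_cases hi : i = r
            · subst hi; simp only [up, Function.update_self]; omega
            · simpa [up, hi] using this
          have h2 : α ∉ face N := fun hh => hr (by
            have := Fintype.mem_piFinset.1 hh r
            simpa using this)
          rw [if_pos h1, if_pos hα, if_neg h2, sub_self]
      · have h1 : up r α ∉ box k N := fun hh => hα (Fintype.mem_piFinset.2 fun i => by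
          have := Fintype.mem_piFinset.1 hh i
          rw [Finset.mem_range] at this ⊢
          by_cases hi : i = r
          · subst hi; simp only [up, Function.update_self] at this; omega
          · simpa [up, hi] using this)
        have h2 : α ∉ face N := fun hh => hα (Fintype.mem_piFinset.2 fun i => by
          have := Fintype.mem_piFinset.1 hh i
          split_ifs at this with hi
          · rw [Finset.mem_singleton] at this
            rw [this]; simp
          · exact this)
        rw [if_neg h1, if_neg hα, if_neg h2, sub_zero]
  have h1 : Tendsto (fun N : ℕ => ((N : ℝ) + 1)⁻¹ * ‖h‖ ^ 2) atTop (𝓝 0) := by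
    have := tendsto_one_div_add_atTop_nhds_zero_nat (𝕜 := ℝ)
    simpa using this.mul_const (‖h‖ ^ 2)
  have h2 := (h1.congr fun N => (hsq N).symm).sqrt
  simpa using h2

end boxes

/-! ### Decomposition of Wold type for a tower of operators. -/

section tower
variable {H : Type} [NormedAddCommGroup H] [InnerProductSpace ℂ H] [CompleteSpace H]

/-- The powers of `x` tend to zero strongly. -/
def Nil (x : H →L[ℂ] H) : Prop := ∀ h, Tendsto (fun a : ℕ => (x ^ a) h) atTop (𝓝 0)

/-- The common kernel of the operators `star (X l)`, `j ≤ l < k`. -/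
def vac (k : ℕ) (X : ℕ → H →L[ℂ] H) (j : ℕ) : Submodule ℂ H where
  carrier := {h | ∀ l, j ≤ l → l < k → star (X l) h = 0}
  add_mem' := fun ha hb l h1 h2 => by rw [map_add, ha l h1 h2, hb l h1 h2, add_zero]
  zero_mem' := fun l _ _ => map_zero _
  smul_mem' := fun c a ha l h1 h2 => by rw [map_smul, ha l h1 h2, smul_zero]

theorem mem_vac {k : ℕ} {X : ℕ → H →L[ℂ] H} {j : ℕ} {h : H} :
    h ∈ vac k X j ↔ ∀ l, j ≤ l → l < k → star (X l) h = 0 := Iff.rfl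

theorem isClosed_vac (k : ℕ) (X : ℕ → H →L[ℂ] H) (j : ℕ) : IsClosed (vac k X j : Set H) := by
  have : (vac k X j : Set H) = ⋂ l, ⋂ (_ : j ≤ l), ⋂ (_ : l < k), {h | star (X l) h = 0} := by
    ext h
    simp [mem_vac]
  rw [this]
  exact isClosed_iInter fun l => isClosed_iInter fun _ => isClosed_iInter fun _ =>
    isClosed_eq (star (X l)).continuous continuous_const

instance (k : ℕ) (X : ℕ → H →L[ℂ] H) (j : ℕ) : CompleteSpace (vac k X j) :=
  (isClosed_vac k X j).completeSpace_coe

/-- A system of operators which builds the space from the common kernel `vac k X 0` of the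
operators `star (X l)`, together with an operator `v` which is unitary on this kernel. -/
structure Tower (k : ℕ) (X : ℕ → H →L[ℂ] H) (v : H →L[ℂ] H) : Prop where
  iso : ∀ j < k, ∀ g ∈ vac k X (j + 1), star (X j) (X j g) = g
  low : ∀ j l, j < l → l < k → ∀ g ∈ vac k X (j + 1), star (X l) (X j g) = 0
  low_star : ∀ j l, j < l → l < k → ∀ g ∈ vac k X (j + 1), star (X l) (star (X j) g) = 0
  nil : ∀ j < k, Nil (star (X j))
  twist : ∀ g ∈ vac k X 0, v g ∈ vac k X 0
  twist_star : ∀ g ∈ vac k X 0, star v g ∈ vac k X 0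
  twist_iso : ∀ g ∈ vac k X 0, star v (v g) = g
  twist_coiso : ∀ g ∈ vac k X 0, v (star v g) = g

/-- The ordered monomial `X (m - 1) ^ α (m - 1) * ⋯ * X 0 ^ α 0`. -/
def mon (X : ℕ → H →L[ℂ] H) (α : ℕ → ℕ) : ℕ → H →L[ℂ] H
  | 0 => 1
  | m + 1 => X m ^ α m * mon X α m

theorem mon_congr {X : ℕ → H →L[ℂ] H} {α β : ℕ → ℕ} {m : ℕ} (h : ∀ i < m, α i = β i) :
    mon X α m = mon X β m := by
  induction m with
  | zero => rfl
  | succ m ih => rw [mon, mon, ih fun i hi => h i (by omega), h m (by omega)]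

theorem inner_pow_left (X : H →L[ℂ] H) (a : ℕ) (g h : H) :
    inner ℂ ((X ^ a) g) h = inner ℂ g ((star X ^ a) h) := by
  rw [← star_pow, ContinuousLinearMap.star_eq_adjoint, ContinuousLinearMap.adjoint_inner_right]

variable {k : ℕ} {X : ℕ → H →L[ℂ] H} {v : H →L[ℂ] H}

theorem vac_mono {i j : ℕ} (h : i ≤ j) {g : H} (hg : g ∈ vac k X i) : g ∈ vac k X j :=
  fun l h1 h2 => hg l (h.trans h1) h2

theorem Tower.map_mem (hT : Tower k X v) {j : ℕ} (hj : j < k) {g : H} (hg : g ∈ vac k X (j + 1)) :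
    X j g ∈ vac k X (j + 1) := fun l h1 h2 => hT.low j l h1 h2 g hg

theorem Tower.star_map_mem (hT : Tower k X v) {j : ℕ} {g : H}
    (hg : g ∈ vac k X (j + 1)) : star (X j) g ∈ vac k X (j + 1) :=
  fun l h1 h2 => hT.low_star j l h1 h2 g hg

theorem Tower.pow_mem (hT : Tower k X v) {j : ℕ} (hj : j < k) {g : H}
    (hg : g ∈ vac k X (j + 1)) (a : ℕ) : (X j ^ a) g ∈ vac k X (j + 1) := by
  induction a with
  | zero => exact hg
  | succ a ih => rw [pow_succ', ContinuousLinearMap.mul_apply]; exact hT.map_mem hj ih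

theorem Tower.star_pow_mem (hT : Tower k X v) {j : ℕ} {g : H}
    (hg : g ∈ vac k X (j + 1)) (a : ℕ) : (star (X j) ^ a) g ∈ vac k X (j + 1) := by
  induction a with
  | zero => exact hg
  | succ a ih => rw [pow_succ', ContinuousLinearMap.mul_apply]; exact hT.star_map_mem ih

theorem Tower.star_pow_pow (hT : Tower k X v) {j : ℕ} (hj : j < k) {g : H}
    (hg : g ∈ vac k X (j + 1)) (a : ℕ) : (star (X j) ^ a) ((X j ^ a) g) = g := by
  induction a with
  | zero => rfl
  | succ a ih =>
    rw [pow_succ, pow_succ', ContinuousLinearMap.mul_apply, ContinuousLinearMap.mul_apply,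
      hT.iso j hj _ (hT.pow_mem hj hg a), ih]

/-- On `vac k X (j + 1)` the operator `X j` is an isometry, and `vac k X j` is the kernel of its
adjoint there, hence a wandering subspace. -/
theorem Tower.inner_pow (hT : Tower k X v) {j : ℕ} (hj : j < k) {g g' : H}
    (hg : g ∈ vac k X j) (hg' : g' ∈ vac k X j) (a b : ℕ) :
    inner ℂ ((X j ^ a) g) ((X j ^ b) g') = if a = b then inner ℂ g g' else 0 := by
  have key : ∀ {g g' : H} (_ : g ∈ vac k X j) (_ : g' ∈ vac k X j) (a c : ℕ),
      inner ℂ ((X j ^ a) g) ((X j ^ (a + (c + 1))) g') = 0 := fun {g g'} hg hg' a c => by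
    have hg'' := vac_mono (Nat.le_succ j) hg'
    rw [inner_pow_left, pow_add, ContinuousLinearMap.mul_apply,
      hT.star_pow_pow hj (hT.pow_mem hj hg'' _), ← inner_conj_symm, inner_pow_left, pow_succ,
      ContinuousLinearMap.mul_apply, hg j le_rfl hj, map_zero, inner_zero_right, map_zero]
  rcases lt_trichotomy a b with h | h | h
  · obtain ⟨c, rfl⟩ := Nat.exists_eq_add_of_lt h
    rw [if_neg h.ne]
    exact key hg hg' a c
  · subst h
    rw [if_pos rfl, inner_pow_left, hT.star_pow_pow hj (vac_mono (Nat.le_succ j) hg')]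
  · obtain ⟨c, rfl⟩ := Nat.exists_eq_add_of_lt h
    rw [if_neg h.ne', ← inner_conj_symm]
    have := key hg' hg b c
    rw [← add_assoc] at this
    rw [this, map_zero]

theorem Tower.mon_mem (hT : Tower k X v) {g : H} (hg : g ∈ vac k X 0) (α : ℕ → ℕ) {m : ℕ}
    (hm : m ≤ k) : mon X α m g ∈ vac k X m := by
  induction m with
  | zero => exact hg
  | succ m ih =>
    rw [mon, ContinuousLinearMap.mul_apply]
    exact hT.pow_mem (by omega) (vac_mono (Nat.le_succ m) (ih (by omega))) _

theorem Tower.inner_mon (hT : Tower k X v) {g g' : H} (hg : g ∈ vac k X 0)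
    (hg' : g' ∈ vac k X 0) (α β : ℕ → ℕ) {m : ℕ} (hm : m ≤ k) :
    inner ℂ (mon X α m g) (mon X β m g') =
      if ∀ i < m, α i = β i then inner ℂ g g' else 0 := by
  induction m with
  | zero => simp [mon]
  | succ m ih =>
    rw [mon, mon, ContinuousLinearMap.mul_apply, ContinuousLinearMap.mul_apply,
      hT.inner_pow (by omega) (hT.mon_mem hg α (by omega)) (hT.mon_mem hg' β (by omega)),
      ih (by omega), ← ite_and]
    congr 1
    rw [Nat.forall_lt_succ_right, and_comm]

/-- Induction on the level. For `f` orthogonal to all monomials, the difference of `(star X)^a f`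
and `X (star X)^{a+1} f`, with `X = X m`, lies one level lower and is orthogonal to the monomials of
that level, so it vanishes. Then the norms of `(star X)^a f` do not depend on `a`, and `nil` forces
`f = 0`. -/
theorem Tower.total (hT : Tower k X v) {m : ℕ} (hm : m ≤ k) {f : H} (hf : f ∈ vac k X m)
    (h : ∀ α, ∀ g ∈ vac k X 0, inner ℂ (mon X α m g) f = 0) : f = 0 := by
  induction m generalizing f with
  | zero =>
    have := h 0 f hf
    exact inner_self_eq_zero.1 this
  | succ m ih =>
    have hmk : m < k := by omega
    have key : ∀ a, (star (X m) ^ a) f = X m ((star (X m) ^ (a + 1)) f) := by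
      intro a
      rw [← sub_eq_zero]
      have hfa := hT.star_pow_mem hf a
      have hfa' := hT.star_pow_mem hf (a + 1)
      refine ih (by omega) (fun l h1 h2 => ?_) fun α g hg => ?_
      · rcases Nat.eq_or_lt_of_le h1 with rfl | h1
        · rw [map_sub, hT.iso m hmk _ hfa', pow_succ', ContinuousLinearMap.mul_apply, sub_self]
        · exact ((vac k X (m + 1)).sub_mem hfa (hT.map_mem hmk hfa')) l h1 h2
      · have h0 := hT.mon_mem hg α hmk.le m le_rfl hmk
        have h1 : inner ℂ (mon X α m g) (X m ((star (X m) ^ (a + 1)) f)) = 0 := by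
          rw [← ContinuousLinearMap.adjoint_inner_left, ← ContinuousLinearMap.star_eq_adjoint, h0,
            inner_zero_left]
        have h2 := h (Function.update α m a) g hg
        rw [mon, Function.update_self, mon_congr (β := α) fun i hi => by
          rw [Function.update_of_ne (by omega)], ContinuousLinearMap.mul_apply,
          inner_pow_left] at h2
        rw [inner_sub_right, h1, h2, sub_zero]
    have hnorm : ∀ a, ‖(star (X m) ^ a) f‖ = ‖f‖ := by
      intro a
      induction a with
      | zero => rfl
      | succ a iha =>
        rw [← iha, key a]
        have hg := hT.star_pow_mem hf (a + 1)
        have e : inner ℂ (X m ((star (X m) ^ (a + 1)) f)) (X m ((star (X m) ^ (a + 1)) f)) =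
            inner ℂ ((star (X m) ^ (a + 1)) f) ((star (X m) ^ (a + 1)) f) := by
          rw [← ContinuousLinearMap.adjoint_inner_right, ← ContinuousLinearMap.star_eq_adjoint,
            hT.iso m hmk _ hg]
        have e2 := congrArg RCLike.re e
        rw [inner_self_eq_norm_sq, inner_self_eq_norm_sq] at e2
        exact ((sq_eq_sq₀ (norm_nonneg _) (norm_nonneg _)).1 e2).symm
    have := (hT.nil m hmk f).norm
    simp only [hnorm, norm_zero] at this
    exact norm_eq_zero.1 (tendsto_nhds_unique tendsto_const_nhds this)

theorem Tower.pow_twist_mem (hT : Tower k X v) {g : H} (hg : g ∈ vac k X 0) (a : ℕ) :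
    (v ^ a) g ∈ vac k X 0 := by
  induction a with
  | zero => exact hg
  | succ a ih => rw [pow_succ', ContinuousLinearMap.mul_apply]; exact hT.twist _ ih

theorem Tower.star_pow_twist (hT : Tower k X v) {g : H} (hg : g ∈ vac k X 0) (a : ℕ) :
    (star v ^ a) ((v ^ a) g) = g := by
  induction a with
  | zero => rfl
  | succ a ih =>
    rw [pow_succ, pow_succ', ContinuousLinearMap.mul_apply, ContinuousLinearMap.mul_apply,
      hT.twist_iso _ (hT.pow_twist_mem hg a), ih]

theorem Tower.exists_pow_twist (hT : Tower k X v) {g : H} (hg : g ∈ vac k X 0) (a : ℕ) :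
    ∃ g' ∈ vac k X 0, (v ^ a) g' = g := by
  induction a generalizing g with
  | zero => exact ⟨g, hg, rfl⟩
  | succ a ih =>
    obtain ⟨g', hg', e⟩ := ih (hT.twist_star g hg)
    exact ⟨g', hg', by rw [pow_succ', ContinuousLinearMap.mul_apply, e, hT.twist_coiso g hg]⟩

/-- Extend a multi-index by zero. -/
def extN (α : Fin k → ℕ) (i : ℕ) : ℕ := if h : i < k then α ⟨i, h⟩ else 0

theorem extN_val (α : Fin k → ℕ) (i : Fin k) : extN α i = α i := dif_pos i.2

/-- The degree of a multi-index. -/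
def deg (α : Fin k → ℕ) : ℕ := ∑ i, α i

/-- The embedding of the common kernel as the summand of the multi-index `α`. -/
noncomputable def Tower.emb (hT : Tower k X v) (α : Fin k → ℕ) : vac k X 0 →ₗᵢ[ℂ] H where
  -- The factor `v ^ deg α` makes the summands compatible. In the application `v` is the adjoint of
  -- `z k 0`, and entries which change the degree then act by one and the same operator of the
  -- kernel for all `α`.
  toLinearMap := ((mon X (extN α) k * v ^ deg α).comp (vac k X 0).subtypeL).toLinearMap
  norm_map' h := by
    change ‖mon X (extN α) k ((v ^ deg α) (h : H))‖ = ‖(h : H)‖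
    have e1 := hT.inner_mon (hT.pow_twist_mem h.2 (deg α)) (hT.pow_twist_mem h.2 (deg α))
      (extN α) (extN α) le_rfl
    rw [if_pos fun _ _ => rfl, inner_pow_left, hT.star_pow_twist h.2] at e1
    have e2 := congrArg RCLike.re e1
    rw [inner_self_eq_norm_sq, inner_self_eq_norm_sq] at e2
    exact (sq_eq_sq₀ (norm_nonneg _) (norm_nonneg _)).1 e2

theorem Tower.emb_apply (hT : Tower k X v) (α : Fin k → ℕ) (h : vac k X 0) :
    hT.emb α h = mon X (extN α) k ((v ^ deg α) (h : H)) := rfl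

/-- Orthogonality is `Tower.inner_mon`. Totality is `Tower.total`, since the powers of `v` map the
common kernel onto itself. -/
theorem Tower.isHilbertSum (hT : Tower k X v) :
    IsHilbertSum ℂ (fun _ : Fin k → ℕ => vac k X 0) hT.emb := by
  refine IsHilbertSum.mk (fun α β hαβ g g' => ?_) ?_
  · rw [hT.emb_apply, hT.emb_apply, hT.inner_mon (hT.pow_twist_mem g.2 _)
      (hT.pow_twist_mem g'.2 _) _ _ le_rfl, if_neg]
    intro h
    refine hαβ (funext fun i => ?_)
    have := h i i.2
    rwa [extN_val, extN_val] at this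
  · rw [top_le_iff, Submodule.topologicalClosure_eq_top_iff, Submodule.eq_bot_iff]
    intro f hf
    refine hT.total le_rfl (fun l h1 h2 => absurd h1 (by omega)) fun α g hg => ?_
    obtain ⟨g', hg', e⟩ := hT.exists_pow_twist hg (deg fun i : Fin k => α i)
    have : mon X α k g = hT.emb (fun i : Fin k => α i) ⟨g', hg'⟩ := by
      rw [hT.emb_apply, ← e]
      congr 1
      refine mon_congr fun i hi => ?_
      rw [extN, dif_pos hi]
    rw [this]
    exact (Submodule.mem_orthogonal _ _).1 hf _ (Submodule.mem_iSup_of_mem _ ⟨_, rfl⟩)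

/-- The identification of the space with `ℓ²(ℕ^k; vac k X 0)`. -/
noncomputable def Tower.equiv (hT : Tower k X v) : H ≃ₗᵢ[ℂ] L2 (Fin k → ℕ) (vac k X 0) :=
  hT.isHilbertSum.linearIsometryEquiv

theorem Tower.equiv_emb (hT : Tower k X v) (α : Fin k → ℕ) (h : vac k X 0) :
    hT.equiv (hT.emb α h) = L2.single α h := by
  have := hT.isHilbertSum.linearIsometryEquiv_symm_apply_single (i := α) h
  rw [Tower.equiv, ← this, LinearIsometryEquiv.apply_symm_apply]
  rfl

/-- Conjugation of operators by `Tower.equiv`. -/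
noncomputable def Tower.conj (hT : Tower k X v) :
    (H →L[ℂ] H) ≃⋆ₐ[ℂ] (L2 (Fin k → ℕ) (vac k X 0) →L[ℂ] L2 (Fin k → ℕ) (vac k X 0)) :=
  hT.equiv.conjStarAlgEquiv

theorem Tower.conj_single (hT : Tower k X v) (T : H →L[ℂ] H) (α : Fin k → ℕ) (h : vac k X 0) :
    hT.conj T (L2.single α h) = hT.equiv (T (hT.emb α h)) := by
  rw [Tower.conj, LinearIsometryEquiv.conjStarAlgEquiv_apply_apply, ← hT.equiv_emb,
    LinearIsometryEquiv.symm_apply_apply]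

/-- The compression of an operator to a closed subspace. -/
noncomputable def compr (K : Submodule ℂ H) [K.HasOrthogonalProjection] (T : H →L[ℂ] H) :
    K →L[ℂ] K := K.orthogonalProjection.comp (T.comp K.subtypeL)

theorem compr_apply (K : Submodule ℂ H) [K.HasOrthogonalProjection] {T : H →L[ℂ] H} {h : K}
    (hT : T h ∈ K) : (compr K T h : H) = T h := by
  change (K.orthogonalProjection (T h) : H) = T h
  exact Submodule.starProjection_eq_self_iff.2 hT

theorem mon_commute {Y : H →L[ℂ] H} {α : ℕ → ℕ} {m : ℕ} (h : ∀ l < m, Commute Y (X l)) :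
    Commute Y (mon X α m) := by
  induction m with
  | zero => exact Commute.one_right _
  | succ m ih => exact ((h m (by omega)).pow_right _).mul_right (ih fun l hl => h l (by omega))

/-- An operator which commutes with the system acts on the common kernel only. -/
theorem Tower.conj_eq_amp (hT : Tower k X v) {Y : H →L[ℂ] H} (h : ∀ l < k, Commute Y (X l))
    (hv : ∀ h ∈ vac k X 0, Y (v h) = v (Y h)) (hY : ∀ h ∈ vac k X 0, Y h ∈ vac k X 0) :
    hT.conj Y = amp (Fin k → ℕ) (vac k X 0) (compr (vac k X 0) Y) := by
  refine L2.ext_single fun α a => ?_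
  rw [hT.conj_single, amp_single, ← hT.equiv_emb]
  congr 1
  rw [hT.emb_apply, hT.emb_apply, compr_apply _ (hY a a.2)]
  have e : ∀ b, Y ((v ^ b) (a : H)) = (v ^ b) (Y a) := by
    intro b
    induction b with
    | zero => rfl
    | succ b ih =>
      rw [pow_succ', ContinuousLinearMap.mul_apply, ContinuousLinearMap.mul_apply, ← ih,
        hv _ (hT.pow_twist_mem a.2 b)]
  rw [← e]
  exact congrArg (fun T => T ((v ^ deg α) (a : H))) (mon_commute (α := extN α) h).eq

end tower

/-! ### Compatibility with homomorphisms. -/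

section maps
variable {B C F : Type*} [Ring B] [StarRing B] [Ring C] [StarRing C] [FunLike F B C]
  [RingHomClass F B C] [StarHomClass F B C] (φ : F)

theorem map_conv (x y : ℕ → ℕ → B) (i j : ℕ) :
    φ (conv x y i j) = conv (fun i j => φ (x i j)) (fun i j => φ (y i j)) i j := by
  simp only [conv, map_sum, map_mul]

theorem map_simpleArr (r : ℕ) (s : B) (i j : ℕ) :
    φ (simpleArr r s i j) = simpleArr r (φ s) i j := by
  simp only [simpleArr]
  split_ifs <;> simp [map_star]

theorem map_act (L : List (ℕ × B)) (y : ℕ → ℕ → B) (i j : ℕ) :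
    φ (act L y i j) = act (L.map fun p => (p.1, φ p.2)) (fun i j => φ (y i j)) i j := by
  induction L generalizing i j with
  | nil => rfl
  | cons p L ih =>
    rw [act_cons, map_conv, List.map_cons, act_cons]
    simp only [map_simpleArr, ih]

theorem map_idArr (i j : ℕ) : φ (idArr i j) = idArr i j := by
  simp only [idArr]
  split_ifs <;> simp

theorem map_wordArr (L : List (ℕ × B)) (i j : ℕ) :
    φ (wordArr L i j) = wordArr (L.map fun p => (p.1, φ p.2)) i j := by
  rw [wordArr, map_act]
  simp only [map_idArr]
  rfl

theorem CRel.map {n : ℕ} {y : ℕ → ℕ → B} (hy : CRel n y) : CRel n fun i j => φ (y i j) where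
  row_zero i j l h1 h2 h3 := by rw [← map_mul, hy.row_zero i j l h1 h2 h3, map_zero]
  col_zero i k j h1 h2 h3 := by rw [← map_mul, hy.col_zero i k j h1 h2 h3, map_zero]
  anti_comm i k j l h1 h2 h3 h4 := by
    rw [← map_mul, ← map_mul, hy.anti_comm i k j l h1 h2 h3 h4]
  anti_zero i k j l h1 h2 h3 h4 h5 := by
    rw [← map_mul, hy.anti_zero i k j l h1 h2 h3 h4 h5, map_zero]
  diag_cross i k j l h1 h2 h3 h4 h5 := by
    rw [← map_mul, ← map_mul, ← map_mul, ← map_sub, hy.diag_cross i k j l h1 h2 h3 h4 h5]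
  diag_comm i k j l h1 h2 h3 h4 h5 := by
    rw [← map_mul, ← map_mul, hy.diag_comm i k j l h1 h2 h3 h4 h5]
  det_one := by rw [← map_oprod φ, hy.det_one, map_one]
  star_eq r s hr hs := by rw [← map_star, hy.star_eq r s hr hs, map_oprod φ]

theorem DC.map {a b : B} (h : DC a b) : DC (φ a) (φ b) := by
  refine ⟨h.1.map φ, ?_⟩
  rw [← map_star]
  exact h.2.map φ

end maps

/-! ### The array of a descending block of letters. -/

section block
variable {B : Type*} [Ring B] [StarRing B]

/-- The letters `k - 1, …, 0` with the coisometries `s (k - 1), …, s 0`. -/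
def blockLegs (s : ℕ → B) : ℕ → List (ℕ × B)
  | 0 => []
  | k + 1 => (k, s k) :: blockLegs s k

/-- The array of the word `k - 1, …, 0` with the coisometries `s (k - 1), …, s 0`. -/
def blockArr (s : ℕ → B) (k : ℕ) : ℕ → ℕ → B := act (blockLegs s k) idArr

variable (s : ℕ → B)

theorem mem_blockLegs {k : ℕ} {p : ℕ × B} : p ∈ blockLegs s k ↔ p.1 < k ∧ p.2 = s p.1 := by
  induction k with
  | zero => simp [blockLegs]
  | succ k ih =>
    rw [blockLegs, List.mem_cons, ih]
    constructor
    · rintro (rfl | ⟨h1, h2⟩)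
      · exact ⟨Nat.lt_succ_self _, rfl⟩
      · exact ⟨by omega, h2⟩
    · rintro ⟨h1, h2⟩
      by_cases h : p.1 = k
      · left
        exact Prod.ext h (by rw [h2, h])
      · right
        exact ⟨by omega, h2⟩

theorem blockLegs_map (k : ℕ) : (blockLegs s k).map Prod.fst = (List.range k).reverse := by
  induction k with
  | zero => rfl
  | succ k ih => rw [blockLegs, List.map_cons, ih, List.range_succ]; simp

theorem blockLegs_legList {n k : ℕ} (hk : k ≤ n) (h1 : ∀ r < k, s r * star (s r) = 1)
    (h2 : ∀ r < k, ∀ r' < k, r ≠ r' → DC (s r) (s r')) : LegList n (blockLegs s k) where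
  lt p hp := by
    have := ((mem_blockLegs s).1 hp).1
    omega
  coisom p hp := by
    obtain ⟨h, e⟩ := (mem_blockLegs s).1 hp
    rw [e]
    exact h1 _ h
  pairwise := by
    induction k with
    | zero => exact List.Pairwise.nil
    | succ k ih =>
      refine List.Pairwise.cons (fun p hp => ?_) (ih (by omega) (fun r hr => h1 r (by omega))
        fun r hr r' hr' => h2 r (by omega) r' (by omega))
      obtain ⟨h, e⟩ := (mem_blockLegs s).1 hp
      rw [e]
      exact h2 k (by omega) _ (by omega) (by omega)

theorem blockArr_succ (k : ℕ) : blockArr s (k + 1) =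
    lmul k (s k) (star (s k)) (1 - star (s k) * s k) (blockArr s k) := conv_simple_eq _ _ _

theorem blockArr_of_gt {k i : ℕ} (h : k < i) (j : ℕ) : blockArr s k i j = idArr i j := by
  induction k with
  | zero => rfl
  | succ k ih => rw [blockArr_succ, lmul_of_ne (by omega) (by omega), ih (by omega)]

/-- When the letter `k` acts, row `k + 1` is still a row of the identity. So at most one
superdiagonal is created. -/
theorem blockArr_upper {k i j : ℕ} (h : i + 1 < j) : blockArr s k i j = 0 := by
  induction k generalizing i with
  | zero => exact if_neg (by omega)
  | succ k ih =>
    rw [blockArr_succ]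
    rcases lt_trichotomy i k with h1 | h1 | h1
    · rw [lmul_of_ne (by omega) (by omega), ih h]
    · subst h1
      have h2 : i + 1 ≠ j := by omega
      rw [lmul, if_pos rfl, ih h, blockArr_of_gt _ (Nat.lt_succ_self i), idArr, if_neg h2]
      simp
    · rcases Nat.eq_or_lt_of_le h1 with h2 | h2
      · subst h2
        rw [lmul, if_neg (by omega), if_pos rfl, if_neg (by omega), ih h, mul_zero, add_zero]
      · rw [lmul_of_ne (by omega) (by omega), ih h]

theorem blockArr_last (k j : ℕ) (hj : j ≤ k) : blockArr s (k + 1) (k + 1) j =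
    (1 - star (s k) * s k) * blockArr s k k j := by
  have h : k + 1 ≠ j := by omega
  rw [blockArr_succ, lmul, if_neg (by omega : ¬ k + 1 = k), if_pos rfl, if_pos hj,
    blockArr_of_gt _ (Nat.lt_succ_self k), idArr, if_neg h, mul_zero, zero_add]

theorem blockArr_last_self (k : ℕ) : blockArr s (k + 1) (k + 1) (k + 1) = star (s k) := by
  rw [blockArr_succ, lmul, if_neg (by omega : ¬ k + 1 = k), if_pos rfl,
    if_neg (by omega : ¬ k + 1 ≤ k), blockArr_of_gt _ (Nat.lt_succ_self k), idArr, if_pos rfl,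
    mul_one, add_zero]

theorem blockArr_super (k j : ℕ) : blockArr s k j (j + 1) =
    if j < k then 1 - star (s j) * s j else 0 := by
  induction k with
  | zero => exact if_neg (by omega)
  | succ k ih =>
    rcases lt_trichotomy j k with h | h | h
    · rw [blockArr_succ, lmul_of_ne (by omega) (by omega), ih, if_pos h, if_pos (by omega)]
    · subst h
      rw [blockArr_succ, lmul, if_pos rfl, ih, if_neg (by omega), if_pos (by omega),
        if_pos (by omega), blockArr_of_gt _ (by omega), idArr, if_pos rfl, mul_zero, zero_add,
        mul_one]
    · rw [if_neg (by omega)]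
      rw [if_neg (by omega)] at ih
      rw [blockArr_succ]
      rcases Nat.eq_or_lt_of_le h with h2 | h2
      · subst h2
        rw [lmul, if_neg (by omega), if_pos rfl, if_neg (by omega), ih, mul_zero, add_zero]
      · rw [lmul_of_ne (by omega) (by omega), ih]

theorem blockArr_diag_zero (k : ℕ) : blockArr s k 0 0 = if 0 < k then s 0 else 1 := by
  induction k with
  | zero => rfl
  | succ k ih =>
    rcases Nat.eq_zero_or_pos k with h | h
    · subst h
      rw [blockArr_succ, lmul, if_pos rfl, ih, if_neg (lt_irrefl 0), if_neg (lt_irrefl 0),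
        if_pos Nat.one_pos, mul_one, add_zero]
    · rw [blockArr_succ, lmul_of_ne (by omega) (by omega), ih, if_pos h, if_pos (by omega)]

theorem blockArr_diag_succ (k j : ℕ) : blockArr s k (j + 1) (j + 1) =
    (if j + 1 < k then s (j + 1) else 1) * (if j < k then star (s j) else 1) := by
  induction k with
  | zero => simp [blockArr, blockLegs, act_nil, idArr]
  | succ k ih =>
    rcases lt_trichotomy (j + 1) k with h | h | h
    · rw [blockArr_succ, lmul_of_ne (by omega) (by omega), ih, if_pos h, if_pos (by omega),
        if_pos (by omega), if_pos (by omega)]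
    · subst h
      rw [blockArr_succ, lmul, if_pos rfl, ih, if_neg (lt_irrefl (j + 1)),
        if_neg (lt_irrefl (j + 1)), if_pos (Nat.lt_succ_self _), if_pos (Nat.lt_succ_self _),
        if_pos (by omega), one_mul, add_zero]
    · by_cases h' : j = k
      · subst h'
        rw [blockArr_last_self, if_neg (by omega), if_pos (by omega), one_mul]
      · rw [blockArr_of_gt _ (by omega), idArr, if_pos rfl, if_neg (by omega), if_neg (by omega),
          one_mul]

/-- Left convolution with the array of a block leaves the rows below the block unchanged. -/
theorem act_blockLegs_of_gt {k i : ℕ} (h : k < i) (y : ℕ → ℕ → B) (j : ℕ) :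
    act (blockLegs s k) y i j = y i j := by
  induction k with
  | zero => rfl
  | succ k ih =>
    rw [blockLegs, act_cons, conv_simple_eq, lmul_of_ne (by simp; omega) (by simp; omega),
      ih (by omega)]

end block

/-! ### Strong convergence of powers to zero. -/

section nil
variable {H : Type} [NormedAddCommGroup H] [InnerProductSpace ℂ H] [CompleteSpace H]

theorem norm_pow_apply_le {x : H →L[ℂ] H} (hx : ‖x‖ ≤ 1) (a : ℕ) (h : H) : ‖(x ^ a) h‖ ≤ ‖h‖ := by
  induction a with
  | zero => rfl
  | succ a ih =>
    rw [pow_succ', ContinuousLinearMap.mul_apply]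
    refine (x.le_opNorm _).trans ?_
    nlinarith [norm_nonneg ((x ^ a) h), norm_nonneg x]

/-- Strong convergence of the powers to zero can be checked on a total set. -/
theorem Nil.of_total {x : H →L[ℂ] H} (hx : ‖x‖ ≤ 1) {S : Set H}
    (hS : (Submodule.span ℂ S).topologicalClosure = ⊤)
    (h : ∀ g ∈ S, Tendsto (fun a : ℕ => (x ^ a) g) atTop (𝓝 0)) : Nil x := by
  have hspan : ∀ g ∈ Submodule.span ℂ S, Tendsto (fun a : ℕ => (x ^ a) g) atTop (𝓝 0) := by
    intro g hg
    induction hg using Submodule.span_induction with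
    | mem g hg => exact h g hg
    | zero => simp
    | add g g' _ _ h1 h2 => simpa using h1.add h2
    | smul c g _ h1 => simpa using h1.const_smul c
  intro f
  have hf : f ∈ closure (Submodule.span ℂ S : Set H) := by
    have : f ∈ (Submodule.span ℂ S).topologicalClosure := by rw [hS]; trivial
    exact this
  rw [Metric.tendsto_atTop]
  intro ε hε
  obtain ⟨g, hg, hfg⟩ := Metric.mem_closure_iff.1 hf (ε / 2) (by positivity)
  obtain ⟨N, hN⟩ := Metric.tendsto_atTop.1 (hspan g hg) (ε / 2) (by positivity)
  refine ⟨N, fun a ha => ?_⟩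
  have h1 := hN a ha
  rw [dist_zero_right] at h1 ⊢
  have h2 : (x ^ a) f = (x ^ a) (f - g) + (x ^ a) g := by rw [map_sub]; abel
  rw [h2]
  have h3 := norm_pow_apply_le hx a (f - g)
  rw [dist_eq_norm] at hfg
  have := norm_add_le ((x ^ a) (f - g)) ((x ^ a) g)
  linarith

theorem norm_le_one_of_coisometry {s : H →L[ℂ] H} (hs : s * star s = 1) : ‖s‖ ≤ 1 := by
  have h1 : ‖s * star s‖ = ‖s‖ * ‖s‖ := CStarRing.norm_self_mul_star
  rw [hs] at h1
  have h2 : ‖(1 : H →L[ℂ] H)‖ ≤ 1 := ContinuousLinearMap.norm_id_le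
  nlinarith [norm_nonneg s]

theorem span_single_dense {I E : Type} [DecidableEq I] [NormedAddCommGroup E]
    [InnerProductSpace ℂ E] [CompleteSpace E] :
    (Submodule.span ℂ {f : L2 I E | ∃ i a, f = L2.single i a}).topologicalClosure = ⊤ := by
  rw [Submodule.topologicalClosure_eq_top_iff, Submodule.eq_bot_iff]
  intro f hf
  ext i
  refine inner_self_eq_zero.1 (?_ : inner ℂ (f i) (f i) = 0)
  rw [← L2.inner_single]
  exact (Submodule.mem_orthogonal _ _).1 hf _ (Submodule.subset_span ⟨i, f i, rfl⟩)

/-- The vector `e_α ⊗ a` is killed after `α r + 1` shifts, and these vectors are total. -/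
theorem nil_legS {k : ℕ} {E : Type} [NormedAddCommGroup E] [InnerProductSpace ℂ E]
    [CompleteSpace E] (r : Fin k) : Nil (legS E r) := by
  refine Nil.of_total (norm_le_one_of_coisometry (legS_mul_star r)) span_single_dense ?_
  rintro _ ⟨α, a, rfl⟩
  have key : ∀ b, ∀ α : Fin k → ℕ, α r < b → (legS E r ^ b) (L2.single α a) = 0 := by
    intro b
    induction b with
    | zero => intro α h; omega
    | succ b ih =>
      intro α h
      rw [pow_succ, ContinuousLinearMap.mul_apply]
      by_cases h0 : α r = 0
      · rw [legS, pullL_single_of_notMem _ _ _ _ fun j hj => (exists_up r α).1 ⟨j, hj⟩ h0, map_zero]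
      · obtain ⟨β, rfl⟩ := (exists_up r α).2 h0
        have e : legS E r (L2.single (up r β) a) = L2.single β a := pullL_single _ _ _ _
        rw [e]
        refine ih β ?_
        simp only [up, Function.update_self] at h
        omega
  refine tendsto_const_nhds.congr' ?_
  filter_upwards [eventually_gt_atTop (α r)] with b hb
  rw [key b α hb]

end nil

/-! ### Products of the entries of the last row of a block with their adjoints. -/

section rows
variable {B : Type*} [Ring B] [StarRing B] {n k : ℕ} {z : ℕ → ℕ → B}

/-- The off-diagonal entries outside of the upper left block of size `k + 1` vanish. -/
def Block {B : Type*} [Zero B] (n k : ℕ) (z : ℕ → ℕ → B) : Prop :=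
  ∀ i j, i ≤ n → j ≤ n → i ≠ j → k < max i j → z i j = 0

/-- The right factors of `star (z k j)`. -/
def rowG (z : ℕ → ℕ → B) (k i : ℕ) : B := if i < k then z i (i + 1) else z (i + 1) (i + 1)

/-- Removing row `k` and column `j ≤ k` leaves the diagonal before position `j`, the superdiagonal
from there up to row `k`, and the diagonal again below it. -/
theorem CRel.star_row (hz : CRel n z) (hk : k ≤ n) {j : ℕ} (hj : j ≤ k) :
    star (z k j) = oprod (fun i => z i i) 0 j * oprod (rowG z k) j n := by
  rw [hz.star_eq k j hk (by omega), ← oprod_mul (Nat.zero_le j) (by omega : j ≤ n)]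
  congr 1
  · refine oprod_congr fun i _ h => ?_
    rw [skip, skip, if_pos (by omega), if_pos h]
  · refine oprod_congr fun i h _ => ?_
    rw [skip, skip, if_neg (by omega : ¬ i < j), rowG]
    split_ifs <;> rfl

/-- The critical factor is `z (k + 1) (k + 1)`: the correction in `diag_cross` contains `z k (k +
1)`, which vanishes by the block condition. -/
theorem CRel.commute_rowG (hz : CRel n z) (hb : Block n k z) (hk : k ≤ n) {i j : ℕ} (hj : j ≤ k)
    (hij : j ≤ i) (hi : i < n) : Commute (z k j) (rowG z k i) := by
  rw [rowG]
  split_ifs with h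
  · exact (hz.anti_comm i k j (i + 1) h hk (by omega) (by omega)).symm
  · rcases Nat.eq_or_lt_of_le (not_lt.1 h) with h' | h'
    · subst h'
      have := hz.diag_cross k (k + 1) j (k + 1) (by omega) (by omega) (by omega) (by omega)
        (by omega)
      rw [hb k (k + 1) (by omega) (by omega) (by omega) (by omega), zero_mul] at this
      exact sub_eq_zero.1 this
    · exact hz.diag_comm k (i + 1) j (i + 1) (by omega) (by omega) (by omega) (by omega)
        (by omega)

/-- `z k j` can be moved to the left through the adjoint of `z k l` until it meets the factor `z (j
- 1) j` of its own column, where `col_zero` applies. -/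
theorem CRel.star_row_mul_of_lt (hz : CRel n z) (hb : Block n k z) (hk : k ≤ n) {j l : ℕ}
    (hj : j ≤ k) (hl : l < j) : star (z k l) * z k j = 0 := by
  rw [hz.star_row hk (by omega : l ≤ k),
    oprod_split (f := rowG z k) (by omega : l ≤ j - 1) (by omega)]
  have h1 : Commute (z k j) (oprod (rowG z k) (j - 1 + 1) n) :=
    commute_oprod fun i h1 h2 => hz.commute_rowG hb hk hj (by omega) h2
  have h2 : rowG z k (j - 1) * z k j = 0 := by
    rw [rowG, if_pos (by omega), Nat.sub_add_cancel (by omega)]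
    exact hz.col_zero _ _ _ (by omega) hk (by omega)
  simp only [mul_assoc]
  rw [← h1.eq, ← mul_assoc (rowG z k (j - 1)), h2, zero_mul, mul_zero, mul_zero]

theorem CRel.star_row_mul_of_ne (hz : CRel n z) (hb : Block n k z) (hk : k ≤ n) {j l : ℕ}
    (hj : j ≤ k) (hl : l ≤ k) (h : l ≠ j) : star (z k l) * z k j = 0 := by
  rcases lt_or_gt_of_ne h with h | h
  · exact hz.star_row_mul_of_lt hb hk hj h
  · have := congrArg star (hz.star_row_mul_of_lt hb hk hl h)
    rwa [star_mul, star_star, star_zero] at this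

/-- A telescoping sum: by `diag_cross` the new summand exchanges the factor `z k j` in the middle
for `z j j * z k (j + 1)`. -/
theorem CRel.row_sum (hz : CRel n z) (hk : k ≤ n) {j : ℕ} (hj : j ≤ k) :
    ∑ i ∈ Finset.range (j + 1), z k i * star (z k i) =
      oprod (fun i => z i i) 0 j * z k j * oprod (rowG z k) j n := by
  induction j with
  | zero =>
    rw [Finset.sum_range_one, hz.star_row hk hj, oprod_self, one_mul, one_mul]
  | succ j ih =>
    rw [Finset.sum_range_succ, ih (by omega), hz.star_row hk hj, oprod_succ (Nat.zero_le j),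
      oprod_cons (f := rowG z k) (by omega : j < n)]
    have c1 := hz.diag_cross j k j (j + 1) (by omega) hk (by omega) (by omega) (by omega)
    have c2 := hz.anti_comm j k j (j + 1) (by omega) hk (by omega) (by omega)
    have c3 : rowG z k j = z j (j + 1) := if_pos (by omega)
    have c4 : Commute (z k (j + 1)) (oprod (fun i => z i i) 0 j) :=
      commute_oprod fun i _ hi => (hz.diag_comm i k i (j + 1) (by omega) hk (by omega) (by omega)
        (by omega)).symm
    rw [c3]
    rw [sub_eq_iff_eq_add, c2, add_comm (z k j * _)] at c1
    have c5 : oprod (fun i => z i i) 0 j * z j j * z k (j + 1) =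
        z k (j + 1) * (oprod (fun i => z i i) 0 j * z j j) +
          oprod (fun i => z i i) 0 j * (z k j * z j (j + 1)) := by
      rw [mul_assoc, c1, mul_add, ← mul_assoc (z k (j + 1)), c4.eq]
      simp only [mul_assoc]
    rw [c5]
    simp only [add_mul, mul_assoc]
    abel

/-- `z k j` commutes with the right factors of its own adjoint; moved to the middle it produces the
telescoped product of `CRel.row_sum`. -/
theorem CRel.star_row_mul_self (hz : CRel n z) (hb : Block n k z) (hk : k ≤ n) {j : ℕ}
    (hj : j ≤ k) : star (z k j) * z k j = ∑ i ∈ Finset.range (j + 1), z k i * star (z k i) := by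
  rw [hz.row_sum hk hj, hz.star_row hk hj, mul_assoc, mul_assoc]
  congr 1
  exact (commute_oprod fun i h1 h2 => hz.commute_rowG hb hk hj h1 h2).eq.symm

theorem CRel.row_sum_one (hz : CRel n z) (hk : k ≤ n) :
    ∑ i ∈ Finset.range (k + 1), z k i * star (z k i) = 1 := by
  rw [hz.row_sum hk le_rfl, ← hz.det_one, oprod_split (f := fun i => z i i) (Nat.zero_le k)
    (by omega : k < n + 1), ← oprod_shift (fun i => z i i) k n 1]
  congr 1
  refine oprod_congr fun i h1 h2 => ?_
  rw [rowG, if_neg (by omega), add_comm 1 i]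

end rows

/-! ### The last row as a tower, and its commutation with the upper entries. -/

section peel
variable {H : Type} [NormedAddCommGroup H] [InnerProductSpace ℂ H] [CompleteSpace H]
  {n k : ℕ} {z : ℕ → ℕ → H →L[ℂ] H}

/-- The entries `z k 1, …, z k k` of row `k`. -/
def rowX (z : ℕ → ℕ → H →L[ℂ] H) (k m : ℕ) : H →L[ℂ] H := z k (m + 1)

/-- The common kernel of the operators `star (z k 1), …, star (z k k)`. -/
abbrev rowK (z : ℕ → ℕ → H →L[ℂ] H) (k : ℕ) : Submodule ℂ H := vac k (rowX z k) 0

theorem CRel.sum_apply (hz : CRel n z) (hk : k ≤ n) {m : ℕ} (hm : m ≤ k) {g : H}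
    (hg : g ∈ vac k (rowX z k) m) :
    (∑ i ∈ Finset.range (m + 1), z k i * star (z k i)) g = g := by
  have h1 : (∑ i ∈ Finset.range (k + 1), z k i * star (z k i)) g = g := by
    rw [hz.row_sum_one hk]; rfl
  refine Eq.trans ?_ h1
  rw [ContinuousLinearMap.sum_apply, ContinuousLinearMap.sum_apply]
  refine Finset.sum_subset (Finset.range_mono (by omega)) fun i h2 h3 => ?_
  rw [Finset.mem_range] at h2 h3
  have h4 : star (z k i) g = 0 := by
    have := hg (i - 1) (by omega) (by omega)
    rwa [rowX, Nat.sub_add_cancel (by omega)] at this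
  rw [ContinuousLinearMap.mul_apply, h4, map_zero]

theorem CRel.row_zero_left (hz : CRel n z) (hk : k ≤ n) {g : H} (hg : g ∈ rowK z k) :
    z k 0 (star (z k 0) g) = g := by
  have := hz.sum_apply hk (Nat.zero_le k) hg
  rwa [Finset.sum_range_one] at this

theorem CRel.row_zero_right (hz : CRel n z) (hb : Block n k z) (hk : k ≤ n) {g : H}
    (hg : g ∈ rowK z k) : star (z k 0) (z k 0 g) = g := by
  have h := hz.star_row_mul_self hb hk (Nat.zero_le k)
  rw [Finset.sum_range_one] at h
  exact (DFunLike.congr_fun h g).trans (hz.row_zero_left hk hg)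

/-- `star (z k j) * z k j` is the partial row sum up to `j`, and this is the identity on vectors
killed by the adjoints of the later entries, because the full row sum is `1`. Different entries of
the row have orthogonal ranges, and their products vanish. On the common kernel the only entry left
is `z k 0`, which is unitary there. -/
theorem CRel.tower (hz : CRel n z) (hb : Block n k z) (hk : k ≤ n)
    (hnil : ∀ j, 1 ≤ j → j ≤ k → Nil (star (z k j))) :
    Tower k (rowX z k) (star (z k 0)) where
  iso j hj g hg := (DFunLike.congr_fun (hz.star_row_mul_self hb hk (by omega : j + 1 ≤ k)) g).trans
    (hz.sum_apply hk (by omega) hg)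
  low j l hjl hl g _ := DFunLike.congr_fun
    (hz.star_row_mul_of_ne hb hk (by omega : j + 1 ≤ k) (by omega : l + 1 ≤ k) (by omega)) g
  low_star j l hjl hl g _ := by
    have := congrArg star (hz.row_zero k (j + 1) (l + 1) hk (by omega) (by omega))
    rw [star_mul, star_zero] at this
    exact DFunLike.congr_fun this g
  nil j hj := hnil (j + 1) (by omega) (by omega)
  twist g _ l _ hl := by
    have := congrArg star (hz.row_zero k 0 (l + 1) hk (by omega) (by omega))
    rw [star_mul, star_zero] at this
    exact DFunLike.congr_fun this g
  twist_star g _ l _ hl := by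
    rw [star_star]
    exact DFunLike.congr_fun
      (hz.star_row_mul_of_ne hb hk (Nat.zero_le k) (by omega : l + 1 ≤ k) (by omega)) g
  twist_iso g hg := by rw [star_star]; exact hz.row_zero_left hk hg
  twist_coiso g hg := by rw [star_star]; exact hz.row_zero_right hb hk hg

section
variable (hz : CRel n z) (hb : Block n k z) (hk : k ≤ n)
include hz hb hk

/-- An operator which commutes with `z k 0` preserves the common kernel. -/
theorem CRel.mem_rowK {T : H →L[ℂ] H} (hT : Commute T (z k 0)) {g : H} (hg : g ∈ rowK z k) :
    T g ∈ rowK z k := by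
  intro l _ hl
  rw [← hz.row_zero_left hk hg]
  have h1 : T (z k 0 (star (z k 0) g)) = z k 0 (T (star (z k 0) g)) := DFunLike.congr_fun hT.eq _
  rw [h1]
  exact DFunLike.congr_fun
    (hz.star_row_mul_of_ne hb hk (Nat.zero_le k) (by omega : l + 1 ≤ k) (by omega)) _

theorem CRel.star_mem_rowK {g : H} (hg : g ∈ rowK z k) : star (z k 0) g ∈ rowK z k := by
  intro l _ hl
  have := congrArg star (hz.row_zero k 0 (l + 1) hk (by omega) (by omega))
  rw [star_mul, star_zero] at this
  exact DFunLike.congr_fun this g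

/-- On the common kernel `star (z k 0)` is the inverse of `z k 0`, so it commutes with whatever
commutes with `z k 0`. -/
theorem CRel.twist_comm {T : H →L[ℂ] H} (hT : Commute T (z k 0)) {g : H} (hg : g ∈ rowK z k) :
    T (star (z k 0) g) = star (z k 0) (T g) := by
  have hg' : star (z k 0) g ∈ rowK z k := hz.star_mem_rowK hb hk hg
  have h1 : T (z k 0 (star (z k 0) g)) = z k 0 (T (star (z k 0) g)) := DFunLike.congr_fun hT.eq _
  rw [hz.row_zero_left hk hg] at h1
  rw [h1, hz.row_zero_right hb hk (hz.mem_rowK hb hk hT hg')]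

theorem CRel.twist_pow_comm {T : H →L[ℂ] H} (hT : Commute T (z k 0)) {g : H}
    (hg : g ∈ rowK z k) (a : ℕ) : T ((star (z k 0) ^ a) g) = (star (z k 0) ^ a) (T g) := by
  induction a generalizing g with
  | zero => rfl
  | succ a ih =>
    rw [pow_succ, ContinuousLinearMap.mul_apply, ContinuousLinearMap.mul_apply,
      ih (hz.star_mem_rowK hb hk hg), hz.twist_comm hb hk hT hg]

-- The rules for moving an upper entry `z i j`, `i < k`, past `z k l`: they commute for `l < j` and
-- for `l > j + 1`, the product vanishes for `l = j`, and a correction term appears for `l = j + 1`.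
-- A diagonal entry `z j j` annihilates all `z k l` with `l ≤ j`.
omit hb in
theorem CRel.commute_row_of_lt {i j l : ℕ} (hi : i < k) (hj : j ≤ n) (hl : l < j) :
    Commute (z i j) (z k l) := hz.anti_comm i k l j hi hk hl hj

omit hb in
theorem CRel.diag_mul_row {j l : ℕ} (hj : j < k) (hl : l ≤ j) : z j j * z k l = 0 := by
  rcases Nat.eq_or_lt_of_le hl with rfl | hl
  · exact hz.col_zero _ _ _ hj hk (by omega)
  · exact hz.anti_zero j k l j hj hk hl (by omega) (by omega)

omit hb in
theorem CRel.mul_row_succ {i j : ℕ} (hij : i ≤ j) (hj : j < k) :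
    z i j * z k (j + 1) = z k (j + 1) * z i j + z k j * z i (j + 1) := by
  have h1 := hz.diag_cross i k j (j + 1) (by omega) hk (by omega) (by omega) (by omega)
  rw [hz.anti_comm i k j (j + 1) (by omega) hk (by omega) (by omega), sub_eq_iff_eq_add] at h1
  rw [h1, add_comm]

omit hb in
theorem CRel.commute_row_of_gt {i j l : ℕ} (hi : i < k) (hij : i ≤ j) (hl : j + 1 < l)
    (hlk : l ≤ k) : Commute (z i j) (z k l) :=
  hz.diag_comm i k j l hi hk (by omega) (by omega) (by omega)

theorem CRel.commute_diag_row {i l : ℕ} (hi : k < i) (hin : i ≤ n) (hl : l ≤ k) :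
    Commute (z i i) (z k l) := by
  rcases Nat.eq_or_lt_of_le hi with rfl | hi
  · have h1 := hz.diag_cross k (k + 1) l (k + 1) (by omega) (by omega) (by omega) (by omega)
      (by omega)
    rw [hb k (k + 1) (by omega) (by omega) (by omega) (by omega), zero_mul] at h1
    exact (sub_eq_zero.1 h1).symm
  · exact (hz.diag_comm k i l i (by omega) (by omega) (by omega) (by omega) (by omega)).symm

end

/-- Raise the exponent `j` by one. -/
def upN (j : ℕ) (α : ℕ → ℕ) : ℕ → ℕ := Function.update α j (α j + 1)

theorem extN_up (r : Fin k) (α : Fin k → ℕ) : extN (up r α) = upN r (extN α) := by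
  funext i
  by_cases hi : i < k
  · by_cases h : i = r
    · subst h
      simp only [upN, Function.update_self]
      rw [extN_val, extN_val]
      simp [up]
    · have h' : (⟨i, hi⟩ : Fin k) ≠ r := fun e => h (by rw [← e])
      rw [upN, Function.update_of_ne h, extN, extN, dif_pos hi, dif_pos hi, up,
        Function.update_of_ne h']
  · have h : i ≠ r := fun e => hi (by rw [e]; exact r.2)
    rw [upN, Function.update_of_ne h, extN, extN, dif_neg hi, dif_neg hi]

theorem deg_up (r : Fin k) (α : Fin k → ℕ) : deg (up r α) = deg α + 1 := by
  rw [deg, deg, up, Finset.sum_update_of_mem (Finset.mem_univ r), ← Finset.erase_eq,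
    ← Finset.add_sum_erase _ _ (Finset.mem_univ r)]
  omega

theorem mul_mon (X : ℕ → H →L[ℂ] H) (α : ℕ → ℕ) (j : ℕ) :
    X j * mon X α (j + 1) = mon X (upN j α) (j + 1) := by
  rw [mon, mon, upN, Function.update_self, pow_succ', mul_assoc]
  congr 2
  exact mon_congr fun i hi => (Function.update_of_ne (by omega) _ _).symm

/-- The factors with index at least `m₀` form a left factor which does not depend on the lower
exponents. It can be commuted past an upper entry, so that only the lower exponents need be
discussed. -/
theorem mon_split (X : ℕ → H →L[ℂ] H) (α : ℕ → ℕ) {m₀ m : ℕ} (h : m₀ ≤ m) :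
    ∃ S, (∀ β : ℕ → ℕ, (∀ l, m₀ ≤ l → β l = α l) → mon X β m = S * mon X β m₀) ∧
      ∀ Y, (∀ l, m₀ ≤ l → l < m → Commute Y (X l)) → Commute Y S := by
  induction m, h using Nat.le_induction with
  | base => exact ⟨1, fun β _ => (one_mul _).symm, fun Y _ => Commute.one_right Y⟩
  | succ m hm ih =>
    obtain ⟨S, h1, h2⟩ := ih
    refine ⟨X m ^ α m * S, fun β hβ => ?_, fun Y hY => ?_⟩
    · rw [mon, h1 β hβ, hβ m hm, mul_assoc]
    · exact ((hY m hm (by omega)).pow_right _).mul_right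
        (h2 Y fun l h3 h4 => hY l h3 (by omega))

section
variable (hz : CRel n z) (hk : k ≤ n)
include hz hk

/-- The first factor of the monomial with a positive exponent is annihilated by `z j j`. If there is
none, the vector lies in the range of `z k 0`, which is annihilated as well. -/
theorem CRel.diag_mon {j : ℕ} (hj : j < k) (α : ℕ → ℕ) {m : ℕ} (hm : m ≤ j) {g : H}
    (hg : g ∈ rowK z k) : z j j (mon (rowX z k) α m g) = 0 := by
  induction m with
  | zero =>
    have := DFunLike.congr_fun (hz.diag_mul_row hk hj (Nat.zero_le j)) (star (z k 0) g)
    change z j j (z k 0 (star (z k 0) g)) = 0 at this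
    rwa [hz.row_zero_left hk hg] at this
  | succ m ih =>
    rcases h : α m with _ | a
    · rw [mon, h, pow_zero, one_mul]
      exact ih (by omega)
    · have := hz.diag_mul_row hk hj (by omega : m + 1 ≤ j)
      rw [mon, h, pow_succ', mul_assoc]
      exact DFunLike.congr_fun this _

/-- The exponent `j - 1` belongs to `z k j`, which stands in the same column as `z i j`; so the
product vanishes unless this exponent is zero. -/
theorem CRel.mul_mon_self {i j : ℕ} (hi : i < k) (hij : i ≤ j) (hj : j ≤ k) (α : ℕ → ℕ) {g : H}
    (hg : g ∈ rowK z k) : z i j (mon (rowX z k) α j g) =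
      if i < j ∧ α (j - 1) = 0 then mon (rowX z k) α j (z i j g) else 0 := by
  rcases Nat.eq_or_lt_of_le hij with rfl | hij
  · rw [if_neg (by omega), hz.diag_mon hk hi α le_rfl hg]
  · obtain ⟨j, rfl⟩ : ∃ j', j = j' + 1 := ⟨j - 1, by omega⟩
    rw [Nat.add_sub_cancel]
    rcases h : α j with _ | a
    · rw [if_pos ⟨hij, rfl⟩, mon, h, pow_zero, one_mul]
      exact DFunLike.congr_fun (mon_commute (α := α) fun l hl =>
        hz.commute_row_of_lt hk hi (by omega : j + 1 ≤ n) (by omega : l + 1 < j + 1)).eq g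
    · rw [if_neg (by omega), mon, h, pow_succ', mul_assoc]
      exact DFunLike.congr_fun (hz.col_zero i k (j + 1) hi hk (by omega)) _

theorem CRel.mul_mon_last {i : ℕ} (hi : i < k) (α : ℕ → ℕ) {g : H} (hg : g ∈ rowK z k) :
    z i k (mon (rowX z k) α k g) =
      if α (k - 1) = 0 then mon (rowX z k) α k (z i k g) else 0 := by
  rw [hz.mul_mon_self hk hi hi.le le_rfl α hg]
  simp only [hi, true_and]

theorem CRel.mul_mon_of_zero {i j : ℕ} (hij : i ≤ j) (hj : j < k) (α : ℕ → ℕ) (hα : α j = 0)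
    {g : H} (hg : g ∈ rowK z k) : z i j (mon (rowX z k) α k g) =
      if i < j ∧ α (j - 1) = 0 then mon (rowX z k) α k (z i j g) else 0 := by
  obtain ⟨S, h1, h2⟩ := mon_split (rowX z k) α (by omega : j + 1 ≤ k)
  have hS : ∀ f, z i j (S f) = S (z i j f) := fun f => DFunLike.congr_fun
    (h2 (z i j) fun l h3 h4 => hz.commute_row_of_gt hk (by omega) hij (by omega : j + 1 < l + 1)
      (by omega)).eq f
  have h3 : mon (rowX z k) α k = S * mon (rowX z k) α j := by
    rw [h1 α fun _ _ => rfl, mon, hα, pow_zero, one_mul]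
  rw [h3, ContinuousLinearMap.mul_apply, hS, hz.mul_mon_self hk (by omega) hij hj.le α hg]
  split_ifs
  · rfl
  · exact map_zero S

theorem CRel.mul_row_pow {i j : ℕ} (hij : i ≤ j) (hj : j < k) (a : ℕ) :
    z i j * z k (j + 1) ^ (a + 1) =
      z k (j + 1) ^ (a + 1) * z i j + z k (j + 1) ^ a * (z k j * z i (j + 1)) := by
  induction a with
  | zero => rw [zero_add, pow_one, pow_zero, one_mul, hz.mul_row_succ hk hij hj]
  | succ a ih =>
    have h0 : z i (j + 1) * z k (j + 1) = 0 := hz.col_zero i k (j + 1) (by omega) hk (by omega)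
    rw [pow_succ' _ (a + 1), ← mul_assoc, hz.mul_row_succ hk hij hj, add_mul, mul_assoc, ih,
      mul_assoc (z k j), pow_succ' _ a, ← mul_assoc (z i (j + 1)), h0, zero_mul, mul_zero,
      add_zero, mul_add]
    simp only [mul_assoc]

/-- Passing the power of `z k (j + 1)`, the entry `z i j` either remains and then meets `z k j`, or
it turns into `z i (j + 1)` while one factor `z k (j + 1)` becomes `z k j`. For `j = 0` this new
factor is `z k 0`, which acts on the common kernel and raises no exponent. -/
theorem CRel.mul_mon_up {i j : ℕ} (hij : i ≤ j) (hj : j < k) (β : ℕ → ℕ)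
    {g : H} (hg : g ∈ rowK z k) : z i j (mon (rowX z k) (upN j β) k g) =
      (if i < j ∧ β (j - 1) = 0 then mon (rowX z k) (upN j β) k (z i j g) else 0) +
      if j = 0 then mon (rowX z k) β k (z k 0 (z i (j + 1) g))
        else mon (rowX z k) (upN (j - 1) β) k (z i (j + 1) g) := by
  obtain ⟨S, h1, h2⟩ := mon_split (rowX z k) β (by omega : j + 1 ≤ k)
  have hS : ∀ f, z i j (S f) = S (z i j f) := fun f => DFunLike.congr_fun
    (h2 (z i j) fun l h3 h4 => hz.commute_row_of_gt hk (by omega) hij (by omega : j + 1 < l + 1)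
      (by omega)).eq f
  have e1 : mon (rowX z k) (upN j β) k =
      S * (z k (j + 1) ^ (β j + 1) * mon (rowX z k) β j) := by
    rw [h1 (upN j β) fun l hl => Function.update_of_ne (by omega) _ _, mon,
      mon_congr (β := β) fun i hi => Function.update_of_ne (by omega) _ _, upN,
      Function.update_self]
    rfl
  have e2 : z i j (mon (rowX z k) (upN j β) k g) =
      S ((z k (j + 1) ^ (β j + 1)) (z i j (mon (rowX z k) β j g)) +
        (z k (j + 1) ^ β j) (z k j (z i (j + 1) (mon (rowX z k) β j g)))) := by
    rw [e1, ContinuousLinearMap.mul_apply, hS]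
    exact congrArg S (DFunLike.congr_fun (hz.mul_row_pow hk hij hj (β j)) _)
  have e3 : z i (j + 1) (mon (rowX z k) β j g) = mon (rowX z k) β j (z i (j + 1) g) :=
    DFunLike.congr_fun (mon_commute (α := β) fun l hl =>
      hz.commute_row_of_lt hk (by omega : i < k) (by omega : j + 1 ≤ n)
        (by omega : l + 1 < j + 1)).eq g
  rw [e2, e3, hz.mul_mon_self hk (by omega) hij hj.le β hg, map_add]
  congr 1
  · split_ifs
    · rw [e1]; rfl
    · rw [map_zero, map_zero]
  · rcases j with _ | j
    · rw [if_pos rfl, h1 β fun _ _ => rfl]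
      rfl
    · have e4 : mon (rowX z k) (upN j β) (j + 1 + 1) =
          rowX z k (j + 1) ^ β (j + 1) * (rowX z k j * mon (rowX z k) β (j + 1)) := by
        rw [mul_mon, mon, upN, Function.update_of_ne (Nat.succ_ne_self j)]
      rw [if_neg (Nat.succ_ne_zero j), Nat.add_sub_cancel,
        h1 (upN j β) fun l hl => Function.update_of_ne (by omega) _ _, e4]
      rfl

end

end peel

/-! ### Legs indexed by `ℕ` and convolution with the array of a block. -/

section legN
variable {k : ℕ} {E : Type} [NormedAddCommGroup E] [InnerProductSpace ℂ E]

/-- The backward shifts of the legs, indexed by `ℕ`. -/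
noncomputable def legN (k : ℕ) (E : Type) [NormedAddCommGroup E] [InnerProductSpace ℂ E] (r : ℕ) :
    L2 (Fin k → ℕ) E →L[ℂ] L2 (Fin k → ℕ) E := if h : r < k then legS E ⟨r, h⟩ else 1

theorem legN_of_lt {r : ℕ} (h : r < k) : legN k E r = legS E ⟨r, h⟩ := dif_pos h

variable [CompleteSpace E]

theorem legS_single_zero {r : Fin k} {α : Fin k → ℕ} (h : α r = 0) (a : E) :
    legS E r (L2.single α a) = 0 :=
  pullL_single_of_notMem _ _ _ _ fun j hj => (exists_up r α).1 ⟨j, hj⟩ h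

theorem legS_single_up (r : Fin k) (α : Fin k → ℕ) (a : E) :
    legS E r (L2.single (up r α) a) = L2.single α a := pullL_single _ _ _ _

theorem up_apply_of_ne {r i : Fin k} (h : i ≠ r) (α : Fin k → ℕ) : up r α i = α i :=
  Function.update_of_ne h _ _

theorem star_legS_single (r : Fin k) (α : Fin k → ℕ) (a : E) :
    star (legS E r) (L2.single α a) = L2.single (up r α) a := star_pullL_single _ _ _ _

theorem legP_single (r : Fin k) (α : Fin k → ℕ) (a : E) :
    (1 - star (legS E r) * legS E r) (L2.single α a) = if α r = 0 then L2.single α a else 0 := by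
  rw [ContinuousLinearMap.sub_apply, ContinuousLinearMap.mul_apply, ContinuousLinearMap.one_apply]
  split_ifs with h
  · rw [legS_single_zero h, map_zero, sub_zero]
  · obtain ⟨β, rfl⟩ := (exists_up r α).2 h
    rw [legS_single_up, star_legS_single, sub_self]

theorem legN_mul_star (r : ℕ) : legN k E r * star (legN k E r) = 1 := by
  rw [legN]
  split_ifs
  · exact legS_mul_star _
  · simp

end legN

section convblock
variable {B : Type*} [Ring B] [StarRing B]

theorem conv_blockArr_diag (x : ℕ → ℕ → B) (s : ℕ → B) (k i : ℕ) :
    conv x (blockArr s k) i i = x i i * blockArr s k i i := by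
  rw [conv, Finset.uIcc_self, Finset.sum_singleton]

theorem conv_blockArr_upper (x : ℕ → ℕ → B) (s : ℕ → B) (k : ℕ) {i j : ℕ} (h : i ≤ j) :
    conv x (blockArr s k) i (j + 1) = x i j * (if j < k then 1 - star (s j) * s j else 0) +
      x i (j + 1) * blockArr s k (j + 1) (j + 1) := by
  rw [conv, Finset.uIcc_of_le (by omega), Finset.sum_Icc_succ_top (by omega)]
  congr 1
  rw [Finset.sum_eq_single_of_mem j (Finset.mem_Icc.2 ⟨h, le_rfl⟩), blockArr_super]
  intro b hb hbj
  rw [Finset.mem_Icc] at hb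
  rw [blockArr_upper _ (by omega), mul_zero]

end convblock

/-! ### The upper entries in the coordinates given by the tower. -/

section peel
variable {H : Type} [NormedAddCommGroup H] [InnerProductSpace ℂ H] [CompleteSpace H]
  {n k : ℕ} {z : ℕ → ℕ → H →L[ℂ] H}

/-- The upper triangular entries of the array on the common kernel of row `k`. -/
noncomputable def peelUpper (z : ℕ → ℕ → H →L[ℂ] H) (k i j : ℕ) : rowK z k →L[ℂ] rowK z k :=
  if i ≤ j ∧ j < k then compr (rowK z k) (z i (j + 1))
  else if i = k ∧ j = k then compr (rowK z k) (z k 0)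
  else if i = j then compr (rowK z k) (z i i) else 0

/-- The array on the common kernel of row `k`. -/
noncomputable def peelArr (n : ℕ) (z : ℕ → ℕ → H →L[ℂ] H) (k i j : ℕ) :
    rowK z k →L[ℂ] rowK z k :=
  if i ≤ j then peelUpper z k i j
  else star (oprod (fun a => peelUpper z k (skip i a) (skip j a)) 0 n)

theorem peelUpper_of_lt {i j : ℕ} (h : i ≤ j) (hj : j < k) :
    peelUpper z k i j = compr (rowK z k) (z i (j + 1)) := if_pos ⟨h, hj⟩

theorem peelUpper_zero {i j : ℕ} (h : i < j) (hj : k ≤ j) : peelUpper z k i j = 0 := by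
  rw [peelUpper, if_neg (by omega), if_neg (by omega), if_neg (by omega)]

theorem peelUpper_corner : peelUpper z k k k = compr (rowK z k) (z k 0) := by
  rw [peelUpper, if_neg (by omega), if_pos ⟨rfl, rfl⟩]

theorem peelUpper_diag {i : ℕ} (h : k < i) : peelUpper z k i i = compr (rowK z k) (z i i) := by
  rw [peelUpper, if_neg (by omega), if_neg (by omega), if_pos rfl]

variable (hz : CRel n z) (hb : Block n k z) (hk : k ≤ n)
  (hT : Tower k (rowX z k) (star (z k 0)))
include hz hb hk

theorem CRel.mon_compr {T : H →L[ℂ] H} (hTc : Commute T (z k 0)) (α : Fin k → ℕ) (h : rowK z k) :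
    mon (rowX z k) (extN α) k (T ((star (z k 0) ^ deg α) (h : H))) =
      hT.emb α (compr (rowK z k) T h) := by
  rw [hz.twist_pow_comm hb hk hTc h.2, hT.emb_apply, compr_apply _ (hz.mem_rowK hb hk hTc h.2)]

theorem CRel.conj_single_zero {i j : ℕ} (hij : i ≤ j) (hj : j < k) {α : Fin k → ℕ}
    (hα : α ⟨j, hj⟩ = 0) (h : rowK z k) : hT.conj (z i j) (L2.single α h) =
      if i < j ∧ extN α (j - 1) = 0 then L2.single α (compr (rowK z k) (z i j) h) else 0 := by
  have hα' : extN α j = 0 := by rw [extN, dif_pos hj, hα]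
  rw [hT.conj_single, hT.emb_apply,
    hz.mul_mon_of_zero hk hij hj _ hα' (hT.pow_twist_mem h.2 _)]
  split_ifs with hc
  · rw [hz.mon_compr hb hk hT (hz.commute_row_of_lt hk (by omega) (by omega) (by omega)),
      hT.equiv_emb]
  · exact map_zero _

theorem CRel.conj_single_up_zero (hk0 : 0 < k) (β : Fin k → ℕ) (h : rowK z k) :
    hT.conj (z 0 0) (L2.single (up ⟨0, hk0⟩ β) h) =
      L2.single β (compr (rowK z k) (z 0 1) h) := by
  have hc : Commute (z 0 1) (z k 0) := hz.commute_row_of_lt hk hk0 (by omega) (by omega)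
  rw [hT.conj_single, hT.emb_apply, extN_up, deg_up,
    hz.mul_mon_up hk le_rfl hk0 _ (hT.pow_twist_mem h.2 _), if_neg (by omega), if_pos rfl,
    zero_add, zero_add, hz.twist_pow_comm hb hk hc h.2, pow_succ', ContinuousLinearMap.mul_apply,
    hz.row_zero_left hk (hT.pow_twist_mem (hz.mem_rowK hb hk hc h.2) _),
    ← hz.twist_pow_comm hb hk hc h.2, hz.mon_compr hb hk hT hc, hT.equiv_emb]

theorem CRel.conj_single_up_succ {i j : ℕ} (hij : i ≤ j + 1) (hj : j + 1 < k) (β : Fin k → ℕ)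
    (h : rowK z k) : hT.conj (z i (j + 1)) (L2.single (up ⟨j + 1, hj⟩ β) h) =
      (if i < j + 1 ∧ extN β j = 0 then
        L2.single (up ⟨j + 1, hj⟩ β) (compr (rowK z k) (z i (j + 1)) h) else 0) +
      L2.single (up ⟨j, by omega⟩ β) (compr (rowK z k) (z i (j + 1 + 1)) h) := by
  have hc : Commute (z i (j + 1 + 1)) (z k 0) :=
    hz.commute_row_of_lt hk (by omega) (by omega) (by omega)
  rw [hT.conj_single, hT.emb_apply, extN_up,
    hz.mul_mon_up hk hij hj _ (hT.pow_twist_mem h.2 _), if_neg (Nat.succ_ne_zero j), map_add,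
    Nat.add_sub_cancel]
  congr 1
  · split_ifs with h1
    · rw [← extN_up ⟨j + 1, hj⟩, hz.mon_compr hb hk hT
        (hz.commute_row_of_lt hk (by omega) (by omega) (by omega)), hT.equiv_emb]
    · exact map_zero _
  · rw [← extN_up ⟨j, by omega⟩, deg_up, ← deg_up ⟨j, by omega⟩, hz.mon_compr hb hk hT hc,
      hT.equiv_emb]

theorem CRel.conj_diag_zero (hk0 : 0 < k) : hT.conj (z 0 0) =
    amp (Fin k → ℕ) (rowK z k) (compr (rowK z k) (z 0 1)) * legS (rowK z k) ⟨0, hk0⟩ := by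
  refine L2.ext_single fun α h => ?_
  rw [ContinuousLinearMap.mul_apply]
  by_cases h0 : α ⟨0, hk0⟩ = 0
  · rw [hz.conj_single_zero hb hk hT le_rfl hk0 h0, if_neg (by omega), legS_single_zero h0,
      map_zero]
  · obtain ⟨β, rfl⟩ := (exists_up _ α).2 h0
    rw [hz.conj_single_up_zero hb hk hT hk0, legS_single_up, amp_single]

theorem CRel.conj_diag_succ {i : ℕ} (hik : i + 1 < k) : hT.conj (z (i + 1) (i + 1)) =
    amp (Fin k → ℕ) (rowK z k) (compr (rowK z k) (z (i + 1) (i + 1 + 1))) *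
      (legS (rowK z k) ⟨i + 1, hik⟩ * star (legS (rowK z k) ⟨i, by omega⟩)) := by
  refine L2.ext_single fun α h => ?_
  rw [ContinuousLinearMap.mul_apply, ContinuousLinearMap.mul_apply, star_legS_single]
  have hne : (⟨i + 1, hik⟩ : Fin k) ≠ ⟨i, by omega⟩ := by simp
  by_cases h0 : α ⟨i + 1, hik⟩ = 0
  · have h1 : up ⟨i, by omega⟩ α ⟨i + 1, hik⟩ = 0 := by rw [up_apply_of_ne hne, h0]
    rw [hz.conj_single_zero hb hk hT le_rfl hik h0, if_neg (by omega), legS_single_zero h1,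
      map_zero]
  · obtain ⟨β, rfl⟩ := (exists_up _ α).2 h0
    rw [hz.conj_single_up_succ hb hk hT le_rfl hik, if_neg (by omega), zero_add,
      up_comm ⟨i, by omega⟩, legS_single_up, amp_single]

/-- The entry `z k k` is the last operator of the tower, so it raises the last exponent. The
additional power of `star (z k 0)` in the embedding is compensated by the factor `z k 0` on the
kernel. -/
theorem CRel.conj_corner {i : ℕ} (hi : i < k) (h : i + 1 = k) : hT.conj (z k k) =
    amp (Fin k → ℕ) (rowK z k) (compr (rowK z k) (z k 0)) * star (legS (rowK z k) ⟨i, hi⟩) := by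
  subst h
  refine L2.ext_single fun α h => ?_
  have e : compr (rowK z (i + 1)) (z (i + 1) 0) h = z (i + 1) 0 (h : H) :=
    compr_apply _ (hz.mem_rowK hb hk (Commute.refl _) h.2)
  have e2 : (star (z (i + 1) 0) ^ (deg α + 1)) (z (i + 1) 0 (h : H)) =
      (star (z (i + 1) 0) ^ deg α) (h : H) := by
    rw [pow_succ]
    exact congrArg _ (hz.row_zero_right hb hk h.2)
  have e3 := DFunLike.congr_fun (mul_mon (rowX z (i + 1)) (extN α) i)
    ((star (z (i + 1) 0) ^ deg α) (h : H))
  rw [ContinuousLinearMap.mul_apply, star_legS_single, amp_single, hT.conj_single,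
    ← hT.equiv_emb, hT.emb_apply, hT.emb_apply, extN_up, deg_up, e, e2, ← e3]
  rfl

theorem CRel.conj_diag_gt {i : ℕ} (hi : k < i) (hin : i ≤ n) : hT.conj (z i i) =
    amp (Fin k → ℕ) (rowK z k) (compr (rowK z k) (z i i)) := by
  have hc : Commute (z i i) (z k 0) := hz.commute_diag_row hb hk hi hin (Nat.zero_le k)
  exact hT.conj_eq_amp (fun l hl => hz.commute_diag_row hb hk hi hin (by omega))
    (fun g hg => hz.twist_comm hb hk hc hg) fun g hg => hz.mem_rowK hb hk hc hg

theorem CRel.conj_super {i j : ℕ} (hij : i ≤ j) (hjk : j + 1 < k) : hT.conj (z i (j + 1)) =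
    amp (Fin k → ℕ) (rowK z k) (compr (rowK z k) (z i (j + 1))) *
      (1 - star (legS (rowK z k) ⟨j, by omega⟩) * legS (rowK z k) ⟨j, by omega⟩) +
    amp (Fin k → ℕ) (rowK z k) (compr (rowK z k) (z i (j + 1 + 1))) *
      (legS (rowK z k) ⟨j + 1, hjk⟩ * star (legS (rowK z k) ⟨j, by omega⟩)) := by
  refine L2.ext_single fun α h => ?_
  have hne : (⟨j + 1, hjk⟩ : Fin k) ≠ ⟨j, by omega⟩ := by simp
  have hext : ∀ α : Fin k → ℕ, extN α j = α ⟨j, by omega⟩ := fun α => extN_val α ⟨j, by omega⟩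
  have hlt : i < j + 1 := by omega
  rw [ContinuousLinearMap.add_apply, ContinuousLinearMap.mul_apply,
    ContinuousLinearMap.mul_apply, ContinuousLinearMap.mul_apply, star_legS_single, legP_single]
  by_cases h0 : α ⟨j + 1, hjk⟩ = 0
  · have h1 : up ⟨j, by omega⟩ α ⟨j + 1, hjk⟩ = 0 := by rw [up_apply_of_ne hne, h0]
    rw [hz.conj_single_zero hb hk hT (by omega) hjk h0, legS_single_zero h1, map_zero, add_zero,
      Nat.add_sub_cancel, hext]
    by_cases h2 : α ⟨j, by omega⟩ = 0
    · rw [if_pos ⟨hlt, h2⟩, if_pos h2, amp_single]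
    · rw [if_neg (fun h => h2 h.2), if_neg h2, map_zero]
  · obtain ⟨β, rfl⟩ := (exists_up _ α).2 h0
    have h1 : up ⟨j + 1, hjk⟩ β ⟨j, by omega⟩ = β ⟨j, by omega⟩ := up_apply_of_ne hne.symm _
    rw [hz.conj_single_up_succ hb hk hT (by omega) hjk, up_comm ⟨j, by omega⟩, legS_single_up,
      amp_single, hext, h1]
    congr 1
    by_cases h2 : β ⟨j, by omega⟩ = 0
    · rw [if_pos ⟨hlt, h2⟩, if_pos h2, amp_single]
    · rw [if_neg (fun h => h2 h.2), if_neg h2, map_zero]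

theorem CRel.conj_super_last {i j : ℕ} (hij : i ≤ j) (hj : j < k) (h : j + 1 = k) :
    hT.conj (z i k) = amp (Fin k → ℕ) (rowK z k) (compr (rowK z k) (z i k)) *
      (1 - star (legS (rowK z k) ⟨j, hj⟩) * legS (rowK z k) ⟨j, hj⟩) := by
  subst h
  refine L2.ext_single fun α h => ?_
  have hext : extN α j = α ⟨j, hj⟩ := extN_val α ⟨j, hj⟩
  rw [ContinuousLinearMap.mul_apply, legP_single, hT.conj_single, hT.emb_apply,
    hz.mul_mon_last hk (by omega) _ (hT.pow_twist_mem h.2 _), Nat.add_sub_cancel, hext]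
  split_ifs with h1
  · rw [hz.mon_compr hb hk hT (hz.commute_row_of_lt hk (by omega) hk (Nat.succ_pos j)),
      hT.equiv_emb, amp_single]
  · rw [map_zero, map_zero]

/-- A block array has one superdiagonal, so an upper entry of the convolution has at most two terms.
They are matched with the action of `z i j` on the vectors `e_α ⊗ h` computed above. -/
theorem CRel.conj_upper (hk0 : 0 < k) {i j : ℕ} (hij : i ≤ j) (hj : j ≤ n) :
    hT.conj (z i j) = conv (fun i j => amp (Fin k → ℕ) (rowK z k) (peelUpper z k i j))
      (blockArr (legN k (rowK z k)) k) i j := by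
  rcases Nat.eq_or_lt_of_le hij with rfl | hlt
  · rw [conv_blockArr_diag]
    rcases i with _ | i
    · rw [blockArr_diag_zero, if_pos hk0, peelUpper_of_lt le_rfl hk0, legN_of_lt hk0,
        hz.conj_diag_zero hb hk hT hk0]
    · rw [blockArr_diag_succ]
      rcases lt_trichotomy (i + 1) k with hik | hik | hik
      · rw [if_pos hik, if_pos (by omega), peelUpper_of_lt le_rfl hik,
          legN_of_lt hik, legN_of_lt (by omega : i < k), hz.conj_diag_succ hb hk hT hik]
      · have hi : i < k := by omega
        rw [if_neg (by omega), if_pos hi, one_mul, hik, peelUpper_corner, legN_of_lt hi,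
          hz.conj_corner hb hk hT hi hik]
      · rw [if_neg (by omega), if_neg (by omega), one_mul, mul_one, peelUpper_diag hik,
          hz.conj_diag_gt hb hk hT hik hj]
  · obtain ⟨j, rfl⟩ : ∃ j', j = j' + 1 := ⟨j - 1, by omega⟩
    rw [conv_blockArr_upper _ _ _ (by omega : i ≤ j), blockArr_diag_succ]
    rcases lt_trichotomy (j + 1) k with hjk | hjk | hjk
    · have hj' : j < k := by omega
      rw [if_pos hj', if_pos hjk, if_pos hj', peelUpper_of_lt (by omega) hj',
        peelUpper_of_lt (by omega) hjk, legN_of_lt hjk, legN_of_lt hj',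
        hz.conj_super hb hk hT (by omega) hjk]
    · have hj' : j < k := by omega
      rw [if_pos hj', peelUpper_of_lt (by omega) hj', peelUpper_zero hlt hjk.ge,
        map_zero, zero_mul, add_zero, legN_of_lt hj', hjk,
        hz.conj_super_last hb hk hT (by omega) hj' hjk]
    · rw [if_neg (by omega), mul_zero, peelUpper_zero hlt hjk.le,
        hb i (j + 1) (by omega) hj (by omega) (by omega), map_zero, map_zero (amp _ _), zero_mul, add_zero]

end peel

/-! ### Congruence of arrays on `[0, n]`, compressions and transport of double commutation. -/

section congr
variable {B : Type*} [Ring B] {n : ℕ}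

theorem conv_congr {x x' y y' : ℕ → ℕ → B} (hx : ∀ i j, i ≤ n → j ≤ n → x i j = x' i j)
    (hy : ∀ i j, i ≤ n → j ≤ n → y i j = y' i j) (i j : ℕ) (hi : i ≤ n) (hj : j ≤ n) :
    conv x y i j = conv x' y' i j := by
  refine Finset.sum_congr rfl fun l hl => ?_
  rw [Finset.uIcc, Finset.mem_Icc] at hl
  have : l ≤ n := hl.2.trans (sup_le hi hj)
  rw [hx i l hi this, hy l j this hj]

variable [StarRing B]

theorem act_congr (L : List (ℕ × B)) {y y' : ℕ → ℕ → B}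
    (h : ∀ i j, i ≤ n → j ≤ n → y i j = y' i j) (i j : ℕ) (hi : i ≤ n) (hj : j ≤ n) :
    act L y i j = act L y' i j := by
  induction L generalizing i j with
  | nil => exact h i j hi hj
  | cons p L ih =>
    rw [act_cons, act_cons]
    exact conv_congr (fun _ _ _ _ => rfl) ih i j hi hj

theorem skip_le {r i : ℕ} (hi : i < n) : skip r i ≤ n := by
  rw [skip]
  split_ifs <;> omega

theorem CRel.congr {y y' : ℕ → ℕ → B} (hy : CRel n y)
    (h : ∀ i j, i ≤ n → j ≤ n → y i j = y' i j) : CRel n y' where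
  row_zero i j l h1 h2 h3 := by
    rw [← h i j h1 (by omega), ← h i l h1 h3]
    exact hy.row_zero i j l h1 h2 h3
  col_zero i k j h1 h2 h3 := by
    rw [← h i j (by omega) h3, ← h k j h2 h3]
    exact hy.col_zero i k j h1 h2 h3
  anti_comm i k j l h1 h2 h3 h4 := by
    rw [← h i l (by omega) h4, ← h k j h2 (by omega)]
    exact hy.anti_comm i k j l h1 h2 h3 h4
  anti_zero i k j l h1 h2 h3 h4 h5 := by
    rw [← h i l (by omega) h4, ← h k j h2 (by omega)]
    exact hy.anti_zero i k j l h1 h2 h3 h4 h5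
  diag_cross i k j l h1 h2 h3 h4 h5 := by
    rw [← h i l (by omega) h4, ← h k j h2 (by omega), ← h i j (by omega) (by omega), ← h k l h2 h4]
    exact hy.diag_cross i k j l h1 h2 h3 h4 h5
  diag_comm i k j l h1 h2 h3 h4 h5 := by
    rw [← h i j (by omega) (by omega), ← h k l h2 h4]
    exact hy.diag_comm i k j l h1 h2 h3 h4 h5
  det_one := by
    rw [← hy.det_one]
    exact oprod_congr fun i _ hi => (h i i (by omega) (by omega)).symm
  star_eq r s hr hs := by
    rw [← h r s hr hs, hy.star_eq r s hr hs]
    exact oprod_congr fun i _ hi => h _ _ (skip_le hi) (skip_le hi)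

theorem CRel.conv_word {y : ℕ → ℕ → B} {L : List (ℕ × B)} (hL : LegList n L) (hy : CRel n y)
    (hLy : ∀ p ∈ L, DComm p.2 y) : CRel n (conv y (wordArr L)) := by
  induction L generalizing y with
  | nil => rwa [wordArr, act_nil, conv_id]
  | cons p L ih =>
    rw [wordArr, act_cons, ← conv_assoc]
    refine ih hL.tail (hy.conv_simple_right (hL.coisom p (by simp)) (hLy p (by simp))
      (hL.lt p (by simp))) fun q hq => ?_
    exact DComm.conv (hLy q (by simp [hq])) fun i j =>
      DC.simple ((List.pairwise_cons.1 hL.pairwise).1 q hq).symm _ i j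

end congr

section compr
variable {H : Type} [NormedAddCommGroup H] [InnerProductSpace ℂ H] [CompleteSpace H]
  (K : Submodule ℂ H) [K.HasOrthogonalProjection] [CompleteSpace K]

theorem compr_zero : compr K 0 = 0 := by
  ext h
  simp [compr]

theorem star_compr (T : H →L[ℂ] H) : star (compr K T) = compr K (star T) := by
  rw [ContinuousLinearMap.star_eq_adjoint, ContinuousLinearMap.star_eq_adjoint, eq_comm,
    ContinuousLinearMap.eq_adjoint_iff]
  intro x y
  change inner ℂ (K.orthogonalProjection (ContinuousLinearMap.adjoint T x)) y =
    inner ℂ x (K.orthogonalProjection (T y))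
  rw [Submodule.inner_orthogonalProjection_eq_of_mem_right,
    Submodule.inner_orthogonalProjection_eq_of_mem_left, ContinuousLinearMap.adjoint_inner_left]

theorem compr_commute {S T : H →L[ℂ] H} (h : Commute S T) (hS : ∀ g ∈ K, S g ∈ K)
    (hT : ∀ g ∈ K, T g ∈ K) : Commute (compr K S) (compr K T) := by
  ext g
  rw [ContinuousLinearMap.mul_apply, ContinuousLinearMap.mul_apply,
    compr_apply _ (hS _ (compr K T g).2), compr_apply _ (hT _ g.2),
    compr_apply _ (hT _ (compr K S g).2), compr_apply _ (hS _ g.2)]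
  exact DFunLike.congr_fun h.eq (g : H)

end compr

theorem Nil.of_conj {H K : Type} [NormedAddCommGroup H] [InnerProductSpace ℂ H]
    [NormedAddCommGroup K] [InnerProductSpace ℂ K] (e : H ≃ₗᵢ[ℂ] K) {S : H →L[ℂ] H}
    {T : K →L[ℂ] K} (h : ∀ g, S (e.symm g) = e.symm (T g)) (hT : Nil T) : Nil S := fun g => by
  have key : ∀ a, (S ^ a) g = e.symm ((T ^ a) (e g)) := by
    intro a
    induction a with
    | zero => simp
    | succ a ih => rw [pow_succ', pow_succ', ContinuousLinearMap.mul_apply,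
        ContinuousLinearMap.mul_apply, ih, h]
  simp only [key]
  have := (e.symm.continuous.tendsto 0).comp (hT (e g))
  rwa [map_zero] at this

theorem DC_amp_legN {k : ℕ} {E : Type} [NormedAddCommGroup E] [InnerProductSpace ℂ E]
    [CompleteSpace E] (Y : E →L[ℂ] E) (r : ℕ) : DC (amp (Fin k → ℕ) E Y) (legN k E r) := by
  rw [legN]
  split_ifs
  · refine DC.symm ⟨commute_pullL_amp _ _ _, commute_star_pullL_amp _ _ _⟩
  · exact DC.one _

theorem legN_legList {n k : ℕ} (E : Type) [NormedAddCommGroup E] [InnerProductSpace ℂ E]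
    [CompleteSpace E] (hk : k ≤ n) : LegList n (blockLegs (legN k E) k) := by
  refine blockLegs_legList _ hk (fun r _ => legN_mul_star r) fun r hr r' hr' hne => ?_
  rw [legN_of_lt hr, legN_of_lt hr']
  exact DC_legS fun h => hne (congrArg Fin.val h)

theorem skip_le_skip {i j : ℕ} (h : j < i) (a : ℕ) : skip i a ≤ skip j a := by
  simp only [skip]
  split_ifs <;> omega

theorem map_blockArr {B C : Type*} [Ring B] [StarRing B] [Ring C] [StarRing C] [Algebra ℂ B]
    [Algebra ℂ C] (φ : B →⋆ₐ[ℂ] C) (s : ℕ → B) (k i j : ℕ) :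
    φ (blockArr s k i j) = blockArr (fun r => φ (s r)) k i j := by
  have h : (blockLegs s k).map (fun p => (p.1, φ p.2)) = blockLegs (fun r => φ (s r)) k := by
    induction k with
    | zero => rfl
    | succ k ih => rw [blockLegs, List.map_cons, ih, blockLegs]
  exact (map_wordArr φ (blockLegs s k) i j).trans (by rw [h]; rfl)

/-! ### Splitting a block off on the right. -/

section transport
variable {H E : Type} [NormedAddCommGroup H] [InnerProductSpace ℂ H] [CompleteSpace H]
  [NormedAddCommGroup E] [InnerProductSpace ℂ E] [CompleteSpace E]
  {n k : ℕ} {z : ℕ → ℕ → H →L[ℂ] H} {v : ℕ → ℕ → E →L[ℂ] E}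
  (φ : (H →L[ℂ] H) →⋆ₐ[ℂ] (L2 (Fin k → ℕ) E →L[ℂ] L2 (Fin k → ℕ) E))

/-- The array of the block has the identity array as its symbol, so the symbol of an upper entry is
that of `v`. The lower entries are adjoints of products of upper ones on both sides. -/
theorem sym_of_upper (hz : CRel n z)
    (hup : ∀ i j, i ≤ j → j ≤ n → φ (z i j) =
      conv (fun i j => amp (Fin k → ℕ) E (v i j)) (blockArr (legN k E) k) i j)
    (hv : ∀ i j, j < i → v i j = star (oprod (fun a => v (skip i a) (skip j a)) 0 n))
    {i j : ℕ} (hi : i ≤ n) (hj : j ≤ n) : Sym (boxIso k E) (φ (z i j)) (v i j) := by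
  have hu : ∀ i j, i ≤ j → j ≤ n → Sym (boxIso k E) (φ (z i j)) (v i j) := by
    intro i j hij hj
    rw [hup i j hij hj, ← conv_id v]
    refine Sym.conv (fun l _ => ?_) fun l _ => ?_
    · rw [conv_id]
      exact sym_amp _
    · refine Sym.act (fun p hp => ?_) (fun i j => Sym.idArr i j) l j
      obtain ⟨h, e⟩ := (mem_blockLegs _).1 hp
      rw [e, legN_of_lt h]
      exact sym_legS _
  rcases le_or_gt i j with h | h
  · exact hu i j h hj
  · rw [hv i j h, ← star_star (z i j), map_star, hz.star_eq i j hi hj, map_oprod φ]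
    exact Sym.star (Sym.oprod fun a _ ha => hu _ _ (skip_le_skip h a) (skip_le ha))

/-- Both sides are crystal arrays, and such arrays are determined by their entries on and above the
diagonal. -/
theorem conv_of_upper (hz : CRel n z) (hk : k ≤ n) (hvr : CRel n v)
    (hup : ∀ i j, i ≤ j → j ≤ n → φ (z i j) =
      conv (fun i j => amp (Fin k → ℕ) E (v i j)) (blockArr (legN k E) k) i j)
    (i j : ℕ) (hi : i ≤ n) (hj : j ≤ n) : φ (z i j) =
      conv (fun i j => amp (Fin k → ℕ) E (v i j)) (blockArr (legN k E) k) i j := by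
  have h2 : CRel n (conv (fun i j => amp (Fin k → ℕ) E (v i j)) (blockArr (legN k E) k)) := by
    refine (hvr.map (amp (Fin k → ℕ) E)).conv_word (legN_legList E hk) fun p hp i j => ?_
    obtain ⟨h, e⟩ := (mem_blockLegs _).1 hp
    rw [e]
    exact (DC_amp_legN _ _).symm
  exact (hz.map φ).ext_upper h2 hup i j hi hj

/-- The factorization is carried back along `e`. The last clause makes the step iterable: operators
which doubly commute with the array doubly commute with both of its factors. -/
theorem exists_splitting (e : H ≃ₗᵢ[ℂ] L2 (Fin k → ℕ) E) (hz : CRel n z) (hk : k ≤ n)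
    (hup : ∀ i j, i ≤ j → j ≤ n → e.conjStarAlgEquiv (z i j) =
      conv (fun i j => amp (Fin k → ℕ) E (v i j)) (blockArr (legN k E) k) i j)
    (hv : ∀ i j, j < i → v i j = star (oprod (fun a => v (skip i a) (skip j a)) 0 n))
    (hvb : Block n (k - 1) v)
    (hY : ∀ Y : H →L[ℂ] H, (∀ i j, i ≤ n → j ≤ n → DC Y (z i j)) →
      ∃ Y', e.conjStarAlgEquiv Y = amp (Fin k → ℕ) E Y' ∧
        ∀ i j, i ≤ n → j ≤ n → DC Y' (v i j)) :
    ∃ (s : ℕ → H →L[ℂ] H) (u : ℕ → ℕ → H →L[ℂ] H), CRel n u ∧ Block n (k - 1) u ∧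
      (∀ r < k, Nil (s r)) ∧ LegList n (blockLegs s k) ∧ (∀ r, DComm (s r) u) ∧
      (∀ i j, i ≤ n → j ≤ n → z i j = conv u (blockArr s k) i j) ∧
      ∀ Y : H →L[ℂ] H, (∀ i j, i ≤ n → j ≤ n → DC Y (z i j)) →
        (∀ r, DC Y (s r)) ∧ DComm Y u := by
  set φ : (H →L[ℂ] H) →⋆ₐ[ℂ] (L2 (Fin k → ℕ) E →L[ℂ] L2 (Fin k → ℕ) E) :=
    e.conjStarAlgEquiv.toStarAlgHom with hφ
  set ψ : (L2 (Fin k → ℕ) E →L[ℂ] L2 (Fin k → ℕ) E) →⋆ₐ[ℂ] (H →L[ℂ] H) :=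
    e.symm.conjStarAlgEquiv.toStarAlgHom with hψ
  have hψφ : ∀ T, ψ (φ T) = T := fun T => by
    ext g
    simp [hφ, hψ]
  -- The relations of `v` need no computation: `v` is the symbol of an array which satisfies them.
  have hvr : CRel n v := (hz.map φ).symbol fun _ _ hi hj => sym_of_upper φ hz hup hv hi hj
  have hc := conv_of_upper φ hz hk hvr hup
  set u₀ : ℕ → ℕ → H →L[ℂ] H := fun i j => ψ (amp (Fin k → ℕ) E (v i j)) with hu0
  -- Cutting off outside of `[0, n]` makes double commutation, known only for indices up to `n`,
  -- hold for all indices.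
  set u : ℕ → ℕ → H →L[ℂ] H := fun i j => if i ≤ n ∧ j ≤ n then u₀ i j else 0 with hu
  have hu₀ : ∀ i j, i ≤ n → j ≤ n → u₀ i j = u i j := fun i j hi hj => (if_pos ⟨hi, hj⟩).symm
  have hDu : ∀ Y, (∀ i j, i ≤ n → j ≤ n → DC Y (u₀ i j)) → DComm Y u := by
    intro Y h i j
    simp only [hu]
    split_ifs with hc
    · exact h i j hc.1 hc.2
    · exact DC.zero _
  have hL : LegList n (blockLegs (fun r => ψ (legN k E r)) k) := by
    refine blockLegs_legList _ hk (fun r _ => ?_) fun r hr r' hr' hne => DC.map ψ ?_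
    · rw [← map_star, ← map_mul, legN_mul_star, map_one]
    · rw [legN_of_lt hr, legN_of_lt hr']
      exact DC_legS fun h => hne (congrArg Fin.val h)
  refine ⟨fun r => ψ (legN k E r), u,
    CRel.congr ((hvr.map (amp (Fin k → ℕ) E)).map ψ) hu₀, ?_, ?_, hL, ?_, ?_, ?_⟩
  · intro i j hi hj hne hlt
    rw [← hu₀ i j hi hj, hu0]
    simp only
    rw [hvb i j hi hj hne hlt, map_zero, map_zero]
  · intro r hr
    refine Nil.of_conj e (T := legN k E r) (fun g => ?_) ?_
    · simp [hψ]
    · rw [legN_of_lt hr]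
      exact nil_legS _
  · exact fun r => hDu _ fun i j _ _ => DC.map ψ (DC_amp_legN _ _).symm
  · intro i j hi hj
    have h1 := congrArg ψ (hc i j hi hj)
    rw [hψφ, map_conv] at h1
    rw [h1]
    exact conv_congr hu₀ (fun i j _ _ => map_blockArr ψ _ k i j) i j hi hj
  · intro Y hYz
    obtain ⟨Y', h1, h2⟩ := hY Y hYz
    have hφY : ψ (amp (Fin k → ℕ) E Y') = Y := by
      rw [← h1]
      exact hψφ Y
    constructor
    · intro r
      have := DC.map ψ (DC_amp_legN (k := k) Y' r)
      rwa [hφY] at this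
    · refine hDu Y fun i j hi hj => ?_
      have := DC.map ψ (DC.map (amp (Fin k → ℕ) E) (h2 i j hi hj))
      rwa [hφY] at this

end transport

section peel
variable {H : Type} [NormedAddCommGroup H] [InnerProductSpace ℂ H] [CompleteSpace H]
  {n k : ℕ} {z : ℕ → ℕ → H →L[ℂ] H}

theorem exists_peelUpper (hz : CRel n z) (hb : Block n k z) (hk : k ≤ n) {i j : ℕ}
    (hij : i ≤ j) (hj : j ≤ n) : ∃ T : H →L[ℂ] H, peelUpper z k i j = compr (rowK z k) T ∧
      Commute T (z k 0) ∧ ∀ Y : H →L[ℂ] H, (∀ i j, i ≤ n → j ≤ n → DC Y (z i j)) → DC Y T := by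
  by_cases hjk : j < k
  · exact ⟨_, peelUpper_of_lt hij hjk, hz.commute_row_of_lt hk (by omega) (by omega) (by omega),
      fun Y hY => hY _ _ (by omega) (by omega)⟩
  rcases Nat.eq_or_lt_of_le hij with rfl | hlt
  · rcases Nat.eq_or_lt_of_le (not_lt.1 hjk) with rfl | hki
    · exact ⟨_, peelUpper_corner, Commute.refl _, fun Y hY => hY _ _ (by omega) (by omega)⟩
    · exact ⟨_, peelUpper_diag hki, hz.commute_diag_row hb hk hki hj (Nat.zero_le k),
        fun Y hY => hY _ _ (by omega) (by omega)⟩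
  · exact ⟨0, by rw [peelUpper_zero hlt (by omega), compr_zero], Commute.zero_left _,
      fun Y _ => DC.zero _⟩

theorem peelArr_of_le {i j : ℕ} (h : i ≤ j) : peelArr n z k i j = peelUpper z k i j := if_pos h

theorem peelArr_of_gt {i j : ℕ} (h : j < i) : peelArr n z k i j =
    star (oprod (fun a => peelUpper z k (skip i a) (skip j a)) 0 n) := if_neg (by omega)

theorem peelArr_block (hk0 : 0 < k) : Block n (k - 1) (peelArr n z k) := by
  intro i j hi hj hne hlt
  rcases lt_or_gt_of_ne hne with h | h
  · rw [peelArr_of_le h.le, peelUpper_zero h (by omega)]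
  -- The minor for an entry below the diagonal has the entry at `(i - 1, i)` as its factor in
  -- position `i - 1`, and this one vanishes since `i ≥ k`.
  · have e : skip i (i - 1) = i - 1 := if_pos (by omega)
    have e' : skip j (i - 1) = i := by rw [skip, if_neg (by omega)]; omega
    rw [peelArr_of_gt h, oprod_eq_zero (Nat.zero_le (i - 1)) (by omega : i - 1 < n)]
    · exact star_zero (rowK z k →L[ℂ] rowK z k)
    rw [e, e', peelUpper_zero (by omega) (by omega)]

theorem CRel.peelArr_DC (hz : CRel n z) (hb : Block n k z) (hk : k ≤ n) {Y : H →L[ℂ] H} (hY : ∀ i j, i ≤ n → j ≤ n → DC Y (z i j)) {i j : ℕ}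
    (hi : i ≤ n) (hj : j ≤ n) : DC (compr (rowK z k) Y) (peelArr n z k i j) := by
  have hup : ∀ i j, i ≤ j → j ≤ n → DC (compr (rowK z k) Y) (peelUpper z k i j) := by
    intro i j hij hj
    obtain ⟨T, e, hTc, hTY⟩ := exists_peelUpper hz hb hk hij hj
    have h0 := hY k 0 hk (Nat.zero_le n)
    rw [e]
    refine ⟨compr_commute _ (hTY Y hY).1 (fun g hg => hz.mem_rowK hb hk h0.1 hg)
      fun g hg => hz.mem_rowK hb hk hTc hg, ?_⟩
    rw [star_compr]
    exact compr_commute _ (hTY Y hY).2 (fun g hg => hz.mem_rowK hb hk h0.2 hg)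
      fun g hg => hz.mem_rowK hb hk hTc hg
  rcases le_or_gt i j with h | h
  · rw [peelArr_of_le h]
    exact hup i j h hj
  · rw [peelArr_of_gt h]
    exact DC.star_right (DC.oprod fun a _ ha => hup _ _ (skip_le_skip h a) (skip_le ha))

theorem CRel.conj_DC (hz : CRel n z) (hb : Block n k z) (hk : k ≤ n)
    (hT : Tower k (rowX z k) (star (z k 0))) {Y : H →L[ℂ] H} (hY : ∀ i j, i ≤ n → j ≤ n → DC Y (z i j)) :
    hT.conj Y = amp (Fin k → ℕ) (rowK z k) (compr (rowK z k) Y) :=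
  have h0 := (hY k 0 hk (Nat.zero_le n)).1
  hT.conj_eq_amp (fun l hl => (hY k (l + 1) hk (by omega)).1)
    (fun _ hg => hz.twist_comm hb hk h0 hg) fun _ hg => hz.mem_rowK hb hk h0 hg

/-- A `k`-block array whose last row consists of pure operators splits off the word
`k - 1, …, 0`. -/
theorem CRel.exists_peel (hz : CRel n z) (hb : Block n k z) (hk : k ≤ n) (hk0 : 0 < k)
    (hnil : ∀ j, 1 ≤ j → j ≤ k → Nil (star (z k j))) :
    ∃ (s : ℕ → H →L[ℂ] H) (u : ℕ → ℕ → H →L[ℂ] H), CRel n u ∧ Block n (k - 1) u ∧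
      (∀ r < k, Nil (s r)) ∧ LegList n (blockLegs s k) ∧ (∀ r, DComm (s r) u) ∧
      (∀ i j, i ≤ n → j ≤ n → z i j = conv u (blockArr s k) i j) ∧
      ∀ Y : H →L[ℂ] H, (∀ i j, i ≤ n → j ≤ n → DC Y (z i j)) →
        (∀ r, DC Y (s r)) ∧ DComm Y u := by
  have hT := hz.tower hb hk hnil
  refine exists_splitting (v := peelArr n z k) hT.equiv hz hk (fun i j hij hj => ?_)
    (fun i j h => ?_) (peelArr_block hk0)
    fun Y hY => ⟨_, hz.conj_DC hb hk hT hY, fun i j hi hj => hz.peelArr_DC hb hk hY hi hj⟩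
  · refine (hz.conj_upper hb hk hT hk0 hij hj).trans ?_
    refine Finset.sum_congr rfl fun l hl => ?_
    rw [Finset.uIcc_of_le hij, Finset.mem_Icc] at hl
    simp only [peelArr_of_le hl.1]
  · rw [peelArr_of_gt h]
    exact congrArg star (oprod_congr fun a _ _ => (peelArr_of_le (skip_le_skip h a)).symm)

end peel

/-! ### Pure coisometries. -/

section pure
variable {H : Type} [NormedAddCommGroup H] [InnerProductSpace ℂ H] [CompleteSpace H]

/-- The projections onto the layers `(star s)^d P`, with `P = 1 - star s * s`, add up to `1 - (star
s)^N s^N`, which tends strongly to `1`. -/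
theorem Nil.span_dense {s : H →L[ℂ] H} (hn : Nil s) (hs : s * star s = 1) :
    (Submodule.span ℂ {g | ∃ (d : ℕ) (h : H), g = (star s ^ d * (1 - star s * s)) h}
      ).topologicalClosure = ⊤ := by
  rw [eq_top_iff]
  intro h _
  have hsum : ∀ N, (∑ d ∈ Finset.range N, star s ^ d * (1 - star s * s) * s ^ d) =
      1 - star s ^ N * s ^ N := by
    intro N
    induction N with
    | zero => simp
    | succ N ih =>
      rw [Finset.sum_range_succ, ih, pow_succ, pow_succ']
      noncomm_ring
  have hstar : ‖star s‖ ≤ 1 := by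
    rw [norm_star]
    exact norm_le_one_of_coisometry hs
  have hlim : Tendsto (fun N => (1 - star s ^ N * s ^ N : H →L[ℂ] H) h) atTop (𝓝 h) := by
    have h0 : Tendsto (fun N => (star s ^ N) ((s ^ N) h)) atTop (𝓝 0) := by
      refine squeeze_zero_norm (fun N => norm_pow_apply_le hstar N _) ?_
      simpa using (hn h).norm
    have := (tendsto_const_nhds (x := h)).sub h0
    rw [sub_zero] at this
    exact this
  refine mem_closure_of_tendsto hlim (Eventually.of_forall fun N => ?_)
  rw [← hsum, ContinuousLinearMap.sum_apply]
  refine Submodule.sum_mem _ fun d _ => Submodule.subset_span ⟨d, (s ^ d) h, rfl⟩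

/-- The operator lowers the layer `(star s)^(d+1) P` to `(star s)^d P` and acts on the layer of `P`
as `Y`. So every vector of a layer reaches the bottom after finitely many steps, where the powers of
`Y` take over; for a contraction a total set suffices. -/
theorem Nil.coisometry_add {s A Y : H →L[ℂ] H} (hs : s * star s = 1) (hsn : Nil s) (hA : DC s A)
    (hY : DC s Y) (hYn : Nil Y) (hT : ‖s * A + (1 - star s * s) * Y‖ ≤ 1) :
    Nil (s * A + (1 - star s * s) * Y) := by
  set T := s * A + (1 - star s * s) * Y with hTdef
  set P := 1 - star s * s with hP
  have hsP : s * P = 0 := by rw [hP, mul_sub, mul_one, ← mul_assoc, hs, one_mul, sub_self]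
  have hPt : P * star s = 0 := by rw [hP, sub_mul, one_mul, mul_assoc, hs, mul_one, sub_self]
  have hPA : Commute P A := (Commute.one_left _).sub_left (hA.2.mul_left hA.1)
  have hPY : Commute P Y := (Commute.one_left _).sub_left (hY.2.mul_left hY.1)
  have hPP : P * P = P := isIdempotent_proj hs
  have e0 : T * P = P * Y := by
    rw [hTdef, add_mul, hA.1.eq, mul_assoc A, hsP, mul_zero, zero_add, hPY.eq, mul_assoc, hPP]
  have e1 : ∀ d, T * (star s ^ (d + 1) * P) = star s ^ d * P * A := by
    intro d
    have h1 : P * Y * (star s ^ (d + 1) * P) = 0 := by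
      rw [hPY.eq, pow_succ', mul_assoc Y, mul_assoc (star s), ← mul_assoc P, hPt, zero_mul,
        mul_zero]
    have h2 : s * A * (star s ^ (d + 1) * P) = star s ^ d * P * A := by
      have : Commute A (star s ^ (d + 1) * P) := (hA.2.symm.pow_right _).mul_right hPA.symm
      rw [mul_assoc, this.eq, pow_succ', mul_assoc (star s), ← mul_assoc s, ← mul_assoc s, hs,
        one_mul]
    rw [hTdef, add_mul, h1, h2, add_zero]
  have e2 : ∀ a, T ^ a * P = P * Y ^ a := by
    intro a
    induction a with
    | zero => simp
    | succ a ih => rw [pow_succ, mul_assoc, e0, ← mul_assoc, ih, mul_assoc, ← pow_succ]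
  have e3 : ∀ d, T ^ d * (star s ^ d * P) = P * A ^ d := by
    intro d
    induction d with
    | zero => simp
    | succ d ih =>
      rw [pow_succ T, mul_assoc, e1, ← mul_assoc, ih, mul_assoc, ← pow_succ]
  refine Nil.of_total hT (hsn.span_dense hs) ?_
  rintro g ⟨d, h, rfl⟩
  rw [← tendsto_add_atTop_iff_nat d]
  have e4 : ∀ a, (T ^ (a + d)) ((star s ^ d * P) h) = P ((Y ^ a) ((A ^ d) h)) := by
    intro a
    have : T ^ (a + d) * (star s ^ d * P) = P * Y ^ a * A ^ d := by
      rw [pow_add, mul_assoc, e3, ← mul_assoc, e2]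
    exact DFunLike.congr_fun this h
  refine Tendsto.congr (fun a => (e4 a).symm) ?_
  have := (P.continuous.tendsto 0).comp (hYn ((A ^ d) h))
  rwa [map_zero] at this

theorem Nil.mul_left {s A : H →L[ℂ] H} (hs : Nil s) (hA : ‖A‖ ≤ 1) (h : Commute s A) :
    Nil (s * A) := fun g => by
  refine squeeze_zero_norm (a := fun a => ‖(s ^ a) g‖) (fun a => ?_) ?_
  · rw [h.mul_pow, (h.pow_pow a a).eq]
    exact norm_pow_apply_le hA a _
  · simpa using (hs g).norm

theorem CRel.norm_le_one {n : ℕ} {u : ℕ → ℕ → H →L[ℂ] H} (hu : CRel n u) {i j : ℕ} (hi : i ≤ n)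
    (hj : j ≤ n) : ‖u i j‖ ≤ 1 := by
  rcases subsingleton_or_nontrivial H with h | h
  · rw [Subsingleton.elim (u i j) 0, norm_zero]
    exact zero_le_one
  · have : CrystalRelations (n := n) fun i j => u i j :=
      (crystalRelations_iff fun _ _ => rfl).2 hu
    exact this.norm_le_one ⟨i, by omega⟩ ⟨j, by omega⟩

end pure

section blocks
variable {B : Type*} [Ring B] [StarRing B]

theorem blockLegs_congr {s s' : ℕ → B} {k : ℕ} (h : ∀ r < k, s r = s' r) :
    blockLegs s k = blockLegs s' k := by
  induction k with
  | zero => rfl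
  | succ k ih => rw [blockLegs, blockLegs, ih fun r hr => h r (by omega), h k (by omega)]

theorem exists_blockLegs {k : ℕ} {L : List (ℕ × B)}
    (h : L.map Prod.fst = (List.range k).reverse) : ∃ s, L = blockLegs s k := by
  induction k generalizing L with
  | zero => exact ⟨fun _ => 0, by simpa [blockLegs] using h⟩
  | succ k ih =>
    rw [List.range_succ, List.reverse_append, List.reverse_singleton, List.singleton_append] at h
    obtain ⟨p, L, rfl⟩ : ∃ p L', L = p :: L' := by
      cases L with
      | nil => simp at h
      | cons p L => exact ⟨p, L, rfl⟩
    rw [List.map_cons, List.cons.injEq] at h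
    obtain ⟨s, rfl⟩ := ih h.2
    refine ⟨Function.update s k p.2, ?_⟩
    rw [blockLegs, Function.update_self, ← h.1]
    refine congrArg _ (blockLegs_congr fun r hr => ?_)
    rw [Function.update_of_ne (by omega)]

theorem act_blockLegs_last (s : ℕ → B) (u : ℕ → ℕ → B) (k j : ℕ) :
    act (blockLegs s (k + 1)) u (k + 1) j = star (s k) * u (k + 1) j +
      if j ≤ k then (1 - star (s k) * s k) * act (blockLegs s k) u k j else 0 := by
  rw [blockLegs, act_cons, conv_simple, if_neg (by omega), if_pos rfl,
    act_blockLegs_of_gt _ (Nat.lt_succ_self k)]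

theorem block_act {n k : ℕ} {u : ℕ → ℕ → B} (hu : Block n k u) (s : ℕ → B) :
    Block n k (act (blockLegs s k) u) := by
  intro i j hi hj hne hlt
  by_cases hik : k < i
  · rw [act_blockLegs_of_gt _ hik, hu i j hi hj hne hlt]
  · rw [act_eq]
    refine Finset.sum_eq_zero fun l hl => ?_
    rw [Finset.uIcc_of_le (by omega), Finset.mem_Icc] at hl
    by_cases hlj : l = j
    · subst hlj
      have : blockArr s k i l = 0 := by
        rcases Nat.lt_or_ge (i + 1) l with h | h
        · exact blockArr_upper s h
        · obtain rfl : l = i + 1 := by omega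
          rw [blockArr_super, if_neg (by omega)]
      exact mul_eq_zero_of_left this _
    · rw [hu l j (by omega) hj hlj (by omega), mul_zero]

theorem LegList.of_append {n : ℕ} {L L' : List (ℕ × B)} (h : LegList n (L ++ L')) :
    LegList n L ∧ LegList n L' ∧ ∀ p ∈ L, ∀ q ∈ L', DC p.2 q.2 := by
  obtain ⟨h1, h2, h3⟩ := List.pairwise_append.1 h.pairwise
  exact ⟨⟨fun p hp => h.lt p (by simp [hp]), fun p hp => h.coisom p (by simp [hp]), h1⟩,
    ⟨fun p hp => h.lt p (by simp [hp]), fun p hp => h.coisom p (by simp [hp]), h2⟩, h3⟩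

theorem LegList.append {n : ℕ} {L L' : List (ℕ × B)} (h : LegList n L) (h' : LegList n L')
    (hc : ∀ p ∈ L, ∀ q ∈ L', DC p.2 q.2) : LegList n (L ++ L') where
  lt p hp := (List.mem_append.1 hp).elim (h.lt p) (h'.lt p)
  coisom p hp := (List.mem_append.1 hp).elim (h.coisom p) (h'.coisom p)
  pairwise := List.pairwise_append.2 ⟨h.pairwise, h'.pairwise, hc⟩

end blocks

/-! ### Absorption of an array by the longest word. -/

section absorb
variable {H : Type} [NormedAddCommGroup H] [InnerProductSpace ℂ H] [CompleteSpace H] {n : ℕ}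

/-- The adjoint of the entry in the last row is `s A + (1 - star s * s) Y`, where `Y` is the adjoint
of the corresponding entry for the shorter block; so `Nil.coisometry_add` applies inductively. In
the last column it is the pure `s` times a commuting contraction. -/
theorem nil_block_row {u : ℕ → ℕ → H →L[ℂ] H} (hu : CRel n u) (s : ℕ → H →L[ℂ] H) {k : ℕ}
    (hk : k ≤ n) (hL : LegList n (blockLegs s k)) (hN : ∀ r < k, Nil (s r))
    (hc : ∀ r < k, DComm (s r) u) {j : ℕ} (hj : 1 ≤ j) (hjk : j ≤ k) :
    Nil (star (act (blockLegs s k) u k j)) := by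
  induction k with
  | zero => omega
  | succ k ih =>
    have hlt := Nat.lt_succ_self k
    have hs : s k * star (s k) = 1 := hL.coisom (k, s k) (by simp [blockLegs])
    have hA : DC (s k) (star (u (k + 1) j)) := DC.star_right (hc k hlt (k + 1) j)
    rcases Nat.eq_or_lt_of_le hjk with rfl | hjk'
    · rw [act_blockLegs_last, if_neg (by omega), add_zero, star_mul, star_star, ← hA.1.eq]
      refine Nil.mul_left (hN k hlt) ?_ hA.1
      rw [norm_star]
      exact hu.norm_le_one hk hk
    · have hL' : LegList n (blockLegs s k) := hL.tail
      have hY : DC (s k) (star (act (blockLegs s k) u k j)) := by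
        refine DC.star_right (DComm.act (fun p hp => ?_) (hc k hlt) k j)
        exact (List.pairwise_cons.1 hL.pairwise).1 p hp
      have hP : Commute (1 - star (s k) * s k) (star (act (blockLegs s k) u k j)) :=
        (Commute.one_left _).sub_left (hY.2.mul_left hY.1)
      have e : star (act (blockLegs s (k + 1)) u (k + 1) j) = s k * star (u (k + 1) j) +
          (1 - star (s k) * s k) * star (act (blockLegs s k) u k j) := by
        rw [act_blockLegs_last, if_pos (by omega), star_add, star_mul, star_mul, star_star,
          ← hA.1.eq, star_proj, hP.eq]
      have hcr : CRel n (act (blockLegs s (k + 1)) u) := hu.act hL fun p hp => by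
        obtain ⟨h1, h2⟩ := (mem_blockLegs s).1 hp
        rw [h2]
        exact hc _ h1
      have hn := hcr.norm_le_one hk (by omega : j ≤ n)
      rw [← norm_star, e] at hn
      rw [e]
      exact Nil.coisometry_add hs (hN k hlt) hA hY
        (ih (by omega) hL' (fun r hr => hN r (by omega)) (fun r hr => hc r (by omega))
          (by omega)) hn

/-- An array acted upon by pure legs along the longest word is a diagonal array acted upon from
the right. -/
theorem exists_absorption {m : ℕ} (hm : m ≤ n) {u : ℕ → ℕ → H →L[ℂ] H} (hu : CRel n u)
    (hb : Block n m u) {A : List (ℕ × (H →L[ℂ] H))} (hA : A.map Prod.fst = lw m)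
    (hL : LegList n A) (hN : ∀ p ∈ A, Nil p.2) (hc : ∀ p ∈ A, DComm p.2 u) :
    ∃ (D : ℕ → ℕ → H →L[ℂ] H) (L : List (ℕ × (H →L[ℂ] H))), CRel n D ∧ Block n 0 D ∧
      L.map Prod.fst = lw m ∧ LegList n L ∧ (∀ p ∈ L, Nil p.2) ∧ (∀ p ∈ L, DComm p.2 D) ∧
      (∀ i j, i ≤ n → j ≤ n → act A u i j = conv D (wordArr L) i j) ∧
      ∀ Y : H →L[ℂ] H, (∀ p ∈ A, DC Y p.2) → DComm Y u → (∀ p ∈ L, DC Y p.2) ∧ DComm Y D := by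
  induction m generalizing u A with
  | zero =>
    have : A = [] := by simpa [lw] using hA
    subst this
    refine ⟨u, [], hu, hb, rfl, hL, by simp, by simp, fun i j _ _ => ?_, fun Y h1 h2 => ⟨h1, h2⟩⟩
    rw [wordArr, act_nil, act_nil, conv_id]
  | succ m ih =>
    rw [lw_succ, List.map_eq_append_iff] at hA
    obtain ⟨A₁, A₂, rfl, hA1, hA2⟩ := hA
    obtain ⟨s, rfl⟩ := exists_blockLegs hA2
    obtain ⟨hL1, hL2, hL12⟩ := hL.of_append
    have hmem : ∀ r < m + 1, (r, s r) ∈ blockLegs s (m + 1) := fun r hr =>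
      (mem_blockLegs s).2 ⟨hr, rfl⟩
    -- The last block of the word acts on `u` first. The result is peeled, which moves a block to
    -- the right, and the other letters then act on the peeled array, which is a smaller block.
    set x := act (blockLegs s (m + 1)) u with hx
    have hxr : CRel n x := hu.act hL2 fun p hp => hc p (by simp [hp])
    obtain ⟨s', u', hu', hb', hN', hL', hc', hxe, hY'⟩ := hxr.exists_peel (block_act hb s) hm
      (Nat.succ_pos m) fun j hj hjm => nil_block_row hu s hm hL2
        (fun r hr => hN _ (List.mem_append_right _ (hmem r hr)))
        (fun r hr => hc _ (List.mem_append_right _ (hmem r hr))) hj hjm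
    have hYx : ∀ Y : H →L[ℂ] H, (∀ p ∈ blockLegs s (m + 1), DC Y p.2) → DComm Y u →
        ∀ i j, DC Y (x i j) := fun Y h1 h2 => DComm.act h1 h2
    have hA1x : ∀ p ∈ A₁, (∀ r, DC p.2 (s' r)) ∧ DComm p.2 u' := fun p hp =>
      hY' _ fun i j _ _ => hYx _ (hL12 p hp) (hc p (by simp [hp])) i j
    obtain ⟨D, L, hD, hDb, hLw, hLL, hLN, hLD, he, hYL⟩ := ih (by omega) hu' hb' hA1 hL1
      (fun p hp => hN p (by simp [hp])) fun p hp => (hA1x p hp).2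
    have hs' : ∀ r, (∀ p ∈ L, DC (s' r) p.2) ∧ DComm (s' r) D := fun r =>
      hYL _ (fun p hp => ((hA1x p hp).1 r).symm) (hc' r)
    refine ⟨D, L ++ blockLegs s' (m + 1), hD, hDb, ?_, ?_, ?_, ?_, ?_, ?_⟩
    · rw [List.map_append, hLw, blockLegs_map, lw_succ]
    · refine hLL.append hL' fun p hp q hq => ?_
      obtain ⟨_, e⟩ := (mem_blockLegs s').1 hq
      rw [e]
      exact ((hs' _).1 p hp).symm
    · intro p hp
      rcases List.mem_append.1 hp with h | h
      · exact hLN p h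
      · obtain ⟨h1, e⟩ := (mem_blockLegs s').1 h
        rw [e]
        exact hN' _ h1
    · intro p hp
      rcases List.mem_append.1 hp with h | h
      · exact hLD p h
      · obtain ⟨h1, e⟩ := (mem_blockLegs s').1 h
        rw [e]
        exact (hs' _).2
    · intro i j hi hj
      have e1 : conv D (wordArr (L ++ blockLegs s' (m + 1))) =
          conv (conv D (wordArr L)) (blockArr s' (m + 1)) := by
        rw [wordArr, act_append, act_eq, ← conv_assoc]
        rfl
      rw [act_append, ← hx, e1,
        act_congr A₁ (y' := conv u' (blockArr s' (m + 1))) hxe i j hi hj, ← conv_act]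
      exact conv_congr he (fun _ _ _ _ => rfl) i j hi hj
    · intro Y h1 h2
      obtain ⟨h3, h4⟩ := hY' Y fun i j _ _ =>
        hYx Y (fun p hp => h1 p (by simp [hp])) h2 i j
      obtain ⟨h5, h6⟩ := hYL Y (fun p hp => h1 p (by simp [hp])) h4
      refine ⟨fun p hp => ?_, h6⟩
      rcases List.mem_append.1 hp with h | h
      · exact h5 p h
      · obtain ⟨_, e⟩ := (mem_blockLegs s').1 h
        rw [e]
        exact h3 _

end absorb

/-! ### Diagonal crystal arrays. -/

section diagonal
variable {B : Type*} [Ring B] [StarRing B] {n : ℕ} {D : ℕ → ℕ → B}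

theorem Block.mono {k l : ℕ} {z : ℕ → ℕ → B} (h : Block n k z) (hkl : k ≤ l) : Block n l z :=
  fun i j hi hj hne hlt => h i j hi hj hne (by omega)

theorem Block.diag (h : Block n 0 D) {i j : ℕ} (hi : i ≤ n) (hj : j ≤ n) (hne : i ≠ j) :
    D i j = 0 := h i j hi hj hne (by omega)

theorem CRel.diag_mul_star (hD : CRel n D) (hb : Block n 0 D) {i : ℕ} (hi : i ≤ n) :
    D i i * star (D i i) = 1 := by
  rw [← hD.row_sum_one hi]
  rw [Finset.sum_eq_single_of_mem i (Finset.self_mem_range_succ i)]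
  intro j hj hne
  rw [Finset.mem_range] at hj
  rw [hb.diag hi (by omega) hne.symm, zero_mul]

theorem CRel.star_mul_diag (hD : CRel n D) (hb : Block n 0 D) {i : ℕ} (hi : i ≤ n) :
    star (D i i) * D i i = 1 := by
  rw [hD.star_row_mul_self (hb.mono (Nat.zero_le i)) hi le_rfl, hD.row_sum_one hi]

theorem conv_diag (hb : Block n 0 D) (y : ℕ → ℕ → B) {i j : ℕ} (hi : i ≤ n) (hj : j ≤ n) :
    conv D y i j = D i i * y i j := by
  refine Finset.sum_eq_single_of_mem i Finset.left_mem_uIcc fun l hl hne => ?_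
  rw [Finset.uIcc, Finset.mem_Icc] at hl
  rw [hb.diag hi (hl.2.trans (sup_le hi hj)) hne.symm, zero_mul]

theorem wordArr_of_lt {L : List (ℕ × B)} {m : ℕ} (hL : ∀ p ∈ L, p.1 < m) {i j : ℕ}
    (h : m < max i j) : wordArr L i j = idArr i j := by
  induction L generalizing i j with
  | nil => rfl
  | cons p L ih =>
    have hp := hL p (by simp)
    have ih' : ∀ {i j : ℕ}, m < max i j → act L idArr i j = idArr i j := fun h =>
      ih (fun q hq => hL q (by simp [hq])) h
    rw [wordArr, act_cons, conv_simple]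
    split_ifs with h1 h2 h3 h4
    · rw [ih' (by omega), ih' (by omega), idArr, idArr, idArr, if_neg (by omega),
        if_neg (by omega), if_neg (by omega), mul_zero, mul_zero, add_zero]
    · omega
    · omega
    · rw [ih' (by omega), idArr, idArr, if_neg (by omega), if_neg (by omega), mul_zero, add_zero]
    · exact ih' h

theorem lt_of_map_eq {L : List (ℕ × B)} {m : ℕ} (hL : L.map Prod.fst = lw m) :
    ∀ p ∈ L, p.1 < m := fun p hp =>
  lw_lt _ (by rw [← hL]; exact List.mem_map_of_mem hp)

end diagonal

/-! ### Invariant subspaces and the vacuum. -/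

section invariant
variable {H : Type} [NormedAddCommGroup H] [InnerProductSpace ℂ H] [CompleteSpace H]

/-- The span of the images of `N` under the powers of `t`. No closure is taken, and operators
commuting with `t` keep acting on it. -/
theorem exists_closure {N M : Submodule ℂ H} {t : H →L[ℂ] H} (hN : N ≤ M)
    (ht : ∀ g ∈ M, t g ∈ M) : ∃ N' : Submodule ℂ H, N ≤ N' ∧ N' ≤ M ∧ (∀ g ∈ N', t g ∈ N') ∧
      ∀ Y : H →L[ℂ] H, Commute Y t → (∀ g ∈ N, Y g ∈ N) → ∀ g ∈ N', Y g ∈ N' := by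
  have hpow : ∀ a : ℕ, ∀ g ∈ M, (t ^ a) g ∈ M := by
    intro a
    induction a with
    | zero => simp
    | succ a ih =>
      intro g hg
      rw [pow_succ']
      exact ht _ (ih g hg)
  refine ⟨Submodule.span ℂ {h | ∃ (a : ℕ) (g : H), g ∈ N ∧ h = (t ^ a) g}, ?_, ?_, ?_, ?_⟩
  · exact fun g hg => Submodule.subset_span ⟨0, g, hg, rfl⟩
  · refine Submodule.span_le.2 ?_
    rintro _ ⟨a, g, hg, rfl⟩
    exact hpow a g (hN hg)
  · intro g hg
    induction hg using Submodule.span_induction with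
    | mem x hx =>
      obtain ⟨a, g, hg, rfl⟩ := hx
      refine Submodule.subset_span ⟨a + 1, g, hg, ?_⟩
      rw [pow_succ']
      rfl
    | zero => simp
    | add x y _ _ hx hy => rw [map_add]; exact Submodule.add_mem _ hx hy
    | smul c x _ hx => rw [map_smul]; exact Submodule.smul_mem _ c hx
  · intro Y hY hYN g hg
    induction hg using Submodule.span_induction with
    | mem x hx =>
      obtain ⟨a, g, hg, rfl⟩ := hx
      exact Submodule.subset_span ⟨a, Y g, hYN g hg, DFunLike.congr_fun (hY.pow_right a).eq g⟩
    | zero => simp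
    | add x y _ _ hx hy => rw [map_add]; exact Submodule.add_mem _ hx hy
    | smul c x _ hx => rw [map_smul]; exact Submodule.smul_mem _ c hx

/-- The entry is `star (s j)` preceded by the projections of the later legs, which act trivially on
vectors killed by those legs. -/
theorem blockArr_last_apply {s : ℕ → H →L[ℂ] H} {j k : ℕ} (hjk : j < k)
    (hc : ∀ r, j < r → r < k → DC (s r) (s j)) {g : H}
    (hg : ∀ r, j < r → r < k → s r g = 0) : blockArr s k k (j + 1) g = star (s j) g := by
  induction k with
  | zero => omega
  | succ k ih =>
    rcases Nat.eq_or_lt_of_le (Nat.lt_succ_iff.1 hjk) with rfl | h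
    · rw [blockArr_last_self]
    · rw [blockArr_last s k (j + 1) h, ContinuousLinearMap.mul_apply,
        ih h (fun r h1 h2 => hc r h1 (by omega)) (fun r h1 h2 => hg r h1 (by omega)),
        ContinuousLinearMap.sub_apply, ContinuousLinearMap.mul_apply]
      have e : s k (star (s j) g) = star (s j) (s k g) :=
        DFunLike.congr_fun (hc k h (Nat.lt_succ_self k)).star_right.1.eq g
      rw [e, hg k h (Nat.lt_succ_self k), map_zero, map_zero]
      exact sub_zero _

theorem LegList.block_DC {B : Type*} [Ring B] [StarRing B] {n k : ℕ} {s : ℕ → B}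
    (h : LegList n (blockLegs s k)) :
    ∀ r < k, ∀ r' < k, r ≠ r' → DC (s r) (s r') := by
  induction k with
  | zero => omega
  | succ k ih =>
    have h1 : ∀ r < k, DC (s k) (s r) := fun r hr =>
      (List.pairwise_cons.1 h.pairwise).1 (r, s r) ((mem_blockLegs s).2 ⟨hr, rfl⟩)
    intro r hr r' hr' hne
    rcases Nat.eq_or_lt_of_le (Nat.lt_succ_iff.1 hr) with rfl | hrk
    · exact h1 r' (by omega)
    · rcases Nat.eq_or_lt_of_le (Nat.lt_succ_iff.1 hr') with rfl | hrk'
      · exact (h1 r hrk).symm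
      · exact ih h.tail r hrk r' hrk' hne

theorem oprod_invariant {M : Submodule ℂ H} {f : ℕ → H →L[ℂ] H} {b : ℕ}
    (h : ∀ a < b, ∀ g ∈ M, f a g ∈ M ∧ star (f a) g ∈ M) :
    ∀ g ∈ M, oprod f 0 b g ∈ M ∧ star (oprod f 0 b) g ∈ M := by
  induction b with
  | zero =>
    intro g hg
    rw [oprod_self, star_one]
    exact ⟨hg, hg⟩
  | succ b ih =>
    intro g hg
    rw [oprod_succ (Nat.zero_le b), star_mul]
    exact ⟨(ih (fun a ha => h a (by omega)) _ (h b (Nat.lt_succ_self b) g hg).1).1,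
      (h b (Nat.lt_succ_self b) _ (ih (fun a ha => h a (by omega)) g hg).2).2⟩

/-- A submodule invariant under the array of the longest word and its adjoint contains, with
every vector killed by all legs, everything obtained from it by the adjoints of the legs. -/
theorem exists_invariant {n m : ℕ} (hm : m ≤ n) {D : ℕ → ℕ → H →L[ℂ] H} (hD : CRel n D)
    (hDb : Block n 0 D) {A : List (ℕ × (H →L[ℂ] H))} (hA : A.map Prod.fst = lw m)
    (hL : LegList n A) (hc : ∀ p ∈ A, DComm p.2 D) {M : Submodule ℂ H}
    (hMD : ∀ i ≤ n, ∀ g ∈ M, D i i g ∈ M ∧ star (D i i) g ∈ M)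
    (hMz : ∀ i j, i ≤ n → j ≤ n → ∀ g ∈ M, conv D (wordArr A) i j g ∈ M ∧
      star (conv D (wordArr A) i j) g ∈ M) {f : H} (hf : f ∈ M) (hf0 : ∀ p ∈ A, p.2 f = 0) :
    ∃ N ≤ M, f ∈ N ∧ ∀ p ∈ A, ∀ g ∈ N, star p.2 g ∈ N := by
  induction m generalizing A M with
  | zero =>
    have : A = [] := by simpa [lw] using hA
    subst this
    exact ⟨M, le_rfl, hf, by simp⟩
  | succ m ih =>
    rw [lw_succ, List.map_eq_append_iff] at hA
    obtain ⟨A₁, A₂, rfl, hA1, hA2⟩ := hA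
    obtain ⟨s, rfl⟩ := exists_blockLegs hA2
    obtain ⟨hL1, hL2, hL12⟩ := hL.of_append
    have hmem : ∀ r < m + 1, (r, s r) ∈ blockLegs s (m + 1) := fun r hr =>
      (mem_blockLegs s).2 ⟨hr, rfl⟩
    have hss : ∀ r < m + 1, ∀ r' < m + 1, r ≠ r' → DC (s r) (s r') :=
      hL2.block_DC
    have hcs : ∀ r < m + 1, DComm (s r) D := fun r hr =>
      hc (r, s r) (List.mem_append_right _ (hmem r hr))
    have hcA : ∀ r < m + 1, ∀ p ∈ A₁, DC (s r) p.2 := fun r hr p hp =>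
      (hL12 p hp _ (hmem r hr)).symm
    set u := conv D (wordArr A₁) with hu
    have hur : CRel n u := hD.conv_word hL1 fun p hp => hc p (by simp [hp])
    have hus : ∀ r < m + 1, DComm (s r) u := fun r hr =>
      DComm.conv (hcs r hr) (DComm.act (hcA r hr) (DComm.idArr _))
    have hu1 : ∀ i j, i ≤ n → j ≤ n → m < max i j → u i j = D i i * idArr i j :=
      fun i j hi hj h => by rw [hu, conv_diag hDb _ hi hj, wordArr_of_lt (lt_of_map_eq hA1) h]
    have hz : conv D (wordArr (A₁ ++ blockLegs s (m + 1))) = conv u (blockArr s (m + 1)) := by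
      rw [wordArr, act_append, act_eq, ← conv_assoc]
      rfl
    rw [hz] at hMz
    -- The vectors of `M` killed by all legs of the last block. The induction hypothesis is applied
    -- to them and to `u`, the array without this block.
    set M₀ : Submodule ℂ H :=
      M ⊓ ⨅ r : Fin (m + 1), LinearMap.ker (s r : H →ₗ[ℂ] H) with hM0
    have hM₀ : ∀ g, g ∈ M₀ ↔ g ∈ M ∧ ∀ r < m + 1, s r g = 0 := by
      intro g
      rw [hM0, Submodule.mem_inf, Submodule.mem_iInf, Fin.forall_iff]
      rfl
    have hker : ∀ {T : H →L[ℂ] H} {g : H} {r : ℕ}, Commute (s r) T → s r g = 0 →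
        s r (T g) = 0 := fun {T g r} h h0 => by
      have := DFunLike.congr_fun h.eq g
      rw [ContinuousLinearMap.mul_apply, ContinuousLinearMap.mul_apply, h0, map_zero] at this
      exact this
    have hM₀D : ∀ i ≤ n, ∀ g ∈ M₀, D i i g ∈ M₀ ∧ star (D i i) g ∈ M₀ := by
      intro i hi g hg
      rw [hM₀] at hg
      rw [hM₀, hM₀]
      exact ⟨⟨(hMD i hi g hg.1).1, fun r hr => hker (hcs r hr i i).1 (hg.2 r hr)⟩,
        (hMD i hi g hg.1).2, fun r hr => hker (DC.star_right (hcs r hr i i)).1 (hg.2 r hr)⟩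
    have hup : ∀ i j, i ≤ j → j ≤ n → ∀ g ∈ M₀, u i j g ∈ M₀ ∧ star (u i j) g ∈ M₀ := by
      intro i j hij hj g hg
      by_cases hjm : j < m + 1
      · rw [hM₀] at hg
        have hPg : (1 - star (s j) * s j) g = g := by
          rw [ContinuousLinearMap.sub_apply, ContinuousLinearMap.mul_apply, hg.2 j hjm, map_zero]
          exact sub_zero _
        -- Among vectors killed by the last block only the term with the projection survives, so
        -- column `j + 1` of the full array acts as column `j` of `u`.
        have e1 : conv u (blockArr s (m + 1)) i (j + 1) g = u i j g ∧
            star (conv u (blockArr s (m + 1)) i (j + 1)) g = star (u i j) g := by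
          rw [conv_blockArr_upper _ _ _ hij, if_pos hjm]
          have e2 : u i (j + 1) * blockArr s (m + 1) (j + 1) (j + 1) =
              if j + 1 < m + 1 then u i (j + 1) * s (j + 1) * star (s j) else 0 := by
            split_ifs with h
            · rw [blockArr_diag_succ, if_pos h, if_pos hjm, mul_assoc]
            · rw [hu1 i (j + 1) (by omega) (by omega) (by omega), idArr, if_neg (by omega),
                mul_zero, zero_mul]
          rw [e2]
          split_ifs with h
          · have hj1 : DC (s j) (s (j + 1)) := hss j hjm (j + 1) h (by omega)
            have e3 : s (j + 1) (star (s j) g) = 0 := hker hj1.symm.star_right.1 (hg.2 _ h)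
            have e4 : s j (star (s (j + 1)) (star (u i (j + 1)) g)) = 0 :=
              hker hj1.star_right.1 (hker (DC.star_right (hus j hjm i (j + 1))).1 (hg.2 j hjm))
            constructor
            · change u i j ((1 - star (s j) * s j) g) + u i (j + 1) (s (j + 1) (star (s j) g)) = _
              rw [hPg, e3, map_zero, add_zero]
            · have e5 : (1 - star (s j) * s j) (star (u i j) g) = star (u i j) g := by
                change star (u i j) g - star (s j) (s j (star (u i j) g)) = _
                rw [hker (DC.star_right (hus j hjm i j)).1 (hg.2 j hjm), map_zero, sub_zero]
              rw [star_add, star_mul, star_proj, star_mul, star_mul, star_star]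
              change (1 - star (s j) * s j) (star (u i j) g) +
                s j (star (s (j + 1)) (star (u i (j + 1)) g)) = _
              rw [e4, e5, add_zero]
          · rw [add_zero, star_mul, star_proj]
            constructor
            · change u i j ((1 - star (s j) * s j) g) = _
              rw [hPg]
            · change star (u i j) g - star (s j) (s j (star (u i j) g)) = _
              rw [hker (DC.star_right (hus j hjm i j)).1 (hg.2 j hjm), map_zero, sub_zero]
        have := hMz i (j + 1) (by omega) (by omega) g hg.1
        rw [e1.1, e1.2] at this
        rw [hM₀, hM₀]
        exact ⟨⟨this.1, fun r hr => hker (hus r hr i j).1 (hg.2 r hr)⟩,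
          this.2, fun r hr => hker (DC.star_right (hus r hr i j)).1 (hg.2 r hr)⟩
      · rw [hu1 i j (by omega) hj (by omega), idArr]
        split_ifs
        · rw [mul_one]
          exact hM₀D i (by omega) g hg
        · simp
    have hdown : ∀ i j, i ≤ n → j ≤ n → ∀ g ∈ M₀, u i j g ∈ M₀ ∧ star (u i j) g ∈ M₀ := by
      intro i j hi hj g hg
      rcases le_or_gt i j with h | h
      · exact hup i j h hj g hg
      · have := oprod_invariant (f := fun a => u (skip i a) (skip j a)) (b := n)
          (fun a ha => hup _ _ (skip_le_skip h a) (skip_le ha)) g hg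
        rw [← hur.star_eq i j hi hj, star_star] at this
        exact this.symm
    have hfM₀ : f ∈ M₀ := (hM₀ f).2 ⟨hf, fun r hr => hf0 _ (List.mem_append_right _ (hmem r hr))⟩
    obtain ⟨N₁, hN1, hfN, hN1s⟩ := ih (by omega) hA1 hL1 (fun p hp => hc p (by simp [hp]))
      hM₀D hdown hfM₀ fun p hp => hf0 p (by simp [hp])
    -- The legs of the block are adjoined in increasing order: on vectors killed by the legs after
    -- `j`, row `m + 1` of the array supplies `star (s j)`.
    have key : ∀ j ≤ m + 1, ∃ N : Submodule ℂ H, f ∈ N ∧ (∀ g ∈ N, g ∈ M ∧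
        ∀ r, j ≤ r → r < m + 1 → s r g = 0) ∧ (∀ p ∈ A₁, ∀ g ∈ N, star p.2 g ∈ N) ∧
        ∀ r < j, ∀ g ∈ N, star (s r) g ∈ N := by
      intro j
      induction j with
      | zero =>
        intro _
        exact ⟨N₁, hfN, fun g hg => ⟨((hM₀ g).1 (hN1 hg)).1, fun r _ hr =>
          ((hM₀ g).1 (hN1 hg)).2 r hr⟩, hN1s, by simp⟩
      | succ j ihj =>
        intro hj
        obtain ⟨N, h1, h2, h3, h4⟩ := ihj (by omega)
        set M' : Submodule ℂ H := M ⊓ ⨅ r : Fin (m + 1), ⨅ _ : j + 1 ≤ r,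
          LinearMap.ker (s r : H →ₗ[ℂ] H) with hM'
        have hM'' : ∀ g, g ∈ M' ↔ g ∈ M ∧ ∀ r, j + 1 ≤ r → r < m + 1 → s r g = 0 := by
          intro g
          simp only [hM', Submodule.mem_inf, Submodule.mem_iInf, Fin.forall_iff]
          exact and_congr_right fun _ => ⟨fun h r h1 h2 => h r h2 h1, fun h r h2 h1 => h r h1 h2⟩
        have ht : ∀ g ∈ M', star (s j) g ∈ M' := by
          intro g hg
          rw [hM''] at hg ⊢
          refine ⟨?_, fun r hr hrm =>
            hker (DC.star_right (hss r hrm j hj (by omega))).1 (hg.2 r hr hrm)⟩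
          -- Applying `star (D (m + 1) (m + 1))` first cancels the unitary in front of the row.
          have e : conv u (blockArr s (m + 1)) (m + 1) (j + 1) (star (D (m + 1) (m + 1)) g) =
              star (s j) g := by
            have e1 : conv u (blockArr s (m + 1)) (m + 1) (j + 1) =
                D (m + 1) (m + 1) * blockArr s (m + 1) (m + 1) (j + 1) := by
              have : u (m + 1) (m + 1) = D (m + 1) (m + 1) := by
                rw [hu1 _ _ hm hm (by omega), idArr, if_pos rfl, mul_one]
              rw [← this]
              refine Finset.sum_eq_single_of_mem (m + 1) Finset.left_mem_uIcc fun l hl hne => ?_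
              rw [Finset.uIcc_of_ge (by omega), Finset.mem_Icc] at hl
              rw [hu1 _ _ hm (by omega) (by omega), idArr, if_neg (by omega), mul_zero, zero_mul]
            rw [e1, ContinuousLinearMap.mul_apply, blockArr_last_apply hj
              (fun r h5 h6 => hss r h6 j hj (by omega))
              (fun r h5 h6 => hker (DC.star_right (hcs r h6 _ _)).1 (hg.2 r h5 h6))]
            have e2 : Commute (D (m + 1) (m + 1)) (star (s j)) :=
              (hcs j hj (m + 1) (m + 1)).2.symm
            have e3 := hD.diag_mul_star hDb hm
            rw [← ContinuousLinearMap.mul_apply, ← ContinuousLinearMap.mul_apply, e2.eq, mul_assoc,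
              e3, mul_one]
          rw [← e]
          exact (hMz _ _ hm (by omega) _ (hMD _ hm g hg.1).2).1
        obtain ⟨N', hNN, hNM, hNt, hNY⟩ := exists_closure (N := N) (fun g hg =>
          (hM'' g).2 ⟨(h2 g hg).1, fun r hr hrm => (h2 g hg).2 r (by omega) hrm⟩) ht
        refine ⟨N', hNN h1, fun g hg => (hM'' g).1 (hNM hg), fun p hp => ?_, fun r hr => ?_⟩
        · exact hNY _ (hcA j hj p hp).symm.star_left.star_right.1 (h3 p hp)
        · rcases Nat.eq_or_lt_of_le (Nat.lt_succ_iff.1 hr) with rfl | h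
          · exact hNt
          · exact hNY _ (hss r (by omega) j hj (by omega)).star_left.star_right.1 (h4 r h)
    obtain ⟨N, h1, h2, h3, h4⟩ := key (m + 1) le_rfl
    refine ⟨N, fun g hg => (h2 g hg).1, h1, fun p hp => ?_⟩
    rcases List.mem_append.1 hp with h | h
    · exact h3 p h
    · obtain ⟨h5, h6⟩ := (mem_blockLegs s).1 h
      rw [h6]
      exact h4 _ h5

end invariant

/-! ### Density of the monomials in the generators. -/

section monomials
variable {n : ℕ}

/-- The monomial in the generators given by a list of indices. -/
noncomputable def genProd (l : List (Fin (n + 1) × Fin (n + 1))) : CrystalAlg n :=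
  (l.map fun p => crystalGen n p.1 p.2).prod

/-- The adjoint of a generator is a product of generators, so monomials without adjoints already
span a star algebra. -/
theorem exists_star_genProd (l : List (Fin (n + 1) × Fin (n + 1))) :
    ∃ l', star (genProd l) = genProd l' := by
  induction l with
  | nil => exact ⟨[], by simp [genProd]⟩
  | cons p l ih =>
    obtain ⟨l', hl'⟩ := ih
    refine ⟨l' ++ List.ofFn fun i : Fin n => (p.1.succAbove i, p.2.succAbove i), ?_⟩
    have h1 : genProd (p :: l) = crystalGen n p.1 p.2 * genProd l := by simp [genProd]
    rw [h1, star_mul, hl', (crystalGen_relations n).star_eq, genProd, genProd, List.map_append,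
      List.prod_append, List.map_ofFn]
    rfl

/-- The monomials in the generators span a dense subspace. -/
theorem mem_of_genProd_mem {K : Submodule ℂ (CrystalAlg n)} (hK : IsClosed (K : Set (CrystalAlg n)))
    (h : ∀ l, genProd l ∈ K) (x : CrystalAlg n) : x ∈ K := by
  set K₀ : Submodule ℂ (CrystalAlg n) := Submodule.span ℂ (Set.range genProd) with hK₀
  have hK0K : K₀ ≤ K := Submodule.span_le.2 (by rintro _ ⟨l, rfl⟩; exact h l)
  have hmul : ∀ a ∈ K₀, ∀ b ∈ K₀, a * b ∈ K₀ := by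
    intro a ha b hb
    have : K₀ * K₀ ≤ K₀ := by
      rw [hK₀, Submodule.span_mul_span]
      refine Submodule.span_mono ?_
      rintro _ ⟨_, ⟨l, rfl⟩, _, ⟨l', rfl⟩, rfl⟩
      exact ⟨l ++ l', by simp [genProd]⟩
    exact this (Submodule.mul_mem_mul ha hb)
  have hone : (1 : CrystalAlg n) ∈ K₀ := Submodule.subset_span ⟨[], by simp [genProd]⟩
  have hstar : ∀ a ∈ K₀, star a ∈ K₀ := by
    intro a ha
    induction ha using Submodule.span_induction with
    | mem x hx =>
      obtain ⟨l, rfl⟩ := hx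
      obtain ⟨l', hl'⟩ := exists_star_genProd l
      exact Submodule.subset_span ⟨l', hl'.symm⟩
    | zero => rw [star_zero]; exact Submodule.zero_mem _
    | add x y _ _ hx hy => rw [star_add]; exact Submodule.add_mem _ hx hy
    | smul c x _ hx => rw [star_smul]; exact Submodule.smul_mem _ _ hx
  set V : Set (CrystalProduct n) := Subtype.val '' (K : Set (CrystalAlg n)) with hV
  have hVc : IsClosed V :=
    ((instIsClosedCrystalSubalgebra n).isClosedEmbedding_subtypeVal).isClosedMap _ hK
  have hsub : ∀ y ∈ StarAlgebra.adjoin ℂ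
      (Set.range fun p : Fin (n + 1) × Fin (n + 1) => crystalTaut n p.1 p.2),
      ∃ a ∈ K₀, (a : CrystalProduct n) = y := by
    intro y hy
    induction hy using StarAlgebra.adjoin_induction with
    | mem x hx =>
      obtain ⟨p, rfl⟩ := hx
      exact ⟨crystalGen n p.1 p.2, Submodule.subset_span ⟨[p], by simp [genProd]⟩, rfl⟩
    | algebraMap r =>
      refine ⟨algebraMap ℂ _ r, ?_, rfl⟩
      rw [Algebra.algebraMap_eq_smul_one]
      exact Submodule.smul_mem _ _ hone
    | add x y _ _ hx hy =>
      obtain ⟨a, ha, rfl⟩ := hx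
      obtain ⟨b, hb, rfl⟩ := hy
      exact ⟨a + b, Submodule.add_mem _ ha hb, rfl⟩
    | mul x y _ _ hx hy =>
      obtain ⟨a, ha, rfl⟩ := hx
      obtain ⟨b, hb, rfl⟩ := hy
      exact ⟨a * b, hmul a ha b hb, rfl⟩
    | star x _ hx =>
      obtain ⟨a, ha, rfl⟩ := hx
      exact ⟨star a, hstar a ha, rfl⟩
  have hx : (x : CrystalProduct n) ∈ V := by
    refine closure_minimal ?_ hVc (show (x : CrystalProduct n) ∈ closure _ from x.2)
    intro y hy
    obtain ⟨a, ha, rfl⟩ := hsub y hy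
    exact ⟨a, hK0K ha, rfl⟩
  obtain ⟨x', hx', e⟩ := hx
  rwa [← Subtype.ext e]

end monomials

/-! ### Symbols of representations. -/

section symrep
variable {H K : Type} [NormedAddCommGroup H] [InnerProductSpace ℂ H] [CompleteSpace H]
  [NormedAddCommGroup K] [InnerProductSpace ℂ K] [CompleteSpace K]

theorem isClosed_tendsto_zero {A V : Type*} [SeminormedAddCommGroup A] [SeminormedAddCommGroup V]
    {F : ℕ → A → V} {C : ℝ} (hF : ∀ N x y, ‖F N x - F N y‖ ≤ C * ‖x - y‖) :
    IsClosed {x | Tendsto (fun N => F N x) atTop (𝓝 0)} := by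
  refine isClosed_of_closure_subset fun x hx => ?_
  rw [Set.mem_ofPred_eq, Metric.tendsto_atTop]
  intro ε hε
  have hC : 0 < |C| + 1 := by positivity
  obtain ⟨y, hy, hxy⟩ := Metric.mem_closure_iff.1 hx (ε / 2 / (|C| + 1)) (by positivity)
  obtain ⟨N₀, hN₀⟩ := Metric.tendsto_atTop.1 hy (ε / 2) (by positivity)
  refine ⟨N₀, fun N hN => ?_⟩
  have h1 := hN₀ N hN
  rw [dist_zero_right] at h1 ⊢
  rw [dist_eq_norm, lt_div_iff₀ hC] at hxy
  have h2 : C * ‖x - y‖ ≤ ‖x - y‖ * (|C| + 1) := by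
    nlinarith [le_abs_self C, norm_nonneg (x - y)]
  calc ‖F N x‖ ≤ ‖F N x - F N y‖ + ‖F N y‖ := by simpa using norm_add_le (F N x - F N y) (F N y)
    _ < ε := by linarith [hF N x y]

/-- The condition is stable under linear combinations and products, and closed because
representations are contractive uniformly in the index of the isometries. -/
theorem Sym.extend {n : ℕ} {ι : ℕ → K →ₗᵢ[ℂ] H} {ρ : CrystalAlg n →⋆ₐ[ℂ] (H →L[ℂ] H)}
    {τ : CrystalAlg n →⋆ₐ[ℂ] (K →L[ℂ] K)}
    (h : ∀ i j, Sym ι (ρ (crystalGen n i j)) (τ (crystalGen n i j))) (x : CrystalAlg n) :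
    Sym ι (ρ x) (τ x) := by
  have hc : ∀ h : K, IsClosed {x | Tendsto (fun N => ρ x (ι N h) - ι N (τ x h)) atTop (𝓝 0)} := by
    intro h
    refine isClosed_tendsto_zero (C := 2 * ‖h‖) fun N x y => ?_
    have e : ρ x (ι N h) - ι N (τ x h) - (ρ y (ι N h) - ι N (τ y h)) =
        ρ (x - y) (ι N h) - ι N (τ (x - y) h) := by
      simp only [map_sub, ContinuousLinearMap.sub_apply]
      abel
    rw [e]
    refine (norm_sub_le _ _).trans ?_
    have h1 : ‖ρ (x - y) (ι N h)‖ ≤ ‖x - y‖ * ‖h‖ := by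
      refine (ContinuousLinearMap.le_opNorm _ _).trans ?_
      rw [LinearIsometry.norm_map]
      exact mul_le_mul_of_nonneg_right (NonUnitalStarAlgHom.norm_apply_le ρ _) (norm_nonneg _)
    have h2 : ‖ι N (τ (x - y) h)‖ ≤ ‖x - y‖ * ‖h‖ := by
      rw [LinearIsometry.norm_map]
      refine (ContinuousLinearMap.le_opNorm _ _).trans ?_
      exact mul_le_mul_of_nonneg_right (NonUnitalStarAlgHom.norm_apply_le τ _) (norm_nonneg _)
    linarith
  let S : Submodule ℂ (CrystalAlg n) :=
    { carrier := {x | Sym ι (ρ x) (τ x)}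
      add_mem' := fun {x y} hx hy => by
        change Sym ι (ρ (x + y)) (τ (x + y))
        rw [map_add, map_add]
        exact Sym.add hx hy
      zero_mem' := by
        change Sym ι (ρ 0) (τ 0)
        rw [map_zero, map_zero]
        exact Sym.zero
      smul_mem' := fun c x hx => by
        change Sym ι (ρ (c • x)) (τ (c • x))
        rw [map_smul, map_smul]
        exact Sym.smul hx c }
  refine mem_of_genProd_mem (K := S) ?_ (fun l => ?_) x
  · have : (S : Set (CrystalAlg n)) =
        (⋂ h : K, {x | Tendsto (fun N => ρ x (ι N h) - ι N (τ x h)) atTop (𝓝 0)}) ∩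
        ⋂ h : K, Star.star ⁻¹' {x | Tendsto (fun N => ρ x (ι N h) - ι N (τ x h)) atTop (𝓝 0)} := by
      ext x
      simp only [Set.mem_inter_iff, Set.mem_iInter, Set.mem_preimage, Set.mem_ofPred_eq, map_star]
      exact Iff.rfl
    rw [this]
    exact (isClosed_iInter hc).inter (isClosed_iInter fun h => (hc h).preimage continuous_star)
  · change Sym ι (ρ (genProd l)) (τ (genProd l))
    induction l with
    | nil => simpa [genProd] using (Sym.one : Sym ι 1 1)
    | cons p l ih =>
      have h1 : genProd (p :: l) = crystalGen n p.1 p.2 * genProd l := by simp [genProd]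
      rw [h1, map_mul, map_mul]
      exact Sym.mul (h _ _) ih

end symrep

/-! ### Torus points from unimodular numbers. -/

section torus
variable {n : ℕ}

/-- The coordinates of `t` are the partial products of `lam`; the quotient of consecutive ones is
`lam i`, and the condition on the full product settles the last index. -/
theorem exists_torus {lam : ℕ → ℂ} (h : ∀ i ≤ n, lam i * star (lam i) = 1)
    (hp : oprod lam 0 (n + 1) = 1) : ∃ t : Fin n → Circle, ∀ i ≤ n, torusNat t i = lam i := by
  have hu : ∀ k ≤ n + 1, oprod lam 0 k * star (oprod lam 0 k) = 1 := by
    intro k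
    induction k with
    | zero => simp [oprod_self]
    | succ k ih =>
      intro hk
      rw [oprod_succ (Nat.zero_le k), star_mul']
      linear_combination (lam k * star (lam k)) * ih (by omega) + h k (by omega)
  have hn : ∀ k ≤ n + 1, ‖oprod lam 0 k‖ = 1 := by
    intro k hk
    have h1 := congrArg norm (hu k hk)
    rw [norm_mul, norm_star, norm_one] at h1
    nlinarith [norm_nonneg (oprod lam 0 k)]
  refine ⟨fun i => ⟨oprod lam 0 (i + 1), by
    exact mem_sphere_zero_iff_norm.2 (hn _ (by omega))⟩, fun i hi => ?_⟩
  refine (torusNat_val _ (⟨i, by omega⟩ : Fin (n + 1))).trans ?_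
  have e : ∀ k, oprod lam 0 (k + 1) = oprod lam 0 k * lam k := fun k => oprod_succ (Nat.zero_le k)
  have hstar : star (oprod lam 0 i) * oprod lam 0 i = 1 := by
    rw [mul_comm]
    exact hu i (by omega)
  have h1 : (if h : 0 < i then star (oprod lam 0 (i - 1 + 1)) else 1) = star (oprod lam 0 i) := by
    split_ifs with h0
    · rw [Nat.sub_add_cancel h0]
    · obtain rfl : i = 0 := by omega
      rw [oprod_self, star_one]
  have h2 : (if h : i < n then oprod lam 0 (i + 1) else 1) = oprod lam 0 i * lam i := by
    split_ifs with h0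
    · exact e i
    · obtain rfl : i = n := by omega
      rw [← e, hp]
  calc _ = (if h : 0 < i then star (oprod lam 0 (i - 1 + 1)) else 1) *
      (if h : i < n then oprod lam 0 (i + 1) else 1) := rfl
    _ = lam i := by rw [h1, h2, ← mul_assoc, hstar, one_mul]

end torus

/-! ### The space generated by a vacuum vector. -/

section fock
variable {H : Type} [NormedAddCommGroup H] [InnerProductSpace ℂ H] [CompleteSpace H] {N : ℕ}

theorem commute_mon {X : ℕ → H →L[ℂ] H} {α : ℕ → ℕ} {Y : H →L[ℂ] H} {m : ℕ}
    (h : ∀ l < m, Commute Y (X l ^ α l)) : Commute Y (mon X α m) := by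
  induction m with
  | zero => exact Commute.one_right _
  | succ m ih => exact (h m (Nat.lt_succ_self m)).mul_right (ih fun l hl => h l (by omega))

theorem mul_mon_of_commute {X : ℕ → H →L[ℂ] H} {l m : ℕ} (hl : l < m)
    (h : ∀ i < m, Commute (X l) (X i)) (α : ℕ → ℕ) : X l * mon X α m = mon X (upN l α) m := by
  induction m with
  | zero => omega
  | succ m ih =>
    rcases Nat.eq_or_lt_of_le (Nat.lt_succ_iff.1 hl) with rfl | h'
    · exact mul_mon X α l
    · rw [mon, mon, ← mul_assoc, ((h m (Nat.lt_succ_self m)).pow_right _).eq, mul_assoc,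
        ih h' fun i hi => h i (by omega), upN, Function.update_of_ne (by omega)]

/-- The adjoints of a family of operators, indexed by `ℕ`. -/
noncomputable def starN (s : Fin N → H →L[ℂ] H) (l : ℕ) : H →L[ℂ] H :=
  if h : l < N then star (s ⟨l, h⟩) else 1

theorem starN_val (s : Fin N → H →L[ℂ] H) (r : Fin N) : starN s r = star (s r) := dif_pos r.2

variable {s : Fin N → H →L[ℂ] H}

theorem mem_vac_starN {a : H} : a ∈ vac N (starN s) 0 ↔ ∀ r, s r a = 0 := by
  rw [mem_vac]
  constructor
  · intro h r
    have := h r (Nat.zero_le _) r.2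
    rwa [starN_val, star_star] at this
  · intro h l _ hl
    have := h ⟨l, hl⟩
    rw [starN, dif_pos hl, star_star, this]

variable (hs : ∀ r, s r * star (s r) = 1) (hc : ∀ r r', r ≠ r' → DC (s r) (s r'))
include hs hc

/-- Adjoints of doubly commuting pure coisometries form a tower without twist, whose common kernel
consists of the vectors killed by all coisometries. -/
theorem tower_starN (hN : ∀ r, Nil (s r)) : Tower N (starN s) 1 := by
  have hX : ∀ l (h : l < N), starN s l = star (s ⟨l, h⟩) := fun l h => dif_pos h
  refine ⟨fun j hj g _ => ?_, fun j l hjl hl g hg => ?_, fun j l hjl hl g hg => ?_,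
    fun j hj => ?_, fun g hg => hg, fun g hg => ?_, fun g _ => ?_, fun g _ => ?_⟩
  · rw [hX j hj, star_star]
    exact DFunLike.congr_fun (hs ⟨j, hj⟩) g
  · have h0 : s ⟨l, hl⟩ g = 0 := by
      have := (mem_vac.1 hg) l hjl hl
      rwa [hX l hl, star_star] at this
    have := DFunLike.congr_fun (hc ⟨l, hl⟩ ⟨j, by omega⟩ (by simp; omega)).star_right.1.eq g
    rw [hX l hl, hX j (by omega), star_star]
    refine this.trans ?_
    rw [ContinuousLinearMap.mul_apply, h0, map_zero]
  · have h0 : s ⟨l, hl⟩ g = 0 := by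
      have := (mem_vac.1 hg) l hjl hl
      rwa [hX l hl, star_star] at this
    have := DFunLike.congr_fun (hc ⟨l, hl⟩ ⟨j, by omega⟩ (by simp; omega)).1.eq g
    rw [hX l hl, hX j (by omega), star_star, star_star]
    refine this.trans ?_
    rw [ContinuousLinearMap.mul_apply, h0, map_zero]
  · rw [hX j hj, star_star]
    exact hN _
  · rw [star_one]
    exact hg
  · rw [star_one]
    rfl
  · rw [star_one]
    rfl

theorem commute_starN (l i : ℕ) : Commute (starN s l) (starN s i) := by
  rw [starN, starN]
  split_ifs with h1 h2
  · by_cases h : l = i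
    · subst h
      exact Commute.refl _
    · exact (hc ⟨l, h1⟩ ⟨i, h2⟩ (by simpa using h)).star_left.star_right.1
  all_goals first | exact Commute.one_right _ | exact Commute.one_left _

theorem mon_up (r : Fin N) (α : Fin N → ℕ) : star (s r) * mon (starN s) (extN α) N =
    mon (starN s) (extN (up r α)) N := by
  rw [extN_up, ← starN_val s r]
  exact mul_mon_of_commute r.2 (fun i _ => commute_starN hs hc _ _) _

theorem mon_of_zero {r : Fin N} {α : Fin N → ℕ} (h : α r = 0) :
    Commute (s r) (mon (starN s) (extN α) N) := by
  refine commute_mon fun l hl => ?_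
  by_cases hlr : l = r
  · subst hlr
    rw [extN_val, h, pow_zero]
    exact Commute.one_right _
  · refine Commute.pow_right ?_ _
    rw [starN, dif_pos hl]
    exact (hc r ⟨l, hl⟩ fun h' => hlr (by rw [h'])).star_right.1

/-- The isometry of `ℓ²` onto the space generated by a unit vector killed by doubly commuting
coisometries. -/
theorem exists_fock (hN : ∀ r, Nil (s r)) {a : H} (ha : ∀ r, s r a = 0) (ha1 : ‖a‖ = 1) :
    ∃ J : L2 (Fin N → ℕ) ℂ →ₗᵢ[ℂ] H, (∀ c, J (L2.single 0 c) = c • a) ∧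
      (∀ b, (∀ r, s r b = 0) → ∀ f : L2 (Fin N → ℕ) ℂ, inner ℂ b (J f) = f 0 * inner ℂ b a) ∧
      ∀ r f, s r (J f) = J (legS ℂ r f) ∧ star (s r) (J f) = J (star (legS ℂ r) f) := by
  have hT := tower_starN hs hc hN
  have hav : a ∈ vac N (starN s) 0 := mem_vac_starN.2 ha
  have hinner : ∀ b, (∀ r, s r b = 0) → ∀ α β : Fin N → ℕ, inner ℂ (mon (starN s) (extN α) N b)
      (mon (starN s) (extN β) N a) = if α = β then inner ℂ b a else 0 := by
    intro b hb α β
    rw [hT.inner_mon (mem_vac_starN.2 hb) hav _ _ le_rfl]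
    refine if_congr ⟨fun h => funext fun i => ?_, fun h i _ => by rw [h]⟩ rfl rfl
    simpa only [extN_val] using h i i.2
  have hmon0 : ∀ b, mon (starN s) (extN (0 : Fin N → ℕ)) N b = b := by
    have : ∀ m, mon (starN s) (extN (0 : Fin N → ℕ)) m = 1 := by
      intro m
      induction m with
      | zero => rfl
      | succ m ih =>
        have : extN (0 : Fin N → ℕ) m = 0 := by simp [extN]
        rw [mon, ih, this, pow_zero, mul_one]
    intro b
    rw [this]
    rfl
  have ho : Orthonormal ℂ fun α : Fin N → ℕ => mon (starN s) (extN α) N a := by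
    rw [orthonormal_iff_ite]
    intro α β
    rw [hinner a ha, inner_self_eq_norm_sq_to_K, ha1]
    simp
  set J : L2 (Fin N → ℕ) ℂ →ₗᵢ[ℂ] H := ho.orthogonalFamily.linearIsometry with hJ
  have hJs : ∀ (α : Fin N → ℕ) (c : ℂ), J (L2.single α c) = c • mon (starN s) (extN α) N a := by
    intro α c
    rw [hJ, L2.single, OrthogonalFamily.linearIsometry_apply_single]
    rfl
  refine ⟨J, fun c => by rw [hJs, hmon0], fun b hb f => ?_, fun r f => ⟨?_, ?_⟩⟩
  · have h1 : (innerSL ℂ b).comp J.toContinuousLinearMap =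
        inner ℂ b a • (innerSL ℂ (L2.single 0 1 : L2 (Fin N → ℕ) ℂ)) := by
      refine L2.ext_single fun α c => ?_
      rw [ContinuousLinearMap.smul_apply]
      change inner ℂ b (J (L2.single α c)) =
        inner ℂ b a • inner ℂ (L2.single 0 1 : L2 (Fin N → ℕ) ℂ) (L2.single α c)
      rw [hJs, inner_smul_right, ← hmon0 b, hinner b hb, hmon0, L2.inner_single, L2.single_apply]
      split_ifs <;> simp [mul_comm]
    have h2 := DFunLike.congr_fun h1 f
    rw [ContinuousLinearMap.smul_apply] at h2
    change inner ℂ b (J f) = inner ℂ b a • inner ℂ (L2.single 0 1 : L2 (Fin N → ℕ) ℂ) f at h2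
    rw [h2, L2.inner_single]
    simp [mul_comm]
  · have h1 : (s r).comp J.toContinuousLinearMap = J.toContinuousLinearMap.comp (legS ℂ r) := by
      refine L2.ext_single fun α c => ?_
      change s r (J (L2.single α c)) = J (legS ℂ r (L2.single α c))
      by_cases h0 : α r = 0
      · have := DFunLike.congr_fun (mon_of_zero hs hc h0).eq a
        rw [ContinuousLinearMap.mul_apply, ContinuousLinearMap.mul_apply, ha, map_zero] at this
        rw [hJs, map_smul, this, legS_single_zero h0, map_zero, smul_zero]
      · obtain ⟨β, rfl⟩ := (exists_up r α).2 h0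
        have h2 : s r * (star (s r) * mon (starN s) (extN β) N) = mon (starN s) (extN β) N := by
          rw [← mul_assoc, hs, one_mul]
        rw [mon_up hs hc] at h2
        rw [legS_single_up, hJs, hJs, map_smul, ← ContinuousLinearMap.mul_apply, h2]
    exact DFunLike.congr_fun h1 f
  · have h1 : (star (s r)).comp J.toContinuousLinearMap =
        J.toContinuousLinearMap.comp (star (legS ℂ r)) := by
      refine L2.ext_single fun α c => ?_
      change star (s r) (J (L2.single α c)) = J (star (legS ℂ r) (L2.single α c))
      rw [star_legS_single, hJs, hJs, map_smul, ← mon_up hs hc]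
      rfl
    exact DFunLike.congr_fun h1 f

/-- By `Tower.total`, the monomials in the adjoints applied to vacuum vectors are total. Only some
subspace inside `M` needs to be invariant under the adjoints. -/
theorem eq_top_of_mon_mem (hN : ∀ r, Nil (s r)) {M : Submodule ℂ H} (hM : IsClosed (M : Set H))
    (h : ∀ a, (∀ r, s r a = 0) → ∃ N' ≤ M, a ∈ N' ∧ ∀ r, ∀ g ∈ N', star (s r) g ∈ N') :
    M = ⊤ := by
  have hT := tower_starN hs hc hN
  have hmon : ∀ a, (∀ r, s r a = 0) → ∀ α, mon (starN s) α N a ∈ M := by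
    intro a ha α
    obtain ⟨N', hN', haN, hst⟩ := h a ha
    have hX : ∀ l, ∀ g ∈ N', starN s l g ∈ N' := by
      intro l g hg
      rw [starN]
      split_ifs with hl
      · exact hst _ g hg
      · exact hg
    have hXp : ∀ l b, ∀ g ∈ N', (starN s l ^ b) g ∈ N' := by
      intro l b
      induction b with
      | zero => simp
      | succ b ih =>
        intro g hg
        rw [pow_succ']
        exact hX l _ (ih g hg)
    have : ∀ m, mon (starN s) α m a ∈ N' := by
      intro m
      induction m with
      | zero => exact haN
      | succ m ih => exact hXp m _ _ ih
    exact hN' (this N)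
  have : CompleteSpace M := hM.completeSpace_coe
  rw [← Submodule.orthogonal_eq_bot_iff, Submodule.eq_bot_iff]
  intro f hf
  refine hT.total le_rfl (mem_vac.2 fun l h1 h2 => by omega) fun α g hg => ?_
  exact (Submodule.mem_orthogonal _ _).1 hf _ (hmon g (mem_vac_starN.1 hg) α)

end fock

/-! ### Commutative subalgebras and characters. -/

section commutative

/-- Doubly commuting elements of a C⋆-algebra lie in a commutative C⋆-algebra. -/
theorem exists_commutative {B : Type} [CStarAlgebra B] {I : Type} (d : I → B)
    (h : ∀ i j, Commute (d i) (d j)) (h' : ∀ i j, Commute (d i) (star (d j))) :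
    ∃ (C : Type) (_ : CommCStarAlgebra C) (φ : C →⋆ₐ[ℂ] B) (d' : I → C),
      Function.Injective φ ∧ ∀ i, φ (d' i) = d i := by
  set S := StarAlgebra.adjoin ℂ (Set.range d) with hS
  have hcomm : ∀ x y : S, x * y = y * x := by
    let _ := StarAlgebra.adjoinCommRingOfComm ℂ (s := Set.range d)
      (by rintro _ ⟨i, rfl⟩ _ ⟨j, rfl⟩; exact (h i j).eq)
      (by rintro _ ⟨i, rfl⟩ _ ⟨j, rfl⟩; exact (h' i j).eq)
    exact fun x y => mul_comm x y
  have hcl : ∀ x y : S.topologicalClosure, x * y = y * x :=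
    (S.commRingTopologicalClosure hcomm).mul_comm
  have : IsClosed (S.topologicalClosure : Set B) := S.isClosed_topologicalClosure
  let C : CommCStarAlgebra S.topologicalClosure :=
    { (inferInstance : CStarAlgebra S.topologicalClosure) with mul_comm := hcl }
  exact ⟨S.topologicalClosure, C, S.topologicalClosure.subtype,
    fun i => ⟨d i, S.le_topologicalClosure (StarAlgebra.subset_adjoin ℂ _ ⟨i, rfl⟩)⟩,
    Subtype.val_injective, fun i => rfl⟩

theorem norm_le_of_characters {C : Type} [CommCStarAlgebra C] {y : C} {ε : ℝ} (hε : 0 ≤ ε)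
    (h : ∀ χ : WeakDual.characterSpace ℂ C, ‖χ y‖ ≤ ε) : ‖y‖ ≤ ε := by
  have h1 : ‖WeakDual.gelfandTransform ℂ C y‖ = ‖y‖ :=
    (gelfandTransform_isometry C).norm_map_of_map_zero (map_zero _) y
  rw [← h1]
  exact (ContinuousMap.norm_le _ hε).2 h

end commutative

/-! ### Vacuum expectations. -/

section vacuum
variable {n : ℕ}

/-- The representation `π_{t,w}` of the longest word. -/
noncomputable def crystalRep (t : Fin n → Circle) :
    CrystalAlg n →⋆ₐ[ℂ] (WordSpace (longestWord n) →L[ℂ] WordSpace (longestWord n)) :=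
  (existsUnique_crystalRep t (longestWord n)).choose

theorem crystalRep_spec (t : Fin n → Circle) : IsCrystalRep t (longestWord n) (crystalRep t) :=
  (existsUnique_crystalRep t (longestWord n)).choose_spec.1

/-- The vacuum vector. -/
noncomputable def vacVec (n : ℕ) : WordSpace (longestWord n) := L2.single 0 1

theorem norm_vacVec : ‖vacVec n‖ = 1 := by rw [vacVec, L2.norm_single, norm_one]

/-- The product of the values of `χ_t` along a list of indices. -/
noncomputable def torusProd (t : Fin n → Circle) (l : List (Fin (n + 1) × Fin (n + 1))) : ℂ :=
  (l.map fun p => torusNat t p.1).prod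

/-- The product of the operators `π_w(z_{i,j})` along a list of indices. -/
noncomputable def wordProd (l : List (Fin (n + 1) × Fin (n + 1))) :
    WordSpace (longestWord n) →L[ℂ] WordSpace (longestWord n) :=
  (l.map fun p => wordArr (wordLegs ℂ (longestWord n)) (p.1 : ℕ) (p.2 : ℕ)).prod

theorem list_prod_mul {ι B : Type*} [Monoid B] {a b : ι → B} (l : List ι)
    (h : ∀ i j, Commute (b i) (a j)) :
    (l.map fun i => a i * b i).prod = (l.map a).prod * (l.map b).prod := by
  induction l with
  | nil => simp
  | cons i l ih =>
    have : Commute (b i) (l.map a).prod := by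
      refine Commute.list_prod_right _ _ fun x hx => ?_
      obtain ⟨j, _, rfl⟩ := List.mem_map.1 hx
      exact h i j
    rw [List.map_cons, List.prod_cons, ih, List.map_cons, List.prod_cons, List.map_cons,
      List.prod_cons, mul_assoc, mul_assoc, ← mul_assoc (b i), this.eq, mul_assoc]

theorem map_genProd {B : Type*} [Ring B] [StarRing B] [Algebra ℂ B] (ρ : CrystalAlg n →⋆ₐ[ℂ] B)
    (l : List (Fin (n + 1) × Fin (n + 1))) :
    ρ (genProd l) = (l.map fun p => ρ (crystalGen n p.1 p.2)).prod := by
  rw [genProd, map_list_prod, List.map_map]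
  rfl

theorem crystalRep_genProd (t : Fin n → Circle) (l : List (Fin (n + 1) × Fin (n + 1))) :
    crystalRep t (genProd l) = torusProd t l • wordProd l := by
  have h : ∀ p : Fin (n + 1) × Fin (n + 1), crystalRep t (crystalGen n p.1 p.2) =
      algebraMap ℂ _ (torusNat t p.1) *
        wordArr (wordLegs ℂ (longestWord n)) (p.1 : ℕ) (p.2 : ℕ) := fun p => by
    rw [crystalRep_spec t, torusWordOp_eq]
  rw [map_genProd]
  simp only [h]
  rw [list_prod_mul _ fun _ _ => (Algebra.commutes _ _).symm, torusProd, wordProd,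
    Algebra.smul_def, map_list_prod, List.map_map]
  rfl

/-- The vacuum state of `π_t`. -/
noncomputable def vacState (t : Fin n → Circle) (x : CrystalAlg n) : ℂ :=
  inner ℂ (vacVec n) (crystalRep t x (vacVec n))

theorem norm_vacState_le (t : Fin n → Circle) (x : CrystalAlg n) : ‖vacState t x‖ ≤ ‖x‖ := by
  refine (norm_inner_le_norm _ _).trans ?_
  rw [norm_vacVec, one_mul]
  refine (ContinuousLinearMap.le_opNorm _ _).trans ?_
  rw [norm_vacVec, mul_one]
  exact NonUnitalStarAlgHom.norm_apply_le _ _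

theorem vacState_add (t : Fin n → Circle) (x y : CrystalAlg n) :
    vacState t (x + y) = vacState t x + vacState t y := by
  rw [vacState, map_add, ContinuousLinearMap.add_apply, inner_add_right]
  rfl

theorem vacState_smul (t : Fin n → Circle) (c : ℂ) (x : CrystalAlg n) :
    vacState t (c • x) = c * vacState t x := by
  rw [vacState, map_smul, ContinuousLinearMap.smul_apply, inner_smul_right]
  rfl

/-- The vacuum expectation of a monomial. -/
noncomputable def vacCoeff (l : List (Fin (n + 1) × Fin (n + 1))) : ℂ :=
  wordProd l (vacVec n) 0

theorem vacState_genProd (t : Fin n → Circle) (l : List (Fin (n + 1) × Fin (n + 1))) :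
    vacState t (genProd l) = torusProd t l * vacCoeff l := by
  rw [vacState, crystalRep_genProd, ContinuousLinearMap.smul_apply, inner_smul_right]
  congr 1
  rw [vacCoeff]
  refine (L2.inner_single (0 : Fin (longestWord n).length → ℕ) (1 : ℂ)
    (wordProd l (vacVec n))).trans ?_
  simp

theorem commute_rep {H : Type} [NormedAddCommGroup H] [InnerProductSpace ℂ H] [CompleteSpace H]
    (ρ : CrystalAlg n →⋆ₐ[ℂ] (H →L[ℂ] H)) {T : H →L[ℂ] H}
    (h : ∀ i j, Commute T (ρ (crystalGen n i j))) (x : CrystalAlg n) : Commute T (ρ x) := by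
  let S : Submodule ℂ (CrystalAlg n) :=
    { carrier := {x | T * ρ x = ρ x * T}
      add_mem' := fun {x y} (hx : T * ρ x = ρ x * T) (hy : T * ρ y = ρ y * T) => by
        change T * ρ (x + y) = ρ (x + y) * T
        rw [map_add, mul_add, add_mul, hx, hy]
      zero_mem' := by
        change T * ρ 0 = ρ 0 * T
        rw [map_zero, mul_zero, zero_mul]
      smul_mem' := fun c x (hx : T * ρ x = ρ x * T) => by
        change T * ρ (c • x) = ρ (c • x) * T
        rw [map_smul, mul_smul_comm, smul_mul_assoc, hx] }
  have hρ : Continuous ρ := AddMonoidHomClass.continuous_of_bound ρ 1 fun a => by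
    rw [one_mul]
    exact NonUnitalStarAlgHom.norm_apply_le ρ a
  refine mem_of_genProd_mem (K := S) ?_ (fun l => ?_) x
  · exact isClosed_eq (continuous_const.mul hρ) (hρ.mul continuous_const)
  · change Commute T (ρ (genProd l))
    rw [map_genProd]
    refine Commute.list_prod_right _ _ fun y hy => ?_
    obtain ⟨p, _, rfl⟩ := List.mem_map.1 hy
    exact h p.1 p.2

theorem CRel.commute_diag {B : Type*} [Ring B] [StarRing B] {D : ℕ → ℕ → B} (hD : CRel n D)
    (hb : Block n 0 D) {i j : ℕ} (hi : i ≤ n) (hj : j ≤ n) : Commute (D i i) (D j j) := by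
  have key : ∀ i j, i < j → j ≤ n → Commute (D i i) (D j j) := by
    intro i j hij hj
    rcases Nat.eq_or_lt_of_le (Nat.succ_le_of_lt hij) with h | h
    · have := hD.diag_cross i j i j hij hj hij hj (by omega)
      rw [hb.diag (by omega) hj hij.ne, zero_mul] at this
      exact sub_eq_zero.1 this
    · exact hD.diag_comm i j i j hij hj hij hj (by omega)
  rcases lt_trichotomy i j with h | rfl | h
  · exact key i j h hj
  · exact Commute.refl _
  · exact (key j i h hi).symm

theorem CRel.commute_star_diag {B : Type*} [Ring B] [StarRing B] {D : ℕ → ℕ → B} (hD : CRel n D)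
    (hb : Block n 0 D) {i j : ℕ} (hi : i ≤ n) (hj : j ≤ n) :
    Commute (D i i) (star (D j j)) := by
  have h := (hD.commute_diag hb hi hj).eq
  have h1 := hD.diag_mul_star hb hj
  have h2 := hD.star_mul_diag hb hj
  calc D i i * star (D j j) = star (D j j) * D j j * (D i i * star (D j j)) := by
        rw [h2, one_mul]
    _ = star (D j j) * (D i i * D j j) * star (D j j) := by rw [h]; simp only [mul_assoc]
    _ = star (D j j) * D i i := by rw [mul_assoc, mul_assoc, h1, mul_one]

theorem exists_ofFn {B : Type*} {w : List (Fin n)} {L : List (ℕ × B)}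
    (h : L.map Prod.fst = w.map Fin.val) :
    ∃ s : Fin w.length → B, L = List.ofFn fun k => ((w.get k : ℕ), s k) := by
  have hlen : L.length = w.length := by simpa using congrArg List.length h
  refine ⟨fun k => (L[(k : ℕ)]'(by omega)).2, List.ext_getElem (by simp [hlen]) fun i h1 h2 => ?_⟩
  rw [List.getElem_ofFn]
  refine Prod.ext ?_ rfl
  have h3 : (L.map Prod.fst)[i]'(by simpa using h1) = (w.map Fin.val)[i]'(by
    simpa [hlen] using h1) := List.getElem_of_eq h _
  rw [List.getElem_map, List.getElem_map] at h3
  exact h3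

/-- The array is built from the legs and their adjoints only, so an isometry intertwining these
intertwines all of its entries. -/
theorem intertwine_wordArr {H K : Type} [NormedAddCommGroup H] [InnerProductSpace ℂ H]
    [CompleteSpace H] [NormedAddCommGroup K] [InnerProductSpace ℂ K] [CompleteSpace K]
    (J : K →ₗᵢ[ℂ] H) {ι : Type*} (r : ι → ℕ) (S : ι → H →L[ℂ] H) (S₀ : ι → K →L[ℂ] K)
    (h : ∀ k f, S k (J f) = J (S₀ k f) ∧ star (S k) (J f) = J (star (S₀ k) f)) (I : List ι)
    (i j : ℕ) (f : K) : wordArr (I.map fun k => (r k, S k)) i j (J f) =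
      J (wordArr (I.map fun k => (r k, S₀ k)) i j f) := by
  induction I generalizing i j f with
  | nil =>
    simp only [List.map_nil, wordArr, act_nil, idArr]
    split_ifs
    · rfl
    · exact (map_zero J).symm
  | cons k I ih =>
    rw [List.map_cons, List.map_cons, wordArr, wordArr, act_cons, act_cons, conv, conv,
      ContinuousLinearMap.sum_apply, ContinuousLinearMap.sum_apply, map_sum]
    refine Finset.sum_congr rfl fun l _ => ?_
    rw [ContinuousLinearMap.mul_apply, ContinuousLinearMap.mul_apply]
    have hs : ∀ i j f, simpleArr (r k) (S k) i j (J f) = J (simpleArr (r k) (S₀ k) i j f) := by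
      intro i j f
      have hP : (1 - star (S k) * S k) (J f) = J ((1 - star (S₀ k) * S₀ k) f) := by
        change J f - star (S k) (S k (J f)) = J (f - star (S₀ k) (S₀ k f))
        rw [(h k f).1, (h k _).2, map_sub]
      simp only [simpleArr]
      split_ifs
      all_goals first | exact (h k f).1 | exact (h k f).2 | exact hP | rfl | exact (map_zero J).symm
    refine Eq.trans ?_ (hs i l _)
    exact congrArg _ (ih l j f)

/-- The diagonal entries generate a commutative C⋆-algebra whose characters give torus points. For a
combination of monomials the vacuum expectation is a vector functional of an element of this
algebra, and the value of a character on that element is the vacuum state of the corresponding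
`π_t`. So the expectation is bounded by the supremum of the vacuum states, which is small for
combinations close to `x`. -/
theorem vacuum_expectation {H : Type} [NormedAddCommGroup H] [InnerProductSpace ℂ H]
    [CompleteSpace H] {D : ℕ → ℕ → H →L[ℂ] H} (hD : CRel n D) (hDb : Block n 0 D)
    {s : Fin (longestWord n).length → H →L[ℂ] H} (hs : ∀ r, s r * star (s r) = 1)
    (hss : ∀ r r', r ≠ r' → DC (s r) (s r')) (hN : ∀ r, Nil (s r)) (hsD : ∀ r, DComm (s r) D)
    (ρ : CrystalAlg n →⋆ₐ[ℂ] (H →L[ℂ] H))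
    (hρ : ∀ i j, ρ (crystalGen n i j) = conv D (wordArr
      (List.ofFn fun k => (((longestWord n).get k : ℕ), s k))) i j)
    {a : H} (ha : ∀ r, s r a = 0) (ha1 : ‖a‖ = 1) {x : CrystalAlg n}
    (hx : ∀ t, crystalRep t x = 0) : inner ℂ a (ρ x a) = 0 := by
  obtain ⟨J, hJ0, hJi, hJs⟩ := exists_fock hs hss hN ha ha1
  set d : ℕ → H →L[ℂ] H := fun i => if i ≤ n then D i i else 1 with hd
  have hdi : ∀ i ≤ n, d i = D i i := fun i hi => if_pos hi
  have hdc : ∀ i j, Commute (d i) (d j) := by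
    intro i j
    simp only [hd]
    split_ifs with h1 h2
    · exact hD.commute_diag hDb h1 h2
    all_goals first | exact Commute.one_right _ | exact Commute.one_left _
  have hdc' : ∀ i j, Commute (d i) (star (d j)) := by
    intro i j
    simp only [hd]
    split_ifs with h1 h2
    · exact hD.commute_star_diag hDb h1 h2
    all_goals first | exact Commute.one_left _ | (rw [star_one]; exact Commute.one_right _)
  obtain ⟨C, _, φ, d', hφ, hφd⟩ := exists_commutative d hdc hdc'
  -- A character sends the commuting unitaries `d' i` to numbers of modulus one with product `1`.
  have hchar : ∀ χ : WeakDual.characterSpace ℂ C, ∃ t : Fin n → Circle,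
      ∀ i ≤ n, torusNat t i = χ (d' i) := by
    intro χ
    refine exists_torus (fun i hi => ?_) ?_
    · have h1 : d' i * star (d' i) = 1 := hφ (by
        rw [map_mul, map_star, hφd, hdi i hi, hD.diag_mul_star hDb hi, map_one])
      rw [← map_star χ, ← map_mul, h1, map_one]
    · have h1 : oprod d' 0 (n + 1) = 1 := hφ (by
        rw [map_oprod φ, map_one, ← hD.det_one]
        exact oprod_congr fun i _ hi => by rw [hφd, hdi i (by omega)])
      rw [← map_oprod χ, h1, map_one]
  choose T hT using hchar
  have hw : ∀ l : List (Fin (n + 1) × Fin (n + 1)), ∀ f : WordSpace (longestWord n),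
      (l.map fun p => wordArr (List.ofFn fun k => (((longestWord n).get k : ℕ), s k))
        (p.1 : ℕ) (p.2 : ℕ)).prod (J f) = J (wordProd l f) := by
    intro l
    induction l with
    | nil => intro f; rfl
    | cons p l ih =>
      intro f
      rw [List.map_cons, List.prod_cons, ContinuousLinearMap.mul_apply, ih, List.ofFn_eq_map,
        intertwine_wordArr J (fun k => ((longestWord n).get k : ℕ)) s (fun k => legS ℂ k) hJs,
        ← List.ofFn_eq_map, wordProd, wordProd, List.map_cons, List.prod_cons]
      rfl
  have hsd : ∀ r i, DC (s r) (d i) := by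
    intro r i
    simp only [hd]
    split_ifs
    · exact hsD r i i
    · exact DC.one _
  have hsdl : ∀ (r) (l : List (Fin (n + 1) × Fin (n + 1))),
      DC (s r) (l.map fun p => d p.1).prod := by
    intro r l
    induction l with
    | nil => exact DC.one _
    | cons p l ih =>
      rw [List.map_cons, List.prod_cons]
      exact (hsd r _).mul ih
  -- The diagonal factors are collected on the left. Their adjoint maps `a` to a vector killed by
  -- the legs, and against such a vector only the vacuum coefficient of the remaining factor counts.
  have hmono : ∀ l, inner ℂ a (ρ (genProd l) a) =
      vacCoeff l * inner ℂ a ((l.map fun p => d p.1).prod a) := by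
    intro l
    have h1 : ρ (genProd l) = (l.map fun p => d p.1).prod *
        (l.map fun p => wordArr (List.ofFn fun k => (((longestWord n).get k : ℕ), s k))
          (p.1 : ℕ) (p.2 : ℕ)).prod := by
      rw [map_genProd, ← list_prod_mul]
      · congr 1
        refine List.map_congr_left fun p _ => ?_
        rw [hρ, conv_diag hDb _ (by omega) (by omega), hdi _ (by omega)]
      · intro p q
        refine (DComm.act (a := d q.1) (fun p' hp' => ?_) (DComm.idArr _) p.1 p.2).1.symm
        obtain ⟨k, rfl⟩ := (List.mem_ofFn' _ _).1 hp'
        exact (hsd k _).symm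
    have h2 : J (vacVec n) = a := by
      have := hJ0 1
      rwa [one_smul] at this
    have h3 : ∀ r, s r (star (l.map fun p => d p.1).prod a) = 0 := by
      intro r
      have hc := hsdl r l
      have := DFunLike.congr_fun hc.star_right.1.eq a
      rw [ContinuousLinearMap.mul_apply, ContinuousLinearMap.mul_apply, ha, map_zero] at this
      exact this
    have h4 := hJi _ h3 (wordProd l (vacVec n))
    rw [ContinuousLinearMap.star_eq_adjoint, ContinuousLinearMap.adjoint_inner_left,
      ContinuousLinearMap.adjoint_inner_left] at h4
    rw [h1, ContinuousLinearMap.mul_apply, vacCoeff, ← h4]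
    congr 2
    rw [← hw, h2]
  -- The elements whose expectation is computed in the commutative algebra by some `y` with the
  -- vacuum states as its Gelfand transform.
  let K : Submodule ℂ (CrystalAlg n) :=
    { carrier := {x | ∃ y : C, inner ℂ a (φ y a) = inner ℂ a (ρ x a) ∧
        ∀ χ : WeakDual.characterSpace ℂ C, χ y = vacState (T χ) x}
      add_mem' := by
        rintro x x' ⟨y, h1, h2⟩ ⟨y', h1', h2'⟩
        refine ⟨y + y', ?_, fun χ => ?_⟩
        · rw [map_add, map_add, ContinuousLinearMap.add_apply, ContinuousLinearMap.add_apply,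
            inner_add_right, inner_add_right, h1, h1']
        · rw [map_add, vacState_add, h2, h2']
      zero_mem' := by
        refine ⟨0, by rw [map_zero, map_zero], fun χ => ?_⟩
        rw [map_zero, vacState, map_zero, ContinuousLinearMap.zero_apply, inner_zero_right]
      smul_mem' := by
        rintro c x ⟨y, h1, h2⟩
        refine ⟨c • y, ?_, fun χ => ?_⟩
        · rw [map_smul, map_smul, ContinuousLinearMap.smul_apply, ContinuousLinearMap.smul_apply,
            inner_smul_right, inner_smul_right, h1]
        · rw [map_smul, vacState_smul, h2, smul_eq_mul] }
  have hK : ∀ l, genProd l ∈ K := by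
    intro l
    refine ⟨vacCoeff l • (l.map fun p => d' p.1).prod, ?_, fun χ => ?_⟩
    · rw [hmono, map_smul, ContinuousLinearMap.smul_apply, inner_smul_right, map_list_prod,
        List.map_map]
      simp only [Function.comp_def, hφd]
    · rw [map_smul, vacState_genProd, map_list_prod, List.map_map, smul_eq_mul, mul_comm, torusProd]
      congr 2
      refine List.map_congr_left fun p _ => ?_
      exact (hT χ p.1 (by omega)).symm
  have hxK : x ∈ K.topologicalClosure :=
    mem_of_genProd_mem K.isClosed_topologicalClosure (fun l => K.le_topologicalClosure (hK l)) x
  by_contra hne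
  have hpos : 0 < ‖inner ℂ a (ρ x a)‖ := norm_pos_iff.2 hne
  obtain ⟨x', ⟨y, hy1, hy2⟩, hxx'⟩ := Metric.mem_closure_iff.1 hxK _ (half_pos hpos)
  rw [dist_eq_norm] at hxx'
  have hbound : ∀ T : H →L[ℂ] H, ‖inner ℂ a (T a)‖ ≤ ‖T‖ := by
    intro T
    refine (norm_inner_le_norm _ _).trans ?_
    rw [ha1, one_mul]
    refine (T.le_opNorm _).trans ?_
    rw [ha1, mul_one]
  have hy : ‖y‖ ≤ ‖x - x'‖ := by
    refine norm_le_of_characters (norm_nonneg _) fun χ => ?_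
    have h0 : vacState (T χ) x = 0 := by
      rw [vacState, hx, ContinuousLinearMap.zero_apply, inner_zero_right]
    have h1 : vacState (T χ) x' = vacState (T χ) ((-1 : ℂ) • (x - x')) := by
      rw [vacState_smul, sub_eq_add_neg, ← neg_one_smul ℂ x', vacState_add, vacState_smul, h0]
      ring
    rw [hy2, h1]
    refine (norm_vacState_le _ _).trans ?_
    rw [norm_smul]
    simp
  have h1 : ‖inner ℂ a (ρ x' a)‖ ≤ ‖x - x'‖ := by
    rw [← hy1]
    exact (hbound _).trans ((NonUnitalStarAlgHom.norm_apply_le φ y).trans hy)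
  have h2 : ‖inner ℂ a (ρ (x - x') a)‖ ≤ ‖x - x'‖ :=
    (hbound _).trans (NonUnitalStarAlgHom.norm_apply_le ρ _)
  have h3 : inner ℂ a (ρ x a) = inner ℂ a (ρ (x - x') a) + inner ℂ a (ρ x' a) := by
    rw [← inner_add_right, ← ContinuousLinearMap.add_apply, ← map_add, sub_add_cancel]
  have h4 := norm_add_le (inner ℂ a (ρ (x - x') a)) (inner ℂ a (ρ x' a))
  rw [← h3] at h4
  linarith

end vacuum

/-! ### The representations `π_t` separate points. -/

section faithful
variable {n : ℕ} {H : Type} [NormedAddCommGroup H] [InnerProductSpace ℂ H] [CompleteSpace H]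

/-- The decomposition of a representation into a diagonal array of unitaries and shifts along the
longest word. -/
structure Split (D : ℕ → ℕ → H →L[ℂ] H) (s : Fin (longestWord n).length → H →L[ℂ] H)
    (ρ : CrystalAlg n →⋆ₐ[ℂ] (H →L[ℂ] H)) : Prop where
  rel : CRel n D
  block : Block n 0 D
  legs : LegList n (List.ofFn fun k => (((longestWord n).get k : ℕ), s k))
  nil : ∀ r, Nil (s r)
  comm : ∀ r, DComm (s r) D
  gen : ∀ i j, ρ (crystalGen n i j) = conv D (wordArr
      (List.ofFn fun k => (((longestWord n).get k : ℕ), s k))) i j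

variable {D : ℕ → ℕ → H →L[ℂ] H} {s : Fin (longestWord n).length → H →L[ℂ] H}
    {ρ : CrystalAlg n →⋆ₐ[ℂ] (H →L[ℂ] H)}

theorem Split.coisom (h : Split D s ρ) (r) : s r * star (s r) = 1 :=
  h.legs.coisom (((longestWord n).get r : ℕ), s r) ((List.mem_ofFn' _ _).2 ⟨r, rfl⟩)

theorem Split.DC_legs (h : Split D s ρ) (r r') (hne : r ≠ r') : DC (s r) (s r') := by
  have h1 := List.pairwise_ofFn.1 h.legs.pairwise
  rcases lt_or_gt_of_ne hne with h2 | h2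
  · exact h1 h2
  · exact (h1 h2).symm

theorem Split.commute_diag (h : Split D s ρ) {i : ℕ} (hi : i ≤ n) (x : CrystalAlg n) :
    Commute (D i i) (ρ x) ∧ Commute (star (D i i)) (ρ x) := by
  have hw : ∀ j k : ℕ, DC (D i i) (wordArr
      (List.ofFn fun k => (((longestWord n).get k : ℕ), s k)) j k) := fun j k => by
    refine DComm.act (a := D i i) (fun p hp => ?_) (DComm.idArr _) j k
    obtain ⟨r, rfl⟩ := (List.mem_ofFn' _ _).1 hp
    exact DC.symm (h.comm r i i)
  constructor
  · refine commute_rep ρ (fun j k => ?_) x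
    rw [h.gen, conv_diag h.block _ (by omega) (by omega)]
    exact (h.rel.commute_diag h.block hi (by omega)).mul_right (hw _ _).1
  · refine commute_rep ρ (fun j k => ?_) x
    rw [h.gen, conv_diag h.block _ (by omega) (by omega)]
    exact (h.rel.commute_star_diag h.block (j := i) (by omega) hi).symm.mul_right (hw _ _).2

/-- A closed submodule that is invariant under the representation and under the diagonal part, and
contains all vacuum vectors, is everything. -/
theorem Split.eq_top (h : Split D s ρ) {M : Submodule ℂ H} (hM : IsClosed (M : Set H))
    (hMD : ∀ i ≤ n, ∀ g ∈ M, D i i g ∈ M ∧ star (D i i) g ∈ M)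
    (hMρ : ∀ x, ∀ g ∈ M, ρ x g ∈ M) (hk : ∀ a, (∀ r, s r a = 0) → a ∈ M) : M = ⊤ := by
  refine eq_top_of_mon_mem h.coisom h.DC_legs h.nil hM fun a ha => ?_
  have hmem : ∀ p ∈ (List.ofFn fun k => (((longestWord n).get k : ℕ), s k)),
      ∃ r, p.2 = s r := fun p hp => by
    obtain ⟨r, rfl⟩ := (List.mem_ofFn' _ _).1 hp
    exact ⟨r, rfl⟩
  obtain ⟨N, hN, haN, hNs⟩ := exists_invariant le_rfl h.rel h.block (A := List.ofFn fun k =>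
      (((longestWord n).get k : ℕ), s k)) (by
        rw [← longestWord_map, List.map_ofFn]
        exact List.ext_getElem (by simp) fun i h1 h2 => by simp) h.legs (fun p hp => by
          obtain ⟨r, hr⟩ := hmem p hp
          rw [hr]
          exact h.comm r) hMD (fun i j hi hj g hg => by
        have := h.gen ⟨i, by omega⟩ ⟨j, by omega⟩
        rw [← this, ← map_star ρ]
        exact ⟨hMρ _ g hg, hMρ _ g hg⟩) (hk a ha) (fun p hp => by
          obtain ⟨r, hr⟩ := hmem p hp
          rw [hr]
          exact ha r)
  exact ⟨N, hN, haN, fun r => hNs (((longestWord n).get r : ℕ), s r)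
    ((List.mem_ofFn' _ _).2 ⟨r, rfl⟩)⟩

theorem inner_rep (ρ : CrystalAlg n →⋆ₐ[ℂ] (H →L[ℂ] H)) (x : CrystalAlg n) (a b : H) :
    inner ℂ (ρ x a) b = inner ℂ a (ρ (star x) b) := by
  rw [map_star, ContinuousLinearMap.star_eq_adjoint, ContinuousLinearMap.adjoint_inner_right]

/-- The vectors killed by all `ρ (x * y)` form a closed subspace, invariant under `ρ` and the
diagonal part. It contains every vacuum vector, because the expectation of `star (x * y) * (x * y)`
vanishes; so it is the whole space. -/
theorem Split.eq_zero (h : Split D s ρ) {x : CrystalAlg n} (hx : ∀ t, crystalRep t x = 0) :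
    ρ x = 0 := by
  let M : Submodule ℂ H :=
    { carrier := {g | ∀ y, ρ (x * y) g = 0}
      add_mem' := fun {a b} ha hb y => by rw [map_add, ha, hb, add_zero]
      zero_mem' := fun y => map_zero _
      smul_mem' := fun c a ha y => by rw [map_smul, ha, smul_zero] }
  have hM : IsClosed (M : Set H) := by
    have : (M : Set H) = ⋂ y, {g | ρ (x * y) g = 0} := by
      ext g
      simp only [Set.mem_iInter]
      rfl
    rw [this]
    exact isClosed_iInter fun y => isClosed_eq (ρ (x * y)).continuous continuous_const
  have htop : M = ⊤ := by
    refine h.eq_top hM (fun i hi g hg => ⟨fun y => ?_, fun y => ?_⟩) (fun a g hg y => ?_)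
      fun a ha y => ?_
    · have := DFunLike.congr_fun (h.commute_diag hi (x * y)).1.eq g
      rw [ContinuousLinearMap.mul_apply, ContinuousLinearMap.mul_apply, hg, map_zero] at this
      exact this.symm
    · have := DFunLike.congr_fun (h.commute_diag hi (x * y)).2.eq g
      rw [ContinuousLinearMap.mul_apply, ContinuousLinearMap.mul_apply, hg, map_zero] at this
      exact this.symm
    · have := hg (y * a)
      rwa [← mul_assoc, map_mul] at this
    · rcases eq_or_ne a 0 with rfl | hne
      · exact map_zero _
      · have h0 : ‖a‖ ≠ 0 := norm_ne_zero_iff.2 hne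
        have h1 := vacuum_expectation h.rel h.block h.coisom h.DC_legs h.nil h.comm ρ h.gen
          (a := ((‖a‖⁻¹ : ℝ) : ℂ) • a) (fun r => by rw [map_smul, ha, smul_zero])
          (by rw [norm_smul, Complex.norm_real, norm_inv, norm_norm, inv_mul_cancel₀ h0])
          (x := star (x * y) * (x * y)) (fun t => by rw [map_mul, map_mul, hx, zero_mul, mul_zero])
        rw [map_mul, ContinuousLinearMap.mul_apply, ← inner_rep, inner_self_eq_zero,
          map_smul, smul_eq_zero] at h1
        refine h1.resolve_left ?_
        simpa using hne
  ext g
  have : g ∈ M := by rw [htop]; trivial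
  simpa using this 1

/-- The representations `π_t` of the longest word separate the points of `A₀`. -/
theorem rep_eq_zero [Nontrivial H] (τ : CrystalAlg n →⋆ₐ[ℂ] (H →L[ℂ] H)) {x : CrystalAlg n}
    (hx : ∀ t, crystalRep t x = 0) : τ x = 0 := by
  set N := (longestWord n).length with hN
  set z : ℕ → ℕ → H →L[ℂ] H := fun i j => τ (toNat (crystalGen n) i j) with hz
  have hzr : CRel n z := ((crystalRelations_iff (toNat_val (crystalGen n))).1
    (crystalGen_relations n)).map τ
  set u : ℕ → ℕ → L2 (Fin N → ℕ) H →L[ℂ] L2 (Fin N → ℕ) H :=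
    fun i j => amp (Fin N → ℕ) H (z i j) with hu
  have hur : CRel n u := hzr.map _
  set A := wordLegs H (longestWord n) with hA
  have hAmem : ∀ p ∈ A, ∃ k, p.2 = legS H k := by
    intro p hp
    obtain ⟨k, rfl⟩ := (List.mem_ofFn' _ _).1 hp
    exact ⟨k, rfl⟩
  have hAc : ∀ p ∈ A, DComm p.2 u := by
    intro p hp i j
    obtain ⟨k, hk⟩ := hAmem p hp
    rw [hk]
    exact ⟨commute_pullL_amp _ _ _, commute_star_pullL_amp _ _ _⟩
  have hAL := wordLegs_legList H (longestWord n)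
  -- `ρ` is the convolution `π_{w_L} * τ` on `ℓ²(ℕ^N; H)`.
  obtain ⟨ρ, hρ, -⟩ := crystalAlg_existsUnique_lift (B := L2 (Fin N → ℕ) H →L[ℂ] L2 (Fin N → ℕ) H)
    ((crystalRelations_iff (z := fun i j : Fin (n + 1) => act A u i j) (y := act A u)
      fun i j => rfl).2 (hur.act hAL hAc))
  -- On large boxes the shifts are almost trivial, so `τ` is the symbol of `ρ`, and it suffices that
  -- `ρ x = 0`.
  have hsym : Sym (boxIso N H) (ρ x) (τ x) := by
    refine Sym.extend (fun i j => ?_) x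
    rw [hρ, toNat_val (crystalGen n) i j]
    refine Sym.act (fun p hp => ?_) (fun i j => sym_amp _) _ _
    obtain ⟨k, hk⟩ := hAmem p hp
    rw [hk]
    exact sym_legS k
  -- An arbitrary array is an `n`-block array for trivial reasons, so the whole word can absorb it.
  obtain ⟨D, L, hD, hDb, hLm, hLL, hLN, hLD, hLz, -⟩ := exists_absorption le_rfl hur
    (fun i j hi hj _ h => by omega)
    ((wordLegs_map H (longestWord n)).trans (longestWord_map n)) hAL (fun p hp => by
      obtain ⟨k, hk⟩ := hAmem p hp
      rw [hk]
      exact nil_legS k) hAc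
  obtain ⟨s, rfl⟩ := exists_ofFn (hLm.trans (longestWord_map n).symm)
  have hS : Split D s ρ :=
    { rel := hD
      block := hDb
      legs := hLL
      nil := fun r => hLN _ ((List.mem_ofFn' _ _).2 ⟨r, rfl⟩)
      comm := fun r => hLD _ ((List.mem_ofFn' _ _).2 ⟨r, rfl⟩)
      gen := fun i j => by rw [hρ, hLz _ _ (by omega) (by omega)] }
  rw [hS.eq_zero hx] at hsym
  exact hsym.unique Sym.zero

end faithful

/-! ### Irreducibility of `π_t`. -/

section irreducible
variable {n : ℕ} (t : Fin n → Circle)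

theorem block_scalar {B : Type*} [Ring B] [Algebra ℂ B] :
    Block n 0 fun i j => algebraMap ℂ B (torusNat t i) * idArr i j := fun i j _ _ hne _ => by
  change _ * idArr i j = 0
  rw [idArr, if_neg hne, mul_zero]

theorem split_crystalRep : Split (fun i j => algebraMap ℂ _ (torusNat t i) * idArr i j)
    (fun k => legS ℂ k) (crystalRep t) where
  rel := twist_scalar idArr_rel t
  block := block_scalar t
  legs := wordLegs_legList ℂ (longestWord n)
  nil := nil_legS
  comm r i j := by
    refine DC.mul (DC_algebraMap _ _).symm ?_
    exact DComm.idArr _ i j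
  gen i j := by
    rw [crystalRep_spec t, torusWordOp_eq, conv_diag (block_scalar t) _ (by omega) (by omega),
      idArr, if_pos rfl, mul_one]
    rfl

theorem eq_single_of_killed {N : ℕ} {f : L2 (Fin N → ℕ) ℂ} (h : ∀ r, legS ℂ r f = 0) :
    f = L2.single 0 (f 0) := by
  ext m
  rw [L2.single_apply]
  split_ifs with hm
  · rw [hm]
  · obtain ⟨r, hr⟩ : ∃ r, m r ≠ 0 := by
      by_contra! h0
      exact hm (funext h0)
    obtain ⟨m', rfl⟩ := (exists_up r m).2 hr
    have := congrArg (fun g : L2 (Fin N → ℕ) ℂ => g m') (h r)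
    exact this

/-- Here the diagonal part consists of scalars, and every vector killed by all shifts is a multiple
of the vacuum. -/
theorem vacVec_generates {M : Submodule ℂ (WordSpace (longestWord n))}
    (hM : IsClosed (M : Set (WordSpace (longestWord n))))
    (hMρ : ∀ x, ∀ g ∈ M, crystalRep t x g ∈ M) (h0 : vacVec n ∈ M) : M = ⊤ := by
  refine (split_crystalRep t).eq_top hM (fun i hi g hg => ?_) hMρ fun a ha => ?_
  · rw [idArr, if_pos rfl, mul_one, ← algebraMap_star_comm]
    exact ⟨M.smul_mem _ hg, M.smul_mem _ hg⟩
  · rw [eq_single_of_killed ha]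
    have : (L2.single 0 (a 0) : WordSpace (longestWord n)) = a 0 • vacVec n := by
      ext m
      change _ = a 0 * (L2.single 0 1 : WordSpace (longestWord n)) m
      rw [L2.single_apply, L2.single_apply, mul_ite, mul_one, mul_zero]
    rw [this]
    exact M.smul_mem _ h0

theorem vacTensor_univ_apply {N : ℕ} (f : L2 (Fin N → ℕ) ℂ) :
    vacTensor Finset.univ f = L2.single 0 (f 0) := by
  have hl : ∀ (r : Fin N) (l : List (Fin N)), r ∈ l →
      legS ℂ r * (l.map fun k => 1 - star (legS ℂ k) * legS ℂ k).prod = 0 := by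
    intro r l
    induction l with
    | nil => simp
    | cons k l ih =>
      intro hr
      rw [List.map_cons, List.prod_cons]
      rcases eq_or_ne r k with rfl | hne
      · rw [← mul_assoc, mul_sub, mul_one, ← mul_assoc, legS_mul_star, one_mul, sub_self, zero_mul]
      · rw [← mul_assoc, ((DC_legS (E := ℂ) hne).proj).1.eq, mul_assoc,
          ih ((List.mem_cons.1 hr).resolve_left hne), mul_zero]
  have hk : ∀ r : Fin N, legS ℂ r * vacTensor Finset.univ = 0 := by
    intro r
    rw [vacTensor_eq, List.ofFn_eq_map]
    simp only [Finset.mem_univ, if_true]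
    exact hl r _ (List.mem_finRange r)
  have h1 := eq_single_of_killed (f := vacTensor Finset.univ f) fun r =>
    DFunLike.congr_fun (hk r) f
  rw [h1]
  congr 1
  have h2 : inner ℂ (L2.single (0 : Fin N → ℕ) (1 : ℂ)) (vacTensor Finset.univ f) =
      inner ℂ (L2.single (0 : Fin N → ℕ) (1 : ℂ)) f := by
    conv_lhs => rw [← vacTensor_star, ContinuousLinearMap.star_eq_adjoint,
      ContinuousLinearMap.adjoint_inner_right, vacTensor_univ_single]
  rw [L2.inner_single, L2.inner_single] at h2
  simpa using h2

theorem crystalRep_key : crystalRep t (star (keyElement n) * keyElement n) =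
    vacTensor Finset.univ := by
  have hs : ‖(List.ofFn (bracketScalar t)).prod‖ = 1 := by
    rw [List.prod_ofFn, norm_prod]
    exact Finset.prod_eq_one fun p _ => norm_bracketScalar t p
  rw [map_mul, map_star, exists_rep_keyElement (crystalRep_spec t), star_smul, vacTensor_star,
    smul_mul_smul_comm, vacTensor_mul, Finset.union_self, RCLike.star_def, RCLike.conj_mul, hs]
  simp

/-- `π_t (star a * a)` is the projection onto the vacuum. If some vector of `K` has a nonzero vacuum
coefficient, `K` contains the vacuum and is everything; otherwise the orthogonal complement contains
it and is everything. -/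
theorem irreducible_crystalRep (K : Submodule ℂ (WordSpace (longestWord n)))
    (hK : IsClosed (K : Set (WordSpace (longestWord n))))
    (hKρ : ∀ x, ∀ g ∈ K, crystalRep t x g ∈ K) : K = ⊥ ∨ K = ⊤ := by
  by_cases h : ∃ g ∈ K, g 0 ≠ 0
  · right
    obtain ⟨g, hg, hg0⟩ := h
    refine vacVec_generates t hK hKρ ?_
    have h1 := hKρ (star (keyElement n) * keyElement n) g hg
    rw [crystalRep_key, vacTensor_univ_apply] at h1
    have h2 : vacVec n = (g 0)⁻¹ • (L2.single 0 (g 0) : WordSpace (longestWord n)) := by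
      ext m
      change (L2.single 0 1 : WordSpace (longestWord n)) m =
        (g 0)⁻¹ * (L2.single 0 (g 0) : WordSpace (longestWord n)) m
      rw [L2.single_apply, L2.single_apply]
      split_ifs
      · rw [inv_mul_cancel₀ hg0]
      · rw [mul_zero]
    rw [h2]
    exact K.smul_mem _ h1
  · left
    push Not at h
    have h1 : Kᗮ = ⊤ := by
      refine vacVec_generates t K.isClosed_orthogonal (fun x g hg => ?_) ?_
      · rw [Submodule.mem_orthogonal] at hg ⊢
        intro k hk
        have := hg _ (hKρ (star x) k hk)
        rwa [inner_rep, star_star] at this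
      · rw [Submodule.mem_orthogonal']
        intro k hk
        refine (L2.inner_single (0 : Fin (longestWord n).length → ℕ) (1 : ℂ) k).trans ?_
        rw [h k hk]
        simp
    rw [Submodule.orthogonal_eq_top_iff] at h1
    exact h1

end irreducible

/-! ### Commutative corners of irreducible sets of operators. -/

section corner
variable {H : Type} [NormedAddCommGroup H] [InnerProductSpace ℂ H] [CompleteSpace H]

theorem mul_posPart {q k : H →L[ℂ] H} (hq : star q = q) (hk : IsSelfAdjoint k) (hqk : q * k = k) :
    q * k⁺ = k⁺ := by
  have hu : star k⁺ = k⁺ := (CFC.posPart_nonneg k).isSelfAdjoint.star_eq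
  have h1 : k * k⁺ = k⁺ * k⁺ := by
    calc k * k⁺ = (k⁺ - k⁻) * k⁺ := by rw [CFC.posPart_sub_negPart k hk]
      _ = k⁺ * k⁺ := by rw [sub_mul, CFC.negPart_mul_posPart, sub_zero]
  have h2 : (q * k⁺ - k⁺) * star (q * k⁺ - k⁺) = 0 := by
    rw [star_sub, star_mul, hu, hq, mul_sub, ← mul_assoc, sub_mul, mul_assoc q, ← h1, ← mul_assoc,
      hqk, sub_self, zero_mul, sub_zero]
  exact sub_eq_zero.1 ((CStarRing.mul_star_self_eq_zero_iff _).1 h2)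

/-- `k⁺` commutes with the corner since it is a function of `k`. So `k⁺ * T * k⁻ = (q * T * q) * k⁺
* k⁻ = 0` for all `T`, and irreducibility makes one of the two parts vanish. -/
theorem corner_dichotomy {q k : H →L[ℂ] H} (hq : star q = q) (hk : IsSelfAdjoint k)
    (hqk : q * k = k) {𝒯 : Set (H →L[ℂ] H)}
    (hirr : ∀ X Y : H →L[ℂ] H, (∀ T ∈ 𝒯, X * T * Y = 0) → X = 0 ∨ Y = 0)
    (hc : ∀ T ∈ 𝒯, Commute k (q * T * q)) : 0 ≤ k ∨ k ≤ 0 := by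
  have h1 := mul_posPart hq hk hqk
  have h2 : q * k⁻ = k⁻ := by
    rw [← CFC.posPart_neg]
    exact mul_posPart hq hk.neg (by rw [mul_neg, hqk])
  have h3 : k⁺ * q = k⁺ := by
    have := congrArg star h1
    rwa [star_mul, hq, (CFC.posPart_nonneg k).isSelfAdjoint.star_eq] at this
  have h4 := CFC.posPart_sub_negPart k hk
  rcases hirr k⁺ k⁻ fun T hT => by
    have h5 : Commute k⁺ (q * T * q) := (hc T hT).cfcₙ_real _
    calc k⁺ * T * k⁻ = k⁺ * (q * T * q) * k⁻ := by
          conv_lhs => rw [← h3, ← h2]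
          simp only [mul_assoc]
      _ = 0 := by rw [h5.eq, mul_assoc, CFC.posPart_mul_negPart, mul_zero] with h | h
  · right
    rw [← h4, h, zero_sub, neg_nonpos]
    exact CFC.negPart_nonneg k
  · left
    rw [← h4, h, sub_zero]
    exact CFC.posPart_nonneg k

/-- A commutative corner of an irreducible set of operators consists of scalars. -/
theorem corner_scalar {q : H →L[ℂ] H} (hq : star q = q) (hqq : q * q = q) (hq0 : q ≠ 0)
    {𝒯 : Set (H →L[ℂ] H)} (hirr : ∀ X Y : H →L[ℂ] H, (∀ T ∈ 𝒯, X * T * Y = 0) → X = 0 ∨ Y = 0)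
    (hc : ∀ T ∈ 𝒯, ∀ T' ∈ 𝒯, Commute (q * T * q) (q * T' * q)) {T : H →L[ℂ] H} (hT : T ∈ 𝒯)
    (hTs : star T = T) : ∃ c : ℂ, q * T * q = c • q := by
  set h := q * T * q with hh
  have hsa : star h = h := by
    rw [hh, star_mul, star_mul, hq, hTs, mul_assoc]
  have hqh : q * h = h := by rw [hh, ← mul_assoc, ← mul_assoc, hqq]
  have hhq : h * q = h := by rw [hh, mul_assoc, hqq]
  -- For every real `c` the operator `h - c • q` is again self-adjoint in the corner, so it has a
  -- definite sign.
  have hdich : ∀ c : ℝ, 0 ≤ h - (c : ℂ) • q ∨ h - (c : ℂ) • q ≤ 0 := by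
    intro c
    refine corner_dichotomy hq ?_ ?_ hirr fun T' hT' => ?_
    · rw [IsSelfAdjoint, star_sub, star_smul, hsa, hq, RCLike.star_def, Complex.conj_ofReal]
    · rw [mul_sub, hqh, mul_smul_comm, hqq]
    · refine (hc T hT T' hT').sub_left (Commute.smul_left ?_ _)
      rw [Commute, SemiconjBy, ← mul_assoc, ← mul_assoc, hqq, mul_assoc (q * T'), hqq]
  obtain ⟨v, hv⟩ : ∃ v, q v ≠ 0 := by
    by_contra! h0
    exact hq0 (ContinuousLinearMap.ext h0)
  have hform : ∀ (c : ℝ) (w : H), ((h - (c : ℂ) • q).reApplyInnerSelf (q w)) =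
      h.reApplyInnerSelf (q w) - c * ‖q w‖ ^ 2 := by
    intro c w
    have hqw : q (q w) = q w := DFunLike.congr_fun hqq w
    rw [ContinuousLinearMap.reApplyInnerSelf_apply, ContinuousLinearMap.reApplyInnerSelf_apply,
      ContinuousLinearMap.sub_apply, ContinuousLinearMap.smul_apply, hqw, inner_sub_left,
      inner_smul_left, map_sub, Complex.conj_ofReal, inner_self_eq_norm_sq_to_K]
    congr 1
    norm_cast
    change ((c : ℂ) * ((‖q w‖ ^ 2 : ℝ) : ℂ)).re = _
    rw [Complex.re_ofReal_mul, Complex.ofReal_re]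
  have hpos : ∀ {k : H →L[ℂ] H}, 0 ≤ k → ∀ w, 0 ≤ k.reApplyInnerSelf w := fun hk w =>
    ((ContinuousLinearMap.nonneg_iff_isPositive _).1 hk).2 w
  have hneg : ∀ {k : H →L[ℂ] H}, k ≤ 0 → ∀ w, k.reApplyInnerSelf w ≤ 0 := fun {k} hk w => by
    have := hpos (neg_nonneg.2 hk) w
    rw [ContinuousLinearMap.reApplyInnerSelf_apply, ContinuousLinearMap.neg_apply, inner_neg_left,
      map_neg] at this
    rw [ContinuousLinearMap.reApplyInnerSelf_apply]
    linarith
  have hvn : 0 < ‖q v‖ ^ 2 := by positivity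
  set c₀ := h.reApplyInnerSelf (q v) / ‖q v‖ ^ 2 with hc₀
  have hc₀' : h.reApplyInnerSelf (q v) = c₀ * ‖q v‖ ^ 2 := by
    rw [hc₀, div_mul_cancel₀ _ hvn.ne']
  -- If the normalized quadratic form took two different values, `h - c • q` would have both signs
  -- for `c` their midpoint.
  have hconst : ∀ w, h.reApplyInnerSelf (q w) = c₀ * ‖q w‖ ^ 2 := by
    intro w
    rcases eq_or_ne (q w) 0 with hw | hw
    · rw [hw, ContinuousLinearMap.reApplyInnerSelf_apply, inner_zero_right]
      simp
    have hwn : 0 < ‖q w‖ ^ 2 := by positivity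
    set c₁ := h.reApplyInnerSelf (q w) / ‖q w‖ ^ 2 with hc₁
    have hc₁' : h.reApplyInnerSelf (q w) = c₁ * ‖q w‖ ^ 2 := by
      rw [hc₁, div_mul_cancel₀ _ hwn.ne']
    rw [hc₁']
    congr 1
    by_contra hne
    have key : ∀ z, h.reApplyInnerSelf (q z) - (c₀ + c₁) / 2 * ‖q z‖ ^ 2 =
        ((h - (((c₀ + c₁) / 2 : ℝ) : ℂ) • q).reApplyInnerSelf (q z)) := fun z => (hform _ z).symm
    have e0 := key v
    have e1 := key w
    rw [hc₀'] at e0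
    rw [hc₁'] at e1
    have f0 : (c₀ - c₁) / 2 * ‖q v‖ ^ 2 =
        ((h - (((c₀ + c₁) / 2 : ℝ) : ℂ) • q).reApplyInnerSelf (q v)) := by rw [← e0]; ring
    have f1 : (c₁ - c₀) / 2 * ‖q w‖ ^ 2 =
        ((h - (((c₀ + c₁) / 2 : ℝ) : ℂ) • q).reApplyInnerSelf (q w)) := by rw [← e1]; ring
    rcases hdich ((c₀ + c₁) / 2) with hd | hd
    · have g0 := hpos hd (q v)
      have g1 := hpos hd (q w)
      rw [← f0] at g0
      rw [← f1] at g1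
      have := nonneg_of_mul_nonneg_left g0 hvn
      have := nonneg_of_mul_nonneg_left g1 hwn
      exact hne (by linarith)
    · have g0 := hneg hd (q v)
      have g1 := hneg hd (q w)
      rw [← f0] at g0
      rw [← f1] at g1
      have := nonpos_of_mul_nonpos_left g0 hvn
      have := nonpos_of_mul_nonpos_left g1 hwn
      exact hne (by linarith)
  refine ⟨c₀, ?_⟩
  have hk : IsSelfAdjoint (h - (c₀ : ℂ) • q) := by
    rw [IsSelfAdjoint, star_sub, star_smul, hsa, hq, RCLike.star_def, Complex.conj_ofReal]
  have hk0 : ((h - (c₀ : ℂ) • q : H →L[ℂ] H) : H →ₗ[ℂ] H) = 0 := by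
    rw [← inner_map_self_eq_zero]
    intro x
    have h1 : (h - (c₀ : ℂ) • q) = q * (h - (c₀ : ℂ) • q) * q := by
      rw [mul_sub, sub_mul, hqh, mul_smul_comm, hqq, smul_mul_assoc, hqq]
      rw [hhq]
    have h2 : inner ℂ ((h - (c₀ : ℂ) • q) x) x =
        inner ℂ ((h - (c₀ : ℂ) • q) (q x)) (q x) := by
      conv_lhs => rw [h1]
      rw [ContinuousLinearMap.mul_apply, ContinuousLinearMap.mul_apply]
      conv_rhs => rw [← hq]
      rw [ContinuousLinearMap.star_eq_adjoint, ContinuousLinearMap.adjoint_inner_right]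
      rw [← ContinuousLinearMap.star_eq_adjoint, hq]
    change inner ℂ ((h - (c₀ : ℂ) • q) x) x = 0
    rw [h2]
    have h3 : (inner ℂ ((h - (c₀ : ℂ) • q) (q x)) (q x) : ℂ) =
        (((h - (c₀ : ℂ) • q).reApplyInnerSelf (q x) : ℝ) : ℂ) :=
      (hk.isSymmetric.coe_re_inner_apply_self (q x)).symm
    rw [h3, hform, hconst, sub_self, Complex.ofReal_zero]
  exact sub_eq_zero.1 (ContinuousLinearMap.coe_injective hk0)

end corner

/-! ### Orbits of vectors and uniqueness of the GNS representation. -/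

section irreps
variable {n : ℕ}

/-- The orbit map of a vector. -/
noncomputable def orbit {A H : Type*} [CStarAlgebra A] [NormedAddCommGroup H]
    [InnerProductSpace ℂ H] [CompleteSpace H] (ρ : A →⋆ₐ[ℂ] (H →L[ℂ] H)) (v : H) : A →ₗ[ℂ] H where
  toFun a := ρ a v
  map_add' a b := by rw [map_add, ContinuousLinearMap.add_apply]
  map_smul' c a := by rw [map_smul, ContinuousLinearMap.smul_apply, RingHom.id_apply]

theorem orbit_dense {A : Type*} [CStarAlgebra A] (ρ : IrrRep A) {v : ρ.space} (hv : v ≠ 0) :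
    DenseRange (orbit ρ.hom v) := by
  rcases ρ.irreducible (LinearMap.range (orbit ρ.hom v)).topologicalClosure
      (Submodule.isClosed_topologicalClosure _) (by
    intro a u hu
    refine map_mem_closure (t := (LinearMap.range (orbit ρ.hom v) : Set ρ.space))
      (ρ.hom a).continuous hu ?_
    rintro _ ⟨b, rfl⟩
    refine ⟨a * b, ?_⟩
    change ρ.hom (a * b) v = ρ.hom a (ρ.hom b v)
    rw [map_mul, ContinuousLinearMap.mul_apply]) with h | h
  · exfalso
    apply hv
    have : v ∈ (LinearMap.range (orbit ρ.hom v)).topologicalClosure := by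
      refine Submodule.le_topologicalClosure _ ⟨1, ?_⟩
      change ρ.hom 1 v = v
      rw [map_one, ContinuousLinearMap.one_apply]
    rwa [h, Submodule.mem_bot] at this
  · intro u
    have : u ∈ (LinearMap.range (orbit ρ.hom v)).topologicalClosure := by rw [h]; trivial
    exact this

theorem irrRep_prime {A : Type*} [CStarAlgebra A] (ρ : IrrRep A) (X Y : ρ.space →L[ℂ] ρ.space)
    (h : ∀ T ∈ Set.range ρ.hom, X * T * Y = 0) : X = 0 ∨ Y = 0 := by
  rw [or_iff_not_imp_right]
  intro hY
  obtain ⟨v, hv⟩ : ∃ v, Y v ≠ 0 := by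
    by_contra! h0
    exact hY (ContinuousLinearMap.ext h0)
  ext u
  refine (orbit_dense ρ hv).induction_on (p := fun u => X u = 0) u
    (isClosed_eq X.continuous continuous_const) fun a => ?_
  exact DFunLike.congr_fun (h _ ⟨a, rfl⟩) v

/-- Equal vector states give equal norms of `ρ x v` and `σ x w`, so the correspondence of the two
dense orbits extends to a unitary. -/
theorem unitaryEquiv_of_inner {H K : Type} [NormedAddCommGroup H] [InnerProductSpace ℂ H]
    [CompleteSpace H] [NormedAddCommGroup K] [InnerProductSpace ℂ K] [CompleteSpace K]
    {ρ : CrystalAlg n →⋆ₐ[ℂ] (H →L[ℂ] H)} {σ : CrystalAlg n →⋆ₐ[ℂ] (K →L[ℂ] K)} {v : H} {w : K}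
    (hv : DenseRange (orbit ρ v)) (hw : DenseRange (orbit σ w))
    (h : ∀ x, inner ℂ v (ρ x v) = inner ℂ w (σ x w)) : UnitaryEquiv ρ σ := by
  have hn : ∀ x, ‖orbit σ w (LinearEquiv.refl ℂ _ x)‖ = ‖orbit ρ v x‖ := by
    intro x
    change ‖σ x w‖ = ‖ρ x v‖
    rw [@norm_eq_sqrt_re_inner ℂ, @norm_eq_sqrt_re_inner ℂ _ _ _ _ (ρ x v), inner_rep, inner_rep,
      ← ContinuousLinearMap.mul_apply, ← ContinuousLinearMap.mul_apply, ← map_mul, ← map_mul, h]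
  refine ⟨(LinearEquiv.refl ℂ _).extendOfIsometry (orbit ρ v) (orbit σ w) hv hw hn,
    fun a u => ?_⟩
  set U := (LinearEquiv.refl ℂ _).extendOfIsometry (orbit ρ v) (orbit σ w) hv hw hn with hU
  have hUx : ∀ x, U (orbit ρ v x) = orbit σ w x := fun x =>
    LinearEquiv.extendOfIsometry_eq _ _ _ hv hw hn x
  refine hv.induction_on (p := fun u => U (ρ a u) = σ a (U u)) u
    (isClosed_eq (U.continuous.comp (ρ a).continuous) ((σ a).continuous.comp U.continuous)) ?_
  intro x
  have h1 : ρ a (orbit ρ v x) = orbit ρ v (a * x) := by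
    change ρ a (ρ x v) = ρ (a * x) v
    rw [map_mul, ContinuousLinearMap.mul_apply]
  rw [h1, hUx, hUx]
  change σ (a * x) w = σ a (σ x w)
  rw [map_mul, ContinuousLinearMap.mul_apply]

/-- The irreducible representation `π_t` of the longest word. -/
noncomputable def crystalIrr (t : Fin n → Circle) : IrrRep (CrystalAlg n) where
  space := WordSpace (longestWord n)
  hom := crystalRep t
  irreducible K hK h := irreducible_crystalRep t K hK h

end irreps

/-! ### The vacuum projection in the algebra. -/

section rank_one
variable {n : ℕ}

/-- An element sent by every `π_t` to the projection onto the vacuum. -/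
noncomputable def vacElt (n : ℕ) : CrystalAlg n := star (keyElement n) * keyElement n

theorem star_vacElt : star (vacElt n) = vacElt n := by rw [vacElt, star_mul, star_star]

theorem vacTensor_vacVec (E : Finset (Fin (longestWord n).length)) :
    vacTensor E (vacVec n) = vacVec n := by
  have h : vacTensor E * vacTensor Finset.univ = vacTensor (N := (longestWord n).length) Finset.univ := by
    rw [vacTensor_mul, Finset.union_eq_right.2 (Finset.subset_univ _)]
  have h1 := DFunLike.congr_fun h (vacVec n)
  rwa [ContinuousLinearMap.mul_apply, vacVec, vacTensor_univ_single] at h1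

/-- The image of `vacElt n` is the rank one projection onto the vacuum, and compression to it gives
the vacuum expectation. -/
theorem crystalRep_corner (t : Fin n → Circle) (x : CrystalAlg n) :
    crystalRep t (vacElt n * x * vacElt n) = vacState t x • crystalRep t (vacElt n) := by
  have hs : ∀ c : ℂ, (L2.single 0 c : WordSpace (longestWord n)) = c • vacVec n := fun c => by
    ext m
    change _ = c * (L2.single 0 1 : WordSpace (longestWord n)) m
    rw [L2.single_apply, L2.single_apply, mul_ite, mul_one, mul_zero]
  have hv : vacState t x = crystalRep t x (vacVec n) 0 := by
    refine (L2.inner_single (0 : Fin (longestWord n).length → ℕ) (1 : ℂ) _).trans ?_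
    simp
  rw [map_mul, map_mul, vacElt, crystalRep_key]
  refine ContinuousLinearMap.ext fun f => ?_
  rw [ContinuousLinearMap.mul_apply, ContinuousLinearMap.mul_apply,
    ContinuousLinearMap.smul_apply, vacTensor_univ_apply, vacTensor_univ_apply, hs (f 0), map_smul,
    hs]
  change (f 0 * crystalRep t x (vacVec n) 0) • vacVec n = _
  rw [hv, smul_smul, mul_comm]

theorem crystalRep_vacElt_mul (t : Fin n → Circle) :
    crystalRep t (vacElt n) * crystalRep t (vacElt n) = crystalRep t (vacElt n) := by
  rw [vacElt, crystalRep_key, vacTensor_mul, Finset.union_self]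

/-- Separation of points in the form in which identities, checked in the representations `π_t`, are
transferred to an arbitrary one. -/
theorem rep_congr {H : Type} [NormedAddCommGroup H] [InnerProductSpace ℂ H] [CompleteSpace H]
    [Nontrivial H] (τ : CrystalAlg n →⋆ₐ[ℂ] (H →L[ℂ] H)) {x y : CrystalAlg n}
    (h : ∀ t, crystalRep t x = crystalRep t y) : τ x = τ y := by
  rw [← sub_eq_zero, ← map_sub]
  exact rep_eq_zero τ fun t => by rw [map_sub, h, sub_self]

/-- The product `p x₁ p x₂ p ⋯ p` for a list `x₁, x₂, …`. -/
def cornerProd {B : Type*} [Monoid B] (p : B) (l : List B) : B := p * (l.map fun x => x * p).prod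

theorem map_cornerProd {ι B : Type*} [Ring B] [StarRing B] [Algebra ℂ B]
    (φ : CrystalAlg n →⋆ₐ[ℂ] B) {p : CrystalAlg n} {g : ι → CrystalAlg n} {ω : ι → ℂ}
    (l : List ι) (h : ∀ i ∈ l, φ (p * g i * p) = ω i • φ p) :
    φ (cornerProd p (l.map g)) = (l.map ω).prod • φ p := by
  induction l with
  | nil => simp [cornerProd]
  | cons i l ih =>
    have h1 : cornerProd p ((i :: l).map g) = p * g i * p * ((l.map g).map fun x => x * p).prod := by
      rw [cornerProd, List.map_cons, List.map_cons, List.prod_cons]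
      simp only [mul_assoc]
    rw [h1, map_mul, h i (by simp), smul_mul_assoc, ← map_mul, List.map_cons, List.prod_cons,
      ← smul_smul, ← ih fun j hj => h j (by simp [hj])]
    rfl

/-- The bracket with rows `i, …, n`. -/
noncomputable def tailElt (n i : ℕ) : CrystalAlg n :=
  -- The value `1` serves `i = n + 1`, where no rows are left, and `i = 0`, where the product of all
  -- values of `χ_t` is `1`.
  if h : 1 ≤ i ∧ i ≤ n then crystalBracket n ⟨n - i, by omega⟩ else 1

theorem crystalRep_tailElt (t : Fin n → Circle) {i : ℕ} (hi : i ≤ n + 1) :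
    crystalRep t (tailElt n i) (vacVec n) = oprod (torusNat t) i (n + 1) • vacVec n ∧
      crystalRep t (star (tailElt n i)) (vacVec n) =
        star (oprod (torusNat t) i (n + 1)) • vacVec n := by
  rw [tailElt]
  split_ifs with h
  · have h1 := rep_bracket_longestWord (crystalRep_spec t) ⟨n - i, by omega⟩
    have h2 : bracketScalar t ⟨n - i, by omega⟩ = oprod (torusNat t) i (n + 1) := by
      change oprod (fun j => torusNat t (n - (n - i) + j)) 0 (n - i + 1) = _
      rw [oprod_shift]
      congr 1 <;> omega
    rw [map_star, h1, h2, star_smul, vacTensor_star, ContinuousLinearMap.smul_apply,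
      ContinuousLinearMap.smul_apply, vacTensor_vacVec]
    exact ⟨rfl, rfl⟩
  · have h1 : oprod (torusNat t) i (n + 1) = 1 := by
      rcases Nat.eq_zero_or_pos i with rfl | h0
      · exact torusNat_prod t
      · rw [show i = n + 1 by omega, oprod_self]
    rw [h1, star_one, star_one, map_one, one_smul]
    exact ⟨rfl, rfl⟩

/-- An element whose vacuum expectation under `π_t` is `χ_t(z_{i,i})`. -/
noncomputable def diagElt (n i : ℕ) : CrystalAlg n := tailElt n i * star (tailElt n (i + 1))

theorem vacState_diagElt (t : Fin n → Circle) {i : ℕ} (hi : i ≤ n) :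
    vacState t (diagElt n i) = torusNat t i := by
  have hn : ∀ a b, a ≤ b → oprod (torusNat t) a b * star (oprod (torusNat t) a b) = 1 := by
    intro a b hab
    induction b, hab using Nat.le_induction with
    | base => simp [oprod_self]
    | succ b hb ih =>
      rw [oprod_succ hb, star_mul, mul_assoc, ← mul_assoc (torusNat t b), torusNat_mul_star,
        one_mul, ih]
  have h1 : star (oprod (torusNat t) (i + 1) (n + 1)) * oprod (torusNat t) i (n + 1) =
      torusNat t i := by
    rw [oprod_cons (show i < n + 1 by omega), mul_comm, mul_assoc, hn _ _ (by omega), mul_one]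
  rw [vacState, diagElt, map_mul, ContinuousLinearMap.mul_apply,
    (crystalRep_tailElt t (by omega)).2, map_smul, (crystalRep_tailElt t (by omega)).1, smul_smul,
    h1, inner_smul_right, inner_self_eq_norm_sq_to_K, norm_vacVec]
  simp

theorem vacState_star (t : Fin n → Circle) (x : CrystalAlg n) :
    vacState t (star x) = star (vacState t x) := by
  rw [vacState, vacState, ← inner_rep]
  exact (inner_conj_symm _ _).symm

end rank_one

/-! ### The stratum of the longest word. -/

section classify
variable {n : ℕ}

/-- In each `π_t` the corner is scalar, hence commutative. Commutativity passes to `τ`, where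
irreducibility makes the corner scalar; general elements are split into real and imaginary parts. -/
theorem exists_corner_scalar (τ : IrrRep (CrystalAlg n)) (h0 : τ.hom (vacElt n) ≠ 0)
    (x : CrystalAlg n) : ∃ c : ℂ, τ.hom (vacElt n * x * vacElt n) = c • τ.hom (vacElt n) := by
  have hq : star (τ.hom (vacElt n)) = τ.hom (vacElt n) := by rw [← map_star, star_vacElt]
  have hqq : τ.hom (vacElt n) * τ.hom (vacElt n) = τ.hom (vacElt n) := by
    rw [← map_mul]
    exact rep_congr τ.hom fun t => by rw [map_mul, crystalRep_vacElt_mul]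
  have hc : ∀ T ∈ Set.range τ.hom, ∀ T' ∈ Set.range τ.hom,
      Commute (τ.hom (vacElt n) * T * τ.hom (vacElt n))
        (τ.hom (vacElt n) * T' * τ.hom (vacElt n)) := by
    rintro _ ⟨a, rfl⟩ _ ⟨b, rfl⟩
    rw [Commute, SemiconjBy, ← map_mul, ← map_mul, ← map_mul, ← map_mul, ← map_mul, ← map_mul]
    refine rep_congr τ.hom fun t => ?_
    rw [map_mul, map_mul (crystalRep t) (vacElt n * b * vacElt n), crystalRep_corner,
      crystalRep_corner, smul_mul_smul_comm, smul_mul_smul_comm, mul_comm]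
  have key : ∀ y : CrystalAlg n, star y = y →
      ∃ c : ℂ, τ.hom (vacElt n * y * vacElt n) = c • τ.hom (vacElt n) := by
    intro y hy
    rw [map_mul, map_mul]
    exact corner_scalar hq hqq h0 (irrRep_prime τ) hc ⟨y, rfl⟩ (by rw [← map_star, hy])
  obtain ⟨c, hc1⟩ := key (realPart x : CrystalAlg n) (realPart x).2
  obtain ⟨d, hd⟩ := key (imaginaryPart x : CrystalAlg n) (imaginaryPart x).2
  refine ⟨c + Complex.I * d, ?_⟩
  conv_lhs => rw [← realPart_add_I_smul_imaginaryPart x]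
  rw [mul_add, add_mul, map_add, hc1, mul_smul_comm, smul_mul_assoc, map_smul, hd, add_smul,
    smul_smul]

theorem continuous_rep {H : Type} [NormedAddCommGroup H] [InnerProductSpace ℂ H] [CompleteSpace H]
    (φ : CrystalAlg n →⋆ₐ[ℂ] (H →L[ℂ] H)) : Continuous φ :=
  AddMonoidHomClass.continuous_of_bound φ 1 fun a => by
    rw [one_mul]
    exact NonUnitalStarAlgHom.norm_apply_le φ a

theorem continuous_vacState (t : Fin n → Circle) : Continuous (vacState t) := by
  have h : Continuous fun x : CrystalAlg n => crystalRep t x (vacVec n) :=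
    (ContinuousLinearMap.apply ℂ _ (vacVec n)).continuous.comp (continuous_rep (crystalRep t))
  exact continuous_const.inner h

theorem corner_eq_of_genProd {H : Type} [NormedAddCommGroup H] [InnerProductSpace ℂ H]
    [CompleteSpace H] (φ : CrystalAlg n →⋆ₐ[ℂ] (H →L[ℂ] H)) {p : CrystalAlg n}
    {t : Fin n → Circle} (h : ∀ l, φ (p * genProd l * p) = vacState t (genProd l) • φ p)
    (x : CrystalAlg n) : φ (p * x * p) = vacState t x • φ p := by
  let K : Submodule ℂ (CrystalAlg n) :=
    { carrier := {x | φ (p * x * p) = vacState t x • φ p}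
      add_mem' := fun {x y} (hx : φ _ = _) (hy : φ _ = _) => by
        change φ _ = _
        rw [mul_add, add_mul, map_add, hx, hy, vacState_add, add_smul]
      zero_mem' := by
        change φ _ = _
        rw [mul_zero, zero_mul, map_zero, vacState, map_zero, ContinuousLinearMap.zero_apply,
          inner_zero_right, zero_smul]
      smul_mem' := fun c x (hx : φ _ = _) => by
        change φ _ = _
        rw [mul_smul_comm, smul_mul_assoc, map_smul, hx, vacState_smul, smul_smul] }
  have h1 : Continuous fun x : CrystalAlg n => φ (p * x * p) :=
    (continuous_rep φ).comp ((continuous_const.mul continuous_id).mul continuous_const)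
  have h2 : Continuous fun x : CrystalAlg n => vacState t x • φ p :=
    (continuous_vacState t).smul continuous_const
  exact mem_of_genProd_mem (K := K) (isClosed_eq h1 h2) h x

/-- The scalars of `diagElt n i` have modulus one and product `1`, because the corresponding
identities hold in all `π_t`; they determine the torus point. It remains to compare monomials. -/
theorem exists_vacState (τ : IrrRep (CrystalAlg n)) (h0 : τ.hom (vacElt n) ≠ 0) :
    ∃ t, ∀ x, τ.hom (vacElt n * x * vacElt n) = vacState t x • τ.hom (vacElt n) := by
  choose ω hω using exists_corner_scalar τ h0
  have hinj : ∀ c d : ℂ, c • τ.hom (vacElt n) = d • τ.hom (vacElt n) → c = d := fun c d h =>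
    smul_left_injective ℂ h0 h
  have hunit : ∀ i ≤ n, ω (diagElt n i) * star (ω (diagElt n i)) = 1 := by
    intro i hi
    apply hinj
    have h1 : τ.hom (vacElt n * star (diagElt n i) * vacElt n) =
        star (ω (diagElt n i)) • τ.hom (vacElt n) := by
      have := congrArg star (hω (diagElt n i))
      rwa [← map_star, star_mul, star_mul, star_vacElt, ← mul_assoc, star_smul, ← map_star,
        star_vacElt] at this
    have h2 : τ.hom (vacElt n * diagElt n i * vacElt n *
        (vacElt n * star (diagElt n i) * vacElt n)) = τ.hom (vacElt n) := by
      refine rep_congr τ.hom fun t => ?_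
      rw [map_mul, crystalRep_corner, crystalRep_corner, smul_mul_smul_comm,
        crystalRep_vacElt_mul, vacState_star, vacState_diagElt t hi, torusNat_mul_star, one_smul]
    have h3 : τ.hom (vacElt n) * τ.hom (vacElt n) = τ.hom (vacElt n) := by
      rw [← map_mul]
      exact rep_congr τ.hom fun t => by rw [map_mul, crystalRep_vacElt_mul]
    rw [map_mul, hω, h1, smul_mul_smul_comm, h3] at h2
    rw [h2, one_smul]
  have hprod : oprod (fun i => ω (diagElt n i)) 0 (n + 1) = 1 := by
    apply hinj
    rw [oprod, ← map_cornerProd τ.hom (g := diagElt n) (ω := fun i => ω (diagElt n i)) _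
      fun i _ => hω _, one_smul]
    refine rep_congr τ.hom fun t => ?_
    rw [map_cornerProd (crystalRep t) (ω := torusNat t) _ fun i hi => ?_]
    · have := torusNat_prod t
      rw [oprod] at this
      rw [this, one_smul]
    · rw [crystalRep_corner, vacState_diagElt]
      have := (List.Ico.mem.1 hi).2
      omega
  obtain ⟨t, ht⟩ := exists_torus hunit hprod
  refine ⟨t, fun x => ?_⟩
  refine corner_eq_of_genProd τ.hom (fun l => ?_) x
  -- In every `π_u` the compressed monomial is its vacuum coefficient times a product of diagonal
  -- values, which the elements `diagElt` reproduce inside the corner.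
  have h1 : τ.hom (vacElt n * genProd l * vacElt n) =
      τ.hom (vacCoeff l • cornerProd (vacElt n) (l.map fun r => diagElt n r.1)) := by
    refine rep_congr τ.hom fun u => ?_
    rw [crystalRep_corner, map_smul, map_cornerProd (crystalRep u)
      (ω := fun r : Fin (n + 1) × Fin (n + 1) => torusNat u r.1) l fun r _ => by
        rw [crystalRep_corner, vacState_diagElt u (by omega)], vacState_genProd, smul_smul,
      mul_comm, torusProd]
  rw [h1, map_smul, map_cornerProd τ.hom
    (ω := fun r : Fin (n + 1) × Fin (n + 1) => torusNat t r.1) l fun r _ => by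
      rw [hω, ht _ (by omega)], vacState_genProd, smul_smul, mul_comm, torusProd]

/-- An irreducible representation that does not kill `a` is one of the `π_t`. -/
theorem exists_unitaryEquiv (τ : IrrRep (CrystalAlg n)) (h0 : τ.hom (keyElement n) ≠ 0) :
    ∃ t, UnitaryEquiv τ.hom (crystalRep t) := by
  have hp : τ.hom (vacElt n) ≠ 0 := by
    rw [vacElt, map_mul, map_star]
    exact fun h => h0 ((CStarRing.star_mul_self_eq_zero_iff _).1 h)
  obtain ⟨t, ht⟩ := exists_vacState τ hp
  refine ⟨t, ?_⟩
  have hqq : τ.hom (vacElt n) * τ.hom (vacElt n) = τ.hom (vacElt n) := by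
    rw [← map_mul]
    exact rep_congr τ.hom fun t => by rw [map_mul, crystalRep_vacElt_mul]
  obtain ⟨v, hv⟩ : ∃ v, τ.hom (vacElt n) v ≠ 0 := by
    by_contra! h
    exact hp (ContinuousLinearMap.ext h)
  -- A unit vector in the range of the projection; its vector state is the vacuum state of `π_t`.
  set ξ : τ.space := ((‖τ.hom (vacElt n) v‖⁻¹ : ℝ) : ℂ) • τ.hom (vacElt n) v with hξ
  have hξ1 : ‖ξ‖ = 1 := by
    rw [hξ, norm_smul, Complex.norm_real, norm_inv, norm_norm,
      inv_mul_cancel₀ (norm_ne_zero_iff.2 hv)]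
  have hξq : τ.hom (vacElt n) ξ = ξ := by
    rw [hξ, map_smul, ← ContinuousLinearMap.mul_apply, hqq]
  have hξ0 : ξ ≠ 0 := norm_ne_zero_iff.1 (by rw [hξ1]; exact one_ne_zero)
  have hΩ0 : vacVec n ≠ 0 := norm_ne_zero_iff.1 (by rw [norm_vacVec]; exact one_ne_zero)
  refine unitaryEquiv_of_inner (orbit_dense τ hξ0) (orbit_dense (crystalIrr t) hΩ0) fun x => ?_
  change _ = vacState t x
  have h1 := congrArg (fun T : τ.space →L[ℂ] τ.space => inner ℂ ξ (T ξ)) (ht x)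
  simp only [map_mul, ContinuousLinearMap.mul_apply, ContinuousLinearMap.smul_apply, hξq,
    inner_smul_right] at h1
  have h2 := inner_rep τ.hom (vacElt n) ξ (τ.hom x ξ)
  rw [star_vacElt, hξq] at h2
  rw [← h2, inner_self_eq_norm_sq_to_K, hξ1] at h1
  simpa using h1

theorem crystalRep_keyElement_ne (t : Fin n → Circle) : crystalRep t (keyElement n) ≠ 0 := by
  intro h
  have h1 := crystalRep_key t
  rw [map_mul, h, mul_zero] at h1
  have h2 := vacTensor_vacVec (n := n) Finset.univ
  rw [← h1, ContinuousLinearMap.zero_apply] at h2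
  have h3 := norm_vacVec (n := n)
  rw [← h2, norm_zero] at h3
  exact zero_ne_one h3

/-- No `π_t` kills `a`, and an irreducible representation which does not kill `a` is equivalent to
some `π_t`. In this form the stratum is visibly open. -/
theorem spectrumStratum_longestWord : spectrumStratum (longestWord n) =
    CStarSpectrum.toPrim ⁻¹' (PrimitiveIdeal.hull {keyElement n})ᶜ := by
  ext x
  induction x using Quotient.inductionOn with
  | h τ =>
  have hmem : CStarSpectrum.toPrim (Quotient.mk _ τ) ∈ PrimitiveIdeal.hull {keyElement n} ↔
      τ.hom (keyElement n) = 0 := Set.singleton_subset_iff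
  refine Iff.trans ?_ (not_congr hmem).symm
  constructor
  · rintro ⟨t, π, ρ, hπ, ⟨U, hU⟩, hρ⟩ h0
    obtain ⟨V, hV⟩ : UnitaryEquiv ρ.hom τ.hom := Quotient.exact hρ
    have hπt : π = crystalRep t :=
      (existsUnique_crystalRep t (longestWord n)).unique hπ (crystalRep_spec t)
    refine crystalRep_keyElement_ne t (ContinuousLinearMap.ext fun f => ?_)
    have h1 := hV (keyElement n) (U.symm f)
    rw [h0, ContinuousLinearMap.zero_apply, map_eq_zero_iff V V.injective] at h1
    have h2 := hU (keyElement n) (U.symm f)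
    rw [h1, map_zero, LinearIsometryEquiv.apply_symm_apply, hπt] at h2
    exact h2.symm
  · intro h0
    obtain ⟨t, ht⟩ := exists_unitaryEquiv τ h0
    exact ⟨t, crystalRep t, τ, crystalRep_spec t, ht, rfl⟩

theorem isOpen_spectrumStratum : IsOpen (spectrumStratum (longestWord n)) := by
  rw [spectrumStratum_longestWord]
  refine isOpen_induced ?_
  exact ⟨_, compl_compl _⟩

/-- If an open set, the complement of the hull of `M`, misses the stratum, then all `π_t` kill `M`.
By separation every irreducible representation kills `M`, and the open set is empty. -/
theorem dense_spectrumStratum : Dense (spectrumStratum (longestWord n)) := by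
  rw [dense_iff_inter_open]
  rintro _ ⟨V, ⟨M, hM⟩, rfl⟩ ⟨x, hx⟩
  have hV : ∀ J, J ∈ V ↔ J ∉ PrimitiveIdeal.hull M := fun J => by rw [← hM, Set.notMem_compl_iff]
  by_contra hne
  rw [Set.not_nonempty_iff_eq_empty] at hne
  have hmem : ∀ t, (Quotient.mk _ (crystalIrr t) : CStarSpectrum (CrystalAlg n)) ∈
      spectrumStratum (longestWord n) := fun t =>
    ⟨t, crystalRep t, crystalIrr t, crystalRep_spec t, ⟨LinearIsometryEquiv.refl ℂ _,
      fun _ _ => rfl⟩, rfl⟩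
  have hker : ∀ m ∈ M, ∀ t, crystalRep t m = 0 := by
    intro m hm t
    by_contra h0
    have h1 : (Quotient.mk _ (crystalIrr t) : CStarSpectrum (CrystalAlg n)) ∈
        (∅ : Set (CStarSpectrum (CrystalAlg n))) := by
      rw [← hne]
      refine ⟨(hV _).2 fun h => h0 ?_, hmem t⟩
      exact h hm
    exact h1
  induction x using Quotient.inductionOn with
  | h τ =>
  refine (hV _).1 hx fun m hm => ?_
  exact rep_eq_zero τ.hom (hker m hm)

end classify

end Crystal

theorem mainTheorem11 (n : ℕ) (hn : 2 ≤ n) :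
    -- every `π_{t,w}` exists and is determined by its values on the generators
    (∀ (t : Fin n → Circle) (w : List (Fin n)),
      ∃! π : CrystalAlg n →⋆ₐ[ℂ] (WordSpace w →L[ℂ] WordSpace w), IsCrystalRep t w π) ∧
    -- `a` is killed by every `π_{t,w}` with `w ≠ w_L`
    (∀ (t : Fin n → Circle) (w : List (Fin n))
      (π : CrystalAlg n →⋆ₐ[ℂ] (WordSpace w →L[ℂ] WordSpace w)),
      IsCrystalRep t w π → IsReducedWord w → wordPerm w ≠ wordPerm (longestWord n) →
        keyElement n ∈ RingHom.ker π) ∧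
    -- `π_{w_L}(a) = P₀ ⊗ ⋯ ⊗ P₀`, and the stratum of `w_L` is open and dense
    (∀ π : CrystalAlg n →⋆ₐ[ℂ] (WordSpace (longestWord n) →L[ℂ] WordSpace (longestWord n)),
      IsCrystalRep 1 (longestWord n) π →
        π (keyElement n) ≠ 0 ∧ π (keyElement n) = tensorOp fun _ => vacuumProj) ∧
    (IsOpen (spectrumStratum (longestWord n)) ∧ Dense (spectrumStratum (longestWord n))) ∧
    -- every bracket goes to a positive elementary tensor of copies of `P₀` and `I`
    (∀ π : CrystalAlg n →⋆ₐ[ℂ] (WordSpace (longestWord n) →L[ℂ] WordSpace (longestWord n)),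
      IsCrystalRep 1 (longestWord n) π → ∀ p : Fin n,
        (π (crystalBracket n p)).IsPositive ∧
        ∃ E : Finset (Fin (longestWord n).length), E.Nonempty ∧ E ≠ Finset.univ ∧
          π (crystalBracket n p) = tensorOp fun k => if k ∈ E then vacuumProj else 1) := by
  exact ⟨fun t w => Crystal.existsUnique_crystalRep t w,
    fun t w π hπ hw hne => Crystal.keyElement_mem_ker hπ hw hne,
    fun π hπ => Crystal.rep_keyElement hπ,
    ⟨Crystal.isOpen_spectrumStratum, Crystal.dense_spectrumStratum⟩,
    fun π hπ p => Crystal.rep_bracket_positive hn hπ p⟩
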